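/- Let $K$ be a real quadratic field, let $D_K$ be the absolute value of its discriminant, let $v_K(n)$ be the number of non-zero integral ideals of $K$ of norm $n$, and let $H=\operatorname{Res}_{s=1}\zeta_K(s)$ be the residue at $s=1$ of the Dedekind zeta function of $K$. For $x>0$ let $$I_K(x)=\sideset{}{'}\sum_{n\le x}v_K(n),$$ where the sum runs over the positive integers $n\le x$ and the prime means that the term with $n=x$ (if $x$ is an integer) is halved. Then for every $x>0$ the series below converges (as the limit of the partial sums over $1\le n\le N$ as $N\to\infty$) and $$I_K(x)=Hx-\sum_{n=1}^{\infty}\frac{v_K(n)}{n}\left[Y_1\!\left(\frac{4\pi\sqrt{xn}}{\sqrt{D_K}}\right)+\frac{2}{\pi}K_1\!\left(\frac{4\pi\sqrt{xn}}{\sqrt{D_K}}\right)\right]\sqrt{xn},$$ where $Y_1$ is the Bessel function of the second kind and $K_1$ is the modified Bessel function of the second kind, both of order $1$. -/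

import Mathlib

open Filter Topology

noncomputable section

/-- The Bessel function of the second kind `Y_ν(x)` of real order `ν` at `x > 0`
(Schläfli's integral). -/
def besselY (ν x : ℝ) : ℝ :=
  (1 / Real.pi) * (∫ θ in (0 : ℝ)..Real.pi, Real.sin (x * Real.sin θ - ν * θ)) -
    (1 / Real.pi) * ∫ t in Set.Ioi (0 : ℝ),
      (Real.exp (ν * t) + Real.exp (-(ν * t)) * Real.cos (ν * Real.pi)) *
        Real.exp (-(x * Real.sinh t))

/-- The modified Bessel function of the second kind `K_ν(x)` of real order `ν` at `x > 0`. -/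
def besselK (ν x : ℝ) : ℝ :=
  ∫ t in Set.Ioi (0 : ℝ), Real.exp (-(x * Real.cosh t)) * Real.cosh (ν * t)

/-- `v_K(n)`: the number of non-zero integral ideals of `K` of norm `n`. -/
def idealCount (K : Type*) [Field K] [NumberField K] (n : ℕ) : ℕ :=
  Nat.card {I : Ideal (NumberField.RingOfIntegers K) // I ≠ ⊥ ∧ Ideal.absNorm I = n}

open Classical in
/-- `I_K(x) = ∑'_{n ≤ x} v_K(n)`, where the term with `n = x` (if there is one) is halved. -/
def idealSum (K : Type*) [Field K] [NumberField K] (x : ℝ) : ℝ :=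
  ∑ n ∈ Finset.Icc 1 ⌊x⌋₊,
    if (n : ℝ) = x then (idealCount K n : ℝ) / 2 else (idealCount K n : ℝ)

/-- `D_K`, the absolute value of the discriminant of `K`. -/
def absDiscr (K : Type*) [Field K] [NumberField K] : ℝ :=
  |(NumberField.discr K : ℝ)|

/-- The `n`-th term of the Bessel series,
`v_K(n)/n · [Y_1(4π√(xn)/√D_K) + (2/π) K_1(4π√(xn)/√D_K)] · √(xn)`. -/
def voronoiTerm (K : Type*) [Field K] [NumberField K] (x : ℝ) (n : ℕ) : ℝ :=
  (idealCount K n : ℝ) / n *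
    (besselY 1 (4 * Real.pi * √(x * n) / √(absDiscr K)) +
      2 / Real.pi * besselK 1 (4 * Real.pi * √(x * n) / √(absDiscr K))) * √(x * n)

end

/-! Write `v` for `v_K`, `D` for `D_K` and `l = 4π²/D`. In a real quadratic field `v(n) = ∑_{d ∣ n}
χ(d)`, where `χ` is an even real character mod `D` whose finite Fourier transform is `√D χ`. The
analysis uses nothing else about `K`: `IsGaussChar.tendsto_kerPartial` holds for every such `χ` with
non-negative divisor sums.

The Riesz mean. In `∑ v(n) e^{-nt} = ∑_a ∑_b χ(b) e^{-abt}`, Poisson summation over `b` together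
with the Gauss sum turns the inner sum into a partial fraction series in `at`, and a second Poisson
summation over `a` gives `IsGaussChar.tsum_divSum_mul_exp`: a pole `H/t` plus `4/(t√D) ∑ v(n)
Q(ln/t)`, where `Q(z)` is the improper integral of `u cos(zu)/(1+u²)` over the half line. Up to the
factor `-2/π`, `Q(u)` is the transform `∫ e^{-s} (Y₀ - (2/π) K₀)(2√(us)) ds` (`lapY_add_lapK`): both
sides satisfy the same linear differential system and have compatible behaviour at `0` and `∞`.
Dividing by `t²` makes everything a Laplace transform, and uniqueness (`eq_zero_of_laplace_eq_zero`)
yields `IsGaussChar.rieszSum_eq`: `∑_{n ≤ x} v(n)(x-n) = Hx²/2 - l^{-3/2} ∑ v(n) n⁻² E(lnx)`, with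
`E' = Z` and `Z(X) = √X (Y₁ + (2/π) K₁)(2√X)`. This series converges absolutely because `E(X) =
O(X^{3/4})`.

Differentiation. The theorem is the derivative of that identity, but absolute convergence is no
longer available for the differentiated series. Its partial sums `∑ v(n) Z(cn)/n`, with `c = lx`,
are summed by parts twice against the Riesz mean, and the Bessel series of the Riesz mean is then
inserted (`IsGaussChar.abs_kerPartial_sub_le`). By the asymptotics of `Y₀` and `Y₁`, the `m`-th term
becomes `∫ sin((2√(lm) - 2√c)√y)/y dy` up to a small error, and this is small uniformly as long as
`√(lm)` stays away from `√c`. For non-integral `x` the convergence is therefore locally uniform, and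
termwise differentiation is legitimate. For integral `x` only `m = x` resonates. Once its
contribution is removed, the partial sums converge uniformly to a continuous function. The resonant
integral vanishes at `x` and is odd in its frequency, so it cancels between the points `(√x ± t)²`.
The limit at `x` is hence the mean of the two one-sided values, which is the halved last term.

Arithmetic. The quadratic Gauss sum comes from comparing two theta expansions (`quadGaussSum_eq`),
and passes to Kronecker characters by twisted multiplicativity and quadratic reciprocity. The
identity for `v` comes from prime decomposition: ideals of norm `p` correspond to ring homomorphisms
from the ring of integers to `ZMod p`, hence to roots of a quadratic congruence. The constant of the
analytic part is the residue of `ζ_K` because both are the mean value of `v`. -/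

/-! ### Laplace type integrals `∫ g(t)^k e^{-z g(t)} dt` -/

/-- `∫₀^∞ g(t)^k e^{-z g(t)} dt`. -/
noncomputable def expMoment (g : ℝ → ℝ) (k : ℕ) (z : ℝ) : ℝ :=
  ∫ t in Set.Ioi (0 : ℝ), g t ^ k * Real.exp (-(z * g t))

/-- Half of the exponent absorbs the power and the other half remains as a dominating function. With
`t ≤ g t` the remainder is at most `e^{-zt/2}`, so `sinh` and `cosh` are treated together. -/
theorem pow_mul_exp_neg_le (k : ℕ) {x z : ℝ} (hz : 0 < z) (hx : 0 ≤ x) :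
    x ^ k * Real.exp (-(z * x)) ≤ k.factorial * (2 / z) ^ k * Real.exp (-(z / 2 * x)) := by
  have h1 : (z / 2 * x) ^ k / k.factorial ≤ Real.exp (z / 2 * x) :=
    Real.pow_div_factorial_le_exp _ (by positivity) k
  have h2 : Real.exp (-(z * x)) = Real.exp (-(z / 2 * x)) * Real.exp (-(z / 2 * x)) := by
    rw [← Real.exp_add]; ring_nf
  have h3 : Real.exp (z / 2 * x) * Real.exp (-(z / 2 * x)) = 1 := by
    rw [← Real.exp_add]; simp
  have h4 : x ^ k = k.factorial * (2 / z) ^ k * ((z / 2 * x) ^ k / k.factorial) := by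
    have hk : (k.factorial : ℝ) ≠ 0 := by positivity
    rw [mul_pow, div_pow, div_pow]
    field_simp
  rw [h2, h4]
  have h5 : (z / 2 * x) ^ k / k.factorial * Real.exp (-(z / 2 * x)) ≤ 1 := by
    rw [← h3]; gcongr
  calc _ = k.factorial * (2 / z) ^ k * Real.exp (-(z / 2 * x)) *
        ((z / 2 * x) ^ k / k.factorial * Real.exp (-(z / 2 * x))) := by ring
    _ ≤ k.factorial * (2 / z) ^ k * Real.exp (-(z / 2 * x)) * 1 := by gcongr
    _ = _ := by ring

theorem pow_mul_exp_neg_le' {g : ℝ → ℝ} (hgt : ∀ t, 0 < t → t ≤ g t) (k : ℕ) {z t : ℝ}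
    (hz : 0 < z) (ht : 0 < t) :
    ‖g t ^ k * Real.exp (-(z * g t))‖ ≤
      k.factorial * (2 / z) ^ k * Real.exp (-(z / 2) * t) := by
  have h0 : 0 ≤ g t := ht.le.trans (hgt t ht)
  rw [Real.norm_of_nonneg (by positivity)]
  refine (pow_mul_exp_neg_le k hz h0).trans ?_
  have := hgt t ht
  gcongr
  nlinarith

theorem integrableOn_expMoment {g : ℝ → ℝ} (hg : Continuous g) (hgt : ∀ t, 0 < t → t ≤ g t)
    (k : ℕ) {z : ℝ} (hz : 0 < z) :
    MeasureTheory.IntegrableOn (fun t => g t ^ k * Real.exp (-(z * g t))) (Set.Ioi 0) := by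
  have h := (exp_neg_integrableOn_Ioi 0 (half_pos hz)).const_mul (k.factorial * (2 / z) ^ k)
  refine h.mono' (by fun_prop) ?_
  filter_upwards [MeasureTheory.ae_restrict_mem measurableSet_Ioi] with t ht
  exact pow_mul_exp_neg_le' hgt k hz ht

theorem hasDerivAt_expMoment {g : ℝ → ℝ} (hg : Continuous g) (hgt : ∀ t, 0 < t → t ≤ g t)
    (k : ℕ) {z : ℝ} (hz : 0 < z) :
    HasDerivAt (expMoment g k) (-expMoment g (k + 1) z) z := by
  have h := (exp_neg_integrableOn_Ioi 0 (half_pos (half_pos hz))).const_mul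
    ((k + 1).factorial * (2 / (z / 2)) ^ (k + 1))
  have key := (hasDerivAt_integral_of_dominated_loc_of_deriv_le
    (μ := MeasureTheory.volume.restrict (Set.Ioi (0 : ℝ))) (Ioi_mem_nhds (half_lt_self hz))
    (F := fun z t => g t ^ k * Real.exp (-(z * g t)))
    (F' := fun z t => -(g t ^ (k + 1) * Real.exp (-(z * g t))))
    (Eventually.of_forall fun x => by fun_prop)
    (integrableOn_expMoment hg hgt k hz) (by fun_prop) (bound := _) ?_ h ?_).2
  · rw [MeasureTheory.integral_neg] at key
    exact key
  · filter_upwards [MeasureTheory.ae_restrict_mem measurableSet_Ioi] with t ht x hx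
    have hx : z / 2 < x := hx
    have ht' : 0 < t := ht
    rw [norm_neg]
    refine le_trans ?_ (pow_mul_exp_neg_le' hgt (k + 1) (half_pos hz) ht)
    have h0 : 0 ≤ g t := (le_of_lt ht).trans (hgt t ht)
    rw [Real.norm_of_nonneg (by positivity), Real.norm_of_nonneg (by positivity)]
    gcongr
  · refine Eventually.of_forall fun t x _ => ?_
    have := (((hasDerivAt_id x).mul_const (g t)).fun_neg.exp).const_mul (g t ^ k)
    refine this.congr_deriv ?_
    simp only [id]
    ring

theorem integrableOn_mul_sub {μ : MeasureTheory.Measure ℝ} {s : Set ℝ} {f g : ℝ → ℝ} (z : ℝ)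
    (hf : MeasureTheory.IntegrableOn f s μ) (hg : MeasureTheory.IntegrableOn g s μ) :
    MeasureTheory.IntegrableOn (fun t => z * (f t - g t)) s μ := (hf.sub hg).const_mul z

theorem integrableOn_mul_add {μ : MeasureTheory.Measure ℝ} {s : Set ℝ} {f g : ℝ → ℝ} (z : ℝ)
    (hf : MeasureTheory.IntegrableOn f s μ) (hg : MeasureTheory.IntegrableOn g s μ) :
    MeasureTheory.IntegrableOn (fun t => z * (f t + g t)) s μ := (hf.add hg).const_mul z

theorem tendsto_mul_exp_neg_atTop {g : ℝ → ℝ} (hgt : ∀ t, 0 < t → t ≤ g t) (k : ℕ) {z : ℝ}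
    (hz : 0 < z) : Tendsto (fun t => g t ^ k * Real.exp (-(z * g t))) atTop (𝓝 0) := by
  have h1 : Tendsto (fun t => k.factorial * (2 / z) ^ k * Real.exp (-(z / 2) * t)) atTop
      (𝓝 0) := by
    have : Tendsto (fun t => -(z / 2) * t) atTop atBot :=
      tendsto_id.const_mul_atTop_of_neg (by linarith)
    simpa using (Real.tendsto_exp_atBot.comp this).const_mul (k.factorial * (2 / z) ^ k)
  refine squeeze_zero_norm' ?_ h1
  filter_upwards [eventually_gt_atTop 0] with t ht
  exact pow_mul_exp_neg_le' hgt k hz ht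

theorem le_sinh {t : ℝ} (ht : 0 < t) : t ≤ Real.sinh t := Real.self_le_sinh_iff.2 ht.le

theorem le_cosh {t : ℝ} (ht : 0 < t) : t ≤ Real.cosh t :=
  (le_sinh ht).trans (Real.sinh_lt_cosh t).le

/-! ### The Bessel functions of the second kind of order `0` and `1` -/

/-- The modified Bessel function `K₀`. -/
noncomputable def besselKZero (z : ℝ) : ℝ := expMoment Real.cosh 0 z

/-- The modified Bessel function `K₁`. -/
noncomputable def besselKOne (z : ℝ) : ℝ := expMoment Real.cosh 1 z

theorem besselK_one (z : ℝ) : besselK 1 z = besselKOne z := by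
  simp [besselK, besselKOne, expMoment, mul_comm]

theorem hasDerivAt_besselKZero {z : ℝ} (hz : 0 < z) :
    HasDerivAt besselKZero (-besselKOne z) z :=
  hasDerivAt_expMoment Real.continuous_cosh (fun _ => le_cosh) 0 hz

/-- The derivative of `sinh t · e^{-z cosh t}` integrates to zero, since this function vanishes at
both ends. It is the recurrence behind `(z K₁)' = -z K₀`. -/
theorem expMoment_cosh_one {z : ℝ} (hz : 0 < z) :
    expMoment Real.cosh 1 z = z * (expMoment Real.cosh 2 z - expMoment Real.cosh 0 z) := by
  have hi := fun k => integrableOn_expMoment Real.continuous_cosh (fun _ => le_cosh) k hz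
  have h0 : ∀ t : ℝ, HasDerivAt (fun t => Real.sinh t * Real.exp (-(z * Real.cosh t)))
      (Real.cosh t ^ 1 * Real.exp (-(z * Real.cosh t)) -
        z * (Real.cosh t ^ 2 * Real.exp (-(z * Real.cosh t)) -
          Real.cosh t ^ 0 * Real.exp (-(z * Real.cosh t)))) t := fun t => by
    refine ((Real.hasDerivAt_sinh t).mul
      (((Real.hasDerivAt_cosh t).const_mul z).fun_neg.exp)).congr_deriv ?_
    rw [Real.cosh_sq]; ring
  have hlim : Tendsto (fun t => Real.sinh t * Real.exp (-(z * Real.cosh t))) atTop (𝓝 0) := by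
    refine squeeze_zero_norm' ?_ (tendsto_mul_exp_neg_atTop (fun _ => le_cosh) 1 hz)
    filter_upwards [eventually_ge_atTop 0] with t ht
    have := Real.sinh_nonneg_iff.2 ht
    rw [Real.norm_of_nonneg (by positivity), pow_one]
    gcongr
    exact (Real.sinh_lt_cosh t).le
  have := MeasureTheory.integral_Ioi_of_hasDerivAt_of_tendsto' (a := 0) (fun t _ => h0 t)
    ((hi 1).sub (integrableOn_mul_sub z (hi 2) (hi 0))) hlim
  rw [MeasureTheory.integral_sub (hi 1) (integrableOn_mul_sub z (hi 2) (hi 0)),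
    MeasureTheory.integral_const_mul, MeasureTheory.integral_sub (hi 2) (hi 0)] at this
  simp only [Real.sinh_zero, zero_mul, sub_zero] at this
  exact sub_eq_zero.1 this

theorem hasDerivAt_mul_besselKOne {z : ℝ} (hz : 0 < z) :
    HasDerivAt (fun z => z * besselKOne z) (-(z * besselKZero z)) z := by
  refine ((hasDerivAt_id z).mul
    (hasDerivAt_expMoment Real.continuous_cosh (fun _ => le_cosh) 1 hz)).congr_deriv ?_
  have := expMoment_cosh_one hz
  simp only [id, one_mul, besselKZero]
  linear_combination this

/-- Same argument with `cosh t · e^{-z sinh t}`, whose value at `0` produces the `1`. In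
`hasDerivAt_mul_besselYOne` it cancels against the `2` of `integral_sin_mul_cos_mul_sin`. -/
theorem expMoment_sinh_one {z : ℝ} (hz : 0 < z) :
    expMoment Real.sinh 1 z + 1 =
      z * (expMoment Real.sinh 0 z + expMoment Real.sinh 2 z) := by
  have hi := fun k => integrableOn_expMoment Real.continuous_sinh (fun _ => le_sinh) k hz
  have h0 : ∀ t : ℝ, HasDerivAt (fun t => Real.cosh t * Real.exp (-(z * Real.sinh t)))
      (Real.sinh t ^ 1 * Real.exp (-(z * Real.sinh t)) -
        z * (Real.sinh t ^ 0 * Real.exp (-(z * Real.sinh t)) +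
          Real.sinh t ^ 2 * Real.exp (-(z * Real.sinh t)))) t := fun t => by
    refine ((Real.hasDerivAt_cosh t).mul
      (((Real.hasDerivAt_sinh t).const_mul z).fun_neg.exp)).congr_deriv ?_
    rw [Real.sinh_sq]; ring
  have hlim : Tendsto (fun t => Real.cosh t * Real.exp (-(z * Real.sinh t))) atTop (𝓝 0) := by
    have h2 := (tendsto_mul_exp_neg_atTop (fun _ => le_sinh) 1 hz).add
      (tendsto_mul_exp_neg_atTop (fun _ => le_sinh) 0 hz)
    rw [add_zero] at h2
    refine squeeze_zero_norm' ?_ h2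
    filter_upwards [eventually_ge_atTop 0] with t ht
    have h3 := Real.sinh_nonneg_iff.2 ht
    have h4 := Real.cosh_pos t
    rw [Real.norm_of_nonneg (by positivity), pow_one, pow_zero, ← add_mul]
    gcongr
    nlinarith [Real.cosh_sq t]
  have := MeasureTheory.integral_Ioi_of_hasDerivAt_of_tendsto' (a := 0) (fun t _ => h0 t)
    ((hi 1).sub (integrableOn_mul_add z (hi 0) (hi 2))) hlim
  rw [MeasureTheory.integral_sub (hi 1) (integrableOn_mul_add z (hi 0) (hi 2)),
    MeasureTheory.integral_const_mul, MeasureTheory.integral_add (hi 0) (hi 2)] at this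
  simp only [Real.sinh_zero, Real.cosh_zero, mul_zero, neg_zero, Real.exp_zero] at this
  unfold expMoment
  linarith

/-- The Bessel function `Y₀`. -/
noncomputable def besselYZero (z : ℝ) : ℝ :=
  1 / Real.pi * (∫ θ in (0 : ℝ)..Real.pi, Real.sin (z * Real.sin θ)) -
    2 / Real.pi * expMoment Real.sinh 0 z

/-- The Bessel function `Y₁`. -/
noncomputable def besselYOne (z : ℝ) : ℝ :=
  -(1 / Real.pi * (∫ θ in (0 : ℝ)..Real.pi, Real.sin θ * Real.cos (z * Real.sin θ))) -
    2 / Real.pi * expMoment Real.sinh 1 z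

theorem besselY_one {z : ℝ} : besselY 1 z = besselYOne z := by
  have h1 : (∫ θ in (0 : ℝ)..Real.pi, Real.sin (z * Real.sin θ - 1 * θ)) =
      -∫ θ in (0 : ℝ)..Real.pi, Real.sin θ * Real.cos (z * Real.sin θ) := by
    have h2 : ∀ θ, Real.sin (z * Real.sin θ - 1 * θ) =
        Real.cos θ * Real.sin (z * Real.sin θ) - Real.sin θ * Real.cos (z * Real.sin θ) :=
      fun θ => by rw [one_mul, Real.sin_sub]; ring
    -- The reflection `θ ↦ π - θ` fixes `sin θ` and changes the sign of `cos θ`.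
    have h3 : (∫ θ in (0 : ℝ)..Real.pi, Real.cos θ * Real.sin (z * Real.sin θ)) = 0 := by
      have h := intervalIntegral.integral_comp_sub_left
        (fun θ => Real.cos θ * Real.sin (z * Real.sin θ)) Real.pi (a := 0) (b := Real.pi)
      simp only [Real.cos_pi_sub, Real.sin_pi_sub, sub_self, sub_zero, neg_mul,
        intervalIntegral.integral_neg] at h
      linarith
    simp_rw [h2]
    rw [intervalIntegral.integral_sub, h3, zero_sub]
    all_goals exact Continuous.intervalIntegrable (by fun_prop) _ _
  -- Since `cos π = -1`, the two exponentials combine to `2 sinh t`.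
  have h4 : (∫ t in Set.Ioi (0 : ℝ), (Real.exp (1 * t) + Real.exp (-(1 * t)) *
      Real.cos (1 * Real.pi)) * Real.exp (-(z * Real.sinh t))) =
      2 * expMoment Real.sinh 1 z := by
    rw [expMoment, ← MeasureTheory.integral_const_mul]
    congr 1 with t
    rw [Real.sinh_eq]; simp; ring
  rw [besselY, besselYOne, h1, h4]; ring

theorem hasDerivAt_integral_of_continuous_deriv {F F' : ℝ → ℝ → ℝ} {a b : ℝ} (hab : a ≤ b)
    (hF : Continuous (Function.uncurry F)) (hF' : Continuous (Function.uncurry F'))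
    (h : ∀ z θ, HasDerivAt (fun z => F z θ) (F' z θ) z) (z : ℝ) :
    HasDerivAt (fun z => ∫ θ in a..b, F z θ) (∫ θ in a..b, F' z θ) z := by
  obtain ⟨C, hC⟩ := ((isCompact_Icc (a := z - 1) (b := z + 1)).prod
    (isCompact_Icc (a := a) (b := b))).exists_bound_of_continuousOn hF'.continuousOn
  refine (intervalIntegral.hasDerivAt_integral_of_dominated_loc_of_deriv_le
    (μ := MeasureTheory.volume) (bound := fun _ => C) (F := F) (F' := F')
    (Ioo_mem_nhds (sub_one_lt z) (lt_add_one z))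
    (Eventually.of_forall fun x => ?_) ?_ ?_ ?_ (by simp)
    (Eventually.of_forall fun t _ x _ => h x t)).2
  · exact (hF.comp (Continuous.prodMk_right x)).aestronglyMeasurable
  · exact (hF.comp (Continuous.prodMk_right z)).intervalIntegrable _ _
  · exact (hF'.comp (Continuous.prodMk_right z)).aestronglyMeasurable
  · refine Eventually.of_forall fun t ht x hx => hC (x, t) ⟨⟨hx.1.le, hx.2.le⟩, ?_⟩
    rw [Set.uIoc_of_le hab] at ht
    exact ⟨ht.1.le, ht.2⟩

theorem hasDerivAt_besselYZero {z : ℝ} (hz : 0 < z) :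
    HasDerivAt besselYZero (-besselYOne z) z := by
  have h1 := hasDerivAt_integral_of_continuous_deriv Real.pi_pos.le
    (F := fun z θ => Real.sin (z * Real.sin θ))
    (F' := fun z θ => Real.sin θ * Real.cos (z * Real.sin θ)) (by fun_prop) (by fun_prop)
    (fun z θ => by
      refine (((hasDerivAt_id z).mul_const (Real.sin θ)).sin).congr_deriv ?_
      simp only [id]; ring) z
  refine ((h1.const_mul _).sub ((hasDerivAt_expMoment Real.continuous_sinh
    (fun _ => le_sinh) 0 hz).const_mul _)).congr_deriv ?_
  rw [besselYOne]; ring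

theorem integral_sin_mul_cos_mul_sin (z : ℝ) :
    (∫ θ in (0 : ℝ)..Real.pi, Real.sin θ * Real.cos (z * Real.sin θ)) +
      z * ((∫ θ in (0 : ℝ)..Real.pi, Real.sin (z * Real.sin θ)) -
        ∫ θ in (0 : ℝ)..Real.pi, Real.sin θ ^ 2 * Real.sin (z * Real.sin θ)) = 2 := by
  have h0 : ∀ θ : ℝ, HasDerivAt (fun θ => -(Real.cos θ * Real.cos (z * Real.sin θ)))
      (Real.sin θ * Real.cos (z * Real.sin θ) + z * (Real.sin (z * Real.sin θ) -
        Real.sin θ ^ 2 * Real.sin (z * Real.sin θ))) θ := fun θ => by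
    refine (((Real.hasDerivAt_cos θ).mul
      (((Real.hasDerivAt_sin θ).const_mul z).cos)).neg).congr_deriv ?_
    rw [Real.sin_sq]; ring
  have h := intervalIntegral.integral_eq_sub_of_hasDerivAt (a := 0) (b := Real.pi)
    (fun θ _ => h0 θ) (Continuous.intervalIntegrable (by fun_prop) _ _)
  rw [intervalIntegral.integral_add, intervalIntegral.integral_const_mul,
    intervalIntegral.integral_sub] at h
  · rw [h]; norm_num
  all_goals exact Continuous.intervalIntegrable (by fun_prop) _ _

theorem hasDerivAt_mul_besselYOne {z : ℝ} (hz : 0 < z) :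
    HasDerivAt (fun z => z * besselYOne z) (z * besselYZero z) z := by
  have h1 := hasDerivAt_integral_of_continuous_deriv Real.pi_pos.le
    (F := fun z θ => Real.sin θ * Real.cos (z * Real.sin θ))
    (F' := fun z θ => -(Real.sin θ ^ 2 * Real.sin (z * Real.sin θ))) (by fun_prop) (by fun_prop)
    (fun z θ => by
      refine ((((hasDerivAt_id z).mul_const (Real.sin θ)).cos).const_mul _).congr_deriv ?_
      simp only [id]; ring) z
  have h2 := ((h1.const_mul (1 / Real.pi)).neg.sub ((hasDerivAt_expMoment Real.continuous_sinh
    (fun _ => le_sinh) 1 hz).const_mul (2 / Real.pi)))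
  refine ((hasDerivAt_id z).mul h2).congr_deriv ?_
  have h3 := expMoment_sinh_one hz
  have h4 := integral_sin_mul_cos_mul_sin z
  rw [intervalIntegral.integral_neg]
  simp only [id, one_mul, besselYZero, Pi.sub_apply, Pi.neg_apply]
  linear_combination (-(1 / Real.pi)) * h4 - (2 / Real.pi) * h3

/-! ### Asymptotics of `Y₀`, `Y₁` -/

/-- On `[1, ∞)` the function `f - M/z` increases, `f + M/z` decreases, and every value of the first
is at most every value of the second. The supremum of the first is the required `L`. -/
theorem exists_limit_of_abs_deriv_le {f f' : ℝ → ℝ} {M : ℝ}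
    (hf : ∀ z, 1 ≤ z → HasDerivAt f (f' z) z) (hf' : ∀ z, 1 ≤ z → |f' z| ≤ M / z ^ 2) :
    ∃ L, ∀ z, 1 ≤ z → |f z - L| ≤ M / z := by
  have hinv : ∀ z : ℝ, 1 ≤ z → HasDerivAt (fun z : ℝ => M / z) (-(M / z ^ 2)) z := fun z hz => by
    have := (hasDerivAt_inv (show z ≠ 0 by positivity)).const_mul M
    simpa [div_eq_mul_inv] using this
  have hmono : MonotoneOn (fun z => f z - M / z) (Set.Ici 1) := by
    refine monotoneOn_of_hasDerivWithinAt_nonneg (convex_Ici 1)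
      (f' := fun z => f' z - -(M / z ^ 2)) ?_ ?_ ?_
    · exact fun z hz => ((hf z hz).fun_sub (hinv z hz)).continuousAt.continuousWithinAt
    · intro z hz
      rw [interior_Ici] at hz
      exact ((hf z (le_of_lt hz)).fun_sub (hinv z (le_of_lt hz))).hasDerivWithinAt
    · intro z hz
      rw [interior_Ici] at hz
      have := (abs_le.1 (hf' z (le_of_lt hz))).1
      linarith
  have hanti : AntitoneOn (fun z => f z + M / z) (Set.Ici 1) := by
    refine antitoneOn_of_hasDerivWithinAt_nonpos (convex_Ici 1)
      (f' := fun z => f' z + -(M / z ^ 2)) ?_ ?_ ?_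
    · exact fun z hz => ((hf z hz).fun_add (hinv z hz)).continuousAt.continuousWithinAt
    · intro z hz
      rw [interior_Ici] at hz
      exact ((hf z (le_of_lt hz)).fun_add (hinv z (le_of_lt hz))).hasDerivWithinAt
    · intro z hz
      rw [interior_Ici] at hz
      have := (abs_le.1 (hf' z (le_of_lt hz))).2
      linarith
  have hM : 0 ≤ M := by simpa using (abs_nonneg _).trans (hf' 1 le_rfl)
  set S := (fun z => f z - M / z) '' Set.Ici 1
  have hle : ∀ a b : ℝ, 1 ≤ a → 1 ≤ b → f a - M / a ≤ f b + M / b := by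
    intro a b ha hb
    have h1 := hmono ha (le_max_of_le_left ha : (1 : ℝ) ≤ max a b) (le_max_left a b)
    have h2 := hanti hb (le_max_of_le_left ha : (1 : ℝ) ≤ max a b) (le_max_right a b)
    have h3 : 0 ≤ M / max a b := div_nonneg hM (by positivity)
    simp only at h1 h2
    linarith
  have hne : S.Nonempty := ⟨_, 1, Set.self_mem_Ici, rfl⟩
  refine ⟨sSup S, fun z hz => abs_le.2 ⟨?_, ?_⟩⟩
  · have : sSup S ≤ f z + M / z := csSup_le hne (by rintro _ ⟨a, ha, rfl⟩; exact hle a z ha hz)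
    linarith
  · have : f z - M / z ≤ sSup S := le_csSup
      ⟨f 1 + M / 1, by rintro _ ⟨a, ha, rfl⟩; exact hle a 1 ha le_rfl⟩ ⟨z, hz, rfl⟩
    linarith

/-- The equation is a perturbation of `w'' = -w` of size `O(z⁻²)`. An energy estimate bounds `w`.
Then the coefficients of variation of constants, `w cos z - d sin z` and `w sin z + d cos z`, have
derivative `O(z⁻²)` and converge to `α` and `β` at rate `1/z`. -/
theorem exists_asymptotics_of_ode {w d : ℝ → ℝ} (hw : ∀ z, 1 ≤ z → HasDerivAt w (d z) z)
    (hd : ∀ z, 1 ≤ z → HasDerivAt d (-(1 + 1 / (4 * z ^ 2)) * w z) z) :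
    ∃ α β C : ℝ, ∀ z, 1 ≤ z → |w z| ≤ C ∧
      |w z - (α * Real.cos z + β * Real.sin z)| ≤ C / z ∧
      |d z - (-(α * Real.sin z) + β * Real.cos z)| ≤ C / z := by
  obtain ⟨M, hM⟩ : ∃ M, ∀ z, 1 ≤ z → |w z| ≤ M := by
    -- The factor `e^{1/(4z)}` is chosen to complete a square: the derivative of the product is `-(w
    -- + d)²/(4z²)` times the exponential.
    have hE : AntitoneOn (fun z => (w z ^ 2 + d z ^ 2) * Real.exp (1 / 4 * z⁻¹))
        (Set.Ici 1) := by
      have hder : ∀ z : ℝ, 1 ≤ z →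
          HasDerivAt (fun z => (w z ^ 2 + d z ^ 2) * Real.exp (1 / 4 * z⁻¹))
          (-((w z + d z) ^ 2 / (4 * z ^ 2)) * Real.exp (1 / 4 * z⁻¹)) z := fun z hz => by
        have hz0 : z ≠ 0 := by positivity
        refine ((((hw z hz).fun_pow 2).fun_add ((hd z hz).fun_pow 2)).fun_mul
          (((hasDerivAt_inv hz0).const_mul (1 / 4)).exp)).congr_deriv ?_
        field_simp
        ring
      refine antitoneOn_of_hasDerivWithinAt_nonpos (convex_Ici 1)
        (f' := fun z => -((w z + d z) ^ 2 / (4 * z ^ 2)) * Real.exp (1 / 4 * z⁻¹)) ?_ ?_ ?_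
      · exact fun z hz => (hder z hz).continuousAt.continuousWithinAt
      · intro z hz
        rw [interior_Ici] at hz
        exact (hder z (le_of_lt hz)).hasDerivWithinAt
      · intro z _
        have : 0 ≤ (w z + d z) ^ 2 / (4 * z ^ 2) * Real.exp (1 / 4 * z⁻¹) := by positivity
        linarith
    refine ⟨√((w 1 ^ 2 + d 1 ^ 2) * Real.exp (1 / 4 * 1⁻¹)), fun z hz => ?_⟩
    refine Real.abs_le_sqrt ?_
    refine le_trans ?_ (hE Set.self_mem_Ici hz hz)
    have h1 : 1 ≤ Real.exp (1 / 4 * z⁻¹) := Real.one_le_exp (by positivity)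
    simp only
    nlinarith [sq_nonneg (w z), sq_nonneg (d z)]
  have hM0 : 0 ≤ M := (abs_nonneg _).trans (hM 1 le_rfl)
  obtain ⟨α, hα⟩ := exists_limit_of_abs_deriv_le
    (f := fun z => w z * Real.cos z - d z * Real.sin z)
    (f' := fun z => w z * Real.sin z / (4 * z ^ 2)) (M := M) (fun z hz => by
      have hz0 : z ≠ 0 := by positivity
      refine (((hw z hz).fun_mul (Real.hasDerivAt_cos z)).fun_sub
        ((hd z hz).fun_mul (Real.hasDerivAt_sin z))).congr_deriv ?_
      field_simp
      ring) (fun z hz => by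
      rw [abs_div, abs_mul, abs_of_pos (show 0 < 4 * z ^ 2 by positivity)]
      have h1 := hM z hz
      have h2 := Real.abs_sin_le_one z
      gcongr
      · nlinarith [abs_nonneg (w z), abs_nonneg (Real.sin z)]
      · nlinarith)
  obtain ⟨β, hβ⟩ := exists_limit_of_abs_deriv_le
    (f := fun z => w z * Real.sin z + d z * Real.cos z)
    (f' := fun z => -(w z * Real.cos z / (4 * z ^ 2))) (M := M) (fun z hz => by
      have hz0 : z ≠ 0 := by positivity
      refine (((hw z hz).fun_mul (Real.hasDerivAt_sin z)).fun_add
        ((hd z hz).fun_mul (Real.hasDerivAt_cos z))).congr_deriv ?_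
      field_simp
      ring) (fun z hz => by
      rw [abs_neg, abs_div, abs_mul, abs_of_pos (show 0 < 4 * z ^ 2 by positivity)]
      have h1 := hM z hz
      have h2 := Real.abs_cos_le_one z
      gcongr
      · nlinarith [abs_nonneg (w z), abs_nonneg (Real.cos z)]
      · nlinarith)
  have key : ∀ A B c s e : ℝ, |A| ≤ e → |B| ≤ e → |c| ≤ 1 → |s| ≤ 1 → |A * c + B * s| ≤ 2 * e := by
    intro A B c s e h1 h2 h3 h4
    calc _ ≤ |A * c| + |B * s| := abs_add_le _ _
      _ ≤ e * 1 + e * 1 := by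
        rw [abs_mul, abs_mul]
        have := (abs_nonneg A).trans h1
        gcongr
      _ = _ := by ring
  refine ⟨α, β, 2 * M, fun z hz => ⟨(hM z hz).trans (by linarith), ?_, ?_⟩⟩
  · have := key _ _ _ _ _ (hα z hz) (hβ z hz) (Real.abs_cos_le_one z) (Real.abs_sin_le_one z)
    rw [mul_div_assoc]
    refine le_trans (le_of_eq ?_) this
    congr 1
    linear_combination (-w z) * Real.sin_sq_add_cos_sq z
  · have := key _ _ _ (-Real.sin z) _ (hβ z hz) (hα z hz) (Real.abs_cos_le_one z)
      (by rw [abs_neg]; exact Real.abs_sin_le_one z)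
    rw [mul_div_assoc]
    refine le_trans (le_of_eq ?_) this
    congr 1
    linear_combination (-d z) * Real.sin_sq_add_cos_sq z

theorem hasDerivAt_besselYOne {z : ℝ} (hz : 0 < z) :
    HasDerivAt besselYOne (besselYZero z - besselYOne z / z) z := by
  have h := (hasDerivAt_mul_besselYOne hz).fun_mul (hasDerivAt_inv hz.ne')
  have h2 : besselYOne =ᶠ[𝓝 z] fun z => z * besselYOne z * z⁻¹ := by
    filter_upwards [eventually_ne_nhds hz.ne'] with x hx
    field_simp
  refine (h.congr_of_eventuallyEq h2).congr_deriv ?_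
  field_simp
  ring

/-- Multiplication by `√z` removes the first-order term of Bessel's equation, so `w = √z Y₀`
satisfies `exists_asymptotics_of_ode`, and `Y₁` is read off from `w'`. The values of `α` and `β` are
never needed, only that they are shared by `Y₀` and `Y₁`. -/
theorem besselY_asymptotics : ∃ α β C : ℝ, ∀ z, 1 ≤ z →
    |√z * besselYZero z - (α * Real.cos z + β * Real.sin z)| ≤ C / z ∧
    |√z * besselYOne z - (α * Real.sin z - β * Real.cos z)| ≤ C / z := by
  obtain ⟨α, β, C, h⟩ := exists_asymptotics_of_ode (w := fun z => √z * besselYZero z)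
    (d := fun z => besselYZero z / (2 * √z) - √z * besselYOne z) (fun z hz => by
      have hz0 : 0 < z := by positivity
      refine ((Real.hasDerivAt_sqrt hz0.ne').fun_mul (hasDerivAt_besselYZero hz0)).congr_deriv ?_
      ring) (fun z hz => by
      have hz0 : 0 < z := by positivity
      have hs : 0 < √z := Real.sqrt_pos.2 hz0
      have h1 := ((Real.hasDerivAt_sqrt hz0.ne').const_mul 2)
      refine (((hasDerivAt_besselYZero hz0).fun_div h1 (by positivity)).fun_sub
        ((Real.hasDerivAt_sqrt hz0.ne').fun_mul (hasDerivAt_besselYOne hz0))).congr_deriv ?_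
      have h2 : z = √z ^ 2 := (Real.sq_sqrt hz0.le).symm
      set s := √z
      rw [h2]
      field_simp
      ring)
  have hC : 0 ≤ C := (abs_nonneg _).trans (h 1 le_rfl).1
  refine ⟨α, β, 2 * C, fun z hz => ⟨(h z hz).2.1.trans ?_, ?_⟩⟩
  · gcongr
    linarith
  · obtain ⟨h1, -, h3⟩ := h z hz
    have hz0 : 0 < z := by positivity
    have hs : 0 < √z := Real.sqrt_pos.2 hz0
    have e : √z * besselYOne z - (α * Real.sin z - β * Real.cos z) =
        √z * besselYZero z / (2 * z) - (besselYZero z / (2 * √z) - √z * besselYOne z -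
          (-(α * Real.sin z) + β * Real.cos z)) := by
      have h2 : z = √z ^ 2 := (Real.sq_sqrt hz0.le).symm
      have : √z * besselYZero z / (2 * z) = besselYZero z / (2 * √z) := by
        rw [div_eq_div_iff (by positivity) (by positivity)]
        linear_combination (-2 * besselYZero z) * h2
      rw [this]; ring
    rw [e]
    refine (abs_sub _ _).trans ?_
    have h4 : |√z * besselYZero z / (2 * z)| ≤ C / z := by
      rw [abs_div, abs_of_pos (show 0 < 2 * z by positivity)]
      gcongr
      linarith
    calc _ ≤ C / z + C / z := add_le_add h4 h3
      _ = _ := by ring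

/-! ### Bounds near `0` and for `K₀`, `K₁` -/

theorem expMoment_nonneg {g : ℝ → ℝ} (hgt : ∀ t, 0 < t → t ≤ g t) (k : ℕ) (z : ℝ) :
    0 ≤ expMoment g k z := by
  refine MeasureTheory.setIntegral_nonneg measurableSet_Ioi fun t ht => ?_
  have : 0 ≤ g t := (le_of_lt ht).trans (hgt t ht)
  positivity

theorem besselKZero_nonneg (z : ℝ) : 0 ≤ besselKZero z := expMoment_nonneg (fun _ => le_cosh) 0 z

theorem besselKOne_nonneg (z : ℝ) : 0 ≤ besselKOne z := expMoment_nonneg (fun _ => le_cosh) 1 z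

/-- Polynomial decay of `K₀` and `K₁` is all that is used, so `e^{-X} ≤ n!/Xⁿ` suffices. As `k < n`,
a factor `1/cosh t ≤ 2e^{-t}` is left over to make the integral converge. -/
theorem expMoment_cosh_le (k n : ℕ) (hk : k < n) {z : ℝ} (hz : 0 < z) :
    expMoment Real.cosh k z ≤ 2 * n.factorial / z ^ n := by
  have hint : MeasureTheory.IntegrableOn (fun t : ℝ => 2 * n.factorial / z ^ n * Real.exp (-t))
      (Set.Ioi 0) := (integrableOn_exp_neg_Ioi 0).const_mul _
  have h := MeasureTheory.setIntegral_mono_on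
    (integrableOn_expMoment Real.continuous_cosh (fun _ => le_cosh) k hz) hint
    measurableSet_Ioi fun t _ => ?_
  · rw [MeasureTheory.integral_const_mul, integral_exp_neg_Ioi_zero, mul_one] at h
    exact h
  · have hc := Real.cosh_pos t
    have hc1 := Real.one_le_cosh t
    have h1 := Real.pow_div_factorial_le_exp (z * Real.cosh t) (by positivity) n
    have hf : (0 : ℝ) < n.factorial := by positivity
    have h2 : Real.exp (-(z * Real.cosh t)) ≤ n.factorial / (z * Real.cosh t) ^ n := by
      rw [Real.exp_neg, inv_le_comm₀ (Real.exp_pos _) (by positivity), inv_div]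
      exact h1
    have h3 : (Real.cosh t)⁻¹ ≤ 2 * Real.exp (-t) := by
      rw [inv_le_comm₀ hc (by positivity), mul_inv, ← Real.exp_neg, neg_neg, Real.cosh_eq]
      linarith [Real.exp_pos (-t)]
    calc Real.cosh t ^ k * Real.exp (-(z * Real.cosh t))
        ≤ Real.cosh t ^ k * (n.factorial / (z * Real.cosh t) ^ n) := by gcongr
      _ ≤ Real.cosh t ^ (n - 1) * (n.factorial / (z * Real.cosh t) ^ n) := by
        gcongr
        exact Nat.le_sub_one_of_lt hk
      _ = n.factorial / z ^ n * (Real.cosh t)⁻¹ := by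
        obtain ⟨m, rfl⟩ : ∃ m, n = m + 1 := ⟨n - 1, by omega⟩
        rw [Nat.add_sub_cancel]
        field_simp
        ring
      _ ≤ n.factorial / z ^ n * (2 * Real.exp (-t)) := by gcongr
      _ = _ := by ring

/-- Since `cosh t = sinh t + e^{-t}`, the integrands differ by a factor `e^{-z e^{-t}}`, hence by at
most `z e^{-t}`. The logarithmic singularities of the two integrals at `z = 0` thus cancel. -/
theorem abs_expMoment_sinh_zero_sub {z : ℝ} (hz : 0 < z) :
    |expMoment Real.sinh 0 z - besselKZero z| ≤ z := by
  have hi := integrableOn_expMoment Real.continuous_sinh (fun _ => le_sinh) 0 hz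
  have hj := integrableOn_expMoment Real.continuous_cosh (fun _ => le_cosh) 0 hz
  have hint : MeasureTheory.IntegrableOn (fun t : ℝ => z * Real.exp (-t))
      (Set.Ioi 0) := (integrableOn_exp_neg_Ioi 0).const_mul _
  rw [besselKZero, expMoment, expMoment, ← MeasureTheory.integral_sub hi hj, ← Real.norm_eq_abs]
  refine (MeasureTheory.norm_integral_le_of_norm_le hint ?_).trans ?_
  · filter_upwards [MeasureTheory.ae_restrict_mem measurableSet_Ioi] with t ht
    have hs := Real.sinh_nonneg_iff.2 (le_of_lt ht)
    have e : Real.cosh t = Real.sinh t + Real.exp (-t) := by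
      rw [Real.cosh_eq, Real.sinh_eq]; ring
    have e2 : Real.exp (-(z * Real.cosh t)) =
        Real.exp (-(z * Real.sinh t)) * Real.exp (-(z * Real.exp (-t))) := by
      rw [← Real.exp_add, e]; ring_nf
    have h1 : Real.exp (-(z * Real.exp (-t))) ≤ 1 := Real.exp_le_one_iff.2 (by
      have : 0 < z * Real.exp (-t) := by positivity
      linarith)
    have h2 := Real.add_one_le_exp (-(z * Real.exp (-t)))
    have h3 : Real.exp (-(z * Real.sinh t)) ≤ 1 := Real.exp_le_one_iff.2 (by
      have : 0 ≤ z * Real.sinh t := by positivity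
      linarith)
    have h4 := Real.exp_pos (-(z * Real.sinh t))
    rw [pow_zero, pow_zero, one_mul, one_mul, e2, Real.norm_of_nonneg (by nlinarith)]
    nlinarith
  · rw [MeasureTheory.integral_const_mul, integral_exp_neg_Ioi_zero, mul_one]

/-- The function `z g' e^{-zg}` is an exact derivative with integral `e^{-z g(0)}`, and replacing
`g'` by `g` costs at most `z e^{-t}`. With `cosh` and `sinh` this isolates the `1/z` singularities
of `K₁` and `Y₁`. -/
theorem abs_mul_expMoment_one_sub {g g' : ℝ → ℝ} (hg : Continuous g)
    (hgt : ∀ t, 0 < t → t ≤ g t) (hgd : ∀ t, HasDerivAt g (g' t) t)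
    (hgg : ∀ t, 0 < t → |g t - g' t| ≤ Real.exp (-t)) {z : ℝ} (hz : 0 < z) :
    |z * expMoment g 1 z - Real.exp (-(z * g 0))| ≤ z := by
  have hi := integrableOn_expMoment hg hgt 1 hz
  have hint : MeasureTheory.IntegrableOn (fun t : ℝ => z * Real.exp (-t))
      (Set.Ioi 0) := (integrableOn_exp_neg_Ioi 0).const_mul _
  have hg'm : Measurable g' := by
    have : g' = deriv g := funext fun t => (hgd t).deriv.symm
    rw [this]; exact measurable_deriv g
  have hbd : ∀ t, 0 < t → ‖z * ((g t - g' t) * Real.exp (-(z * g t)))‖ ≤ z * Real.exp (-t) := by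
    intro t ht
    have h0 : 0 ≤ g t := ht.le.trans (hgt t ht)
    have h3 : Real.exp (-(z * g t)) ≤ 1 := Real.exp_le_one_iff.2 (by
      have : 0 ≤ z * g t := by positivity
      linarith)
    have h4 := Real.exp_pos (-(z * g t))
    rw [norm_mul, norm_mul, Real.norm_of_nonneg hz.le, Real.norm_of_nonneg h4.le, Real.norm_eq_abs]
    have := hgg t ht
    have h5 := Real.exp_pos (-t)
    gcongr
    nlinarith [abs_nonneg (g t - g' t)]
  have hd : MeasureTheory.IntegrableOn
      (fun t => z * ((g t - g' t) * Real.exp (-(z * g t)))) (Set.Ioi 0) := by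
    refine hint.mono' ?_ ?_
    · exact ((hg.measurable.sub hg'm).mul (by fun_prop)).const_mul z |>.aestronglyMeasurable
    · filter_upwards [MeasureTheory.ae_restrict_mem measurableSet_Ioi] with t ht
      exact hbd t ht
  have hsub : MeasureTheory.IntegrableOn (fun t => z * (g t ^ 1 * Real.exp (-(z * g t))) -
      z * ((g t - g' t) * Real.exp (-(z * g t)))) (Set.Ioi 0) := (hi.const_mul z).sub hd
  have hFTC := MeasureTheory.integral_Ioi_of_hasDerivAt_of_tendsto' (a := (0 : ℝ))
    (f := fun t => -Real.exp (-(z * g t)))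
    (f' := fun t => z * (g t ^ 1 * Real.exp (-(z * g t))) -
      z * ((g t - g' t) * Real.exp (-(z * g t)))) (m := -0) (fun t _ => by
        refine (((hgd t).const_mul z).fun_neg.exp).fun_neg.congr_deriv ?_
        ring) hsub (by
        have := tendsto_mul_exp_neg_atTop hgt 0 hz
        simpa using this.neg)
  rw [MeasureTheory.integral_sub (hi.const_mul z) hd, MeasureTheory.integral_const_mul] at hFTC
  have e : z * expMoment g 1 z - Real.exp (-(z * g 0)) =
      ∫ t in Set.Ioi (0 : ℝ), z * ((g t - g' t) * Real.exp (-(z * g t))) := by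
    rw [expMoment]; linarith
  rw [e, ← Real.norm_eq_abs]
  refine (MeasureTheory.norm_integral_le_of_norm_le hint ?_).trans ?_
  · filter_upwards [MeasureTheory.ae_restrict_mem measurableSet_Ioi] with t ht
    exact hbd t ht
  · rw [MeasureTheory.integral_const_mul, integral_exp_neg_Ioi_zero, mul_one]

theorem abs_mul_besselKOne_sub {z : ℝ} (hz : 0 < z) : |z * besselKOne z - 1| ≤ 2 * z := by
  have h := abs_mul_expMoment_one_sub Real.continuous_cosh (fun _ => le_cosh)
    Real.hasDerivAt_cosh (fun t _ => by
      rw [Real.cosh_eq, Real.sinh_eq, show (Real.exp t + Real.exp (-t)) / 2 -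
        (Real.exp t - Real.exp (-t)) / 2 = Real.exp (-t) by ring, abs_of_pos (Real.exp_pos _)]) hz
  rw [Real.cosh_zero, mul_one] at h
  have h1 : Real.exp (-z) ≤ 1 := Real.exp_le_one_iff.2 (by linarith)
  have h2 := Real.add_one_le_exp (-z)
  rw [abs_le] at h ⊢
  unfold besselKOne
  constructor <;> linarith [h.1, h.2]

theorem abs_mul_expMoment_sinh_one_sub {z : ℝ} (hz : 0 < z) :
    |z * expMoment Real.sinh 1 z - 1| ≤ z := by
  have h := abs_mul_expMoment_one_sub Real.continuous_sinh (fun _ => le_sinh)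
    Real.hasDerivAt_sinh (fun t _ => by
      rw [Real.cosh_eq, Real.sinh_eq, show (Real.exp t - Real.exp (-t)) / 2 -
        (Real.exp t + Real.exp (-t)) / 2 = -Real.exp (-t) by ring, abs_neg,
        abs_of_pos (Real.exp_pos _)]) hz
  simpa using h

theorem abs_besselYZero_add {z : ℝ} (hz : 0 < z) :
    |besselYZero z + 2 / Real.pi * besselKZero z| ≤ 2 * z := by
  have hπ := Real.pi_pos
  have h1 : |∫ θ in (0 : ℝ)..Real.pi, Real.sin (z * Real.sin θ)| ≤ z * |Real.pi - 0| := by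
    rw [← Real.norm_eq_abs]
    refine intervalIntegral.norm_integral_le_of_norm_le_const fun θ _ => ?_
    rw [Real.norm_eq_abs]
    refine Real.abs_sin_le_abs.trans ?_
    rw [abs_mul, abs_of_pos hz]
    nlinarith [Real.abs_sin_le_one θ]
  rw [sub_zero, abs_of_pos hπ] at h1
  have h2 := abs_expMoment_sinh_zero_sub hz
  have h3 : 2 / Real.pi ≤ 1 := by rw [div_le_one hπ]; exact Real.two_le_pi
  have e : besselYZero z + 2 / Real.pi * besselKZero z =
      1 / Real.pi * (∫ θ in (0 : ℝ)..Real.pi, Real.sin (z * Real.sin θ)) -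
        2 / Real.pi * (expMoment Real.sinh 0 z - besselKZero z) := by
    rw [besselYZero]; ring
  rw [e]
  refine (abs_sub _ _).trans ?_
  rw [abs_mul, abs_mul, abs_of_pos (show 0 < 1 / Real.pi by positivity),
    abs_of_pos (show 0 < 2 / Real.pi by positivity)]
  calc _ ≤ 1 / Real.pi * (z * Real.pi) + 1 * z := by gcongr
    _ = 2 * z := by field_simp; ring

theorem abs_mul_besselYOne_add {z : ℝ} (hz : 0 < z) :
    |z * besselYOne z + 2 / Real.pi| ≤ 2 * z := by
  have hπ := Real.pi_pos
  have h1 : |∫ θ in (0 : ℝ)..Real.pi, Real.sin θ * Real.cos (z * Real.sin θ)| ≤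
      1 * |Real.pi - 0| := by
    rw [← Real.norm_eq_abs]
    refine intervalIntegral.norm_integral_le_of_norm_le_const fun θ _ => ?_
    rw [Real.norm_eq_abs, abs_mul]
    nlinarith [Real.abs_sin_le_one θ, Real.abs_cos_le_one (z * Real.sin θ),
      abs_nonneg (Real.sin θ), abs_nonneg (Real.cos (z * Real.sin θ))]
  rw [sub_zero, abs_of_pos hπ, one_mul] at h1
  have h2 := abs_mul_expMoment_sinh_one_sub hz
  have h3 : 2 / Real.pi ≤ 1 := by rw [div_le_one hπ]; exact Real.two_le_pi
  have e : z * besselYOne z + 2 / Real.pi =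
      -(z / Real.pi * (∫ θ in (0 : ℝ)..Real.pi, Real.sin θ * Real.cos (z * Real.sin θ))) -
        2 / Real.pi * (z * expMoment Real.sinh 1 z - 1) := by
    rw [besselYOne]; ring
  rw [e]
  refine (abs_sub _ _).trans ?_
  rw [abs_neg, abs_mul, abs_mul, abs_of_pos (show 0 < z / Real.pi by positivity),
    abs_of_pos (show 0 < 2 / Real.pi by positivity)]
  calc _ ≤ z / Real.pi * Real.pi + 1 * z := by gcongr
    _ = 2 * z := by field_simp; ring

/-! ### The kernel functions in the variable `x`, with `z = 2√x` -/

/-- `Y₀(2√x)`. -/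
noncomputable def kerY0 (x : ℝ) : ℝ := besselYZero (2 * √x)

/-- `(2/π) K₀(2√x)`. -/
noncomputable def kerK0 (x : ℝ) : ℝ := 2 / Real.pi * besselKZero (2 * √x)

/-- `√x Y₁(2√x)`. -/
noncomputable def kerY1 (x : ℝ) : ℝ := √x * besselYOne (2 * √x)

/-- `(2/π) √x K₁(2√x)`. -/
noncomputable def kerK1 (x : ℝ) : ℝ := 2 / Real.pi * (√x * besselKOne (2 * √x))

/-- `√x (Y₁ + (2/π) K₁)(2√x)`. -/
noncomputable def kerZ (x : ℝ) : ℝ := kerY1 x + kerK1 x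

/-- The antiderivative of `kerZ` vanishing at `0`. -/
noncomputable def kerE (x : ℝ) : ℝ := ∫ t in (0 : ℝ)..x, kerZ t

theorem hasDerivAt_two_mul_sqrt {x : ℝ} (hx : 0 < x) :
    HasDerivAt (fun x => 2 * √x) (1 / √x) x := by
  refine ((Real.hasDerivAt_sqrt hx.ne').const_mul 2).congr_deriv ?_
  ring

theorem hasDerivAt_kerY0 {x : ℝ} (hx : 0 < x) : HasDerivAt kerY0 (-kerY1 x / x) x := by
  have hs := Real.sqrt_pos.2 hx
  refine ((hasDerivAt_besselYZero (by positivity)).comp x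
    (hasDerivAt_two_mul_sqrt hx)).congr_deriv ?_
  have h2 : x = √x ^ 2 := (Real.sq_sqrt hx.le).symm
  rw [kerY1]
  set s := √x
  rw [h2]
  field_simp

theorem hasDerivAt_kerK0 {x : ℝ} (hx : 0 < x) : HasDerivAt kerK0 (-kerK1 x / x) x := by
  have hs := Real.sqrt_pos.2 hx
  refine (((hasDerivAt_besselKZero (by positivity)).comp x
    (hasDerivAt_two_mul_sqrt hx)).const_mul (2 / Real.pi)).congr_deriv ?_
  have h2 : x = √x ^ 2 := (Real.sq_sqrt hx.le).symm
  rw [kerK1]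
  set s := √x
  rw [h2]
  field_simp

theorem hasDerivAt_kerY1 {x : ℝ} (hx : 0 < x) : HasDerivAt kerY1 (kerY0 x) x := by
  have hs := Real.sqrt_pos.2 hx
  have h := (((hasDerivAt_mul_besselYOne (z := 2 * √x) (by positivity)).comp x
    (hasDerivAt_two_mul_sqrt hx)).const_mul (1 / 2))
  refine (h.congr_of_eventuallyEq (Eventually.of_forall fun y => ?_)).congr_deriv ?_
  · simp only [kerY1, Function.comp]; ring
  · rw [kerY0]; field_simp

theorem hasDerivAt_kerK1 {x : ℝ} (hx : 0 < x) : HasDerivAt kerK1 (-kerK0 x) x := by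
  have hs := Real.sqrt_pos.2 hx
  have h := (((hasDerivAt_mul_besselKOne (z := 2 * √x) (by positivity)).comp x
    (hasDerivAt_two_mul_sqrt hx)).const_mul (1 / Real.pi))
  refine (h.congr_of_eventuallyEq (Eventually.of_forall fun y => ?_)).congr_deriv ?_
  · simp only [kerK1, Function.comp]; ring
  · rw [kerK0]; field_simp

theorem hasDerivAt_kerZ {x : ℝ} (hx : 0 < x) : HasDerivAt kerZ (kerY0 x - kerK0 x) x := by
  rw [sub_eq_add_neg]
  exact (hasDerivAt_kerY1 hx).add (hasDerivAt_kerK1 hx)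

theorem two_div_pi_le_one : 2 / Real.pi ≤ 1 := by
  rw [div_le_one Real.pi_pos]; exact Real.two_le_pi

theorem abs_kerY1_add {x : ℝ} (hx : 0 < x) : |kerY1 x + 1 / Real.pi| ≤ 2 * √x := by
  have hs := Real.sqrt_pos.2 hx
  have h := abs_mul_besselYOne_add (z := 2 * √x) (by positivity)
  have e : 2 * √x * besselYOne (2 * √x) + 2 / Real.pi = 2 * (kerY1 x + 1 / Real.pi) := by
    rw [kerY1]; ring
  rw [e, abs_mul, abs_two] at h
  linarith

theorem abs_kerK1_sub {x : ℝ} (hx : 0 < x) : |kerK1 x - 1 / Real.pi| ≤ 2 * √x := by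
  have hs := Real.sqrt_pos.2 hx
  have h := abs_mul_besselKOne_sub (z := 2 * √x) (by positivity)
  have e : kerK1 x - 1 / Real.pi = 1 / Real.pi * (2 * √x * besselKOne (2 * √x) - 1) := by
    rw [kerK1]; ring
  have h1 := two_div_pi_le_one
  rw [e, abs_mul, abs_of_pos (show 0 < 1 / Real.pi by positivity)]
  calc _ ≤ 1 / Real.pi * (2 * (2 * √x)) := by gcongr
    _ = 2 / Real.pi * (2 * √x) := by ring
    _ ≤ 1 * (2 * √x) := by gcongr
    _ = _ := one_mul _

theorem abs_kerY0_add_kerK0 {x : ℝ} (hx : 0 < x) : |kerY0 x + kerK0 x| ≤ 4 * √x := by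
  have hs := Real.sqrt_pos.2 hx
  have h := abs_besselYZero_add (z := 2 * √x) (by positivity)
  rw [kerY0, kerK0]
  linarith

theorem kerK0_nonneg (x : ℝ) : 0 ≤ kerK0 x :=
  mul_nonneg (by positivity) (besselKZero_nonneg _)

theorem kerK1_nonneg (x : ℝ) : 0 ≤ kerK1 x :=
  mul_nonneg (by positivity) (mul_nonneg (by positivity) (besselKOne_nonneg _))

theorem kerK0_le {x : ℝ} (hx : 0 < x) : kerK0 x ≤ 1 / √x := by
  have hs := Real.sqrt_pos.2 hx
  have h := expMoment_cosh_le 0 1 one_pos (z := 2 * √x) (by positivity)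
  calc kerK0 x ≤ 1 * besselKZero (2 * √x) := by
        rw [kerK0]; gcongr
        · exact besselKZero_nonneg _
        · exact two_div_pi_le_one
    _ ≤ 1 * (2 * (Nat.factorial 1) / (2 * √x) ^ 1) := by gcongr; exact h
    _ = _ := by simp; field_simp

theorem kerK0_le' {x : ℝ} (hx : 0 < x) : kerK0 x ≤ 1 / x := by
  have hs := Real.sqrt_pos.2 hx
  have h := expMoment_cosh_le 0 2 two_pos (z := 2 * √x) (by positivity)
  calc kerK0 x ≤ 1 * besselKZero (2 * √x) := by
        rw [kerK0]; gcongr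
        · exact besselKZero_nonneg _
        · exact two_div_pi_le_one
    _ ≤ 1 * (2 * (Nat.factorial 2) / (2 * √x) ^ 2) := by gcongr; exact h
    _ = _ := by rw [mul_pow, Real.sq_sqrt hx.le]; norm_num [Nat.factorial]; field_simp

theorem kerK1_le {x : ℝ} (hx : 0 < x) : kerK1 x ≤ 1 / √x := by
  have hs := Real.sqrt_pos.2 hx
  have h := expMoment_cosh_le 1 2 one_lt_two (z := 2 * √x) (by positivity)
  calc kerK1 x ≤ 1 * (√x * besselKOne (2 * √x)) := by
        rw [kerK1]; gcongr
        · exact mul_nonneg hs.le (besselKOne_nonneg _)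
        · exact two_div_pi_le_one
    _ ≤ 1 * (√x * (2 * (Nat.factorial 2) / (2 * √x) ^ 2)) := by gcongr; exact h
    _ = _ := by norm_num [Nat.factorial]; field_simp; norm_num

theorem ker_asymptotics : ∃ ρ φ C : ℝ, 0 ≤ C ∧ ∀ x, 1 ≤ x →
    |kerY0 x - x ^ (-(1 / 4) : ℝ) * (ρ * Real.cos (2 * √x - φ))| ≤ C * x ^ (-(3 / 4) : ℝ) ∧
    |kerY1 x - x ^ (1 / 4 : ℝ) * (ρ * Real.sin (2 * √x - φ))| ≤ C * x ^ (-(1 / 4) : ℝ) := by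
  obtain ⟨α, β, C, h⟩ := besselY_asymptotics
  have hC : 0 ≤ C := by simpa using (abs_nonneg _).trans (h 1 le_rfl).1
  -- Polar form of `α + iβ`. The factor `√2` comes from `√z = √2 x^{1/4}` at `z = 2√x`.
  obtain ⟨ρ, φ, hα, hβ⟩ : ∃ ρ φ : ℝ, α = √2 * ρ * Real.cos φ ∧ β = √2 * ρ * Real.sin φ := by
    have h2 : √2 ≠ 0 := by positivity
    refine ⟨‖(⟨α, β⟩ : ℂ)‖ / √2, Complex.arg ⟨α, β⟩, ?_, ?_⟩
    · rw [mul_div_cancel₀ _ h2, Complex.norm_mul_cos_arg]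
    · rw [mul_div_cancel₀ _ h2, Complex.norm_mul_sin_arg]
  refine ⟨ρ, φ, C, hC, fun x hx => ?_⟩
  have hx0 : 0 < x := by positivity
  set r : ℝ := x ^ (1 / 4 : ℝ) with hr
  have hr0 : 0 < r := by positivity
  have hr1 : 1 ≤ r := Real.one_le_rpow hx (by norm_num)
  have hsq : √x = r ^ 2 := by
    rw [Real.sqrt_eq_rpow, hr, ← Real.rpow_natCast, ← Real.rpow_mul hx0.le]; norm_num
  have h1 : x ^ (-(1 / 4) : ℝ) = r⁻¹ := by rw [Real.rpow_neg hx0.le]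
  have h3 : x ^ (-(3 / 4) : ℝ) = (r ^ 3)⁻¹ := by
    rw [Real.rpow_neg hx0.le, hr, ← Real.rpow_natCast, ← Real.rpow_mul hx0.le]; norm_num
  have hz : √(2 * r ^ 2) = √2 * r := by
    rw [Real.sqrt_mul (by norm_num), Real.sqrt_sq hr0.le]
  have h22 : 1 ≤ √2 := by rw [Real.one_le_sqrt]; norm_num
  have h20 : 0 < √2 := by positivity
  obtain ⟨hA, hB⟩ := h (2 * √x) (by rw [hsq]; nlinarith)
  rw [h1, h3, kerY0, kerY1, Real.cos_sub, Real.sin_sub, hsq]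
  rw [hsq, hz] at hA hB
  have fin : ∀ A e : ℝ, |√2 * A| ≤ C / (2 * r ^ 2) * e → 0 ≤ e → |A| ≤ C / r ^ 2 * e := by
    intro A e hAe he
    rw [abs_mul, abs_of_pos h20] at hAe
    have : |A| ≤ √2 * |A| := by nlinarith [abs_nonneg A]
    refine this.trans (hAe.trans ?_)
    gcongr
    nlinarith
  constructor
  · refine (fin _ r⁻¹ ?_ (by positivity)).trans (le_of_eq (by field_simp))
    have e : √2 * (besselYZero (2 * r ^ 2) - r⁻¹ * (ρ * (Real.cos (2 * r ^ 2) * Real.cos φ +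
        Real.sin (2 * r ^ 2) * Real.sin φ))) = (√2 * r * besselYZero (2 * r ^ 2) -
          (α * Real.cos (2 * r ^ 2) + β * Real.sin (2 * r ^ 2))) * r⁻¹ := by
      rw [hα, hβ]; field_simp
    rw [e, abs_mul, abs_of_pos (inv_pos.2 hr0)]
    gcongr
  · refine (fin _ r ?_ (by positivity)).trans (le_of_eq (by field_simp))
    have e : √2 * (r ^ 2 * besselYOne (2 * r ^ 2) - r * (ρ * (Real.sin (2 * r ^ 2) * Real.cos φ -
        Real.cos (2 * r ^ 2) * Real.sin φ))) = (√2 * r * besselYOne (2 * r ^ 2) -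
          (α * Real.sin (2 * r ^ 2) - β * Real.cos (2 * r ^ 2))) * r := by
      rw [hα, hβ]; ring
    rw [e, abs_mul, abs_of_pos hr0]
    gcongr

theorem ker_bounds : ∃ C : ℝ, 0 ≤ C ∧ ∀ x, 1 ≤ x →
    |kerY0 x| ≤ C * x ^ (-(1 / 4) : ℝ) ∧ |kerY1 x| ≤ C * x ^ (1 / 4 : ℝ) := by
  obtain ⟨ρ, φ, C, hC, h⟩ := ker_asymptotics
  refine ⟨C + |ρ|, by positivity, fun x hx => ?_⟩
  have hx0 : 0 < x := by positivity
  obtain ⟨h1, h2⟩ := h x hx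
  have key : ∀ A B c e e' : ℝ, |A - e * (ρ * c)| ≤ C * e' → |c| ≤ 1 → e' ≤ e → 0 ≤ e →
      |A| ≤ (C + |ρ|) * e := by
    intro A B c e e' h1 hc he he0
    have h3 : |A| ≤ |A - e * (ρ * c)| + |e * (ρ * c)| := by
      simpa using abs_add_le (A - e * (ρ * c)) (e * (ρ * c))
    rw [abs_mul e, abs_mul ρ, abs_of_nonneg he0] at h3
    calc |A| ≤ C * e' + e * (|ρ| * |c|) := by linarith
      _ ≤ C * e + e * (|ρ| * 1) := by gcongr
      _ = _ := by ring
  constructor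
  · exact key _ 0 _ _ _ h1 (Real.abs_cos_le_one _)
      (Real.rpow_le_rpow_of_exponent_le hx (by norm_num)) (by positivity)
  · exact key _ 0 _ _ _ h2 (Real.abs_sin_le_one _)
      (Real.rpow_le_rpow_of_exponent_le hx (by norm_num)) (by positivity)

/-- The limits `-1/π` and `1/π` of the two parts at `0` cancel. For `x ≤ 0` the square root is `0`,
so the function is identically zero there and turns out continuous on the whole line. -/
theorem abs_kerZ_le (x : ℝ) : |kerZ x| ≤ 4 * √x := by
  rcases le_or_gt x 0 with hx | hx
  · simp [kerZ, kerY1, kerK1, Real.sqrt_eq_zero_of_nonpos hx]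
  · have e : kerZ x = (kerY1 x + 1 / Real.pi) + (kerK1 x - 1 / Real.pi) := by rw [kerZ]; ring
    rw [e]
    refine (abs_add_le _ _).trans ?_
    linarith [abs_kerY1_add hx, abs_kerK1_sub hx]

theorem continuous_kerZ : Continuous kerZ := by
  rw [continuous_iff_continuousAt]
  intro x
  rcases lt_trichotomy x 0 with hx | rfl | hx
  · have : kerZ =ᶠ[𝓝 x] fun _ => 0 := by
      filter_upwards [Iio_mem_nhds hx] with y hy
      simp [kerZ, kerY1, kerK1, Real.sqrt_eq_zero_of_nonpos (le_of_lt hy)]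
    exact continuousAt_const.congr this.symm
  · have h0 : kerZ 0 = 0 := by simp [kerZ, kerY1, kerK1]
    rw [ContinuousAt, h0]
    refine squeeze_zero_norm (fun y => abs_kerZ_le y) ?_
    have : Continuous fun y : ℝ => 4 * √y := by fun_prop
    simpa using this.tendsto 0
  · exact (hasDerivAt_kerZ hx).continuousAt

theorem hasDerivAt_kerE (x : ℝ) : HasDerivAt kerE (kerZ x) x :=
  intervalIntegral.integral_hasDerivAt_right (continuous_kerZ.intervalIntegrable _ _)
    (continuous_kerZ.stronglyMeasurableAtFilter _ _) continuous_kerZ.continuousAt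

theorem continuous_kerE : Continuous kerE :=
  continuous_iff_continuousAt.2 fun x => (hasDerivAt_kerE x).continuousAt

theorem kerE_zero : kerE 0 = 0 := by simp [kerE]

/-- Both sides have derivative `Z` on the positive axis. The constant `2/π` makes the right side
tend to `0` at `0`, where `kerY1` and `-kerK1` both tend to `-1/π`. -/
theorem kerE_eq {x : ℝ} (hx : 0 < x) :
    kerE x = 2 / Real.pi - x * (kerY0 x + kerK0 x) + kerY1 x - kerK1 x := by
  set D : ℝ → ℝ := fun x => kerE x - (2 / Real.pi - x * (kerY0 x + kerK0 x) + kerY1 x - kerK1 x)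
  have hD : ∀ y, 0 < y → HasDerivAt D 0 y := fun y hy => by
    refine ((hasDerivAt_kerE y).fun_sub (((((hasDerivAt_id y).fun_mul
      ((hasDerivAt_kerY0 hy).fun_add (hasDerivAt_kerK0 hy))).const_sub (2 / Real.pi)).fun_add
      (hasDerivAt_kerY1 hy)).fun_sub (hasDerivAt_kerK1 hy))).congr_deriv ?_
    simp only [kerZ, id]
    field_simp
    ring
  have hconst : ∀ y, 0 < y → D y = D x := fun y hy => by
    have hd : DifferentiableOn ℝ D (Set.Ioi 0) :=
      fun z hz => (hD z hz).differentiableAt.differentiableWithinAt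
    exact isOpen_Ioi.is_const_of_deriv_eq_zero isPreconnected_Ioi hd
      (fun z hz => (hD z hz).deriv) hy hx
  have hlim : Tendsto D (𝓝[>] 0) (𝓝 0) := by
    have h1 : Tendsto (fun y : ℝ => |kerE y| + y * (4 * √y) + 2 * √y + 2 * √y) (𝓝[>] 0)
        (𝓝 0) := by
      have hc := continuous_kerE
      have : Continuous fun y : ℝ => |kerE y| + y * (4 * √y) + 2 * √y + 2 * √y := by fun_prop
      have h := this.tendsto 0
      simp only [kerE_zero, Real.sqrt_zero, abs_zero, mul_zero, add_zero] at h
      exact h.mono_left nhdsWithin_le_nhds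
    refine squeeze_zero_norm' ?_ h1
    filter_upwards [self_mem_nhdsWithin] with y hy
    have hy : 0 < y := hy
    have e : D y = kerE y + y * (kerY0 y + kerK0 y) - (kerY1 y + 1 / Real.pi) +
        (kerK1 y - 1 / Real.pi) := by simp only [D]; ring
    rw [e, Real.norm_eq_abs]
    refine (abs_add_le _ _).trans (add_le_add ((abs_sub _ _).trans (add_le_add
      ((abs_add_le _ _).trans (add_le_add le_rfl ?_)) (abs_kerY1_add hy))) (abs_kerK1_sub hy))
    rw [abs_mul, abs_of_pos hy]
    gcongr
    exact abs_kerY0_add_kerK0 hy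
  have h2 : Tendsto D (𝓝[>] 0) (𝓝 (D x)) := by
    refine tendsto_const_nhds.congr' ?_
    filter_upwards [self_mem_nhdsWithin] with y hy
    exact (hconst y hy).symm
  have := tendsto_nhds_unique h2 hlim
  simp only [D] at this
  linarith

theorem rpow_le_rpow_of_one_le {x a b : ℝ} (hx : 1 ≤ x) (h : a ≤ b) : x ^ a ≤ x ^ b :=
  Real.rpow_le_rpow_of_exponent_le hx h

/-- In `kerE_eq` only `-x Y₀` has order `x^{3/4}`. The term in `Y₁` has order `x^{1/4}`, and those
in `K₀`, `K₁` are bounded. -/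
theorem kerE_asymptotics {ρ φ C : ℝ} (hC : 0 ≤ C) (h : ∀ x, 1 ≤ x →
    |kerY0 x - x ^ (-(1 / 4) : ℝ) * (ρ * Real.cos (2 * √x - φ))| ≤ C * x ^ (-(3 / 4) : ℝ) ∧
    |kerY1 x - x ^ (1 / 4 : ℝ) * (ρ * Real.sin (2 * √x - φ))| ≤ C * x ^ (-(1 / 4) : ℝ)) :
    ∃ C', 0 ≤ C' ∧ ∀ x, 1 ≤ x →
      |kerE x + x ^ (3 / 4 : ℝ) * (ρ * Real.cos (2 * √x - φ))| ≤ C' * x ^ (1 / 4 : ℝ) := by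
  obtain ⟨B, hB, hb⟩ := ker_bounds
  refine ⟨C + B + 3, by positivity, fun x hx => ?_⟩
  have hx0 : 0 < x := by positivity
  have e1 : x ^ (3 / 4 : ℝ) = x * x ^ (-(1 / 4) : ℝ) := by
    rw [← Real.rpow_one_add' hx0.le (by norm_num)]; norm_num
  have e2 : x ^ (1 / 4 : ℝ) = x * x ^ (-(3 / 4) : ℝ) := by
    rw [← Real.rpow_one_add' hx0.le (by norm_num)]; norm_num
  have h1 : 1 ≤ x ^ (1 / 4 : ℝ) := Real.one_le_rpow hx (by norm_num)
  have hs : 1 ≤ √x := Real.one_le_sqrt.2 hx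
  have e : kerE x + x ^ (3 / 4 : ℝ) * (ρ * Real.cos (2 * √x - φ)) =
      (2 / Real.pi - x * kerK0 x) + (kerY1 x - kerK1 x) -
      x * (kerY0 x - x ^ (-(1 / 4) : ℝ) * (ρ * Real.cos (2 * √x - φ))) := by
    rw [kerE_eq hx0, e1]; ring
  have b1 : |2 / Real.pi - x * kerK0 x| ≤ 2 := by
    have h3 : x * kerK0 x ≤ 1 := by
      have := kerK0_le' hx0
      rw [le_div_iff₀ hx0] at this
      linarith
    have h4 : 0 ≤ x * kerK0 x := mul_nonneg hx0.le (kerK0_nonneg x)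
    have h5 := two_div_pi_le_one
    have h6 : 0 ≤ 2 / Real.pi := by positivity
    rw [abs_le]; constructor <;> linarith
  have b2 : |kerK1 x| ≤ 1 := by
    rw [abs_of_nonneg (kerK1_nonneg x)]
    refine (kerK1_le hx0).trans ?_
    rw [div_le_one (by positivity)]; exact hs
  have b3 : |x * (kerY0 x - x ^ (-(1 / 4) : ℝ) * (ρ * Real.cos (2 * √x - φ)))| ≤
      C * x ^ (1 / 4 : ℝ) := by
    rw [abs_mul, abs_of_pos hx0, e2]
    calc _ ≤ x * (C * x ^ (-(3 / 4) : ℝ)) := by gcongr; exact (h x hx).1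
      _ = _ := by ring
  rw [e]
  refine (abs_sub _ _).trans ?_
  have b4 := abs_add_le (2 / Real.pi - x * kerK0 x) (kerY1 x - kerK1 x)
  have b5 := abs_sub (kerY1 x) (kerK1 x)
  have b6 := (hb x hx).2
  nlinarith

theorem abs_kerE_le : ∃ C, 0 ≤ C ∧ ∀ x, 0 ≤ x → |kerE x| ≤ C * x ^ (3 / 4 : ℝ) := by
  obtain ⟨ρ, φ, C, hC, h⟩ := ker_asymptotics
  obtain ⟨C', hC', h'⟩ := kerE_asymptotics hC h
  refine ⟨C' + |ρ| + 4, by positivity, fun x hx => ?_⟩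
  rcases le_or_gt 1 x with hx1 | hx1
  · have hx0 : 0 < x := by positivity
    have h1 := h' x hx1
    have h2 : |kerE x| ≤ |kerE x + x ^ (3 / 4 : ℝ) * (ρ * Real.cos (2 * √x - φ))| +
        |x ^ (3 / 4 : ℝ) * (ρ * Real.cos (2 * √x - φ))| := by
      simpa using abs_sub (kerE x + x ^ (3 / 4 : ℝ) * (ρ * Real.cos (2 * √x - φ)))
        (x ^ (3 / 4 : ℝ) * (ρ * Real.cos (2 * √x - φ)))
    have h3 : x ^ (1 / 4 : ℝ) ≤ x ^ (3 / 4 : ℝ) := rpow_le_rpow_of_one_le hx1 (by norm_num)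
    have h4 : |x ^ (3 / 4 : ℝ) * (ρ * Real.cos (2 * √x - φ))| ≤ x ^ (3 / 4 : ℝ) * (|ρ| * 1) := by
      rw [abs_mul, abs_mul, abs_of_nonneg (by positivity : 0 ≤ x ^ (3 / 4 : ℝ))]
      gcongr
      exact Real.abs_cos_le_one _
    have h5 : C' * x ^ (1 / 4 : ℝ) ≤ C' * x ^ (3 / 4 : ℝ) := by gcongr
    have h6 : 0 ≤ x ^ (3 / 4 : ℝ) := by positivity
    nlinarith
  · have h1 : |kerE x| ≤ 4 * |x - 0| := by
      rw [kerE, ← Real.norm_eq_abs]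
      refine intervalIntegral.norm_integral_le_of_norm_le_const fun t ht => ?_
      rw [Set.uIoc_of_le hx] at ht
      refine (abs_kerZ_le t).trans ?_
      have : √t ≤ 1 := Real.sqrt_le_iff.2 ⟨zero_le_one, by linarith [ht.2]⟩
      linarith
    rw [sub_zero, abs_of_nonneg hx] at h1
    have h2 : x ≤ x ^ (3 / 4 : ℝ) := by
      rcases hx.eq_or_lt with rfl | hx0
      · rw [Real.zero_rpow (by norm_num)]
      · conv_lhs => rw [← Real.rpow_one x]
        exact Real.rpow_le_rpow_of_exponent_ge hx0 hx1.le (by norm_num)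
    have h6 : 0 ≤ x ^ (3 / 4 : ℝ) := by positivity
    nlinarith [abs_nonneg ρ]

/-! ### Cosine and sine transforms of rational functions -/

/-- `∫₀^∞ a(u) cos(zu) du`. -/
noncomputable def cosInt (a : ℝ → ℝ) (z : ℝ) : ℝ := ∫ u in Set.Ioi (0 : ℝ), a u * Real.cos (z * u)

/-- `∫₀^∞ a(u) sin(zu) du`. -/
noncomputable def sinInt (a : ℝ → ℝ) (z : ℝ) : ℝ := ∫ u in Set.Ioi (0 : ℝ), a u * Real.sin (z * u)

/-- Continuous functions on `ℝ` that are `O(1/(1+u²))`. -/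
structure QuadDecay (a : ℝ → ℝ) : Prop where
  cont : Continuous a
  bound : ∃ C, ∀ u, |a u| ≤ C * (1 + u ^ 2)⁻¹

namespace QuadDecay

variable {a b : ℝ → ℝ}

theorem integrable_mul (ha : QuadDecay a) {b : ℝ → ℝ} (hb : Continuous b)
    (hb1 : ∀ u, |b u| ≤ 1) : MeasureTheory.IntegrableOn (fun u => a u * b u) (Set.Ioi 0) := by
  obtain ⟨C, hC⟩ := ha.bound
  have hac := ha.cont
  refine ((integrable_inv_one_add_sq.const_mul C).integrableOn).mono' (by fun_prop)
    (Eventually.of_forall fun u => ?_)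
  rw [norm_mul, Real.norm_eq_abs, Real.norm_eq_abs]
  calc _ ≤ |a u| * 1 := by gcongr; exact hb1 u
    _ ≤ _ := by rw [mul_one]; exact hC u

theorem integrable_cos (ha : QuadDecay a) (z : ℝ) :
    MeasureTheory.IntegrableOn (fun u => a u * Real.cos (z * u)) (Set.Ioi 0) :=
  ha.integrable_mul (by fun_prop) fun _ => Real.abs_cos_le_one _

theorem integrable_sin (ha : QuadDecay a) (z : ℝ) :
    MeasureTheory.IntegrableOn (fun u => a u * Real.sin (z * u)) (Set.Ioi 0) :=
  ha.integrable_mul (by fun_prop) fun _ => Real.abs_sin_le_one _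

theorem tendsto_mul (ha : QuadDecay a) {b : ℝ → ℝ}
    (hb1 : ∀ u, |b u| ≤ 1) : Tendsto (fun u => a u * b u) atTop (𝓝 0) := by
  obtain ⟨C, hC⟩ := ha.bound
  have h : Tendsto (fun u : ℝ => C * (1 + u ^ 2)⁻¹) atTop (𝓝 0) := by
    have : Tendsto (fun u : ℝ => 1 + u ^ 2) atTop atTop :=
      tendsto_atTop_add_const_left _ _ (tendsto_pow_atTop two_ne_zero)
    simpa using this.inv_tendsto_atTop.const_mul C
  refine squeeze_zero_norm (fun u => ?_) h
  rw [norm_mul, Real.norm_eq_abs, Real.norm_eq_abs]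
  calc _ ≤ |a u| * 1 := by gcongr; exact hb1 u
    _ ≤ _ := by rw [mul_one]; exact hC u

theorem abs_sinInt_le (ha : QuadDecay a) : ∃ M, ∀ z, |sinInt a z| ≤ M := by
  obtain ⟨C, hC⟩ := ha.bound
  refine ⟨_, fun z => (Real.norm_eq_abs _).symm.trans_le <| MeasureTheory.norm_integral_le_of_norm_le
    (integrable_inv_one_add_sq.const_mul C).integrableOn (Eventually.of_forall fun u => ?_)⟩
  rw [norm_mul, Real.norm_eq_abs, Real.norm_eq_abs]
  calc _ ≤ |a u| * 1 := by gcongr; exact Real.abs_sin_le_one _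
    _ ≤ _ := by rw [mul_one]; exact hC u

theorem abs_cosInt_le (ha : QuadDecay a) : ∃ M, ∀ z, |cosInt a z| ≤ M := by
  obtain ⟨C, hC⟩ := ha.bound
  refine ⟨_, fun z => (Real.norm_eq_abs _).symm.trans_le <| MeasureTheory.norm_integral_le_of_norm_le
    (integrable_inv_one_add_sq.const_mul C).integrableOn (Eventually.of_forall fun u => ?_)⟩
  rw [norm_mul, Real.norm_eq_abs, Real.norm_eq_abs]
  calc _ ≤ |a u| * 1 := by gcongr; exact Real.abs_cos_le_one _
    _ ≤ _ := by rw [mul_one]; exact hC u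

theorem continuous_sinInt (ha : QuadDecay a) : Continuous (sinInt a) := by
  obtain ⟨C, hC⟩ := ha.bound
  have hac := ha.cont
  refine MeasureTheory.continuous_of_dominated (bound := fun u => C * (1 + u ^ 2)⁻¹)
    (fun z => by fun_prop) (fun z => Eventually.of_forall fun u => ?_)
    (integrable_inv_one_add_sq.const_mul C).integrableOn (Eventually.of_forall fun u => by fun_prop)
  rw [norm_mul, Real.norm_eq_abs, Real.norm_eq_abs]
  calc _ ≤ |a u| * 1 := by gcongr; exact Real.abs_sin_le_one _
    _ ≤ _ := by rw [mul_one]; exact hC u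

theorem hasDerivAt_cosInt (ha : QuadDecay a) (hb : QuadDecay fun u => u * a u) (z : ℝ) :
    HasDerivAt (cosInt a) (-sinInt (fun u => u * a u) z) z := by
  obtain ⟨C, hC⟩ := hb.bound
  have hac := ha.cont
  have key := (hasDerivAt_integral_of_dominated_loc_of_deriv_le
    (μ := MeasureTheory.volume.restrict (Set.Ioi (0 : ℝ))) (x₀ := z) (s := Set.univ) univ_mem
    (F := fun z u => a u * Real.cos (z * u))
    (F' := fun z u => -(u * a u * Real.sin (z * u)))
    (Eventually.of_forall fun x => by fun_prop) (ha.integrable_cos z) (by fun_prop)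
    (bound := fun u => C * (1 + u ^ 2)⁻¹) (Eventually.of_forall fun u x _ => ?_)
    (integrable_inv_one_add_sq.const_mul C).integrableOn
    (Eventually.of_forall fun u x _ => ?_)).2
  · rw [MeasureTheory.integral_neg] at key
    exact key
  · rw [norm_neg, norm_mul, Real.norm_eq_abs, Real.norm_eq_abs]
    calc _ ≤ |u * a u| * 1 := by gcongr; exact Real.abs_sin_le_one _
      _ ≤ _ := by rw [mul_one]; exact hC u
  · refine ((((hasDerivAt_id x).mul_const u).cos).const_mul (a u)).congr_deriv ?_
    simp only [id]; ring

theorem mul_sinInt (ha : QuadDecay a) (hb : QuadDecay b) (hab : ∀ u, HasDerivAt a (b u) u)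
    (z : ℝ) : z * sinInt a z = a 0 + cosInt b z := by
  have hs : MeasureTheory.IntegrableOn (fun u => b u * Real.cos (z * u) -
      z * (a u * Real.sin (z * u))) (Set.Ioi 0) :=
    (hb.integrable_cos z).sub ((ha.integrable_sin z).const_mul z)
  have h := MeasureTheory.integral_Ioi_of_hasDerivAt_of_tendsto' (a := (0 : ℝ))
    (f := fun u => a u * Real.cos (z * u)) (fun u _ => by
      refine ((hab u).fun_mul (((hasDerivAt_id u).const_mul z).cos)).congr_deriv ?_
      simp only [id]; ring) hs (ha.tendsto_mul fun _ => Real.abs_cos_le_one _)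
  rw [MeasureTheory.integral_sub (hb.integrable_cos z) ((ha.integrable_sin z).const_mul z),
    MeasureTheory.integral_const_mul] at h
  simp only [mul_zero, Real.cos_zero, mul_one] at h
  unfold sinInt cosInt
  linarith

theorem mul_cosInt (ha : QuadDecay a) (hb : QuadDecay b) (hab : ∀ u, HasDerivAt a (b u) u)
    (z : ℝ) : z * cosInt a z = -sinInt b z := by
  have hs : MeasureTheory.IntegrableOn (fun u => b u * Real.sin (z * u) +
      z * (a u * Real.cos (z * u))) (Set.Ioi 0) :=
    (hb.integrable_sin z).add ((ha.integrable_cos z).const_mul z)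
  have h := MeasureTheory.integral_Ioi_of_hasDerivAt_of_tendsto' (a := (0 : ℝ))
    (f := fun u => a u * Real.sin (z * u)) (fun u _ => by
      refine ((hab u).fun_mul (((hasDerivAt_id u).const_mul z).sin)).congr_deriv ?_
      simp only [id]; ring) hs (ha.tendsto_mul fun _ => Real.abs_sin_le_one _)
  rw [MeasureTheory.integral_add (hb.integrable_sin z) ((ha.integrable_cos z).const_mul z),
    MeasureTheory.integral_const_mul] at h
  simp only [mul_zero, Real.sin_zero, sub_zero] at h
  unfold sinInt cosInt
  linarith

theorem of_div {p : ℝ → ℝ} (hp : Continuous p) (C : ℝ) (n : ℕ)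
    (h : ∀ u, |p u| * (1 + u ^ 2) ≤ C * (1 + u ^ 2) ^ n) :
    QuadDecay fun u => p u / (1 + u ^ 2) ^ n where
  cont := hp.div₀ (by fun_prop) fun u => by positivity
  bound := ⟨C, fun u => by
    have h1 : 0 < 1 + u ^ 2 := by positivity
    rw [abs_div, abs_of_pos (by positivity : 0 < (1 + u ^ 2) ^ n), div_le_iff₀ (by positivity),
      mul_assoc, mul_comm _ ((1 + u ^ 2) ^ n), ← mul_assoc, ← div_eq_mul_inv, le_div_iff₀ h1]
    exact h u⟩

theorem abs_div_le_of_nonneg (ha : QuadDecay a) : ∃ C, 0 ≤ C ∧ ∀ u, |a u| ≤ C * (1 + u ^ 2)⁻¹ := by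
  obtain ⟨C, hC⟩ := ha.bound
  exact ⟨C, by simpa using (abs_nonneg _).trans (hC 0), hC⟩

end QuadDecay

/-- `1/(1+u²)`. -/
noncomputable def ratJ (u : ℝ) : ℝ := 1 / (1 + u ^ 2) ^ 1

/-- `-(1/(1+u²))' = 2u/(1+u²)²`. -/
noncomputable def ratJ1 (u : ℝ) : ℝ := 2 * u / (1 + u ^ 2) ^ 2

/-- The derivative of `2u/(1+u²)²`. -/
noncomputable def ratJ2 (u : ℝ) : ℝ := 2 * (1 - 3 * u ^ 2) / (1 + u ^ 2) ^ 3

/-- `u/(1+u²)`. -/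
noncomputable def ratK (u : ℝ) : ℝ := u / (1 + u ^ 2)

/-- The derivative of `u/(1+u²)`. -/
noncomputable def ratK1 (u : ℝ) : ℝ := (1 - u ^ 2) / (1 + u ^ 2) ^ 2

/-- The second derivative of `u/(1+u²)`. -/
noncomputable def ratK2 (u : ℝ) : ℝ := 2 * u * (u ^ 2 - 3) / (1 + u ^ 2) ^ 3

theorem hasDerivAt_ratJ (u : ℝ) : HasDerivAt ratJ (-ratJ1 u) u := by
  refine ((hasDerivAt_const u (1 : ℝ)).fun_div ((((hasDerivAt_id u).fun_pow 2).const_add 1).fun_pow 1)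
    (by simp only [id]; positivity)).congr_deriv ?_
  simp only [ratJ1, id]; field_simp; ring

theorem hasDerivAt_ratJ1 (u : ℝ) : HasDerivAt ratJ1 (ratJ2 u) u := by
  refine ((((hasDerivAt_id u).const_mul 2)).fun_div
    ((((hasDerivAt_id u).fun_pow 2).const_add 1).fun_pow 2)
    (by simp only [id]; positivity)).congr_deriv ?_
  simp only [ratJ2, id]; field_simp; ring

theorem hasDerivAt_ratK (u : ℝ) : HasDerivAt ratK (ratK1 u) u := by
  refine ((hasDerivAt_id u).fun_div (((hasDerivAt_id u).fun_pow 2).const_add 1)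
    (by simp only [id]; positivity)).congr_deriv ?_
  simp only [ratK1, id]; field_simp; ring

theorem hasDerivAt_ratK1 (u : ℝ) : HasDerivAt ratK1 (ratK2 u) u := by
  refine ((((hasDerivAt_id u).fun_pow 2).const_sub 1).fun_div
    ((((hasDerivAt_id u).fun_pow 2).const_add 1).fun_pow 2)
    (by simp only [id]; positivity)).congr_deriv ?_
  simp only [ratK2, id]; field_simp; ring

theorem two_mul_abs_le (u : ℝ) : 2 * |u| ≤ 1 + u ^ 2 := by
  nlinarith [sq_nonneg (|u| - 1), sq_abs u]

theorem quadDecay_ratJ : QuadDecay ratJ :=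
  .of_div (p := fun _ => 1) (by fun_prop) 1 1 fun u => by simp

theorem quadDecay_ratJ1 : QuadDecay ratJ1 :=
  .of_div (p := fun u => 2 * u) (by fun_prop) 1 2 fun u => by
    have := two_mul_abs_le u
    rw [abs_mul, abs_two, sq (1 + u ^ 2)]
    nlinarith [sq_nonneg u]

theorem quadDecay_mul_ratJ1 : QuadDecay fun u => u * ratJ1 u := by
  have := QuadDecay.of_div (p := fun u => 2 * u ^ 2) (by fun_prop) 2 2 fun u => by
    rw [abs_of_nonneg (by positivity), sq (1 + u ^ 2)]
    nlinarith [sq_nonneg u, sq_nonneg (u ^ 2)]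
  convert this using 2 with u
  rw [ratJ1]; ring

theorem quadDecay_ratJ2 : QuadDecay ratJ2 :=
  .of_div (p := fun u => 2 * (1 - 3 * u ^ 2)) (by fun_prop) 6 3 fun u => by
    have h1 : |2 * (1 - 3 * u ^ 2)| ≤ 6 * (1 + u ^ 2) := by
      rw [abs_le]; constructor <;> nlinarith [sq_nonneg u]
    have h2 : 0 ≤ u ^ 2 := sq_nonneg u
    calc _ ≤ 6 * (1 + u ^ 2) * (1 + u ^ 2) := by gcongr
      _ ≤ 6 * (1 + u ^ 2) * (1 + u ^ 2) * (1 + u ^ 2) := le_mul_of_one_le_right (by positivity)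
        (by linarith)
      _ = _ := by ring

theorem quadDecay_ratK1 : QuadDecay ratK1 :=
  .of_div (p := fun u => 1 - u ^ 2) (by fun_prop) 1 2 fun u => by
    have h1 : |1 - u ^ 2| ≤ 1 + u ^ 2 := by
      rw [abs_le]; constructor <;> nlinarith [sq_nonneg u]
    calc _ ≤ (1 + u ^ 2) * (1 + u ^ 2) := by gcongr
      _ = _ := by ring

theorem quadDecay_ratK2 : QuadDecay ratK2 :=
  .of_div (p := fun u => 2 * u * (u ^ 2 - 3)) (by fun_prop) 3 3 fun u => by
    have h1 : |u ^ 2 - 3| ≤ 3 * (1 + u ^ 2) := by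
      rw [abs_le]; constructor <;> nlinarith [sq_nonneg u]
    rw [abs_mul, abs_mul, abs_two]
    calc _ ≤ (1 + u ^ 2) * (3 * (1 + u ^ 2)) * (1 + u ^ 2) := by
          gcongr; exact two_mul_abs_le u
      _ = _ := by ring

theorem quadDecay_mul_ratK2 : QuadDecay fun u => u * ratK2 u := by
  have := QuadDecay.of_div (p := fun u => 2 * u ^ 2 * (u ^ 2 - 3)) (by fun_prop) 6 3 fun u => by
    have h1 : |u ^ 2 - 3| ≤ 3 * (1 + u ^ 2) := by
      rw [abs_le]; constructor <;> nlinarith [sq_nonneg u]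
    rw [abs_mul, abs_of_nonneg (by positivity : 0 ≤ 2 * u ^ 2)]
    calc _ ≤ 2 * (1 + u ^ 2) * (3 * (1 + u ^ 2)) * (1 + u ^ 2) := by
          gcongr; linarith
      _ = _ := by ring
  convert this using 2 with u
  rw [ratK2]; ring

/-- `∫₀^∞ sin(zu)/(1+u²) du`. -/
noncomputable def auxR (z : ℝ) : ℝ := sinInt ratJ z

/-- The improper integral `∫₀^∞ u cos(zu)/(1+u²) du`, written in absolutely convergent form. -/
noncomputable def auxQ (z : ℝ) : ℝ := -(1 + cosInt ratK2 z) / z ^ 2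

theorem abs_auxQ_le : ∃ C, 0 ≤ C ∧ ∀ z, 0 < z → |auxQ z| ≤ C / z ^ 2 := by
  obtain ⟨M, hM⟩ := quadDecay_ratK2.abs_cosInt_le
  refine ⟨1 + M, by linarith [(abs_nonneg _).trans (hM 0)], fun z hz => ?_⟩
  rw [auxQ, abs_div, abs_neg, abs_of_pos (by positivity : 0 < z ^ 2)]
  gcongr
  refine (abs_add_le _ _).trans ?_
  rw [abs_one]
  linarith [hM z]

theorem mul_auxQ {z : ℝ} (hz : 0 < z) : z * auxQ z = -sinInt ratK1 z := by
  have h := quadDecay_ratK1.mul_sinInt quadDecay_ratK2 hasDerivAt_ratK1 z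
  have h0 : ratK1 0 = 1 := by simp [ratK1]
  rw [h0] at h
  rw [auxQ, ← h]
  field_simp

theorem mul_auxR (z : ℝ) : z * auxR z = 1 - cosInt ratJ1 z := by
  have hd : QuadDecay fun u => -ratJ1 u := ⟨quadDecay_ratJ1.cont.neg, by
    simpa using quadDecay_ratJ1.bound⟩
  have h := quadDecay_ratJ.mul_sinInt hd hasDerivAt_ratJ z
  rw [auxR, h, cosInt, cosInt, sub_eq_add_neg, ← MeasureTheory.integral_neg]
  simp [ratJ]

theorem sinInt_sub {a b : ℝ → ℝ} (ha : QuadDecay a) (hb : QuadDecay b) (r z : ℝ) :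
    sinInt (fun u => a u - r * b u) z = sinInt a z - r * sinInt b z := by
  rw [sinInt, sinInt, sinInt, ← MeasureTheory.integral_const_mul,
    ← MeasureTheory.integral_sub (ha.integrable_sin z) ((hb.integrable_sin z).const_mul r)]
  congr 1 with u
  ring

/-- Differentiation under the integral would give an integral that is not absolutely convergent, so
the identity `zR = 1 - ∫ 2u cos(zu)/(1+u²)²` is differentiated instead. The result is rearranged
with `2u²/(1+u²)² = 1/(1+u²) - (1-u²)/(1+u²)²`. -/
theorem hasDerivAt_auxR {z : ℝ} (hz : 0 < z) : HasDerivAt auxR (auxQ z) z := by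
  have h := ((quadDecay_ratJ1.hasDerivAt_cosInt quadDecay_mul_ratJ1 z).const_sub 1).fun_div
    (hasDerivAt_id z) hz.ne'
  have h2 : auxR =ᶠ[𝓝 z] fun z => (1 - cosInt ratJ1 z) / z := by
    filter_upwards [eventually_ne_nhds hz.ne'] with x hx
    rw [← mul_auxR]; field_simp
  refine (h.congr_of_eventuallyEq h2).congr_deriv ?_
  have e : sinInt (fun u => u * ratJ1 u) z = auxR z + z * auxQ z := by
    rw [mul_auxQ hz, auxR, ← sub_eq_add_neg, ← one_mul (sinInt ratK1 z),
      ← sinInt_sub quadDecay_ratJ quadDecay_ratK1]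
    congr 1 with u
    rw [ratJ1, ratJ, ratK1]; field_simp; ring
  simp only [neg_neg, id]
  rw [e, ← mul_auxR]
  field_simp
  ring

/-- Formally `Q' = -∫ u² sin(zu)/(1+u²) du = R - ∫ sin(zu) du`, the last integral having Abel value
`1/z`. The proof uses the absolutely convergent form of `Q` and reduces `u · ratK2` to `ratJ2 - 2
ratK1`. -/
theorem hasDerivAt_auxQ {z : ℝ} (hz : 0 < z) : HasDerivAt auxQ (auxR z - 1 / z) z := by
  refine (((quadDecay_ratK2.hasDerivAt_cosInt quadDecay_mul_ratK2 z).const_add 1).fun_neg.fun_div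
    ((hasDerivAt_id z).fun_pow 2) (by simp only [id]; positivity)).congr_deriv ?_
  have e1 : sinInt (fun u => u * ratK2 u) z = sinInt ratJ2 z - 2 * sinInt ratK1 z := by
    rw [← sinInt_sub quadDecay_ratJ2 quadDecay_ratK1]
    congr 1 with u
    rw [ratJ2, ratK2, ratK1]; field_simp; ring
  have e2 := mul_auxR z
  have e3 := quadDecay_ratJ1.mul_cosInt quadDecay_ratJ2 hasDerivAt_ratJ1 z
  have e4 := mul_auxQ hz
  have e5 : 1 + cosInt ratK2 z = -(z ^ 2 * auxQ z) := by rw [auxQ]; field_simp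
  simp only [neg_neg, id]
  rw [e5, e1]
  have e6 : sinInt ratJ2 z = z ^ 2 * auxR z - z := by linear_combination e3 - z * e2
  have e7 : sinInt ratK1 z = -(z * auxQ z) := by linarith
  rw [e6, e7]
  field_simp
  ring

theorem auxR_tendsto : Tendsto auxR (𝓝 0) (𝓝 0) := by
  have := quadDecay_ratJ.continuous_sinInt.tendsto 0
  have h0 : sinInt ratJ 0 = 0 := by simp [sinInt]
  rwa [h0] at this

/-! ### Laplace transforms of the kernel functions -/

/-- `∫₀^∞ e^{-s} f(us) ds`. -/
noncomputable def lapInt (f : ℝ → ℝ) (u : ℝ) : ℝ :=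
  ∫ s in Set.Ioi (0 : ℝ), Real.exp (-s) * f (u * s)

theorem integral_Ioi_of_hasDerivAt_of_tendsto_nhdsGT {f f' : ℝ → ℝ} {m₀ m : ℝ}
    (hf : ∀ x, 0 < x → HasDerivAt f (f' x) x)
    (hi : MeasureTheory.IntegrableOn f' (Set.Ioi 0)) (h0 : Tendsto f (𝓝[>] 0) (𝓝 m₀))
    (h1 : Tendsto f atTop (𝓝 m)) : ∫ x in Set.Ioi (0 : ℝ), f' x = m - m₀ := by
  have h := MeasureTheory.integral_Ioi_of_hasDerivAt_of_tendsto (a := (0 : ℝ))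
    (f := Function.update f 0 m₀) (f' := f') (m := m) ?_ (fun x hx => ?_) hi ?_
  · simpa using h
  · rw [continuousWithinAt_update_same]
    simpa using h0
  · refine (hf x hx).congr_of_eventuallyEq ?_
    filter_upwards [eventually_ne_nhds (ne_of_gt hx)] with y hy
    exact Function.update_of_ne hy _ _
  · refine h1.congr' ?_
    filter_upwards [eventually_ne_atTop 0] with y hy
    exact (Function.update_of_ne hy _ _).symm

theorem integrableOn_exp_neg_mul_id :
    MeasureTheory.IntegrableOn (fun s : ℝ => Real.exp (-s) * s) (Set.Ioi 0) := by
  have h := Real.GammaIntegral_convergent (s := 2) two_pos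
  refine h.congr_fun (fun s _ => ?_) measurableSet_Ioi
  norm_num

theorem integrableOn_exp_neg_div_sqrt :
    MeasureTheory.IntegrableOn (fun s : ℝ => Real.exp (-s) * (1 / √s)) (Set.Ioi 0) := by
  have h := Real.GammaIntegral_convergent (s := 1 / 2) (by norm_num)
  refine h.congr_fun (fun s hs => ?_) measurableSet_Ioi
  have hs : 0 < s := hs
  simp only
  rw [Real.sqrt_eq_rpow, one_div (s ^ _), ← Real.rpow_neg hs.le]
  norm_num

theorem integrableOn_exp_neg_mul (A B D : ℝ) :
    MeasureTheory.IntegrableOn (fun s : ℝ => Real.exp (-s) * (A + B * s + D * (1 / √s)))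
      (Set.Ioi 0) := by
  have h : MeasureTheory.IntegrableOn (fun s : ℝ => A * Real.exp (-s) +
      B * (Real.exp (-s) * s) + D * (Real.exp (-s) * (1 / √s))) (Set.Ioi 0) :=
    (((integrableOn_exp_neg_Ioi 0).const_mul A).add
      (integrableOn_exp_neg_mul_id.const_mul B)).add (integrableOn_exp_neg_div_sqrt.const_mul D)
  refine h.congr_fun (fun s _ => ?_) measurableSet_Ioi
  simp only
  ring

theorem integrableOn_exp_neg_mul_comp {f : ℝ → ℝ} {A B D : ℝ}
    (hf : ContinuousOn f (Set.Ioi 0)) (hb : ∀ x, 0 < x → |f x| ≤ A + B * x + D * (1 / √x))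
    {u : ℝ} (hu : 0 < u) :
    MeasureTheory.IntegrableOn (fun s => Real.exp (-s) * f (u * s)) (Set.Ioi 0) := by
  refine (integrableOn_exp_neg_mul A (B * u) (D * (1 / √u))).mono' ?_ ?_
  · refine ContinuousOn.aestronglyMeasurable ?_ measurableSet_Ioi
    refine ContinuousOn.mul (by fun_prop) (hf.comp (by fun_prop) fun s hs => ?_)
    exact mul_pos hu hs
  · filter_upwards [MeasureTheory.ae_restrict_mem measurableSet_Ioi] with s hs
    have hs : 0 < s := hs
    rw [norm_mul, Real.norm_of_nonneg (Real.exp_pos _).le, Real.norm_eq_abs]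
    gcongr
    refine (hb _ (mul_pos hu hs)).trans (le_of_eq ?_)
    rw [Real.sqrt_mul hu.le]
    have := Real.sqrt_pos.2 hu
    have := Real.sqrt_pos.2 hs
    field_simp

/-- Integration by parts against `e^{-s}`. Bounds of the form `A + Bx + D/√x` accommodate at once
the singularities of `Y₀`, `K₀` at `0` and the growth of `Y₁`, `Z` and `E`. -/
theorem lapInt_eq_add {f₀ f₁ : ℝ → ℝ} {A B D A' B' D' c : ℝ}
    (h : ∀ x, 0 < x → HasDerivAt f₁ (f₀ x) x) (hf₀ : ContinuousOn f₀ (Set.Ioi 0))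
    (hb₀ : ∀ x, 0 < x → |f₀ x| ≤ A + B * x + D * (1 / √x))
    (hb₁ : ∀ x, 0 < x → |f₁ x| ≤ A' + B' * x + D' * (1 / √x))
    (hc : Tendsto f₁ (𝓝[>] 0) (𝓝 c)) {u : ℝ} (hu : 0 < u) :
    lapInt f₁ u = c + u * lapInt f₀ u := by
  have hf₁ : ContinuousOn f₁ (Set.Ioi 0) := fun x hx => (h x hx).continuousAt.continuousWithinAt
  have hi₀ := integrableOn_exp_neg_mul_comp hf₀ hb₀ hu
  have hi₁ := integrableOn_exp_neg_mul_comp hf₁ hb₁ hu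
  have hs : MeasureTheory.IntegrableOn (fun s => Real.exp (-s) * f₁ (u * s) -
      u * (Real.exp (-s) * f₀ (u * s))) (Set.Ioi 0) := hi₁.sub (hi₀.const_mul u)
  have hFTC := integral_Ioi_of_hasDerivAt_of_tendsto_nhdsGT
    (f := fun s => -(Real.exp (-s) * f₁ (u * s))) (m₀ := -(Real.exp (-0) * c)) (m := -0)
    (fun s hs => by
      have h1 := (h (u * s) (mul_pos hu hs)).comp s ((hasDerivAt_id s).const_mul u)
      refine (((hasDerivAt_id s).fun_neg.exp).fun_mul h1).fun_neg.congr_deriv ?_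
      simp only [id, Function.comp]; ring) hs ?_ ?_
  · rw [MeasureTheory.integral_sub hi₁ (hi₀.const_mul u),
      MeasureTheory.integral_const_mul] at hFTC
    simp only [neg_zero, Real.exp_zero, one_mul, zero_sub, neg_neg] at hFTC
    unfold lapInt
    linarith
  · refine Tendsto.neg (Tendsto.mul ?_ ?_)
    · have : Continuous fun s : ℝ => Real.exp (-s) := by fun_prop
      exact (this.tendsto 0).mono_left nhdsWithin_le_nhds
    · refine hc.comp ?_
      refine tendsto_nhdsWithin_iff.2 ⟨?_, ?_⟩
      · have : Continuous fun s : ℝ => u * s := by fun_prop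
        simpa using (this.tendsto 0).mono_left nhdsWithin_le_nhds
      · filter_upwards [self_mem_nhdsWithin] with s hs
        exact mul_pos hu hs
  · refine Tendsto.neg ?_
    have h1 : Tendsto (fun s : ℝ => |A'| * Real.exp (-s) + |B' * u| * (s * Real.exp (-s)) +
        |D' * (1 / √u)| * Real.exp (-s)) atTop (𝓝 0) := by
      have e1 := Real.tendsto_exp_neg_atTop_nhds_zero
      have e2 := Real.tendsto_pow_mul_exp_neg_atTop_nhds_zero 1
      simp only [pow_one] at e2
      simpa using ((e1.const_mul |A'|).add (e2.const_mul |B' * u|)).add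
        (e1.const_mul |D' * (1 / √u)|)
    refine squeeze_zero_norm' ?_ h1
    filter_upwards [eventually_ge_atTop 1] with s hs
    have hs0 : 0 < s := by positivity
    have h2 : 1 / √s ≤ 1 := by
      rw [div_le_one (by positivity)]; exact Real.one_le_sqrt.2 hs
    have h3 := hb₁ _ (mul_pos hu hs0)
    rw [norm_mul, Real.norm_of_nonneg (Real.exp_pos _).le, Real.norm_eq_abs]
    have h4 : |f₁ (u * s)| ≤ |A'| + |B' * u| * s + |D' * (1 / √u)| := by
      refine h3.trans ?_
      have e : D' * (1 / √(u * s)) = D' * (1 / √u) * (1 / √s) := by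
        rw [Real.sqrt_mul hu.le]
        have := Real.sqrt_pos.2 hu
        have := Real.sqrt_pos.2 hs0
        field_simp
      rw [e]
      have h5 : D' * (1 / √u) * (1 / √s) ≤ |D' * (1 / √u)| * 1 := by
        gcongr
        exact le_abs_self _
      have h6 := le_abs_self A'
      have h7 : B' * (u * s) ≤ |B' * u| * s := by
        rw [← mul_assoc]; gcongr; exact le_abs_self _
      linarith
    calc _ ≤ Real.exp (-s) * (|A'| + |B' * u| * s + |D' * (1 / √u)|) := by gcongr
      _ = _ := by ring

theorem hasDerivAt_lapInt {f₀ f₁ : ℝ → ℝ} {A B D A' B' D' σ : ℝ}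
    (h : ∀ x, 0 < x → HasDerivAt f₀ (σ * f₁ x / x) x) (hf₁ : ContinuousOn f₁ (Set.Ioi 0))
    (hb₀ : ∀ x, 0 < x → |f₀ x| ≤ A + B * x + D * (1 / √x))
    (hb₁ : ∀ x, 0 < x → |f₁ x| ≤ A' + B' * x + D' * (1 / √x)) (hB : 0 ≤ B')
    (hD : 0 ≤ D') {u : ℝ} (hu : 0 < u) :
    HasDerivAt (lapInt f₀) (σ / u * lapInt f₁ u) u := by
  have hf₀ : ContinuousOn f₀ (Set.Ioi 0) := fun x hx => (h x hx).continuousAt.continuousWithinAt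
  have hm : ∀ {f : ℝ → ℝ}, ContinuousOn f (Set.Ioi 0) → ∀ x, 0 < x →
      MeasureTheory.AEStronglyMeasurable (fun s => Real.exp (-s) * f (x * s))
        (MeasureTheory.volume.restrict (Set.Ioi 0)) := fun hf x hx => by
    refine ContinuousOn.aestronglyMeasurable ?_ measurableSet_Ioi
    refine ContinuousOn.mul (by fun_prop) (hf.comp (by fun_prop) fun s hs => ?_)
    exact mul_pos hx hs
  have key := (hasDerivAt_integral_of_dominated_loc_of_deriv_le
    (μ := MeasureTheory.volume.restrict (Set.Ioi (0 : ℝ))) (x₀ := u)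
    (s := Set.Ioo (u / 2) (2 * u)) (Ioo_mem_nhds (by linarith) (by linarith))
    (F := fun x s => Real.exp (-s) * f₀ (x * s))
    (F' := fun x s => σ / x * (Real.exp (-s) * f₁ (x * s)))
    ?_ (integrableOn_exp_neg_mul_comp hf₀ hb₀ hu) ((hm hf₁ u hu).const_mul _)
    (bound := fun s => |σ| / (u / 2) * (Real.exp (-s) * (A' + B' * (2 * u) * s +
      D' * (1 / √(u / 2)) * (1 / √s)))) ?_
    ((integrableOn_exp_neg_mul _ _ _).const_mul _) ?_).2
  · rw [MeasureTheory.integral_const_mul] at key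
    exact key
  · filter_upwards [Ioi_mem_nhds hu] with x hx using hm hf₀ x hx
  · filter_upwards [MeasureTheory.ae_restrict_mem measurableSet_Ioi] with s hs x hx
    have hs : 0 < s := hs
    have hx0 : 0 < x := by linarith [hx.1]
    rw [norm_mul, norm_mul, norm_div, Real.norm_of_nonneg (Real.exp_pos _).le, Real.norm_eq_abs,
      Real.norm_eq_abs, Real.norm_eq_abs, abs_of_pos hx0]
    gcongr ?_ * (_ * ?_)
    · gcongr
      exact hx.1.le
    · refine (hb₁ _ (mul_pos hx0 hs)).trans ?_
      have e : D' * (1 / √(u / 2)) * (1 / √s) = D' * (1 / √(u / 2 * s)) := by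
        rw [Real.sqrt_mul (by positivity)]
        have := Real.sqrt_pos.2 hs
        field_simp
      rw [e, mul_assoc B']
      have h1 := hx.1
      have h2 := hx.2
      have h3 : √(u / 2 * s) ≤ √(x * s) := Real.sqrt_le_sqrt (by gcongr)
      have h4 : 0 < √(u / 2 * s) := by positivity
      gcongr
  · filter_upwards [MeasureTheory.ae_restrict_mem measurableSet_Ioi] with s hs x hx
    have hs : 0 < s := hs
    have hx0 : 0 < x := by linarith [hx.1]
    have h1 := (h (x * s) (mul_pos hx0 hs)).comp x ((hasDerivAt_id x).mul_const s)
    refine (h1.const_mul (Real.exp (-s))).congr_deriv ?_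
    field_simp

theorem abs_kerY0_le : ∃ C, 0 ≤ C ∧ ∀ x, 0 < x → |kerY0 x| ≤ C + 0 * x + 1 * (1 / √x) := by
  obtain ⟨C, hC, h⟩ := ker_bounds
  refine ⟨C + 4, by positivity, fun x hx => ?_⟩
  have hs : 0 < 1 / √x := by positivity
  rcases le_or_gt 1 x with hx1 | hx1
  · have h1 := (h x hx1).1
    have h2 : x ^ (-(1 / 4) : ℝ) ≤ 1 := Real.rpow_le_one_of_one_le_of_nonpos hx1 (by norm_num)
    nlinarith
  · have h1 := abs_kerY0_add_kerK0 hx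
    have h2 := kerK0_le hx
    have h3 := kerK0_nonneg x
    have h4 : √x ≤ 1 := Real.sqrt_le_iff.2 ⟨zero_le_one, by linarith⟩
    rw [abs_le] at h1 ⊢
    constructor <;> linarith [h1.1, h1.2]

theorem abs_kerY1_le : ∃ C, 0 ≤ C ∧ ∀ x, 0 < x → |kerY1 x| ≤ C + C * x + 0 * (1 / √x) := by
  obtain ⟨C, hC, h⟩ := ker_bounds
  refine ⟨C + 3, by positivity, fun x hx => ?_⟩
  have h5 : 1 / Real.pi ≤ 1 := by rw [div_le_one Real.pi_pos]; linarith [Real.two_le_pi]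
  have h6 : 0 < 1 / Real.pi := by positivity
  rcases le_or_gt 1 x with hx1 | hx1
  · have h1 := (h x hx1).2
    have h2 : x ^ (1 / 4 : ℝ) ≤ x ^ (1 : ℝ) := rpow_le_rpow_of_one_le hx1 (by norm_num)
    rw [Real.rpow_one] at h2
    nlinarith
  · have h1 := abs_kerY1_add hx
    have h4 : √x ≤ 1 := Real.sqrt_le_iff.2 ⟨zero_le_one, by linarith⟩
    have h7 : 0 ≤ C + C * x := by positivity
    rw [abs_le] at h1 ⊢
    constructor <;> nlinarith [h1.1, h1.2]

theorem abs_kerK1_le {x : ℝ} (hx : 0 < x) : |kerK1 x| ≤ 0 + 0 * x + 1 * (1 / √x) := by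
  rw [abs_of_nonneg (kerK1_nonneg x)]
  linarith [kerK1_le hx]

theorem abs_neg_kerK0_le {x : ℝ} (hx : 0 < x) : |-kerK0 x| ≤ 0 + 0 * x + 1 * (1 / √x) := by
  rw [abs_neg, abs_of_nonneg (kerK0_nonneg x)]
  linarith [kerK0_le hx]

theorem tendsto_of_abs_sub_le_sqrt {f : ℝ → ℝ} {c : ℝ} (h : ∀ x, 0 < x → |f x - c| ≤ 2 * √x) :
    Tendsto f (𝓝[>] 0) (𝓝 c) := by
  rw [tendsto_iff_norm_sub_tendsto_zero]
  have h1 : Tendsto (fun x : ℝ => 2 * √x) (𝓝[>] 0) (𝓝 0) := by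
    have : Continuous fun x : ℝ => 2 * √x := by fun_prop
    simpa using (this.tendsto 0).mono_left nhdsWithin_le_nhds
  refine squeeze_zero' (Eventually.of_forall fun _ => norm_nonneg _) ?_ h1
  filter_upwards [self_mem_nhdsWithin] with x hx using h x hx

/-- `∫₀^∞ e^{-s} Y₀(2√(us)) ds`. -/
noncomputable def lapY (u : ℝ) : ℝ := lapInt kerY0 u

/-- `-(2/π) ∫₀^∞ e^{-s} K₀(2√(us)) ds`. -/
noncomputable def lapK (u : ℝ) : ℝ := lapInt (fun x => -kerK0 x) u

theorem continuousOn_kerY0 : ContinuousOn kerY0 (Set.Ioi 0) :=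
  fun _ hx => (hasDerivAt_kerY0 hx).continuousAt.continuousWithinAt

theorem continuousOn_kerY1 : ContinuousOn kerY1 (Set.Ioi 0) :=
  fun _ hx => (hasDerivAt_kerY1 hx).continuousAt.continuousWithinAt

theorem continuousOn_kerK0 : ContinuousOn (fun x => -kerK0 x) (Set.Ioi 0) :=
  fun _ hx => (hasDerivAt_kerK0 hx).fun_neg.continuousAt.continuousWithinAt

theorem continuousOn_kerK1 : ContinuousOn kerK1 (Set.Ioi 0) :=
  fun _ hx => (hasDerivAt_kerK1 hx).continuousAt.continuousWithinAt

theorem lapInt_kerY1 {u : ℝ} (hu : 0 < u) : lapInt kerY1 u = -(1 / Real.pi) + u * lapY u := by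
  obtain ⟨C, -, h0⟩ := abs_kerY0_le
  obtain ⟨C', -, h1⟩ := abs_kerY1_le
  exact lapInt_eq_add (fun _ hx => hasDerivAt_kerY1 hx) continuousOn_kerY0 h0 h1
    (tendsto_of_abs_sub_le_sqrt fun _ hx => by rw [sub_neg_eq_add]; exact abs_kerY1_add hx) hu

theorem lapInt_kerK1 {u : ℝ} (hu : 0 < u) : lapInt kerK1 u = 1 / Real.pi + u * lapK u :=
  lapInt_eq_add (fun _ hx => hasDerivAt_kerK1 hx) continuousOn_kerK0
    (fun _ hx => abs_neg_kerK0_le hx) (fun _ hx => abs_kerK1_le hx)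
    (tendsto_of_abs_sub_le_sqrt fun _ hx => abs_kerK1_sub hx) hu

/-- Differentiating `Y₀(2√x)` produces `-kerY1 x / x`, and the transform of `kerY1` is again
expressed by `lapY` through integration by parts. The system closes into a first-order equation. -/
theorem hasDerivAt_lapY {u : ℝ} (hu : 0 < u) :
    HasDerivAt lapY (-lapY u + 1 / (Real.pi * u)) u := by
  obtain ⟨C, -, h0⟩ := abs_kerY0_le
  obtain ⟨C', hC', h1⟩ := abs_kerY1_le
  refine (hasDerivAt_lapInt (σ := -1) (fun x hx => ?_) continuousOn_kerY1 h0 h1 hC' le_rfl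
    hu).congr_deriv ?_
  · simpa using hasDerivAt_kerY0 hx
  · rw [lapInt_kerY1 hu]
    field_simp
    ring

theorem hasDerivAt_lapK {u : ℝ} (hu : 0 < u) :
    HasDerivAt lapK (lapK u + 1 / (Real.pi * u)) u := by
  refine (hasDerivAt_lapInt (σ := 1) (fun x hx => ?_) continuousOn_kerK1
    (fun _ hx => abs_neg_kerK0_le hx) (fun _ hx => abs_kerK1_le hx) le_rfl zero_le_one
    hu).congr_deriv ?_
  · refine (hasDerivAt_kerK0 hx).fun_neg.congr_deriv ?_
    ring
  · rw [lapInt_kerK1 hu]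
    field_simp
    ring

theorem abs_lapK_le : ∃ M, ∀ u, 1 ≤ u → |lapK u| ≤ M := by
  refine ⟨_, fun u hu => (Real.norm_eq_abs _).symm.trans_le <|
    MeasureTheory.norm_integral_le_of_norm_le integrableOn_exp_neg_div_sqrt ?_⟩
  filter_upwards [MeasureTheory.ae_restrict_mem measurableSet_Ioi] with s hs
  have hs : 0 < s := hs
  have h1 := abs_neg_kerK0_le (mul_pos (by positivity : 0 < u) hs)
  rw [norm_mul, Real.norm_of_nonneg (Real.exp_pos _).le, Real.norm_eq_abs]
  gcongr
  have h2 : √s ≤ √(u * s) := Real.sqrt_le_sqrt (by nlinarith)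
  have h3 : 0 < √s := by positivity
  have h4 : 1 / √(u * s) ≤ 1 / √s := by gcongr
  linarith

theorem abs_lapK_sub_lapY_le : ∃ M, ∀ u, 0 < u → |lapK u - lapY u| ≤ M * √u := by
  obtain ⟨C, -, h0⟩ := abs_kerY0_le
  refine ⟨∫ s in Set.Ioi (0 : ℝ), Real.exp (-s) * (4 + 4 * s + 0 * (1 / √s)), fun u hu => ?_⟩
  have hY := integrableOn_exp_neg_mul_comp continuousOn_kerY0 h0 hu
  have hK := integrableOn_exp_neg_mul_comp continuousOn_kerK0 (fun _ hx => abs_neg_kerK0_le hx) hu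
  rw [lapK, lapY, lapInt, lapInt, ← MeasureTheory.integral_sub hK hY, ← Real.norm_eq_abs,
    ← MeasureTheory.integral_mul_const]
  refine MeasureTheory.norm_integral_le_of_norm_le
    ((integrableOn_exp_neg_mul 4 4 0).mul_const _) ?_
  filter_upwards [MeasureTheory.ae_restrict_mem measurableSet_Ioi] with s hs
  have hs : 0 < s := hs
  have h1 := abs_kerY0_add_kerK0 (mul_pos hu hs)
  rw [← mul_sub, norm_mul, Real.norm_of_nonneg (Real.exp_pos _).le, Real.norm_eq_abs, mul_assoc]
  gcongr
  have e : -kerK0 (u * s) - kerY0 (u * s) = -(kerY0 (u * s) + kerK0 (u * s)) := by ring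
  rw [e, abs_neg]
  refine h1.trans ?_
  rw [Real.sqrt_mul hu.le]
  have h5 : √s ≤ 1 + s := by
    nlinarith [Real.sq_sqrt hs.le, sq_nonneg (√s - 1), Real.sqrt_nonneg s]
  nlinarith [Real.sqrt_nonneg u]

theorem eq_of_hasDerivAt_zero {f : ℝ → ℝ} (h : ∀ x, 0 < x → HasDerivAt f 0 x) {x y : ℝ}
    (hx : 0 < x) (hy : 0 < y) : f x = f y :=
  isOpen_Ioi.is_const_of_deriv_eq_zero isPreconnected_Ioi
    (fun z hz => (h z hz).differentiableAt.differentiableWithinAt)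
    (fun z hz => (h z hz).deriv) hx hy

/-- The transforms satisfy `lapY' = -lapY + 1/(πu)` and `lapK' = lapK + 1/(πu)`, while `R' = Q` and
`Q' = R - 1/u`. Hence the two combinations `T` and `V` below satisfy `T' = V` and `V' = T` with the
inhomogeneous terms gone. Such a pair is determined by its growth at infinity and its value at `0`.
-/
theorem lapY_add_lapK {u : ℝ} (hu : 0 < u) : lapY u + lapK u = -(2 / Real.pi) * auxQ u := by
  set T : ℝ → ℝ := fun u => lapY u + lapK u + 2 / Real.pi * auxQ u
  set V : ℝ → ℝ := fun u => lapK u - lapY u + 2 / Real.pi * auxR u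
  have hT : ∀ u, 0 < u → HasDerivAt T (V u) u := fun u hu => by
    refine (((hasDerivAt_lapY hu).fun_add (hasDerivAt_lapK hu)).fun_add
      ((hasDerivAt_auxQ hu).const_mul (2 / Real.pi))).congr_deriv ?_
    simp only [V]; field_simp; ring
  have hV : ∀ u, 0 < u → HasDerivAt V (T u) u := fun u hu => by
    refine (((hasDerivAt_lapK hu).fun_sub (hasDerivAt_lapY hu)).fun_add
      ((hasDerivAt_auxR hu).const_mul (2 / Real.pi))).congr_deriv ?_
    simp only [T]; ring
  -- `T + V` is a multiple of `e^u`, and it is bounded because `lapY` drops out of it.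
  have hplus : ∀ u, 0 < u → T u + V u = 0 := by
    have hc : ∀ u, 0 < u → HasDerivAt (fun u => (T u + V u) * Real.exp (-u)) 0 u := fun u hu => by
      refine (((hT u hu).fun_add (hV u hu)).fun_mul
        ((hasDerivAt_id u).fun_neg.exp)).congr_deriv ?_
      simp only [id]; ring
    obtain ⟨M, hM⟩ := abs_lapK_le
    obtain ⟨C, hC, hQ⟩ := abs_auxQ_le
    obtain ⟨N, hN⟩ := quadDecay_ratJ.abs_sinInt_le
    intro u hu
    have hlim : Tendsto (fun u => (T u + V u) * Real.exp (-u)) atTop (𝓝 0) := by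
      have h1 : Tendsto (fun u : ℝ => (2 * M + C + N) * Real.exp (-u)) atTop (𝓝 0) := by
        simpa using Real.tendsto_exp_neg_atTop_nhds_zero.const_mul (2 * M + C + N)
      refine squeeze_zero_norm' ?_ h1
      filter_upwards [eventually_ge_atTop 1] with u hu
      rw [norm_mul, Real.norm_of_nonneg (Real.exp_pos _).le, Real.norm_eq_abs]
      gcongr
      have e : T u + V u = lapK u + lapK u + 2 / Real.pi * (auxQ u + auxR u) := by
        simp only [T, V]; ring
      have h2 : |auxQ u| ≤ C := by
        refine (hQ u (by positivity)).trans (div_le_self hC ?_)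
        nlinarith
      have h3 : |2 / Real.pi * (auxQ u + auxR u)| ≤ 1 * (C + N) := by
        rw [abs_mul, abs_of_pos (by positivity : 0 < 2 / Real.pi)]
        have := two_div_pi_le_one
        gcongr
        exact (abs_add_le _ _).trans (add_le_add h2 (hN u))
      rw [e]
      refine (abs_add_le _ _).trans ?_
      linarith [abs_add_le (lapK u) (lapK u), hM u hu]
    have h2 : Tendsto (fun u => (T u + V u) * Real.exp (-u)) atTop
        (𝓝 ((T u + V u) * Real.exp (-u))) := by
      refine tendsto_const_nhds.congr' ?_
      filter_upwards [eventually_gt_atTop 0] with y hy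
      exact eq_of_hasDerivAt_zero hc hu hy
    have h3 := tendsto_nhds_unique h2 hlim
    exact (mul_eq_zero.1 h3).resolve_right (Real.exp_pos _).ne'
  -- Now `V' = -V`, so `V` is a multiple of `e^{-u}`. It tends to `0` at `0` because the
  -- singularities of `Y₀` and `K₀` cancel in `lapK - lapY`.
  have hVz : V u = 0 := by
    have hc : ∀ u, 0 < u → HasDerivAt (fun u => V u * Real.exp u) 0 u := fun u hu => by
      refine ((hV u hu).fun_mul (Real.hasDerivAt_exp u)).congr_deriv ?_
      rw [← add_mul, hplus u hu, zero_mul]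
    obtain ⟨M, hM⟩ := abs_lapK_sub_lapY_le
    have hV0 : Tendsto V (𝓝[>] 0) (𝓝 0) := by
      have h1 : Tendsto (fun u => lapK u - lapY u) (𝓝[>] 0) (𝓝 0) := by
        have h2 : Tendsto (fun u => M * √u) (𝓝[>] 0) (𝓝 0) := by
          have : Continuous fun u => M * √u := by fun_prop
          simpa using (this.tendsto 0).mono_left nhdsWithin_le_nhds
        refine squeeze_zero_norm' ?_ h2
        filter_upwards [self_mem_nhdsWithin] with x hx using hM x hx
      simpa using h1.add ((auxR_tendsto.mono_left nhdsWithin_le_nhds).const_mul (2 / Real.pi))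
    have hlim : Tendsto (fun u => V u * Real.exp u) (𝓝[>] 0) (𝓝 (0 * Real.exp 0)) :=
      hV0.mul ((Real.continuous_exp.tendsto 0).mono_left nhdsWithin_le_nhds)
    have h2 : Tendsto (fun u => V u * Real.exp u) (𝓝[>] 0) (𝓝 (V u * Real.exp u)) := by
      refine tendsto_const_nhds.congr' ?_
      filter_upwards [self_mem_nhdsWithin] with y hy
      exact eq_of_hasDerivAt_zero hc hu hy
    have h3 := tendsto_nhds_unique h2 hlim
    rw [zero_mul] at h3
    exact (mul_eq_zero.1 h3).resolve_right (Real.exp_pos _).ne'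
  have := hplus u hu
  rw [hVz, add_zero] at this
  simp only [T] at this
  linarith

theorem abs_kerZ_le' {x : ℝ} (hx : 0 < x) : |kerZ x| ≤ 4 + 4 * x + 0 * (1 / √x) := by
  refine (abs_kerZ_le x).trans ?_
  nlinarith [Real.sq_sqrt hx.le, sq_nonneg (√x - 1), Real.sqrt_nonneg x]

theorem abs_kerE_le' : ∃ C, 0 ≤ C ∧ ∀ x, 0 < x → |kerE x| ≤ C + C * x + 0 * (1 / √x) := by
  obtain ⟨C, hC, h⟩ := abs_kerE_le
  refine ⟨C, hC, fun x hx => (h x hx.le).trans ?_⟩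
  rw [zero_mul, add_zero, ← mul_one_add]
  gcongr
  rcases le_total 1 x with h1 | h1
  · have := rpow_le_rpow_of_one_le h1 (show (3 / 4 : ℝ) ≤ 1 by norm_num)
    rw [Real.rpow_one] at this
    linarith
  · have := Real.rpow_le_one hx.le h1 (show (0 : ℝ) ≤ 3 / 4 by norm_num)
    linarith

/-- Two integrations by parts, as `E'' = Y₀ - (2/π) K₀`. Each gives a factor `u`, and no boundary
term survives because `E` and `Z` vanish at `0`. -/
theorem lapInt_kerE {u : ℝ} (hu : 0 < u) :
    lapInt kerE u = -(2 / Real.pi) * u ^ 2 * auxQ u := by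
  obtain ⟨C, -, hE⟩ := abs_kerE_le'
  obtain ⟨C0, -, h0⟩ := abs_kerY0_le
  obtain ⟨C1, -, h1⟩ := abs_kerY1_le
  have hE0 : Tendsto kerE (𝓝[>] 0) (𝓝 0) := by
    have := (continuous_kerE.tendsto 0).mono_left (nhdsWithin_le_nhds (s := Set.Ioi 0))
    rwa [kerE_zero] at this
  have hZ : lapInt kerZ u = u * (lapY u + lapK u) := by
    have h2 : lapInt kerZ u = lapInt kerY1 u + lapInt kerK1 u := by
      rw [lapInt, lapInt, lapInt, ← MeasureTheory.integral_add
        (integrableOn_exp_neg_mul_comp continuousOn_kerY1 h1 hu)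
        (integrableOn_exp_neg_mul_comp continuousOn_kerK1 (fun _ hx => abs_kerK1_le hx) hu)]
      simp only [kerZ, mul_add]
    rw [h2, lapInt_kerY1 hu, lapInt_kerK1 hu]
    ring
  rw [lapInt_eq_add (fun x _ => hasDerivAt_kerE x) continuous_kerZ.continuousOn
    (fun _ hx => abs_kerZ_le' hx) hE hE0 hu, hZ, lapY_add_lapK hu]
  ring

/-! ### Uniqueness of the Laplace transform -/

/-- In the variable `u = e^{-x}` the hypothesis says that `e^{-3x} h` is orthogonal to all
polynomials in `u`. By Weierstrass it is orthogonal to continuous functions of `u`, in particular to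
`e^{-2x} h`, so `∫ e^{-5x} h² = 0`. -/
theorem eq_zero_of_laplace_eq_zero {h : ℝ → ℝ} (hc : Continuous h) {C : ℝ}
    (hb : ∀ x, 0 ≤ x → |h x| ≤ C * Real.exp x)
    (hL : ∀ n : ℕ, ∫ x in Set.Ioi (0 : ℝ), Real.exp (-((n + 3) * x)) * h x = 0)
    {x : ℝ} (hx : 0 < x) : h x = 0 := by
  have hC : 0 ≤ C := by simpa using (abs_nonneg _).trans (hb 0 le_rfl)
  -- The function `e^{-2x} h(x)` in the variable `u`. The growth bound gives `|g u| ≤ C u`, so `g`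
  -- extends continuously to `u = 0`, where it takes the value `0`.
  set g : ℝ → ℝ := fun u => u ^ 2 * h (-Real.log u)
  have hgb : ∀ u ∈ Set.Icc (0 : ℝ) 1, |g u| ≤ C * u := by
    intro u hu
    rcases hu.1.eq_or_lt with rfl | hu0
    · simp [g]
    · have h1 := hb (-Real.log u) (by linarith [Real.log_nonpos hu.1 hu.2])
      rw [Real.exp_neg, Real.exp_log hu0] at h1
      simp only [g]
      rw [abs_mul, abs_of_pos (by positivity)]
      calc _ ≤ u ^ 2 * (C * u⁻¹) := by gcongr
        _ = _ := by field_simp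
  have hgc : ContinuousOn g (Set.Icc 0 1) := by
    intro u hu
    rcases hu.1.eq_or_lt with rfl | hu0
    · have h0 : g 0 = 0 := by simp [g]
      rw [ContinuousWithinAt, h0]
      refine squeeze_zero_norm' (a := fun u => C * u) ?_ ?_
      · filter_upwards [self_mem_nhdsWithin] with u hu using hgb u hu
      · have : Continuous fun u : ℝ => C * u := by fun_prop
        simpa using (this.tendsto 0).mono_left nhdsWithin_le_nhds
    · refine ContinuousAt.continuousWithinAt ?_
      exact (continuousAt_id.pow 2).mul
        (hc.continuousAt.comp (Real.continuousAt_log hu0.ne').neg)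
  have hge : ∀ x, g (Real.exp (-x)) = Real.exp (-(2 * x)) * h x := by
    intro x
    simp only [g, Real.log_exp, neg_neg]
    rw [← Real.exp_nat_mul]
    push_cast; ring_nf
  have hI : ∀ k : ℝ, 3 ≤ k → MeasureTheory.IntegrableOn
      (fun x => Real.exp (-(k * x)) * |h x|) (Set.Ioi 0) := by
    intro k hk
    refine ((exp_neg_integrableOn_Ioi 0 (zero_lt_two (α := ℝ))).const_mul C).mono'
      (by fun_prop) ?_
    filter_upwards [MeasureTheory.ae_restrict_mem measurableSet_Ioi] with x hx
    have hx : 0 < x := hx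
    rw [norm_mul, Real.norm_of_nonneg (Real.exp_pos _).le, norm_abs_eq_norm, Real.norm_eq_abs]
    calc _ ≤ Real.exp (-(3 * x)) * (C * Real.exp x) := by
          gcongr
          exact hb x hx.le
      _ = C * (Real.exp (-(3 * x)) * Real.exp x) := by ring
      _ = _ := by rw [← Real.exp_add]; ring_nf
  have hI' : ∀ k : ℝ, 3 ≤ k → MeasureTheory.IntegrableOn
      (fun x => Real.exp (-(k * x)) * h x) (Set.Ioi 0) := by
    intro k hk
    refine (hI k hk).mono' (by fun_prop) (Eventually.of_forall fun x => ?_)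
    rw [norm_mul, Real.norm_of_nonneg (Real.exp_pos _).le, Real.norm_eq_abs]
  have hP : ∀ p : Polynomial ℝ, MeasureTheory.IntegrableOn
      (fun x => Real.exp (-(3 * x)) * h x * p.eval (Real.exp (-x))) (Set.Ioi 0) ∧
      ∫ x in Set.Ioi (0 : ℝ), Real.exp (-(3 * x)) * h x * p.eval (Real.exp (-x)) = 0 := by
    intro p
    have e : ∀ x, Real.exp (-(3 * x)) * h x * p.eval (Real.exp (-x)) =
        ∑ i ∈ Finset.range (p.natDegree + 1), p.coeff i *
          (Real.exp (-((i + 3 : ℝ) * x)) * h x) := by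
      intro x
      rw [Polynomial.eval_eq_sum_range, Finset.mul_sum]
      refine Finset.sum_congr rfl fun i _ => ?_
      have : Real.exp (-((i + 3 : ℝ) * x)) = Real.exp (-(3 * x)) * Real.exp (-x) ^ i := by
        rw [← Real.exp_nat_mul, ← Real.exp_add]; ring_nf
      rw [this]; ring
    simp_rw [e]
    have hi : ∀ i ∈ Finset.range (p.natDegree + 1), MeasureTheory.IntegrableOn (fun x =>
        p.coeff i * (Real.exp (-((i + 3 : ℝ) * x)) * h x)) (Set.Ioi 0) := fun i _ =>
      (hI' _ (by linarith [(Nat.cast_nonneg i : (0 : ℝ) ≤ i)])).const_mul _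
    refine ⟨MeasureTheory.integrable_finsetSum _ hi, ?_⟩
    rw [MeasureTheory.integral_finsetSum _ hi]
    refine Finset.sum_eq_zero fun i _ => ?_
    rw [MeasureTheory.integral_const_mul, hL, mul_zero]
  set J := ∫ x in Set.Ioi (0 : ℝ), Real.exp (-(3 * x)) * h x * g (Real.exp (-x)) with hJ
  have hmem : ∀ x : ℝ, 0 < x → Real.exp (-x) ∈ Set.Icc (0 : ℝ) 1 := fun x hx =>
    ⟨(Real.exp_pos _).le, Real.exp_le_one_iff.2 (by linarith)⟩
  have hgi : MeasureTheory.IntegrableOn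
      (fun x => Real.exp (-(3 * x)) * h x * g (Real.exp (-x))) (Set.Ioi 0) := by
    refine ((hI 3 le_rfl).const_mul C).mono' ?_ ?_
    · simp_rw [hge]; fun_prop
    · filter_upwards [MeasureTheory.ae_restrict_mem measurableSet_Ioi] with x hx
      have h1 := hgb _ (hmem x hx)
      rw [norm_mul, norm_mul, Real.norm_of_nonneg (Real.exp_pos _).le, Real.norm_eq_abs,
        Real.norm_eq_abs, mul_comm]
      gcongr
      have h2 := (hmem x hx).2
      nlinarith
  have hJ0 : J = 0 := by
    by_contra hne
    set A := ∫ x in Set.Ioi (0 : ℝ), Real.exp (-(3 * x)) * |h x| with hA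
    have hA0 : 0 ≤ A := MeasureTheory.integral_nonneg fun x => by positivity
    obtain ⟨p, hp⟩ := exists_polynomial_near_of_continuousOn 0 1 g hgc (|J| / (2 * (A + 1)))
      (by have := abs_pos.2 hne; positivity)
    have h1 : J = ∫ x in Set.Ioi (0 : ℝ), (Real.exp (-(3 * x)) * h x * g (Real.exp (-x)) -
        Real.exp (-(3 * x)) * h x * p.eval (Real.exp (-x))) := by
      rw [MeasureTheory.integral_sub hgi (hP p).1, (hP p).2, sub_zero]
    have h2 : |J| ≤ |J| / (2 * (A + 1)) * A := by
      rw [hA, ← MeasureTheory.integral_const_mul]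
      conv_lhs => rw [h1]
      rw [← Real.norm_eq_abs]
      refine MeasureTheory.norm_integral_le_of_norm_le ((hI 3 le_rfl).const_mul _) ?_
      filter_upwards [MeasureTheory.ae_restrict_mem measurableSet_Ioi] with x hx
      rw [← mul_sub, norm_mul, norm_mul, Real.norm_of_nonneg (Real.exp_pos _).le,
        Real.norm_eq_abs, Real.norm_eq_abs, mul_comm]
      gcongr
      rw [abs_sub_comm]
      exact (hp _ (hmem x hx)).le
    have h3 : |J| / (2 * (A + 1)) * A < |J| := by
      have := abs_pos.2 hne
      rw [div_mul_eq_mul_div, div_lt_iff₀ (by positivity)]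
      nlinarith
    linarith
  have hnn : 0 ≤ᵐ[MeasureTheory.volume.restrict (Set.Ioi (0 : ℝ))]
      fun x => Real.exp (-(3 * x)) * h x * g (Real.exp (-x)) := by
    refine Eventually.of_forall fun x => ?_
    simp only [hge, Pi.zero_apply]
    have : Real.exp (-(3 * x)) * h x * (Real.exp (-(2 * x)) * h x) =
      Real.exp (-(3 * x)) * Real.exp (-(2 * x)) * h x ^ 2 := by ring
    rw [this]; positivity
  have hae := (MeasureTheory.integral_eq_zero_iff_of_nonneg_ae hnn hgi).1 hJ0
  have hcont : Continuous fun x => Real.exp (-(3 * x)) * h x * g (Real.exp (-x)) := by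
    simp_rw [hge]; fun_prop
  have heq := MeasureTheory.Measure.eqOn_open_of_ae_eq hae isOpen_Ioi hcont.continuousOn
    continuousOn_const hx
  simp only [hge, Pi.zero_apply] at heq
  simpa using heq

/-! ### Poisson summation for even functions -/

theorem fourier_comp_abs {g : ℝ → ℝ} (hg : QuadDecay g) (ξ : ℝ) :
    FourierTransform.fourier (fun y : ℝ => (g |y| : ℂ)) ξ =
      ((2 * cosInt g (2 * Real.pi * ξ) : ℝ) : ℂ) := by
  obtain ⟨C, hC⟩ := hg.bound
  have hgc := hg.cont
  have hi : MeasureTheory.Integrable fun y : ℝ =>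
      Complex.exp ((-2 * Real.pi * y * ξ : ℝ) * Complex.I) • (g |y| : ℂ) := by
    refine (integrable_inv_one_add_sq.const_mul C).mono' (by fun_prop)
      (Eventually.of_forall fun y => ?_)
    rw [norm_smul, Complex.norm_exp_ofReal_mul_I, one_mul, Complex.norm_real, Real.norm_eq_abs]
    simpa using hC |y|
  have h1 : FourierTransform.fourier (fun y : ℝ => (g |y| : ℂ)) ξ =
      ∫ y : ℝ, Complex.exp ((-2 * Real.pi * y * ξ : ℝ) * Complex.I) • (g |y| : ℂ) :=
    Real.fourier_real_eq_integral_exp_smul _ _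
  have h2 : FourierTransform.fourier (fun y : ℝ => (g |y| : ℂ)) ξ =
      ∫ y : ℝ, Complex.exp ((2 * Real.pi * y * ξ : ℝ) * Complex.I) • (g |y| : ℂ) := by
    rw [h1, ← MeasureTheory.integral_neg_eq_self]
    congr 1 with y
    rw [abs_neg]; congr 3; push_cast; ring
  have hi2 : MeasureTheory.Integrable fun y : ℝ =>
      Complex.exp ((2 * Real.pi * y * ξ : ℝ) * Complex.I) • (g |y| : ℂ) := by
    have := hi.comp_neg
    refine this.congr (Eventually.of_forall fun y => ?_)
    simp only [abs_neg]; congr 3; push_cast; ring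
  have h3 : (2 : ℂ) * FourierTransform.fourier (fun y : ℝ => (g |y| : ℂ)) ξ =
      2 * ((2 * cosInt g (2 * Real.pi * ξ) : ℝ) : ℂ) := by
    calc (2 : ℂ) * FourierTransform.fourier (fun y : ℝ => (g |y| : ℂ)) ξ =
        FourierTransform.fourier (fun y : ℝ => (g |y| : ℂ)) ξ +
        FourierTransform.fourier (fun y : ℝ => (g |y| : ℂ)) ξ := two_mul _
      _ = ∫ y : ℝ, ((2 * (g |y| * Real.cos (2 * Real.pi * ξ * |y|)) : ℝ) : ℂ) := by
        conv_lhs => arg 1; rw [h1]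
        rw [h2, ← MeasureTheory.integral_add hi hi2]
        congr 1 with y
        have hcos : Real.cos (2 * Real.pi * ξ * |y|) = Real.cos (2 * Real.pi * y * ξ) := by
          rw [← Real.cos_abs (2 * Real.pi * y * ξ), ← Real.cos_abs]
          congr 1
          simp only [abs_mul, abs_abs]; ring
        rw [hcos]
        have e : ((-2 * Real.pi * y * ξ : ℝ) : ℂ) * Complex.I =
            -(((2 * Real.pi * y * ξ : ℝ) : ℂ)) * Complex.I := by push_cast; ring
        have := Complex.two_cos ((2 * Real.pi * y * ξ : ℝ) : ℂ)
        rw [← Complex.ofReal_cos] at this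
        rw [e, smul_eq_mul, smul_eq_mul, ← add_mul, add_comm, ← this]
        push_cast; ring
      _ = _ := by
        rw [integral_complex_ofReal, MeasureTheory.integral_const_mul,
          integral_comp_abs (f := fun y => g y * Real.cos (2 * Real.pi * ξ * y))]
        rw [cosInt]; push_cast; ring
  exact mul_left_cancel₀ two_ne_zero h3

/-- The even extension may have a corner at `0`, as for `e^{-a|u|}`, so no smoothness is available.
Quadratic decay of the cosine transform is assumed in its place. -/
theorem poisson_even {g : ℝ → ℝ} (hg : QuadDecay g) {B : ℝ}
    (hB : ∀ ω, 0 < ω → |cosInt g ω| ≤ B / ω ^ 2) (x : ℝ) :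
    (Summable fun n : ℤ => ((2 * cosInt g (2 * Real.pi * n) : ℝ) : ℂ)) ∧
    ∑' n : ℤ, (g |x + n| : ℂ) = ∑' n : ℤ, ((2 * cosInt g (2 * Real.pi * n) : ℝ) : ℂ) *
      Complex.exp (2 * Real.pi * Complex.I * n * x) := by
  obtain ⟨C, hC⟩ := hg.bound
  have hgc := hg.cont
  have hsum : Summable fun n : ℤ => ((2 * cosInt g (2 * Real.pi * n) : ℝ) : ℂ) := by
    refine summable_of_isBigO (Real.summable_abs_int_rpow one_lt_two) ?_
    refine Asymptotics.IsBigO.of_bound (2 * (B / (2 * Real.pi) ^ 2)) ?_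
    rw [Int.cofinite_eq]
    have key : ∀ n : ℤ, n ≠ 0 → ‖((2 * cosInt g (2 * Real.pi * n) : ℝ) : ℂ)‖ ≤
        2 * (B / (2 * Real.pi) ^ 2) * ‖|(n : ℝ)| ^ (-2 : ℝ)‖ := by
      intro n hn
      have hn' : 0 < |(n : ℝ)| := by positivity
      have e : cosInt g (2 * Real.pi * n) = cosInt g (2 * Real.pi * |(n : ℝ)|) := by
        rcases abs_choice (n : ℝ) with h | h <;> rw [h]
        simp only [cosInt, mul_neg, neg_mul, Real.cos_neg]
      have h1 := hB (2 * Real.pi * |(n : ℝ)|) (by positivity)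
      rw [Complex.norm_real, Real.norm_of_nonneg (by positivity : 0 ≤ |(n : ℝ)| ^ (-2 : ℝ)),
        norm_mul, Real.norm_two, Real.norm_eq_abs, e]
      refine (mul_le_mul_of_nonneg_left h1 zero_le_two).trans (le_of_eq ?_)
      rw [Real.rpow_neg (abs_nonneg _), Real.rpow_two]
      field_simp
    exact Filter.eventually_sup.2 ⟨(eventually_lt_atBot 0).mono fun n hn => key n hn.ne,
      (eventually_gt_atTop 0).mono fun n hn => key n hn.ne'⟩
  refine ⟨hsum, ?_⟩
  have hP := Real.tsum_eq_tsum_fourier_of_rpow_decay_of_summable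
    (f := fun y : ℝ => (g |y| : ℂ)) (by fun_prop) one_lt_two ?_ ?_ x
  · rw [hP]
    congr 1 with n
    rw [fourier_comp_abs hg, fourier_coe_apply]
    simp
  · refine Asymptotics.IsBigO.of_bound C ?_
    have h0 : ∀ᶠ y : ℝ in cocompact ℝ, y ≠ 0 := by
      have : ({0} : Set ℝ)ᶜ ∈ cocompact ℝ := isCompact_singleton.compl_mem_cocompact
      exact this
    filter_upwards [h0] with y hy
    have hy' : 0 < |y| := abs_pos.2 hy
    rw [Complex.norm_real, Real.norm_eq_abs, Real.norm_of_nonneg (by positivity),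
      Real.rpow_neg (abs_nonneg _), Real.rpow_two, sq_abs]
    have hC0 : 0 ≤ C := by simpa using (abs_nonneg _).trans (hC 0)
    refine (hC |y|).trans ?_
    rw [sq_abs]
    have : 0 < y ^ 2 := by positivity
    gcongr
    linarith
  · simp_rw [fourier_comp_abs hg]; exact hsum

theorem quadDecay_exp {a : ℝ} (ha : 0 < a) : QuadDecay fun u => Real.exp (-(a * |u|)) where
  cont := by fun_prop
  bound := ⟨1 + 2 / a ^ 2, fun u => by
    have h1 := Real.pow_div_factorial_le_exp (a * |u|) (by positivity) 2
    have h2 := Real.one_le_exp (show 0 ≤ a * |u| by positivity)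
    rw [abs_of_pos (Real.exp_pos _), Real.exp_neg, ← div_eq_mul_inv, le_div_iff₀ (by positivity),
      inv_mul_le_iff₀ (Real.exp_pos _)]
    norm_num [Nat.factorial, mul_pow] at h1
    have h3 : u ^ 2 ≤ Real.exp (a * |u|) * (2 / a ^ 2) := by
      rw [mul_div_assoc', le_div_iff₀ (by positivity)]; linarith
    linarith⟩

theorem cosInt_exp {a : ℝ} (ha : 0 < a) (ω : ℝ) :
    cosInt (fun u => Real.exp (-(a * |u|))) ω = a / (a ^ 2 + ω ^ 2) := by
  have hd : 0 < a ^ 2 + ω ^ 2 := by positivity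
  have hq := quadDecay_exp ha
  have h := MeasureTheory.integral_Ioi_of_hasDerivAt_of_tendsto' (a := (0 : ℝ))
    (f := fun u => Real.exp (-(a * u)) * ((-a * Real.cos (ω * u) + ω * Real.sin (ω * u)) /
      (a ^ 2 + ω ^ 2))) (f' := fun u => Real.exp (-(a * u)) * Real.cos (ω * u)) (m := 0)
    (fun u _ => by
      refine ((((hasDerivAt_id u).const_mul a).fun_neg.exp).fun_mul
        (((((hasDerivAt_id u).const_mul ω).cos.const_mul (-a)).fun_add
        (((hasDerivAt_id u).const_mul ω).sin.const_mul ω)).div_const _)).congr_deriv ?_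
      simp only [id]; field_simp; ring) ?_ ?_
  · rw [cosInt]
    rw [zero_sub] at h
    refine Eq.trans (MeasureTheory.setIntegral_congr_fun measurableSet_Ioi fun u hu => ?_)
      (h.trans ?_)
    · have hu : 0 < u := hu
      simp only [abs_of_pos hu]
    · simp; field_simp
  · refine (hq.integrable_cos ω).congr_fun (fun u hu => ?_) measurableSet_Ioi
    have hu : 0 < u := hu
    simp only [abs_of_pos hu]
  · have h1 : Tendsto (fun u => Real.exp (-(a * u)) * ((a + |ω|) / (a ^ 2 + ω ^ 2))) atTop
        (𝓝 0) := by
      have h2 : Tendsto (fun u => -(a * u)) atTop atBot :=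
        tendsto_neg_atTop_atBot.comp (tendsto_id.const_mul_atTop ha)
      simpa using (Real.tendsto_exp_atBot.comp h2).mul_const ((a + |ω|) / (a ^ 2 + ω ^ 2))
    refine squeeze_zero_norm (fun u => ?_) h1
    rw [norm_mul, Real.norm_of_nonneg (Real.exp_pos _).le, Real.norm_eq_abs, abs_div,
      abs_of_pos hd]
    gcongr
    refine (abs_add_le _ _).trans ?_
    rw [abs_mul, abs_mul, abs_neg, abs_of_pos ha]
    have h3 := Real.abs_cos_le_one (ω * u)
    have h4 := Real.abs_sin_le_one (ω * u)
    have h5 := abs_nonneg ω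
    nlinarith

/-! ### Real even periodic functions with a Gauss sum -/

/-- An even real function mod `q` which is, up to the factor `√q`, its own finite Fourier
transform. -/
structure IsGaussChar (q : ℕ) (χ : ℤ → ℝ) : Prop where
  pos : 0 < q
  periodic : ∀ n k : ℤ, χ (n + k * q) = χ n
  bound : ∀ n, |χ n| ≤ 1
  zero : χ 0 = 0
  even : ∀ n, χ (-n) = χ n
  gauss : ∀ m : ℤ, ∑ r ∈ Finset.range q, (χ r : ℂ) *
    Complex.exp (2 * Real.pi * Complex.I * m * (r / q : ℝ)) = √q * χ m

/-- The frequency `2πm/q`. -/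
noncomputable def freq (q : ℕ) (m : ℕ+) : ℝ := 2 * Real.pi * m / q

/-- The partial fraction series `(2/√q) ∑ χ(m) w/(w² + (2πm/q)²)`. -/
noncomputable def fracSeries (q : ℕ) (χ : ℤ → ℝ) (w : ℝ) : ℝ :=
  2 / √q * ∑' m : ℕ+, χ m * (1 / freq q m * ratK (w / freq q m))

theorem summable_pnat_rpow {s : ℝ} (hs : 1 < s) : Summable fun n : ℕ+ => (n : ℝ) ^ (-s) :=
  summable_pnat_iff_summable_nat.2 (Real.summable_nat_rpow.2 (by linarith) : Summable
    fun n : ℕ => (n : ℝ) ^ (-s))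

theorem summable_pnat_inv_sq : Summable fun n : ℕ+ => 1 / (n : ℝ) ^ 2 :=
  summable_pnat_iff_summable_nat.2 (Real.summable_one_div_nat_pow.2 one_lt_two : Summable
    fun n : ℕ => 1 / (n : ℝ) ^ 2)

theorem summable_exp_neg_mul {w : ℝ} (hw : 0 < w) : Summable fun n : ℕ => Real.exp (-(n * w)) := by
  have h := Real.summable_exp_nat_mul_iff.2 (neg_lt_zero.2 hw)
  simpa using h

theorem tsum_int_of_even {f : ℤ → ℂ} (hf : Function.Even f) (h0 : f 0 = 0) (hs : Summable f) :
    ∑' n : ℤ, f n = 2 * ∑' n : ℕ+, f n := by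
  rw [tsum_int_eq_zero_add_two_mul_tsum_pnat hf hs, h0, zero_add]
  simp

namespace IsGaussChar

variable {q : ℕ} {χ : ℤ → ℝ}

theorem freq_pos (h : IsGaussChar q χ) (m : ℕ+) : 0 < freq q m := by
  have := h.pos
  have := Real.pi_pos
  have := m.pos
  unfold freq
  positivity

theorem summable_inv_freq_sq (h : IsGaussChar q χ) : Summable fun m : ℕ+ => 1 / freq q m ^ 2 := by
  have h1 := summable_pnat_inv_sq.mul_left ((q : ℝ) ^ 2 / (2 * Real.pi) ^ 2)
  refine h1.congr fun m => ?_
  have := h.pos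
  have := Real.pi_pos
  unfold freq
  field_simp

/-- The left side is the sum of `χ(k) e^{-|k|w}` over all integers `k`, sorted by residue class mod
`q`. As `χ` is even with `χ(0) = 0`, it is twice the sum over positive `k`. -/
theorem tsum_int_exp (h : IsGaussChar q χ) {w : ℝ} (hw : 0 < w) :
    (∑ r : Fin q, (χ r : ℂ) * ∑' n : ℤ, (Real.exp (-(w * q * |((r : ℕ) / q : ℝ) + n|)) : ℂ)) =
      2 * ∑' b : ℕ+, ((χ b * Real.exp (-(b * w)) : ℝ) : ℂ) := by
  have hq : (0 : ℝ) < q := Nat.cast_pos.2 h.pos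
  have : NeZero q := ⟨h.pos.ne'⟩
  set F : ℤ → ℂ := fun k => ((χ k * Real.exp (-(|(k : ℝ)| * w)) : ℝ) : ℂ)
  have hS : Summable F := by
    have h1 : Summable fun k : ℤ => Real.exp (-(|(k : ℝ)| * w)) :=
      Summable.of_nat_of_neg (by simpa using summable_exp_neg_mul hw)
        (by simpa using summable_exp_neg_mul hw)
    refine Summable.of_norm_bounded h1 fun k => ?_
    rw [Complex.norm_real, norm_mul, Real.norm_of_nonneg (Real.exp_pos _).le, Real.norm_eq_abs]
    exact mul_le_of_le_one_left (Real.exp_pos _).le (h.bound k)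
  have hE : Function.Even F := fun k => by simp only [F, h.even, Int.cast_neg, abs_neg]
  have h2 := tsum_int_of_even hE (by simp [F, h.zero]) hS
  have h3 : ∑' n : ℕ+, F n = ∑' b : ℕ+, ((χ b * Real.exp (-(b * w)) : ℝ) : ℂ) := by
    refine tsum_congr fun b => ?_
    simp [F]
  rw [← h3, ← h2]
  have hS' : Summable fun p : ℤ × Fin q => F (p.1 * q + (p.2 : ℕ)) := by
    have := (Int.divModEquiv q).symm.summable_iff.2 hS
    refine this.congr fun p => ?_
    simp [Int.divModEquiv_symm_apply]
  have h4 : ∑' k : ℤ, F k = ∑' p : ℤ × Fin q, F (p.1 * q + (p.2 : ℕ)) := by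
    rw [← (Int.divModEquiv q).symm.tsum_eq]
    refine tsum_congr fun p => ?_
    simp [Int.divModEquiv_symm_apply]
  rw [h4, hS'.tsum_prod]
  have hS'' : ∀ r : Fin q, Summable fun n : ℤ => F (n * q + (r : ℕ)) := fun r =>
    hS'.comp_injective (i := fun n : ℤ => (n, r)) fun a b hab => (Prod.mk.inj hab).1
  simp_rw [tsum_fintype]
  rw [Summable.tsum_finsetSum fun r _ => hS'' r]
  refine Finset.sum_congr rfl fun r _ => ?_
  rw [← tsum_mul_left]
  refine tsum_congr fun n => ?_
  have e1 : χ (n * q + (r : ℕ)) = χ r := by rw [add_comm]; exact h.periodic _ _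
  have e2 : |((r : ℕ) / q : ℝ) + n| * q = |((n * q + (r : ℕ) : ℤ) : ℝ)| := by
    rw [← abs_of_pos hq, ← abs_mul, abs_of_pos hq]
    congr 1
    push_cast
    field_simp
    ring
  simp only [F]
  rw [e1, ← e2]
  push_cast
  congr 2
  ring

/-- Poisson summation is applied in each residue class to `e^{-wq|u|}` at the point `r/q`. The sum
over `r` of `χ(r)` times the resulting additive character is `√q χ(n)` by the Gauss sum property,
and the transform of the exponential supplies the partial fractions. -/
theorem tsum_exp_eq_fracSeries (h : IsGaussChar q χ) {w : ℝ} (hw : 0 < w) :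
    ∑' b : ℕ+, χ b * Real.exp (-(b * w)) = fracSeries q χ w := by
  have hq : (0 : ℝ) < q := Nat.cast_pos.2 h.pos
  have hsq : 0 < √(q : ℝ) := Real.sqrt_pos.2 hq
  have ha : 0 < w * q := by positivity
  have hπ := Real.pi_pos
  have hB : ∀ ω : ℝ, 0 < ω → |cosInt (fun u => Real.exp (-(w * q * |u|))) ω| ≤ w * q / ω ^ 2 := by
    intro ω hω
    rw [cosInt_exp ha, abs_of_pos (by positivity)]
    gcongr
    nlinarith [sq_nonneg (w * q)]
  have hP := fun x => poisson_even (quadDecay_exp ha) hB x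
  have h1 := h.tsum_int_exp hw
  have hS := (hP 0).1
  have h2 : (∑ r : Fin q, (χ r : ℂ) * ∑' n : ℤ,
      (Real.exp (-(w * q * |((r : ℕ) / q : ℝ) + n|)) : ℂ)) =
      ∑' n : ℤ, ((2 * cosInt (fun u => Real.exp (-(w * q * |u|))) (2 * Real.pi * n) : ℝ) : ℂ) *
        (√q * χ n) := by
    have e : ∀ r : Fin q, (χ r : ℂ) * ∑' n : ℤ,
        (Real.exp (-(w * q * |((r : ℕ) / q : ℝ) + n|)) : ℂ) = ∑' n : ℤ, (χ r : ℂ) *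
        (((2 * cosInt (fun u => Real.exp (-(w * q * |u|))) (2 * Real.pi * n) : ℝ) : ℂ) *
        Complex.exp (2 * Real.pi * Complex.I * n * ((r : ℕ) / q : ℝ))) := by
      intro r
      rw [tsum_mul_left, ← (hP _).2]
      simp only [abs_abs]
    simp_rw [e]
    rw [← Summable.tsum_finsetSum]
    · refine tsum_congr fun n => ?_
      rw [← h.gauss n, Finset.mul_sum, Finset.sum_range]
      refine Finset.sum_congr rfl fun r _ => ?_
      ring
    · intro r _
      refine Summable.mul_left _ ?_
      refine Summable.of_norm_bounded hS.norm fun n => ?_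
      rw [norm_mul]
      have : ‖Complex.exp (2 * Real.pi * Complex.I * n * ((r : ℕ) / q : ℝ))‖ = 1 := by
        have e2 : (2 * Real.pi * Complex.I * n * ((r : ℕ) / q : ℝ) : ℂ) =
          ((2 * Real.pi * n * ((r : ℕ) / q) : ℝ) : ℂ) * Complex.I := by push_cast; ring
        rw [e2, Complex.norm_exp_ofReal_mul_I]
      rw [this, mul_one]
  rw [h2, tsum_int_of_even] at h1
  · have h3 := mul_left_cancel₀ two_ne_zero h1
    have h4 : ∑' n : ℕ+, (2 * cosInt (fun u => Real.exp (-(w * q * |u|)))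
        (2 * Real.pi * ((n : ℤ) : ℝ)) * (√q * χ n)) = ∑' b : ℕ+, χ b * Real.exp (-(b * w)) := by
      have := congrArg Complex.re h3
      rw [← Complex.ofReal_tsum, Complex.ofReal_re] at this
      rw [← this, ← Complex.ofReal_re (∑' n : ℕ+, _), Complex.ofReal_tsum]
      push_cast
      rfl
    rw [← h4, fracSeries, ← tsum_mul_left]
    refine tsum_congr fun m => ?_
    rw [cosInt_exp ha, ratK, freq]
    have hm : (0 : ℝ) < m := Nat.cast_pos.2 m.pos
    push_cast
    have e5 : (√(q : ℝ)) ^ 2 = q := Real.sq_sqrt hq.le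
    have d1 : (w * q) ^ 2 + (2 * Real.pi * m) ^ 2 ≠ 0 := by positivity
    have d2 : 1 + (w / (2 * Real.pi * m / q)) ^ 2 ≠ 0 := by positivity
    field_simp
    rw [e5]
    ring
  · intro n
    simp only [h.even, Int.cast_neg, mul_neg, cosInt, neg_mul, Real.cos_neg]
  · simp [h.zero]
  · refine Summable.of_norm_bounded (hS.norm.mul_left √q) fun n => ?_
    rw [norm_mul, norm_mul, mul_comm (√(q : ℝ)), Complex.norm_real (√(q : ℝ)), Complex.norm_real (χ n),
      Real.norm_of_nonneg hsq.le, Real.norm_eq_abs]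
    gcongr
    exact mul_le_of_le_one_right hsq.le (h.bound n)

end IsGaussChar

/-! ### The cosine transform of the partial fraction series. -/

theorem abs_ratK_le (u : ℝ) : |ratK u| ≤ |u| := by
  rw [ratK, abs_div, abs_of_pos (by positivity : 0 < 1 + u ^ 2)]
  exact div_le_self (abs_nonneg _) (by nlinarith [sq_nonneg u])

theorem continuous_ratK : Continuous ratK :=
  continuous_iff_continuousAt.2 fun u => (hasDerivAt_ratK u).continuousAt

theorem ratK_neg (u : ℝ) : ratK (-u) = -ratK u := by simp [ratK, neg_div]

/-- The bounded remainder in the double integration by parts of `∫₀^τ u cos(zu)/(1+u²) du`. -/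
noncomputable def ratKRem (z τ : ℝ) : ℝ :=
  1 - ratK1 τ * Real.cos (z * τ) + ∫ u in (0 : ℝ)..τ, ratK2 u * Real.cos (z * u)

theorem sq_mul_integral_ratK (z τ : ℝ) :
    z ^ 2 * ∫ u in (0 : ℝ)..τ, ratK u * Real.cos (z * u) =
      z * (ratK τ * Real.sin (z * τ)) - ratKRem z τ := by
  have c0 := continuous_ratK
  have c2 := quadDecay_ratK2.cont
  have h := intervalIntegral.integral_eq_sub_of_hasDerivAt (a := 0) (b := τ)
    (f := fun u => z * (ratK u * Real.sin (z * u)) + ratK1 u * Real.cos (z * u))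
    (f' := fun u => z ^ 2 * (ratK u * Real.cos (z * u)) + ratK2 u * Real.cos (z * u))
    (fun u _ => by
      refine ((((hasDerivAt_ratK u).fun_mul ((hasDerivAt_id u).const_mul z).sin).const_mul z).fun_add
        ((hasDerivAt_ratK1 u).fun_mul ((hasDerivAt_id u).const_mul z).cos)).congr_deriv ?_
      simp only [id]; ring) (Continuous.intervalIntegrable (by fun_prop) _ _)
  rw [intervalIntegral.integral_add (Continuous.intervalIntegrable (by fun_prop) _ _)
    (Continuous.intervalIntegrable (by fun_prop) _ _), intervalIntegral.integral_const_mul] at h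
  have h0 : ratK1 0 = 1 := by simp [ratK1]
  simp only [mul_zero, Real.sin_zero, Real.cos_zero, h0, mul_one, zero_add] at h
  rw [ratKRem]
  linarith

theorem abs_ratKRem_le : ∃ M, ∀ z τ, 0 ≤ τ → |ratKRem z τ| ≤ M := by
  obtain ⟨C1, hC1⟩ := quadDecay_ratK1.bound
  obtain ⟨C2, hC2⟩ := quadDecay_ratK2.bound
  have hC10 : 0 ≤ C1 := by simpa using (abs_nonneg _).trans (hC1 0)
  have hC20 : 0 ≤ C2 := by simpa using (abs_nonneg _).trans (hC2 0)
  refine ⟨1 + C1 + ∫ u in Set.Ioi (0 : ℝ), C2 * (1 + u ^ 2)⁻¹, fun z τ hτ => ?_⟩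
  refine (abs_add_le _ _).trans (add_le_add ((abs_sub _ _).trans (add_le_add (by simp) ?_)) ?_)
  · rw [abs_mul]
    have h1 : (1 + τ ^ 2)⁻¹ ≤ 1 := inv_le_one_of_one_le₀ (by nlinarith [sq_nonneg τ])
    calc _ ≤ C1 * (1 + τ ^ 2)⁻¹ * 1 := by
          gcongr
          · exact hC1 τ
          · exact Real.abs_cos_le_one _
      _ ≤ C1 * 1 * 1 := by gcongr
      _ = _ := by ring
  · rw [intervalIntegral.integral_of_le hτ, ← Real.norm_eq_abs]
    have hi : MeasureTheory.IntegrableOn (fun u : ℝ => C2 * (1 + u ^ 2)⁻¹) (Set.Ioi 0) :=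
      (integrable_inv_one_add_sq.const_mul C2).integrableOn
    refine (MeasureTheory.norm_integral_le_of_norm_le
      (hi.mono_set Set.Ioc_subset_Ioi_self) (Eventually.of_forall fun u => ?_)).trans ?_
    · rw [norm_mul, Real.norm_eq_abs, Real.norm_eq_abs]
      calc _ ≤ |ratK2 u| * 1 := by gcongr; exact Real.abs_cos_le_one _
        _ ≤ _ := by rw [mul_one]; exact hC2 u
    · exact MeasureTheory.setIntegral_mono_set hi (Eventually.of_forall fun u => by positivity)
        (Eventually.of_forall fun _ h => Set.Ioc_subset_Ioi_self h)

theorem tendsto_ratKRem (z : ℝ) : Tendsto (ratKRem z) atTop (𝓝 (1 + cosInt ratK2 z)) := by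
  have h1 := quadDecay_ratK1.tendsto_mul (b := fun u => Real.cos (z * u))
    fun _ => Real.abs_cos_le_one _
  have h2 := MeasureTheory.intervalIntegral_tendsto_integral_Ioi 0
    (quadDecay_ratK2.integrable_cos z) tendsto_id
  have h3 := (h1.const_sub 1).add h2
  rw [sub_zero] at h3
  exact h3

theorem integral_ratK_scaled {c ω : ℝ} (hc : 0 < c) (hω : 0 < ω) (T : ℝ) :
    ∫ w in (0 : ℝ)..T, 1 / c * ratK (w / c) * Real.cos (ω * w) =
      1 / c * ratK (T / c) * (Real.sin (ω * T) / ω) - ratKRem (c * ω) (T / c) / (c * ω) ^ 2 := by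
  have h := sq_mul_integral_ratK (c * ω) (T / c)
  have h1 : ∫ w in (0 : ℝ)..T, 1 / c * ratK (w / c) * Real.cos (ω * w) =
      ∫ u in (0 : ℝ)..T / c, ratK u * Real.cos (c * ω * u) := by
    have := intervalIntegral.integral_comp_div (a := 0) (b := T)
      (fun u => ratK u * Real.cos (c * ω * u)) hc.ne'
    rw [zero_div, smul_eq_mul] at this
    have e : ∀ w, 1 / c * ratK (w / c) * Real.cos (ω * w) =
        1 / c * (ratK (w / c) * Real.cos (c * ω * (w / c))) := fun w => by
      rw [show c * ω * (w / c) = ω * w by field_simp]; ring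
    simp_rw [e]
    rw [intervalIntegral.integral_const_mul, this]
    field_simp
  rw [h1]
  have e2 : c * ω * (T / c) = ω * T := by field_simp
  rw [e2] at h
  field_simp
  field_simp at h
  linarith

namespace IsGaussChar

variable {q : ℕ} {χ : ℤ → ℝ}

theorem abs_fracTerm_le (h : IsGaussChar q χ) (w : ℝ) (m : ℕ+) :
    |χ m * (1 / freq q m * ratK (w / freq q m))| ≤ |w| * (1 / freq q m ^ 2) := by
  have hc := h.freq_pos m
  rw [abs_mul, abs_mul, abs_of_pos (by positivity : 0 < 1 / freq q m)]
  calc _ ≤ 1 * (1 / freq q m * |w / freq q m|) :=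
        mul_le_mul (h.bound _) (mul_le_mul_of_nonneg_left (abs_ratK_le _) (by positivity))
          (by positivity) zero_le_one
    _ = _ := by rw [abs_div, abs_of_pos hc]; field_simp

theorem summable_fracTerm (h : IsGaussChar q χ) (w : ℝ) :
    Summable fun m : ℕ+ => χ m * (1 / freq q m * ratK (w / freq q m)) :=
  Summable.of_norm_bounded (h.summable_inv_freq_sq.mul_left |w|) fun m => h.abs_fracTerm_le w m

theorem continuous_fracSeries (h : IsGaussChar q χ) : Continuous (fracSeries q χ) := by
  have hk := continuous_ratK
  rw [continuous_iff_continuousAt]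
  intro w₀
  refine ContinuousAt.mul continuousAt_const ?_
  refine ContinuousOn.continuousAt (s := Set.Icc (-(|w₀| + 1)) (|w₀| + 1)) ?_
    (Icc_mem_nhds (by linarith [neg_abs_le w₀]) (by linarith [le_abs_self w₀]))
  refine continuousOn_tsum (fun m => by fun_prop)
    (h.summable_inv_freq_sq.mul_left (|w₀| + 1)) fun m w hw => ?_
  have hc := h.freq_pos m
  refine (h.abs_fracTerm_le w m).trans ?_
  gcongr
  exact abs_le.2 ⟨hw.1, hw.2⟩

theorem fracSeries_neg (w : ℝ) : fracSeries q χ (-w) = -fracSeries q χ w := by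
  simp only [fracSeries, neg_div, ratK_neg, mul_neg, tsum_neg]

theorem fracSeries_zero : fracSeries q χ 0 = 0 := by simp [fracSeries, ratK]

/-- For `w ≥ 1` the exponential series gives the decay, on `[-1, 1]` continuity suffices, and
oddness covers `w ≤ -1`. The decay is invisible in the partial fractions, whose terms are only
`O(1/w)`. -/
theorem abs_fracSeries_le (h : IsGaussChar q χ) :
    ∃ C, 0 ≤ C ∧ ∀ w, |fracSeries q χ w| ≤ C * Real.exp (-(1 / 2 * |w|)) := by
  have hS : Summable fun b : ℕ+ => Real.exp (-((b : ℕ) * (1 / 2 : ℝ))) :=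
    (summable_exp_neg_mul one_half_pos).comp_injective PNat.coe_injective
  set A := ∑' b : ℕ+, Real.exp (-((b : ℕ) * (1 / 2 : ℝ)))
  obtain ⟨B, hB⟩ := isCompact_Icc (a := (-1 : ℝ)) (b := 1) |>.exists_bound_of_continuousOn
    h.continuous_fracSeries.continuousOn
  have hA : 0 ≤ A := tsum_nonneg fun b => (Real.exp_pos _).le
  have hB0 : 0 ≤ B := (norm_nonneg _).trans (hB 0 (by simp))
  have hpos : ∀ w, 1 ≤ w → |fracSeries q χ w| ≤ A * Real.exp (-(1 / 2 * |w|)) := by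
    intro w hw
    have hw0 : 0 < w := by linarith
    rw [← h.tsum_exp_eq_fracSeries hw0, ← Real.norm_eq_abs, ← tsum_mul_right]
    refine tsum_of_norm_bounded (hS.mul_right _).hasSum fun b => ?_
    rw [norm_mul, Real.norm_of_nonneg (Real.exp_pos _).le, Real.norm_eq_abs, ← Real.exp_add,
      abs_of_pos hw0]
    refine (mul_le_of_le_one_left (Real.exp_pos _).le (h.bound b)).trans (Real.exp_le_exp.2 ?_)
    have hb : (1 : ℝ) ≤ (b : ℕ) := Nat.one_le_cast.2 b.pos
    nlinarith
  refine ⟨A + B * Real.exp (1 / 2), by positivity, fun w => ?_⟩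
  have he := Real.exp_pos (-(1 / 2 * |w|))
  rcases le_total |w| 1 with h1 | h1
  · have h2 := hB w (abs_le.1 h1)
    rw [Real.norm_eq_abs] at h2
    have h3 : 1 ≤ Real.exp (1 / 2) * Real.exp (-(1 / 2 * |w|)) := by
      rw [← Real.exp_add]; exact Real.one_le_exp (by linarith)
    calc _ ≤ B * 1 := by linarith
      _ ≤ B * (Real.exp (1 / 2) * Real.exp (-(1 / 2 * |w|))) := by gcongr
      _ ≤ _ := by
        rw [add_mul, mul_assoc B]
        have : 0 ≤ A * Real.exp (-(1 / 2 * |w|)) := by positivity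
        linarith
  · have h2 : |fracSeries q χ w| ≤ A * Real.exp (-(1 / 2 * |w|)) := by
      rcases abs_choice w with h3 | h3
      · rw [h3] at h1; exact hpos w h1
      · rw [h3] at h1
        have := hpos (-w) h1
        rwa [fracSeries_neg, abs_neg, abs_neg] at this
    rw [add_mul]
    have : 0 ≤ B * Real.exp (1 / 2) * Real.exp (-(1 / 2 * |w|)) := by positivity
    linarith

theorem quadDecay_fracSeries (h : IsGaussChar q χ) : QuadDecay (fracSeries q χ) where
  cont := h.continuous_fracSeries
  bound := by
    obtain ⟨C, hC0, hC⟩ := h.abs_fracSeries_le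
    obtain ⟨B, hB⟩ := (quadDecay_exp one_half_pos).bound
    refine ⟨C * B, fun w => (hC w).trans ?_⟩
    have := hB w
    rw [abs_of_pos (Real.exp_pos _)] at this
    rw [mul_assoc]
    gcongr

theorem summable_ratKRem (h : IsGaussChar q χ) (ω : ℝ) {T : ℝ} (hT : 0 ≤ T) :
    Summable fun m : ℕ+ => χ m * (ratKRem (freq q m * ω) (T / freq q m) / (freq q m * ω) ^ 2) := by
  obtain ⟨M, hM⟩ := abs_ratKRem_le
  refine Summable.of_norm_bounded (h.summable_inv_freq_sq.mul_left (M / ω ^ 2)) fun m => ?_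
  have hc := h.freq_pos m
  rw [norm_mul, norm_div, Real.norm_eq_abs, Real.norm_eq_abs,
    Real.norm_of_nonneg (by positivity : 0 ≤ (freq q m * ω) ^ 2)]
  calc _ ≤ 1 * (M / (freq q m * ω) ^ 2) := by
        gcongr
        · exact h.bound _
        · exact hM _ _ (by positivity)
    _ = _ := by rw [mul_pow]; field_simp

/-- The terms decay like `1/w` and are not absolutely integrable on the half line, so the exchange
of sum and integral is made on `[0, T]`. The boundary terms at `T` reassemble into `fracSeries`
itself, which is known to decay. -/
theorem integral_fracSeries (h : IsGaussChar q χ) {ω T : ℝ} (hω : 0 < ω) (hT : 0 ≤ T) :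
    ∫ w in (0 : ℝ)..T, fracSeries q χ w * Real.cos (ω * w) =
      fracSeries q χ T * (Real.sin (ω * T) / ω) - 2 / √q * ∑' m : ℕ+,
        χ m * (ratKRem (freq q m * ω) (T / freq q m) / (freq q m * ω) ^ 2) := by
  have hk := continuous_ratK
  have hterm := intervalIntegral.hasSum_integral_of_dominated_convergence
    (μ := MeasureTheory.volume) (a := 0) (b := T)
    (F := fun (m : ℕ+) w => χ m * (1 / freq q m * ratK (w / freq q m) * Real.cos (ω * w)))
    (f := fun w => (∑' m : ℕ+, χ m * (1 / freq q m * ratK (w / freq q m))) * Real.cos (ω * w))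
    (fun m _ => T * (1 / freq q m ^ 2)) (fun m => by
      apply Continuous.aestronglyMeasurable; fun_prop) ?_
    (Eventually.of_forall fun w _ => h.summable_inv_freq_sq.mul_left T) (by simp) ?_
  · have h1 : ∫ w in (0 : ℝ)..T, fracSeries q χ w * Real.cos (ω * w) = 2 / √q *
        ∫ w in (0 : ℝ)..T, (∑' m : ℕ+, χ m * (1 / freq q m * ratK (w / freq q m))) *
          Real.cos (ω * w) := by
      rw [← intervalIntegral.integral_const_mul]
      simp only [fracSeries, mul_assoc]
    rw [h1, ← hterm.tsum_eq]
    have e : ∀ m : ℕ+, (∫ w in (0 : ℝ)..T, χ m * (1 / freq q m * ratK (w / freq q m) *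
        Real.cos (ω * w))) = χ m * (1 / freq q m * ratK (T / freq q m)) * (Real.sin (ω * T) / ω) -
        χ m * (ratKRem (freq q m * ω) (T / freq q m) / (freq q m * ω) ^ 2) := fun m => by
      rw [intervalIntegral.integral_const_mul, integral_ratK_scaled (h.freq_pos m) hω]
      ring
    simp_rw [e]
    rw [((h.summable_fracTerm T).mul_right _).tsum_sub (h.summable_ratKRem ω hT), tsum_mul_right,
      fracSeries]
    ring
  · refine fun m => Eventually.of_forall fun w hw => ?_
    rw [Set.uIoc_of_le hT] at hw
    have hc := h.freq_pos m
    rw [← mul_assoc, norm_mul, Real.norm_eq_abs, Real.norm_eq_abs]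
    calc _ ≤ |w| * (1 / freq q m ^ 2) * 1 := by
          gcongr
          · exact h.abs_fracTerm_le w m
          · exact Real.abs_cos_le_one _
      _ ≤ _ := by
        rw [mul_one, abs_of_pos hw.1]
        gcongr
        exact hw.2
  · refine Eventually.of_forall fun w _ => ?_
    have := (h.summable_fracTerm w).hasSum.mul_right (Real.cos (ω * w))
    simpa only [mul_assoc] using this

theorem abs_auxQ_freq_le (h : IsGaussChar q χ) : ∃ C, 0 ≤ C ∧ ∀ (ω : ℝ), 0 < ω → ∀ m : ℕ+,
    |χ m * auxQ (freq q m * ω)| ≤ C / ω ^ 2 * (1 / freq q m ^ 2) := by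
  obtain ⟨C, hC, hQ⟩ := abs_auxQ_le
  refine ⟨C, hC, fun ω hω m => ?_⟩
  have hc := h.freq_pos m
  rw [abs_mul]
  calc _ ≤ 1 * (C / (freq q m * ω) ^ 2) := by
        gcongr
        · exact h.bound _
        · exact hQ _ (by positivity)
    _ = _ := by rw [mul_pow]; field_simp

/-- Let `T → ∞` in `integral_fracSeries`. The boundary term disappears, and the remainders are
bounded uniformly, so dominated convergence applies with `∑ 1/freq²`. -/
theorem cosInt_fracSeries (h : IsGaussChar q χ) {ω : ℝ} (hω : 0 < ω) :
    cosInt (fracSeries q χ) ω = 2 / √q * ∑' m : ℕ+, χ m * auxQ (freq q m * ω) := by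
  obtain ⟨M, hM⟩ := abs_ratKRem_le
  have hq := h.quadDecay_fracSeries
  have h1 := MeasureTheory.intervalIntegral_tendsto_integral_Ioi 0 (hq.integrable_cos ω) tendsto_id
  have h2 : Tendsto (fun T => fracSeries q χ T * (Real.sin (ω * T) / ω)) atTop (𝓝 0) := by
    have := (hq.tendsto_mul (b := fun T => Real.sin (ω * T))
      fun _ => Real.abs_sin_le_one _).div_const ω
    simpa only [mul_div_assoc, zero_div] using this
  have h3 : Tendsto (fun T => ∑' m : ℕ+,
      χ m * (ratKRem (freq q m * ω) (T / freq q m) / (freq q m * ω) ^ 2)) atTop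
      (𝓝 (∑' m : ℕ+, -(χ m * auxQ (freq q m * ω)))) := by
    refine tendsto_tsum_of_dominated_convergence
      (h.summable_inv_freq_sq.mul_left (M / ω ^ 2)) (fun m => ?_) ?_
    · have hc := h.freq_pos m
      have h4 := ((tendsto_ratKRem (freq q m * ω)).comp
        (tendsto_id.atTop_div_const hc)).div_const ((freq q m * ω) ^ 2)
      refine (h4.const_mul (χ m)).congr' ?_ |>.trans_eq ?_
      · exact Eventually.of_forall fun T => by simp [Function.comp]
      · rw [auxQ]; congr 1; ring
    · filter_upwards [eventually_ge_atTop 0] with T hT m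
      have hc := h.freq_pos m
      rw [norm_mul, norm_div, Real.norm_eq_abs, Real.norm_eq_abs,
        Real.norm_of_nonneg (by positivity : 0 ≤ (freq q m * ω) ^ 2)]
      calc _ ≤ 1 * (M / (freq q m * ω) ^ 2) := by
            gcongr
            · exact h.bound _
            · exact hM _ _ (by positivity)
        _ = _ := by rw [mul_pow]; field_simp
  have h5 := h2.sub (h3.const_mul (2 / √q))
  refine tendsto_nhds_unique h1 (Tendsto.congr' ?_ (h5.trans_eq ?_))
  · filter_upwards [eventually_ge_atTop 0] with T hT
    exact (h.integral_fracSeries hω hT).symm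
  · rw [tsum_neg]; congr 1; ring

theorem abs_cosInt_fracSeries_le (h : IsGaussChar q χ) :
    ∃ C, ∀ ω, 0 < ω → |cosInt (fracSeries q χ) ω| ≤ C / ω ^ 2 := by
  obtain ⟨C, hC, hQ⟩ := h.abs_auxQ_freq_le
  refine ⟨2 / √q * (C * ∑' m : ℕ+, 1 / freq q m ^ 2), fun ω hω => ?_⟩
  rw [h.cosInt_fracSeries hω, abs_mul, abs_of_nonneg (by positivity), mul_div_assoc]
  gcongr
  rw [← Real.norm_eq_abs, mul_div_right_comm]
  rw [← tsum_mul_left]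
  exact tsum_of_norm_bounded (h.summable_inv_freq_sq.mul_left (C / ω ^ 2)).hasSum fun m => hQ ω hω m

end IsGaussChar

/-- The divisor sum `∑_{d ∣ n} χ(d)`. -/
noncomputable def divSum (χ : ℤ → ℝ) (n : ℕ) : ℝ := ∑ d ∈ n.divisors, χ d

/-! ### Sums over divisors. -/

section DivisorSums

variable {χ : ℤ → ℝ}

theorem abs_divSum_le (hχ : ∀ n, |χ n| ≤ 1) (n : ℕ) : |divSum χ n| ≤ divSum (fun _ => 1) n :=
  (Finset.abs_sum_le_sum_abs _ _).trans (Finset.sum_le_sum fun d _ => hχ d)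

theorem divSum_one_nonneg (n : ℕ) : 0 ≤ divSum (fun _ => 1) n :=
  Finset.sum_nonneg fun _ _ => zero_le_one

theorem summable_prod_of_rpow (hχ : ∀ n, |χ n| ≤ 1) {g : ℕ → ℝ} {C s : ℝ} (hs : 1 < s)
    (hg : ∀ n : ℕ+, |g n| ≤ C * (n : ℝ) ^ (-s)) :
    Summable fun p : ℕ+ × ℕ+ => χ p.2 * g (p.1 * p.2) := by
  have h0 := summable_pnat_rpow hs
  have h1 := (h0.mul_of_nonneg h0 (fun n => by positivity) (fun n => by positivity)).mul_left C
  refine Summable.of_norm_bounded h1 fun p => ?_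
  rw [norm_mul, Real.norm_eq_abs, Real.norm_eq_abs]
  have h2 := hg (p.1 * p.2)
  rw [PNat.mul_coe, Nat.cast_mul, Real.mul_rpow (by positivity) (by positivity)] at h2
  exact (mul_le_of_le_one_left (abs_nonneg _) (hχ _)).trans h2

theorem hasSum_divSum_mul {g : ℕ → ℝ}
    (hg : Summable fun p : ℕ+ × ℕ+ => χ p.2 * g (p.1 * p.2)) :
    HasSum (fun n : ℕ+ => divSum χ n * g n) (∑' p : ℕ+ × ℕ+, χ p.2 * g (p.1 * p.2)) := by
  have h1 := hg.hasSum
  rw [← sigmaAntidiagonalEquivProd.hasSum_iff] at h1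
  have h2 := h1.sigma fun n => hasSum_fintype _
  convert h2 using 1
  funext n
  have e : ∀ x : (n : ℕ).divisorsAntidiagonal, ((fun p : ℕ+ × ℕ+ => χ p.2 * g (p.1 * p.2)) ∘
      sigmaAntidiagonalEquivProd) ⟨n, x⟩ = χ (x.1.2 : ℕ) * g n := fun x =>
    congrArg (fun m => χ (x.1.2 : ℕ) * g m) (Nat.mem_divisorsAntidiagonal.1 x.2).1
  simp_rw [e]
  rw [Finset.sum_coe_sort (n : ℕ).divisorsAntidiagonal fun x => χ (x.2 : ℕ) * g n,
    Nat.sum_divisorsAntidiagonal' fun _ d => χ (d : ℕ) * g n, divSum, Finset.sum_mul]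

theorem summable_divSum_one_mul_rpow {s : ℝ} (hs : 1 < s) :
    Summable fun n : ℕ+ => divSum (fun _ => 1) n * (n : ℝ) ^ (-s) := by
  have h := summable_prod_of_rpow (χ := fun _ => 1) (g := fun n => (n : ℝ) ^ (-s)) (C := 1)
    (by simp) hs fun n => by rw [one_mul, abs_of_nonneg (by positivity)]
  exact (hasSum_divSum_mul (χ := fun _ => 1) (g := fun n => (n : ℝ) ^ (-s)) h).summable

theorem summable_divSum_mul (hχ : ∀ n, |χ n| ≤ 1) {g : ℕ+ → ℝ} {C s : ℝ} (hs : 1 < s)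
    (hg : ∀ n : ℕ+, |g n| ≤ C * (n : ℝ) ^ (-s)) : Summable fun n : ℕ+ => divSum χ n * g n := by
  refine Summable.of_norm_bounded ((summable_divSum_one_mul_rpow hs).mul_left C) fun n => ?_
  rw [norm_mul, Real.norm_eq_abs, Real.norm_eq_abs, mul_left_comm]
  exact mul_le_mul (abs_divSum_le hχ n) (hg n) (abs_nonneg _) (divSum_one_nonneg _)

theorem exp_neg_mul_le {t x : ℝ} (ht : 0 < t) (hx : 0 < x) :
    Real.exp (-(x * t)) ≤ 2 / t ^ 2 * x ^ (-2 : ℝ) := by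
  have h1 : (x * t) ^ 2 / 2 ≤ Real.exp (x * t) := by
    have := Real.quadratic_le_exp_of_nonneg (x := x * t) (by positivity)
    have : 0 < x * t := by positivity
    linarith
  rw [Real.exp_neg, Real.rpow_neg hx.le, Real.rpow_two]
  calc _ ≤ ((x * t) ^ 2 / 2)⁻¹ := by gcongr
    _ = _ := by field_simp

end DivisorSums

theorem cosInt_comp_mul {g : ℝ → ℝ} {t : ℝ} (ht : 0 < t) (ω : ℝ) :
    cosInt (fun u => g (t * u)) ω = 1 / t * cosInt g (ω / t) := by
  have := MeasureTheory.integral_comp_mul_left_Ioi (fun v => g v * Real.cos (ω / t * v)) 0 ht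
  rw [mul_zero, smul_eq_mul] at this
  rw [cosInt, cosInt, one_div, ← this]
  refine MeasureTheory.integral_congr_ae (Eventually.of_forall fun u => ?_)
  simp only
  congr 2
  field_simp

theorem QuadDecay.comp_mul {g : ℝ → ℝ} (hg : QuadDecay g) {t : ℝ} (ht : 0 < t) :
    QuadDecay fun u => g (t * u) where
  cont := hg.cont.comp (by fun_prop)
  bound := by
    obtain ⟨C, hC0, hC⟩ := hg.abs_div_le_of_nonneg
    refine ⟨C * (1 + 1 / t ^ 2), fun u => (hC _).trans ?_⟩
    rw [mul_assoc]
    gcongr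
    rw [← div_eq_mul_inv, inv_eq_one_div, div_le_div_iff₀ (by positivity) (by positivity)]
    have e : (1 + 1 / t ^ 2) * (1 + (t * u) ^ 2) = 1 + u ^ 2 + (1 / t ^ 2 + (t * u) ^ 2) := by
      field_simp
      ring
    rw [e]
    have : 0 ≤ 1 / t ^ 2 + (t * u) ^ 2 := by positivity
    linarith

namespace IsGaussChar

variable {q : ℕ} {χ : ℤ → ℝ}

/-- `fracSeries` is odd, but Poisson summation is applied to the even extension of its restriction
to `[0, ∞)`, which contributes `0` at the origin. The zero frequency gives the pole `1/t`. -/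
theorem tsum_fracSeries (h : IsGaussChar q χ) {t : ℝ} (ht : 0 < t) :
    ∑' a : ℕ+, fracSeries q χ (t * a) = 1 / t * cosInt (fracSeries q χ) 0 +
      2 / t * ∑' k : ℕ+, cosInt (fracSeries q χ) (2 * Real.pi * k / t) := by
  obtain ⟨B, hB⟩ := h.abs_cosInt_fracSeries_le
  have hg := h.quadDecay_fracSeries.comp_mul ht
  have hgB : ∀ ω : ℝ, 0 < ω → |cosInt (fun u => fracSeries q χ (t * u)) ω| ≤ B * t / ω ^ 2 := by
    intro ω hω
    rw [cosInt_comp_mul ht, abs_mul, abs_of_pos (by positivity)]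
    calc _ ≤ 1 / t * (B / (ω / t) ^ 2) := by
          gcongr
          exact hB _ (by positivity)
      _ = _ := by field_simp
  obtain ⟨hS, hP⟩ := poisson_even hg hgB 0
  simp only [Complex.ofReal_zero, mul_zero, Complex.exp_zero, mul_one, zero_add] at hP
  rw [tsum_int_eq_zero_add_two_mul_tsum_pnat
      (f := fun n : ℤ => (fracSeries q χ (t * |(n : ℝ)|) : ℂ)) (fun n => by simp) ?_,
    tsum_int_eq_zero_add_two_mul_tsum_pnat (f := fun n : ℤ =>
      ((2 * cosInt (fun u => fracSeries q χ (t * u)) (2 * Real.pi * n) : ℝ) : ℂ))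
      (fun n => ?_) hS] at hP
  · have h1 : ((2 * ∑' a : ℕ+, fracSeries q χ (t * a) : ℝ) : ℂ) =
        ((2 * cosInt (fun u => fracSeries q χ (t * u)) 0 + 2 * ∑' k : ℕ+,
          (2 * cosInt (fun u => fracSeries q χ (t * u)) (2 * Real.pi * k)) : ℝ) : ℂ) := by
      push_cast
      simpa [fracSeries_zero] using hP
    have h2 := Complex.ofReal_injective h1
    simp_rw [cosInt_comp_mul ht] at h2
    rw [tsum_mul_left, tsum_mul_left, zero_div] at h2
    linear_combination h2 / 2
  · simp only [Int.cast_neg, mul_neg, cosInt, neg_mul, Real.cos_neg]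
  · obtain ⟨C, hC⟩ := hg.bound
    refine Summable.of_norm_bounded (g := fun n : ℤ => C * (1 + (n : ℝ) ^ 2)⁻¹) ?_ fun n => ?_
    · refine Summable.mul_left _ ?_
      refine Summable.of_norm_bounded_eventually (Real.summable_one_div_int_pow.2 one_lt_two) ?_
      filter_upwards [(Set.finite_singleton (0 : ℤ)).compl_mem_cofinite] with n hn
      have hn' : (n : ℝ) ≠ 0 := Int.cast_ne_zero.2 (by simpa using hn)
      rw [Real.norm_of_nonneg (by positivity), inv_eq_one_div]
      gcongr
      linarith
    · have := hC |(n : ℝ)|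
      rwa [sq_abs, ← Real.norm_eq_abs, ← Complex.norm_real] at this

/-- Writing `n = ab`, the sum over `b` is `fracSeries (t * a)`, and `tsum_fracSeries` handles the
sum over `a`. Each transform is a series over `b` twisted by `χ`, so the product of the dual
variables again runs over the integers with weight `divSum χ`. -/
theorem tsum_divSum_mul_exp (h : IsGaussChar q χ) {t : ℝ} (ht : 0 < t) :
    ∑' n : ℕ+, divSum χ n * Real.exp (-(n * t)) = cosInt (fracSeries q χ) 0 / t +
      4 / (t * √q) * ∑' n : ℕ+, divSum χ n * auxQ (4 * Real.pi ^ 2 / q * n / t) := by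
  have hq : (0 : ℝ) < q := Nat.cast_pos.2 h.pos
  have hπ := Real.pi_pos
  have hg1 : Summable fun p : ℕ+ × ℕ+ => χ p.2 * Real.exp (-(((p.1 * p.2 : ℕ) : ℝ) * t)) :=
    summable_prod_of_rpow h.bound (g := fun n => Real.exp (-(n * t))) (C := 2 / t ^ 2)
    one_lt_two fun n => by
      rw [abs_of_pos (Real.exp_pos _)]
      exact exp_neg_mul_le ht (Nat.cast_pos.2 n.pos)
  obtain ⟨C, hC, hQ⟩ := abs_auxQ_le
  have hg2 : Summable fun p : ℕ+ × ℕ+ =>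
      χ p.2 * auxQ (4 * Real.pi ^ 2 / q * ((p.1 * p.2 : ℕ) : ℝ) / t) :=
    summable_prod_of_rpow h.bound (g := fun n => auxQ (4 * Real.pi ^ 2 / q * n / t))
    (C := C / (4 * Real.pi ^ 2 / q / t) ^ 2) one_lt_two fun n => by
      have hn : (0 : ℝ) < n := Nat.cast_pos.2 n.pos
      refine (hQ _ (by positivity)).trans_eq ?_
      rw [Real.rpow_neg hn.le, Real.rpow_two]
      field_simp
  rw [(hasSum_divSum_mul (g := fun n => Real.exp (-(n * t))) hg1).tsum_eq,
    (hasSum_divSum_mul (g := fun n => auxQ (4 * Real.pi ^ 2 / q * n / t)) hg2).tsum_eq, hg1.tsum_prod,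
    hg2.tsum_prod]
  have e1 : ∀ a : ℕ+, ∑' b : ℕ+, χ b * Real.exp (-(((a * b : ℕ) : ℝ) * t)) =
      fracSeries q χ (t * a) := fun a => by
    rw [← h.tsum_exp_eq_fracSeries (mul_pos ht (Nat.cast_pos.2 a.pos))]
    refine tsum_congr fun b => ?_
    push_cast
    congr 3
    ring
  have e2 : ∀ k : ℕ+, cosInt (fracSeries q χ) (2 * Real.pi * k / t) = 2 / √q *
      ∑' b : ℕ+, χ b * auxQ (4 * Real.pi ^ 2 / q * ((k * b : ℕ) : ℝ) / t) := fun k => by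
    have hk : (0 : ℝ) < k := Nat.cast_pos.2 k.pos
    rw [h.cosInt_fracSeries (by positivity)]
    congr 1
    refine tsum_congr fun b => ?_
    rw [freq]
    push_cast
    congr 2
    field_simp
    ring
  simp_rw [e1]
  rw [h.tsum_fracSeries ht]
  simp_rw [e2]
  rw [tsum_mul_left]
  field_simp
  ring

end IsGaussChar

/-! ### The Riesz sum as a Bessel series -/

/-- The first Riesz sum `∑_{n ≤ x} v(n) (x - n)` of the divisor sums of `χ`. -/
noncomputable def rieszSum (χ : ℤ → ℝ) (x : ℝ) : ℝ :=
  ∑' n : ℕ+, divSum χ n * max (x - n) 0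

/-- The constant `4π²/q`. -/
noncomputable def scaleConst (q : ℕ) : ℝ := 4 * Real.pi ^ 2 / q

/-- The series `∑ v(n) n⁻² E(4π²nx/q)`. -/
noncomputable def kerSeries (q : ℕ) (χ : ℤ → ℝ) (x : ℝ) : ℝ :=
  ∑' n : ℕ+, divSum χ n * (kerE (scaleConst q * n * x) / n ^ 2)

theorem laplace_posPart {p a : ℝ} (hp : 0 < p) (ha : 0 ≤ a) :
    MeasureTheory.IntegrableOn (fun x => Real.exp (-(p * x)) * max (x - a) 0) (Set.Ioi 0) ∧
      ∫ x in Set.Ioi (0 : ℝ), Real.exp (-(p * x)) * max (x - a) 0 = Real.exp (-(a * p)) / p ^ 2 := by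
  set f : ℝ → ℝ := fun x => Real.exp (-(p * x)) * max (x - a) 0 with hf
  set F : ℝ → ℝ := fun x => -((x - a) / p + 1 / p ^ 2) * Real.exp (-(p * x)) with hF
  have hd : ∀ x ∈ Set.Ici a, HasDerivAt F ((x - a) * Real.exp (-(p * x))) x := fun x _ => by
    have h := ((((hasDerivAt_id x).sub_const a).div_const p).add_const (1 / p ^ 2)).fun_neg.fun_mul
      ((hasDerivAt_id x).const_mul p).fun_neg.exp
    refine h.congr_deriv ?_
    simp only [id]
    field_simp
    ring
  have hpos : ∀ x ∈ Set.Ioi a, 0 ≤ (x - a) * Real.exp (-(p * x)) := fun x hx =>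
    mul_nonneg (sub_nonneg.2 (le_of_lt hx)) (Real.exp_pos _).le
  have ht : Tendsto F atTop (𝓝 0) := by
    have h0 := tendsto_rpow_mul_exp_neg_mul_atTop_nhds_zero 0 p hp
    have h1 := tendsto_rpow_mul_exp_neg_mul_atTop_nhds_zero 1 p hp
    have h2 := (h1.const_mul (-1 / p)).add (h0.const_mul (a / p - 1 / p ^ 2))
    simp only [mul_zero, add_zero, Real.rpow_zero, Real.rpow_one, one_mul] at h2
    refine h2.congr fun x => ?_
    rw [hF, neg_mul]
    ring
  have hm : MeasurableSet (Set.Ioi (0 : ℝ)) := measurableSet_Ioi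
  have hz : ∀ x ∈ Set.Ioi (0 : ℝ) \ Set.Ioi a, f x = 0 := fun x hx => by
    have : x ≤ a := not_lt.1 hx.2
    simp only [hf]
    rw [max_eq_right (by linarith), mul_zero]
  have he : Set.EqOn (fun x => (x - a) * Real.exp (-(p * x))) f (Set.Ioi a) := fun x hx => by
    have : a < x := hx
    rw [hf]
    simp only
    rw [max_eq_left (by linarith), mul_comm]
  have hi := (MeasureTheory.integrableOn_Ioi_deriv_of_nonneg' hd hpos ht).congr_fun he
    measurableSet_Ioi
  refine ⟨hi.of_forall_sdiff_eq_zero hm hz, ?_⟩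
  rw [MeasureTheory.setIntegral_eq_of_subset_of_forall_sdiff_eq_zero hm (Set.Ioi_subset_Ioi ha) hz,
    ← MeasureTheory.setIntegral_congr_fun measurableSet_Ioi he,
    MeasureTheory.integral_Ioi_of_hasDerivAt_of_nonneg' hd hpos ht, hF]
  simp only
  rw [sub_self, zero_div, zero_add, mul_comm a p]
  ring

theorem posPart_le_exp {x a : ℝ} : max (x - a) 0 ≤ Real.exp x * Real.exp (-a) := by
  rw [← Real.exp_add]
  exact max_le (by linarith [Real.add_one_le_exp (x + -a)]) (Real.exp_pos _).le

theorem abs_kerE_le_all : ∃ C, 0 ≤ C ∧ ∀ x, |kerE x| ≤ C * |x| ^ (3 / 4 : ℝ) := by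
  obtain ⟨C, hC, h⟩ := abs_kerE_le
  refine ⟨C, hC, fun x => ?_⟩
  rcases le_total 0 x with hx | hx
  · rw [abs_of_nonneg hx]; exact h x hx
  · have : kerE x = 0 := by
      rw [kerE]
      refine (intervalIntegral.integral_congr (g := fun _ => 0) fun t ht => ?_).trans (by simp)
      rw [Set.uIcc_of_ge hx] at ht
      have := abs_kerZ_le t
      rw [Real.sqrt_eq_zero_of_nonpos ht.2, mul_zero] at this
      exact abs_nonpos_iff.1 this
    rw [this, abs_zero]
    positivity

theorem rpow_le_exp {x s : ℝ} (hx : 0 ≤ x) (hs : 0 ≤ s) (hs1 : s ≤ 1) : x ^ s ≤ Real.exp x := by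
  rcases le_total 1 x with h1 | h1
  · have := Real.rpow_le_rpow_of_exponent_le h1 hs1
    rw [Real.rpow_one] at this
    linarith [Real.add_one_le_exp x]
  · exact (Real.rpow_le_one hx h1 hs).trans (Real.one_le_exp hx)

namespace IsGaussChar

variable {q : ℕ} {χ : ℤ → ℝ}

theorem scaleConst_pos (h : IsGaussChar q χ) : 0 < scaleConst q := by
  have hq : (0 : ℝ) < q := Nat.cast_pos.2 h.pos
  have hπ := Real.pi_pos
  unfold scaleConst
  positivity

theorem summable_abs_divSum_mul_exp (h : IsGaussChar q χ) {t : ℝ} (ht : 0 < t) :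
    Summable fun n : ℕ+ => |divSum χ n| * Real.exp (-(n * t)) := by
  have h1 := summable_divSum_mul h.bound (g := fun n => Real.exp (-(n * t))) (C := 2 / t ^ 2)
    one_lt_two fun n => by
      rw [abs_of_pos (Real.exp_pos _)]
      exact exp_neg_mul_le ht (Nat.cast_pos.2 n.pos)
  refine h1.abs.congr fun n => ?_
  rw [abs_mul, Real.abs_exp]

/-- The growth `E(X) = O(X^{3/4})` against `n⁻²` leaves `n^{-5/4}`, which is summable even with the
weight `d(n)`. This absolute convergence is the reason for working with the Riesz mean first. -/
theorem abs_kerSeries_term_le (h : IsGaussChar q χ) : ∃ C, 0 ≤ C ∧ ∀ (n : ℕ+) (x : ℝ),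
    |divSum χ n * (kerE (scaleConst q * n * x) / n ^ 2)| ≤
      C * |x| ^ (3 / 4 : ℝ) * (divSum (fun _ => 1) n * (n : ℝ) ^ (-(5 / 4) : ℝ)) := by
  obtain ⟨C, hC, hE⟩ := abs_kerE_le_all
  have hl := h.scaleConst_pos
  refine ⟨C * scaleConst q ^ (3 / 4 : ℝ), by positivity, fun n x => ?_⟩
  have hn : (0 : ℝ) < n := Nat.cast_pos.2 n.pos
  rw [abs_mul, abs_div, abs_of_pos (by positivity : (0 : ℝ) < n ^ 2)]
  calc _ ≤ divSum (fun _ => 1) n * (C * |scaleConst q * n * x| ^ (3 / 4 : ℝ) / n ^ 2) := by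
        gcongr
        · exact divSum_one_nonneg _
        · exact abs_divSum_le h.bound n
        · exact hE _
    _ = _ := by
      rw [abs_mul, abs_of_pos (by positivity : 0 < scaleConst q * n),
        Real.mul_rpow (by positivity) (abs_nonneg _), Real.mul_rpow hl.le hn.le,
        show (-(5 / 4) : ℝ) = 3 / 4 - 2 by norm_num, Real.rpow_sub hn, Real.rpow_two]
      ring

theorem summable_kerSeries (h : IsGaussChar q χ) (x : ℝ) :
    Summable fun n : ℕ+ => divSum χ n * (kerE (scaleConst q * n * x) / n ^ 2) := by
  obtain ⟨C, hC, hE⟩ := h.abs_kerSeries_term_le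
  exact Summable.of_norm_bounded ((summable_divSum_one_mul_rpow (by norm_num)).mul_left _)
    fun n => hE n x

theorem abs_kerSeries_le (h : IsGaussChar q χ) :
    ∃ C, 0 ≤ C ∧ ∀ x, |kerSeries q χ x| ≤ C * |x| ^ (3 / 4 : ℝ) := by
  obtain ⟨C, hC, hE⟩ := h.abs_kerSeries_term_le
  have hS := summable_divSum_one_mul_rpow (s := 5 / 4) (by norm_num)
  refine ⟨C * ∑' n : ℕ+, divSum (fun _ => 1) n * (n : ℝ) ^ (-(5 / 4) : ℝ), ?_, fun x => ?_⟩
  · exact mul_nonneg hC (tsum_nonneg fun n => mul_nonneg (divSum_one_nonneg _) (by positivity))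
  · rw [mul_right_comm, ← Real.norm_eq_abs, ← tsum_mul_left]
    exact tsum_of_norm_bounded (hS.mul_left _).hasSum fun n => hE n x

theorem continuous_kerSeries (h : IsGaussChar q χ) : Continuous (kerSeries q χ) := by
  obtain ⟨C, hC, hE⟩ := h.abs_kerSeries_term_le
  have hS := summable_divSum_one_mul_rpow (s := 5 / 4) (by norm_num)
  have hc := continuous_kerE
  rw [continuous_iff_continuousAt]
  intro w₀
  refine ContinuousOn.continuousAt (s := Set.Icc (-(|w₀| + 1)) (|w₀| + 1)) ?_
    (Icc_mem_nhds (by linarith [neg_abs_le w₀]) (by linarith [le_abs_self w₀]))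
  refine continuousOn_tsum (fun m => by fun_prop)
    (hS.mul_left (C * (|w₀| + 1) ^ (3 / 4 : ℝ))) fun m w hw => (hE m w).trans ?_
  have := divSum_one_nonneg m
  gcongr
  exact abs_le.2 ⟨hw.1, hw.2⟩

theorem abs_rieszSum_term_le (x : ℝ) (n : ℕ+) :
    |divSum χ n * max (x - n) 0| ≤ Real.exp x * (|divSum χ n| * Real.exp (-(n * 1))) := by
  rw [abs_mul, abs_of_nonneg (le_max_right (x - n) 0), mul_one, mul_left_comm]
  gcongr
  exact posPart_le_exp

theorem continuous_rieszSum (h : IsGaussChar q χ) : Continuous (rieszSum χ) := by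
  have hS := h.summable_abs_divSum_mul_exp one_pos
  rw [continuous_iff_continuousAt]
  intro w₀
  refine ContinuousOn.continuousAt (s := Set.Iic (w₀ + 1)) ?_ (Iic_mem_nhds (by linarith))
  refine continuousOn_tsum (fun m => by fun_prop) (hS.mul_left (Real.exp (w₀ + 1)))
    fun m w hw => (abs_rieszSum_term_le w m).trans ?_
  gcongr
  exact hw

theorem abs_rieszSum_le (h : IsGaussChar q χ) (x : ℝ) :
    |rieszSum χ x| ≤ (∑' n : ℕ+, |divSum χ n| * Real.exp (-(n * 1))) * Real.exp x := by
  rw [mul_comm, ← Real.norm_eq_abs, ← tsum_mul_left]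
  exact tsum_of_norm_bounded ((h.summable_abs_divSum_mul_exp one_pos).mul_left _).hasSum
    fun n => abs_rieszSum_term_le x n

theorem laplace_rieszSum (h : IsGaussChar q χ) {p : ℝ} (hp : 0 < p) :
    ∫ x in Set.Ioi (0 : ℝ), Real.exp (-(p * x)) * rieszSum χ x =
      1 / p ^ 2 * ∑' n : ℕ+, divSum χ n * Real.exp (-(n * p)) := by
  have hi := fun n : ℕ+ => laplace_posPart hp (Nat.cast_nonneg (n : ℕ))
  have h1 := MeasureTheory.hasSum_integral_of_summable_integral_norm
    (μ := MeasureTheory.volume.restrict (Set.Ioi 0))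
    (F := fun (n : ℕ+) x => divSum χ n * (Real.exp (-(p * x)) * max (x - n) 0))
    (fun n => (hi n).1.const_mul _) ?_
  · rw [← tsum_mul_left]
    have h2 := h1.tsum_eq
    simp_rw [MeasureTheory.integral_const_mul, (hi _).2] at h2
    rw [← tsum_congr fun n => ?_, h2]
    · refine MeasureTheory.integral_congr_ae (Eventually.of_forall fun x => ?_)
      simp only
      rw [rieszSum, ← tsum_mul_left]
      exact tsum_congr fun n => mul_left_comm _ _ _
    · ring
  · refine ((h.summable_abs_divSum_mul_exp hp).mul_left (1 / p ^ 2)).congr fun n => ?_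
    simp_rw [norm_mul]
    rw [MeasureTheory.integral_const_mul, Real.norm_eq_abs]
    have : ∀ x : ℝ, ‖Real.exp (-(p * x))‖ * ‖max (x - n) 0‖ =
        Real.exp (-(p * x)) * max (x - n) 0 := fun x => by
      rw [Real.norm_of_nonneg (Real.exp_pos _).le, Real.norm_of_nonneg (le_max_right _ _)]
    simp_rw [this, (hi n).2]
    ring

theorem integrableOn_laplace_rpow {p s : ℝ} (hp : 0 < p) (hs : 0 ≤ s) :
    MeasureTheory.IntegrableOn (fun x => Real.exp (-(p * x)) * x ^ s) (Set.Ioi 0) := by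
  have := integrableOn_rpow_mul_exp_neg_mul_rpow (by linarith : -1 < s) one_pos hp
  refine this.congr_fun (fun x _ => ?_) measurableSet_Ioi
  simp only
  rw [Real.rpow_one, mul_comm, neg_mul]

theorem laplace_kerE {p c : ℝ} (hp : 0 < p) (hc : 0 < c) :
    ∫ x in Set.Ioi (0 : ℝ), Real.exp (-(p * x)) * kerE (c * x) =
      -(2 / Real.pi) * c ^ 2 / p ^ 3 * auxQ (c / p) := by
  have h1 := MeasureTheory.integral_comp_mul_left_Ioi
    (fun s => Real.exp (-s) * kerE (c / p * s)) 0 hp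
  rw [mul_zero, smul_eq_mul] at h1
  have h2 := lapInt_kerE (u := c / p) (by positivity)
  rw [lapInt] at h2
  rw [h2] at h1
  have e : ∀ x, c / p * (p * x) = c * x := fun x => by field_simp
  simp_rw [e] at h1
  rw [h1]
  field_simp

theorem laplace_kerSeries (h : IsGaussChar q χ) {p : ℝ} (hp : 0 < p) :
    ∫ x in Set.Ioi (0 : ℝ), Real.exp (-(p * x)) * kerSeries q χ x =
      -(2 / Real.pi) * scaleConst q ^ 2 / p ^ 3 *
        ∑' n : ℕ+, divSum χ n * auxQ (scaleConst q * n / p) := by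
  obtain ⟨C, hC, hE⟩ := h.abs_kerSeries_term_le
  have hc := continuous_kerE
  have hl := h.scaleConst_pos
  have hM := integrableOn_laplace_rpow hp (s := 3 / 4) (by norm_num)
  have hb : ∀ (n : ℕ+), ∀ x ∈ Set.Ioi (0 : ℝ), ‖divSum χ n * (Real.exp (-(p * x)) *
      (kerE (scaleConst q * n * x) / n ^ 2))‖ ≤ C * (divSum (fun _ => 1) n *
        (n : ℝ) ^ (-(5 / 4) : ℝ)) * (Real.exp (-(p * x)) * x ^ (3 / 4 : ℝ)) := fun n x hx => by
    have hx : 0 < x := hx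
    rw [mul_left_comm, norm_mul, Real.norm_of_nonneg (Real.exp_pos _).le, Real.norm_eq_abs]
    have := hE n x
    rw [abs_of_pos hx] at this
    calc _ ≤ _ := mul_le_mul_of_nonneg_left this (Real.exp_pos _).le
      _ = _ := by ring
  have hi : ∀ n : ℕ+, MeasureTheory.IntegrableOn (fun x => divSum χ n * (Real.exp (-(p * x)) *
      (kerE (scaleConst q * n * x) / n ^ 2))) (Set.Ioi 0) := fun n => by
    exact (hM.const_mul _).mono' (Continuous.aestronglyMeasurable (by fun_prop))
      (MeasureTheory.ae_restrict_of_forall_mem measurableSet_Ioi (hb n))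
  have h1 := MeasureTheory.hasSum_integral_of_summable_integral_norm hi ?_
  · rw [← tsum_mul_left]
    have h2 := h1.tsum_eq
    rw [← tsum_congr fun n => ?_, h2]
    · refine MeasureTheory.integral_congr_ae (Eventually.of_forall fun x => ?_)
      simp only
      rw [kerSeries, ← tsum_mul_left]
      exact tsum_congr fun n => mul_left_comm _ _ _
    · have hn : (0 : ℝ) < n := Nat.cast_pos.2 n.pos
      rw [MeasureTheory.integral_const_mul]
      simp_rw [← mul_div_assoc]
      rw [MeasureTheory.integral_div, laplace_kerE hp (by positivity)]
      field_simp
  · refine Summable.of_nonneg_of_le (fun n => MeasureTheory.integral_nonneg fun x => norm_nonneg _)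
      (fun n => ?_) (((summable_divSum_one_mul_rpow (s := 5 / 4) (by norm_num)).mul_left C).mul_right
        (∫ x in Set.Ioi (0 : ℝ), Real.exp (-(p * x)) * x ^ (3 / 4 : ℝ)))
    rw [← MeasureTheory.integral_const_mul]
    exact MeasureTheory.setIntegral_mono_on (hi n).norm (hM.const_mul _) measurableSet_Ioi (hb n)

theorem laplace_sq {p : ℝ} (hp : 0 < p) :
    ∫ x in Set.Ioi (0 : ℝ), Real.exp (-(p * x)) * x ^ (2 : ℝ) = 2 / p ^ 3 := by
  have h := Real.integral_rpow_mul_exp_neg_mul_Ioi (a := 3) three_pos hp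
  have e : ∀ x : ℝ, x ^ (3 - 1 : ℝ) * Real.exp (-(p * x)) = Real.exp (-(p * x)) * x ^ (2 : ℝ) :=
    fun x => by rw [mul_comm]; norm_num
  simp_rw [e] at h
  rw [h, show (3 : ℝ) = ((2 : ℕ) : ℝ) + 1 by norm_num, Real.Gamma_nat_eq_factorial]
  rw [show ((2 : ℕ) : ℝ) + 1 = ((3 : ℕ) : ℝ) by norm_num, Real.rpow_natCast]
  norm_num [Nat.factorial]
  field_simp

/-- Both sides are continuous and `O(e^x)`, and their Laplace transforms agree: the relation is
`tsum_divSum_mul_exp` divided by `p²`. So the uniqueness theorem applies. -/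
theorem rieszSum_eq (h : IsGaussChar q χ) {x : ℝ} (hx : 0 < x) :
    rieszSum χ x = cosInt (fracSeries q χ) 0 / 2 * x ^ 2 -
      (√(scaleConst q))⁻¹ / scaleConst q * kerSeries q χ x := by
  have hl := h.scaleConst_pos
  have hπ := Real.pi_pos
  have hq : (0 : ℝ) < q := Nat.cast_pos.2 h.pos
  obtain ⟨C, hC, hE⟩ := h.abs_kerSeries_le
  set A := ∑' n : ℕ+, |divSum χ n| * Real.exp (-(n * 1))
  have hA : ∀ x, |rieszSum χ x| ≤ A * Real.exp x := h.abs_rieszSum_le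
  set c := cosInt (fracSeries q χ) 0
  set d := (√(scaleConst q))⁻¹ / scaleConst q with hd
  have hcr := h.continuous_rieszSum
  have hck := h.continuous_kerSeries
  have key := eq_zero_of_laplace_eq_zero
    (h := fun x => rieszSum χ x - (c / 2 * x ^ 2 - d * kerSeries q χ x)) (by fun_prop)
    (C := A + (|c| + |d| * C)) (fun x hx => ?_) (fun n => ?_) hx
  · linarith
  · rw [add_mul]
    refine (abs_sub _ _).trans (add_le_add (hA x) ((abs_sub _ _).trans ?_))
    rw [abs_mul, abs_mul, abs_div, add_mul, mul_assoc |d|]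
    refine add_le_add ?_ (mul_le_mul_of_nonneg_left ((hE x).trans ?_) (abs_nonneg _))
    · rw [abs_of_nonneg (sq_nonneg x), abs_two, div_mul_eq_mul_div, mul_div_assoc]
      have := Real.quadratic_le_exp_of_nonneg hx
      exact mul_le_mul_of_nonneg_left (by linarith) (abs_nonneg _)
    · rw [abs_of_nonneg hx]
      exact mul_le_mul_of_nonneg_left (rpow_le_exp hx (by norm_num) (by norm_num)) hC
  · set p : ℝ := n + 3
    have hp : 0 < p := by positivity
    have i1 : MeasureTheory.IntegrableOn (fun x => Real.exp (-(p * x)) * rieszSum χ x)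
        (Set.Ioi 0) := by
      have hp1 : 0 < p - 1 := by simp only [p]; linarith [(n.cast_nonneg : (0 : ℝ) ≤ n)]
      refine ((integrableOn_laplace_rpow hp1 le_rfl).const_mul A).mono'
        (Continuous.aestronglyMeasurable (by fun_prop)) (Eventually.of_forall fun x => ?_)
      rw [norm_mul, Real.norm_of_nonneg (Real.exp_pos _).le, Real.norm_eq_abs, Real.rpow_zero,
        mul_one]
      refine (mul_le_mul_of_nonneg_left (hA x) (Real.exp_pos _).le).trans_eq ?_
      rw [mul_left_comm, ← Real.exp_add]
      ring_nf
    have i2 : MeasureTheory.IntegrableOn (fun x => Real.exp (-(p * x)) * x ^ (2 : ℝ))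
        (Set.Ioi 0) := integrableOn_laplace_rpow hp zero_le_two
    have i3 : MeasureTheory.IntegrableOn (fun x => Real.exp (-(p * x)) * kerSeries q χ x)
        (Set.Ioi 0) := by
      refine ((integrableOn_laplace_rpow hp (s := 3 / 4) (by norm_num)).const_mul C).mono'
        (Continuous.aestronglyMeasurable (by fun_prop))
        (MeasureTheory.ae_restrict_of_forall_mem measurableSet_Ioi fun x hx => ?_)
      have hx : 0 < x := hx
      rw [norm_mul, Real.norm_of_nonneg (Real.exp_pos _).le, Real.norm_eq_abs, mul_left_comm]
      have := hE x
      rw [abs_of_pos hx] at this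
      exact mul_le_mul_of_nonneg_left this (Real.exp_pos _).le
    have e : ∀ x : ℝ, Real.exp (-(p * x)) *
        (rieszSum χ x - (c / 2 * x ^ 2 - d * kerSeries q χ x)) =
        Real.exp (-(p * x)) * rieszSum χ x - (c / 2 * (Real.exp (-(p * x)) * x ^ (2 : ℝ)) -
        d * (Real.exp (-(p * x)) * kerSeries q χ x)) := fun x => by
      rw [Real.rpow_two]; ring
    have i4 : MeasureTheory.IntegrableOn (fun x => c / 2 * (Real.exp (-(p * x)) * x ^ (2 : ℝ)) -
        d * (Real.exp (-(p * x)) * kerSeries q χ x)) (Set.Ioi 0) :=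
      (i2.const_mul _).sub (i3.const_mul _)
    simp_rw [e]
    rw [MeasureTheory.integral_sub i1 i4,
      MeasureTheory.integral_sub (i2.const_mul _) (i3.const_mul _),
      MeasureTheory.integral_const_mul, MeasureTheory.integral_const_mul, h.laplace_rieszSum hp,
      laplace_sq hp, h.laplace_kerSeries hp, h.tsum_divSum_mul_exp hp]
    have es : (√(scaleConst q))⁻¹ = √q / (2 * Real.pi) := by
      rw [scaleConst, show 4 * Real.pi ^ 2 / q = (2 * Real.pi) ^ 2 / q by ring,
        Real.sqrt_div (by positivity), Real.sqrt_sq (by positivity), inv_div]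
    have e5 : (√(q : ℝ)) ^ 2 = q := Real.sq_sqrt hq.le
    have hsq : 0 < √(q : ℝ) := Real.sqrt_pos.2 hq
    rw [hd, es]
    -- Matching of constants: `√q · scaleConst q = 4π²/√q`.
    have e6 : ∀ T : ℝ, 4 / (p * √q) * T = √q / (2 * Real.pi) * (2 / Real.pi) * scaleConst q / p * T :=
      fun T => by
        rw [scaleConst]
        nth_rewrite 3 [← e5]
        field_simp
    have e7 : ∑' n : ℕ+, divSum χ n * auxQ (4 * Real.pi ^ 2 / q * n / p) =
        ∑' n : ℕ+, divSum χ n * auxQ (scaleConst q * n / p) := rfl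
    rw [e7, e6]
    field_simp
    ring

end IsGaussChar

/-! ### Oscillating integrals -/

theorem abs_integral_le_rpow {f : ℝ → ℝ} {C s M N : ℝ} (hs : 1 < s) (hM : 0 < M) (hMN : M ≤ N)
    (hC : 0 ≤ C) (hf : ∀ y ∈ Set.Icc M N, |f y| ≤ C * y ^ (-s)) :
    |∫ y in M..N, f y| ≤ C / (s - 1) * M ^ (1 - s) := by
  have h0 : (0 : ℝ) ∉ Set.uIcc M N := by
    rw [Set.uIcc_of_le hMN]; exact fun h => absurd h.1 (not_le.2 hM)
  have hi : IntervalIntegrable (fun y : ℝ => C * y ^ (-s)) MeasureTheory.volume M N :=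
    (intervalIntegral.intervalIntegrable_rpow (Or.inr h0)).const_mul C
  have h1 := intervalIntegral.norm_integral_le_of_norm_le hMN (f := f)
    (Eventually.of_forall fun y hy => hf y ⟨hy.1.le, hy.2⟩) hi
  rw [Real.norm_eq_abs] at h1
  refine h1.trans ?_
  rw [intervalIntegral.integral_const_mul, integral_rpow (Or.inr ⟨by linarith, h0⟩), div_mul_eq_mul_div,
    mul_div_assoc]
  refine mul_le_mul_of_nonneg_left ?_ hC
  have hN : 0 ≤ N ^ (1 - s) := Real.rpow_nonneg (hM.le.trans hMN) _
  rw [show -s + 1 = -(s - 1) by ring, div_neg, ← neg_div, show -(s - 1) = 1 - s by ring]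
  have : 0 < s - 1 := by linarith
  gcongr
  linarith

/-- `∫_M^N sin(k√y + ψ)/y dy`. -/
noncomputable def oscInt (k ψ M N : ℝ) : ℝ := ∫ y in M..N, Real.sin (k * √y + ψ) / y

theorem oscInt_neg (k M N : ℝ) : oscInt (-k) 0 M N = -oscInt k 0 M N := by
  rw [oscInt, oscInt, ← intervalIntegral.integral_neg]
  refine intervalIntegral.integral_congr fun y _ => ?_
  rw [add_zero, add_zero, neg_mul, Real.sin_neg, neg_div]

theorem oscInt_zero (M N : ℝ) : oscInt 0 0 M N = 0 := by simp [oscInt]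

theorem continuousOn_osc (k ψ : ℝ) :
    ContinuousOn (fun y => Real.sin (k * √y + ψ) / y) (Set.Ioi 0) :=
  ContinuousOn.div (by fun_prop) (by fun_prop) fun y hy => ne_of_gt hy

theorem uIcc_subset_Ioi {M N : ℝ} (hM : 0 < M) (hN : 0 < N) : Set.uIcc M N ⊆ Set.Ioi 0 :=
  fun _ hy => (lt_min hM hN).trans_le hy.1

theorem oscInt_add {k ψ L M N : ℝ} (hL : 0 < L) (hM : 0 < M) (hN : 0 < N) :
    oscInt k ψ L M + oscInt k ψ M N = oscInt k ψ L N :=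
  intervalIntegral.integral_add_adjacent_intervals
    ((continuousOn_osc k ψ).mono (uIcc_subset_Ioi hL hM)).intervalIntegrable
    ((continuousOn_osc k ψ).mono (uIcc_subset_Ioi hM hN)).intervalIntegrable

/-- Integration by parts with the primitive `-(2/k) y^{-1/2} cos(k√y + ψ)`. The two boundary terms
and the remaining integral contribute `2` each to the constant `6`. The factor `1/|k|` makes the
estimate uniform for frequencies bounded away from `0`. -/
theorem abs_oscInt_le {k ψ M N : ℝ} (hk : k ≠ 0) (hM : 0 < M) (hMN : M ≤ N) :
    |oscInt k ψ M N| ≤ 6 / |k| * M ^ (-(1 / 2) : ℝ) := by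
  have hN := hM.trans_le hMN
  have hsub := uIcc_subset_Ioi hM hN
  have hd : ∀ y ∈ Set.uIcc M N, HasDerivAt (fun y => -(2 / k) * (y ^ (-(1 / 2) : ℝ) *
      Real.cos (k * √y + ψ))) (Real.sin (k * √y + ψ) / y +
      1 / k * (y ^ (-(3 / 2) : ℝ) * Real.cos (k * √y + ψ))) y := fun y hy => by
    have hy : 0 < y := hsub hy
    have h1 := ((Real.hasDerivAt_rpow_const (p := (-(1 / 2) : ℝ)) (Or.inl hy.ne')).fun_mul
      (((Real.hasDerivAt_sqrt hy.ne').const_mul k).add_const ψ).cos).const_mul (-(2 / k))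
    refine h1.congr_deriv ?_
    rw [show (-(1 / 2) - 1 : ℝ) = -(3 / 2) by norm_num,
      show y ^ (-(1 / 2) : ℝ) = 1 / √y by rw [Real.rpow_neg hy.le, Real.sqrt_eq_rpow, one_div (y ^ _)]]
    have hs : 0 < √y := Real.sqrt_pos.2 hy
    rw [show Real.sin (k * √y + ψ) / y = Real.sin (k * √y + ψ) / (√y * √y) by
      rw [Real.mul_self_sqrt hy.le]]
    field_simp
    ring
  have i1 := ((continuousOn_osc k ψ).mono hsub).intervalIntegrable
    (μ := MeasureTheory.volume)
  have i2 : IntervalIntegrable (fun y => 1 / k * (y ^ (-(3 / 2) : ℝ) * Real.cos (k * √y + ψ)))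
      MeasureTheory.volume M N := by
    refine ContinuousOn.intervalIntegrable ?_
    refine continuousOn_const.mul (ContinuousOn.mul ?_ (by fun_prop))
    exact fun y hy => (Real.continuousAt_rpow_const _ _ (Or.inl (ne_of_gt (hsub hy)))).continuousWithinAt
  have h1 := intervalIntegral.integral_eq_sub_of_hasDerivAt hd (i1.add i2)
  rw [intervalIntegral.integral_add i1 i2, intervalIntegral.integral_const_mul] at h1
  have h2 : |∫ y in M..N, y ^ (-(3 / 2) : ℝ) * Real.cos (k * √y + ψ)| ≤
      1 / (3 / 2 - 1) * M ^ (1 - 3 / 2 : ℝ) :=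
    abs_integral_le_rpow (by norm_num) hM hMN zero_le_one fun y hy => by
      rw [abs_mul, abs_of_nonneg (Real.rpow_nonneg (hM.le.trans hy.1) _), one_mul]
      exact mul_le_of_le_one_right (Real.rpow_nonneg (hM.le.trans hy.1) _) (Real.abs_cos_le_one _)
  rw [show (1 - 3 / 2 : ℝ) = -(1 / 2) by norm_num] at h2
  have h3 : N ^ (-(1 / 2) : ℝ) ≤ M ^ (-(1 / 2) : ℝ) :=
    Real.rpow_le_rpow_of_nonpos hM hMN (by norm_num)
  have hc : ∀ y, 0 < y → |y ^ (-(1 / 2) : ℝ) * Real.cos (k * √y + ψ)| ≤ y ^ (-(1 / 2) : ℝ) :=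
    fun y hy => by
      rw [abs_mul, abs_of_nonneg (Real.rpow_nonneg hy.le _)]
      exact mul_le_of_le_one_right (Real.rpow_nonneg hy.le _) (Real.abs_cos_le_one _)
  have h4 := hc N hN
  have h5 := hc M hM
  set X := N ^ (-(1 / 2) : ℝ) * Real.cos (k * √N + ψ)
  set Y := M ^ (-(1 / 2) : ℝ) * Real.cos (k * √M + ψ)
  set Z := ∫ y in M..N, y ^ (-(3 / 2) : ℝ) * Real.cos (k * √y + ψ)
  set B := M ^ (-(1 / 2) : ℝ)
  have h6 : oscInt k ψ M N = 1 / k * (2 * Y - 2 * X - Z) := by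
    rw [oscInt]
    linear_combination h1
  rw [h6, abs_mul, abs_div, abs_one, div_mul_eq_mul_div, div_mul_eq_mul_div, one_mul]
  gcongr
  rw [abs_le] at h2 h4 h5 ⊢
  constructor <;> linarith [h2.1, h2.2, h4.1, h4.2, h5.1, h5.2]

/-! ### The function `X ↦ Z(X)/X` and its first two derivatives -/

/-- `Z(X)/X`. -/
noncomputable def kerF (X : ℝ) : ℝ := kerZ X / X

/-- The derivative of `kerF`. -/
noncomputable def kerF1 (X : ℝ) : ℝ := (kerY0 X - kerK0 X) / X - kerZ X / X ^ 2

/-- The second derivative of `kerF`. -/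
noncomputable def kerF2 (X : ℝ) : ℝ :=
  (kerK1 X - kerY1 X) / X ^ 2 - 2 * (kerY0 X - kerK0 X) / X ^ 2 + 2 * kerZ X / X ^ 3

theorem hasDerivAt_kerF {X : ℝ} (hX : 0 < X) : HasDerivAt kerF (kerF1 X) X := by
  refine ((hasDerivAt_kerZ hX).fun_div (hasDerivAt_id X) hX.ne').congr_deriv ?_
  rw [kerF1, id]
  field_simp

theorem hasDerivAt_kerF1 {X : ℝ} (hX : 0 < X) : HasDerivAt kerF1 (kerF2 X) X := by
  have h1 := (((hasDerivAt_kerY0 hX).fun_sub (hasDerivAt_kerK0 hX)).fun_div (hasDerivAt_id X)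
    hX.ne').fun_sub ((hasDerivAt_kerZ hX).fun_div ((hasDerivAt_id X).fun_pow 2) (by
      simp only [id]; positivity))
  refine h1.congr_deriv ?_
  simp only [id, kerF2]
  field_simp
  ring

theorem continuousOn_kerF2 : ContinuousOn kerF2 (Set.Ioi 0) := by
  have h0 := continuousOn_kerY0
  have h1 := continuousOn_kerY1
  have h2 : ContinuousOn kerK0 (Set.Ioi 0) := fun x hx =>
    (hasDerivAt_kerK0 hx).continuousAt.continuousWithinAt
  have h3 := continuousOn_kerK1
  have h4 := continuous_kerZ.continuousOn (s := Set.Ioi 0)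
  have hp : ∀ n : ℕ, ∀ x ∈ Set.Ioi (0 : ℝ), x ^ n ≠ 0 := fun n x hx => pow_ne_zero _ (ne_of_gt hx)
  exact (((h3.sub h1).div (by fun_prop) (hp 2)).sub
    (((h0.sub h2).const_smul (2 : ℝ)).div (by fun_prop) (hp 2))).add
    ((h4.const_smul (2 : ℝ)).div (by fun_prop) (hp 3))

/-- In `F''` only `-Y₁/X²` is of order `X^{-7/4}`. Every other term is smaller by at least
`X^{-1/2}` and ends up in an absolutely integrable error. -/
theorem kerF_bounds : ∃ C, 0 ≤ C ∧ ∀ X, 1 ≤ X → |kerF X| ≤ C * X ^ (-(3 / 4) : ℝ) ∧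
    |kerF1 X| ≤ C * X ^ (-(5 / 4) : ℝ) ∧
    |kerF2 X + kerY1 X / X ^ 2| ≤ C * X ^ (-(9 / 4) : ℝ) := by
  obtain ⟨C, hC, h⟩ := ker_bounds
  have hZ : ∀ X, 1 ≤ X → |kerZ X| ≤ (C + 1) * X ^ (1 / 4 : ℝ) := fun X hX => by
    have hX0 : 0 < X := by linarith
    have h1 := kerK1_le hX0
    have h2 : 1 / √X ≤ X ^ (1 / 4 : ℝ) := by
      rw [Real.sqrt_eq_rpow, one_div (X ^ _), ← Real.rpow_neg hX0.le]
      exact rpow_le_rpow_of_one_le hX (by norm_num)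
    rw [kerZ]
    refine (abs_add_le _ _).trans ?_
    rw [abs_of_nonneg (kerK1_nonneg X), add_mul, one_mul]
    exact add_le_add (h X hX).2 (h1.trans h2)
  have hY : ∀ X, 1 ≤ X → |kerY0 X - kerK0 X| ≤ (C + 1) * X ^ (-(1 / 4) : ℝ) := fun X hX => by
    have hX0 : 0 < X := by linarith
    have h1 := kerK0_le' hX0
    have h2 : 1 / X ≤ X ^ (-(1 / 4) : ℝ) := by
      rw [one_div, ← Real.rpow_neg_one]
      exact rpow_le_rpow_of_one_le hX (by norm_num)
    refine (abs_sub _ _).trans ?_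
    rw [abs_of_nonneg (kerK0_nonneg X), add_mul, one_mul]
    exact add_le_add (h X hX).1 (h1.trans h2)
  have hdiv : ∀ X A B e : ℝ, ∀ n : ℕ, 1 ≤ X → |A| ≤ B * X ^ e →
      |A / X ^ n| ≤ B * X ^ (e - n) := fun X A B e n hX hA => by
    have hX0 : 0 < X := by linarith
    rw [abs_div, abs_of_pos (pow_pos hX0 n), Real.rpow_sub hX0, Real.rpow_natCast, ← mul_div_assoc]
    gcongr
  refine ⟨5 * (C + 1), by positivity, fun X hX => ⟨?_, ?_, ?_⟩⟩
  · have h1 := hdiv X _ _ _ 1 hX (hZ X hX)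
    rw [pow_one, Nat.cast_one, show (1 / 4 - 1 : ℝ) = -(3 / 4) by norm_num] at h1
    rw [kerF]
    have : 0 ≤ (C + 1) * X ^ (-(3 / 4) : ℝ) := by positivity
    linarith
  · have h1 := hdiv X _ _ _ 1 hX (hY X hX)
    have h2 := hdiv X _ _ _ 2 hX (hZ X hX)
    rw [pow_one, Nat.cast_one, show (-(1 / 4) - 1 : ℝ) = -(5 / 4) by norm_num] at h1
    rw [Nat.cast_two, show (1 / 4 - 2 : ℝ) = -(7 / 4) by norm_num] at h2
    have h3 : X ^ (-(7 / 4) : ℝ) ≤ X ^ (-(5 / 4) : ℝ) := rpow_le_rpow_of_one_le hX (by norm_num)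
    rw [kerF1]
    refine (abs_sub _ _).trans ?_
    have h4 := mul_le_mul_of_nonneg_left h3 (by positivity : 0 ≤ C + 1)
    have : 0 ≤ (C + 1) * X ^ (-(5 / 4) : ℝ) := by positivity
    linarith
  · have hX0 : 0 < X := by linarith
    have h0 : |kerK1 X / X ^ 2| ≤ 1 * X ^ (-(1 / 2) - (2 : ℕ) : ℝ) := hdiv X _ _ _ 2 hX (by
      rw [abs_of_nonneg (kerK1_nonneg X), one_mul, Real.rpow_neg hX0.le, ← Real.sqrt_eq_rpow,
        ← one_div]
      exact kerK1_le hX0)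
    have h1 := hdiv X _ _ _ 2 hX (hY X hX)
    have h2 := hdiv X _ _ _ 3 hX (hZ X hX)
    rw [Nat.cast_two, show (-(1 / 2) - 2 : ℝ) = -(5 / 2) by norm_num] at h0
    rw [Nat.cast_two, show (-(1 / 4) - 2 : ℝ) = -(9 / 4) by norm_num] at h1
    rw [Nat.cast_ofNat, show (1 / 4 - 3 : ℝ) = -(11 / 4) by norm_num] at h2
    have h3 : X ^ (-(11 / 4) : ℝ) ≤ X ^ (-(9 / 4) : ℝ) := rpow_le_rpow_of_one_le hX (by norm_num)
    have h3' : X ^ (-(5 / 2) : ℝ) ≤ X ^ (-(9 / 4) : ℝ) := rpow_le_rpow_of_one_le hX (by norm_num)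
    have h4 := mul_le_mul_of_nonneg_left h3 (by positivity : 0 ≤ C + 1)
    have h5 : 0 ≤ C * X ^ (-(9 / 4) : ℝ) := by positivity
    have e : kerF2 X + kerY1 X / X ^ 2 = kerK1 X / X ^ 2 - 2 * ((kerY0 X - kerK0 X) / X ^ 2) +
        2 * (kerZ X / X ^ 3) := by rw [kerF2]; ring
    rw [e]
    rw [abs_le] at h0 h1 h2 ⊢
    constructor <;> linarith [h0.1, h0.2, h1.1, h1.2, h2.1, h2.2]

/-- The product of `E(ay)` and `c³ F''(cy)`, integrated: main term and error. -/
theorem integral_kerE_mul_kerF2 : ∃ ρ : ℝ, ∃ C, 0 ≤ C ∧ ∀ a c M N, 0 < a → 0 < c → 0 < M →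
    M ≤ N → 1 ≤ a * M → 1 ≤ c * M →
    |(∫ y in M..N, kerE (a * y) * (c ^ 3 * kerF2 (c * y))) +
      ρ * (a ^ (3 / 4 : ℝ) * c ^ (5 / 4 : ℝ)) * oscInt (2 * √a - 2 * √c) 0 M N| ≤
      C * (a ^ (3 / 4 : ℝ) * c ^ (3 / 4 : ℝ) + a ^ (1 / 4 : ℝ) * c ^ (5 / 4 : ℝ)) *
        M ^ (-(1 / 2) : ℝ) := by
  obtain ⟨ρ, φ, C₀, hC₀, h0⟩ := ker_asymptotics
  obtain ⟨C₁, hC₁, h1⟩ := kerE_asymptotics hC₀ h0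
  obtain ⟨C₂, hC₂, h2⟩ := abs_kerE_le
  obtain ⟨C₃, hC₃, h3⟩ := kerF_bounds
  -- Leading oscillation of `F''`, with the same amplitude and phase as in the asymptotics of `E`.
  have hF2 : ∀ X, 1 ≤ X → |kerF2 X + X ^ (-(7 / 4) : ℝ) * (ρ * Real.sin (2 * √X - φ))| ≤
      (C₃ + C₀) * X ^ (-(9 / 4) : ℝ) := fun X hX => by
    have hX0 : 0 < X := by linarith
    have e1 : X ^ (-(7 / 4) : ℝ) = X ^ (1 / 4 : ℝ) / X ^ 2 := by
      rw [← Real.rpow_two, ← Real.rpow_sub hX0]; norm_num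
    have e2 : X ^ (-(9 / 4) : ℝ) = X ^ (-(1 / 4) : ℝ) / X ^ 2 := by
      rw [← Real.rpow_two, ← Real.rpow_sub hX0]; norm_num
    have h4 : |(kerY1 X - X ^ (1 / 4 : ℝ) * (ρ * Real.sin (2 * √X - φ))) / X ^ 2| ≤
        C₀ * X ^ (-(9 / 4) : ℝ) := by
      rw [abs_div, abs_of_pos (by positivity : 0 < X ^ 2), e2, ← mul_div_assoc]
      gcongr
      exact (h0 X hX).2
    have h5 := (h3 X hX).2.2
    have e3 : kerF2 X + X ^ (-(7 / 4) : ℝ) * (ρ * Real.sin (2 * √X - φ)) =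
        (kerF2 X + kerY1 X / X ^ 2) -
        (kerY1 X - X ^ (1 / 4 : ℝ) * (ρ * Real.sin (2 * √X - φ))) / X ^ 2 := by
      rw [e1]; ring
    rw [e3, add_mul]
    exact (abs_sub _ _).trans (add_le_add h5 h4)
  set C₄ := C₃ + C₀
  have hC₄ : 0 ≤ C₄ := add_nonneg hC₃ hC₀
  -- The factor `1/2` comes from the product formula for cosine and sine, which splits the main term
  -- into a sum frequency and a difference frequency. The summand `3ρ²` of the constant pays for the
  -- sum frequency.
  refine ⟨ρ ^ 2 / 2, 2 * (C₂ * C₄ + C₁ * |ρ|) + 3 * ρ ^ 2, by positivity,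
    fun a c M N ha hc hM hMN haM hcM => ?_⟩
  have hN := hM.trans_le hMN
  have hsub := uIcc_subset_Ioi hM hN
  set A := a ^ (3 / 4 : ℝ) * c ^ (5 / 4 : ℝ) with hA
  set B := a ^ (3 / 4 : ℝ) * c ^ (3 / 4 : ℝ)
  set D := a ^ (1 / 4 : ℝ) * c ^ (5 / 4 : ℝ)
  have hA0 : 0 ≤ A := by positivity
  have hB0 : 0 ≤ B := by positivity
  have hD0 : 0 ≤ D := by positivity
  -- Pointwise comparison with the product of the leading terms. The phase doubles in the sum
  -- frequency and cancels in the difference frequency. The latter is therefore a pure sine, odd in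
  -- its frequency, and the integers rely on this later.
  have hpt : ∀ y ∈ Set.Icc M N, |kerE (a * y) * (c ^ 3 * kerF2 (c * y)) +
      ρ ^ 2 / 2 * A * (Real.sin ((2 * √a - 2 * √c) * √y + 0) / y) -
      ρ ^ 2 / 2 * A * (Real.sin ((2 * √a + 2 * √c) * √y + -2 * φ) / y)| ≤
      (C₂ * C₄ * B + C₁ * |ρ| * D) * y ^ (-(3 / 2) : ℝ) := fun y hy => by
    have hy0 : 0 < y := hM.trans_le hy.1
    have hay : 1 ≤ a * y := haM.trans (by gcongr; exact hy.1)
    have hcy : 1 ≤ c * y := hcM.trans (by gcongr; exact hy.1)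
    have hs : |Real.sin (2 * √(c * y) - φ)| ≤ 1 := Real.abs_sin_le_one _
    have t1 := h1 _ hay
    have t2 := h2 (a * y) (by positivity)
    have t3 := hF2 _ hcy
    have p : ∀ b e : ℝ, 0 < b → (b * y) ^ e = b ^ e * y ^ e := fun b e hb =>
      Real.mul_rpow hb.le hy0.le
    have e1 : kerE (a * y) * (c ^ 3 * kerF2 (c * y)) +
        ρ ^ 2 / 2 * A * (Real.sin ((2 * √a - 2 * √c) * √y + 0) / y) -
        ρ ^ 2 / 2 * A * (Real.sin ((2 * √a + 2 * √c) * √y + -2 * φ) / y) =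
        kerE (a * y) * (c ^ 3 * (kerF2 (c * y) + (c * y) ^ (-(7 / 4) : ℝ) *
          (ρ * Real.sin (2 * √(c * y) - φ)))) -
        (kerE (a * y) + (a * y) ^ (3 / 4 : ℝ) * (ρ * Real.cos (2 * √(a * y) - φ))) *
          (c ^ 3 * (c * y) ^ (-(7 / 4) : ℝ) * (ρ * Real.sin (2 * √(c * y) - φ))) := by
      have q1 : (a * y) ^ (3 / 4 : ℝ) * (c ^ 3 * (c * y) ^ (-(7 / 4) : ℝ)) = A / y := by
        rw [p a _ ha, p c _ hc, ← Real.rpow_natCast c 3, hA]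
        have : c ^ (5 / 4 : ℝ) = c ^ ((3 : ℕ) : ℝ) * c ^ (-(7 / 4) : ℝ) := by
          rw [← Real.rpow_add hc]; norm_num
        rw [this]
        have : y⁻¹ = y ^ (3 / 4 : ℝ) * y ^ (-(7 / 4) : ℝ) := by
          rw [← Real.rpow_add hy0, ← Real.rpow_neg_one]; norm_num
        rw [div_eq_mul_inv _ y, this]
        ring
      have q2 : Real.cos (2 * √(a * y) - φ) * Real.sin (2 * √(c * y) - φ) =
          (Real.sin ((2 * √a + 2 * √c) * √y + -2 * φ) -
            Real.sin ((2 * √a - 2 * √c) * √y + 0)) / 2 := by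
        have u1 : (2 * √a + 2 * √c) * √y + -2 * φ = (2 * √(a * y) - φ) + (2 * √(c * y) - φ) := by
          rw [Real.sqrt_mul ha.le, Real.sqrt_mul hc.le]; ring
        have u2 : (2 * √a - 2 * √c) * √y + 0 = (2 * √(a * y) - φ) - (2 * √(c * y) - φ) := by
          rw [Real.sqrt_mul ha.le, Real.sqrt_mul hc.le]; ring
        rw [u1, u2]
        generalize 2 * √(a * y) - φ = α
        generalize 2 * √(c * y) - φ = β
        rw [Real.sin_add, Real.sin_sub]
        ring
      linear_combination (Real.sin ((2 * √a + 2 * √c) * √y + -2 * φ) -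
        Real.sin ((2 * √a - 2 * √c) * √y + 0)) * ρ ^ 2 / 2 * q1 +
        (a * y) ^ (3 / 4 : ℝ) * (c ^ 3 * (c * y) ^ (-(7 / 4) : ℝ)) * ρ ^ 2 * q2
    rw [e1, add_mul (C₂ * C₄ * B)]
    refine (abs_sub _ _).trans (add_le_add ?_ ?_)
    · rw [abs_mul, abs_mul, abs_of_pos (by positivity : 0 < c ^ 3)]
      calc _ ≤ C₂ * (a * y) ^ (3 / 4 : ℝ) * (c ^ 3 * (C₄ * (c * y) ^ (-(9 / 4) : ℝ))) := by
            gcongr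
        _ = C₂ * C₄ * (a ^ (3 / 4 : ℝ) * (c ^ ((3 : ℕ) : ℝ) * c ^ (-(9 / 4) : ℝ))) *
            (y ^ (3 / 4 : ℝ) * y ^ (-(9 / 4) : ℝ)) := by
            rw [p a _ ha, p c _ hc, ← Real.rpow_natCast c 3]; ring
        _ = _ := by rw [← Real.rpow_add hc, ← Real.rpow_add hy0]; norm_num [B]
    · rw [abs_mul, abs_mul, abs_mul ρ,
        abs_of_pos (by positivity : 0 < c ^ 3 * (c * y) ^ (-(7 / 4) : ℝ))]
      calc _ ≤ C₁ * (a * y) ^ (1 / 4 : ℝ) * (c ^ 3 * (c * y) ^ (-(7 / 4) : ℝ) * (|ρ| * 1)) := by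
            gcongr
        _ = C₁ * |ρ| * (a ^ (1 / 4 : ℝ) * (c ^ ((3 : ℕ) : ℝ) * c ^ (-(7 / 4) : ℝ))) *
            (y ^ (1 / 4 : ℝ) * y ^ (-(7 / 4) : ℝ)) := by
            rw [p a _ ha, p c _ hc, ← Real.rpow_natCast c 3]; ring
        _ = _ := by rw [← Real.rpow_add hc, ← Real.rpow_add hy0]; norm_num [D]
  have hE := continuous_kerE
  have i1 : IntervalIntegrable (fun y => kerE (a * y) * (c ^ 3 * kerF2 (c * y)))
      MeasureTheory.volume M N := by
    refine ContinuousOn.intervalIntegrable (ContinuousOn.mul (by fun_prop)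
      (continuousOn_const.mul (continuousOn_kerF2.comp (by fun_prop) fun y hy => ?_)))
    exact mul_pos hc (hsub hy)
  have i2 : ∀ k ψ, IntervalIntegrable (fun y => ρ ^ 2 / 2 * A * (Real.sin (k * √y + ψ) / y))
      MeasureTheory.volume M N := fun k ψ =>
    (((continuousOn_osc k ψ).mono hsub).intervalIntegrable).const_mul _
  have hint := abs_integral_le_rpow (s := 3 / 2) (by norm_num) hM hMN (by positivity) hpt
  rw [intervalIntegral.integral_sub (i1.add (i2 _ _)) (i2 _ _),
    intervalIntegral.integral_add i1 (i2 _ _), intervalIntegral.integral_const_mul,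
    intervalIntegral.integral_const_mul] at hint
  rw [show (1 - 3 / 2 : ℝ) = -(1 / 2) by norm_num] at hint
  change |_ + ρ ^ 2 / 2 * A * oscInt _ 0 M N - ρ ^ 2 / 2 * A * oscInt _ (-2 * φ) M N| ≤ _ at hint
  have hsc : 0 < √c := Real.sqrt_pos.2 hc
  have hk : 2 * √c ≤ 2 * √a + 2 * √c := by linarith [Real.sqrt_nonneg a]
  have hk0 : 0 < 2 * √a + 2 * √c := by linarith
  have hosc := abs_oscInt_le (ψ := -2 * φ) hk0.ne' hM hMN
  rw [abs_of_pos hk0] at hosc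
  -- The sum frequency is at least `2√c`, and `A/√c = B`.
  have hosc2 : |ρ ^ 2 / 2 * A * oscInt (2 * √a + 2 * √c) (-2 * φ) M N| ≤
      3 * ρ ^ 2 * B * M ^ (-(1 / 2) : ℝ) := by
    rw [abs_mul, abs_of_nonneg (by positivity : 0 ≤ ρ ^ 2 / 2 * A)]
    calc _ ≤ ρ ^ 2 / 2 * A * (6 / (2 * √c) * M ^ (-(1 / 2) : ℝ)) := by
          refine mul_le_mul_of_nonneg_left (hosc.trans ?_) (by positivity)
          gcongr
      _ = 3 / 2 * ρ ^ 2 * (A / √c) * M ^ (-(1 / 2) : ℝ) := by field_simp; ring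
      _ = 3 / 2 * ρ ^ 2 * B * M ^ (-(1 / 2) : ℝ) := by
          rw [hA, mul_div_assoc, Real.sqrt_eq_rpow, ← Real.rpow_sub hc]; norm_num [B]
      _ ≤ _ := by gcongr; norm_num
  set J := ∫ y in M..N, kerE (a * y) * (c ^ 3 * kerF2 (c * y))
  set O := oscInt (2 * √a + 2 * √c) (-2 * φ) M N
  set P := M ^ (-(1 / 2) : ℝ)
  have hP : 0 ≤ P := Real.rpow_nonneg hM.le _
  have hfin : |J + ρ ^ 2 / 2 * A * oscInt (2 * √a - 2 * √c) 0 M N| ≤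
      (C₂ * C₄ * B + C₁ * |ρ| * D) / (3 / 2 - 1) * P + 3 * ρ ^ 2 * B * P := by
    rw [abs_le] at hint hosc2 ⊢
    constructor <;> linarith [hint.1, hint.2, hosc2.1, hosc2.2]
  refine hfin.trans ?_
  have e : (2 * (C₂ * C₄ + C₁ * |ρ|) + 3 * ρ ^ 2) * (B + D) * P -
      ((C₂ * C₄ * B + C₁ * |ρ| * D) / (3 / 2 - 1) * P + 3 * ρ ^ 2 * B * P) =
      (2 * (C₂ * C₄) * D + 2 * (C₁ * |ρ|) * B + 3 * ρ ^ 2 * D) * P := by ring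
  have : 0 ≤ (2 * (C₂ * C₄) * D + 2 * (C₁ * |ρ|) * B + 3 * ρ ^ 2 * D) * P := by positivity
  linarith

/-! ### Summation by parts against the Riesz sum -/

/-- The summatory function `∑_{n ≤ N} v(n)` of the divisor sums of `χ`. -/
noncomputable def divSumTo (χ : ℤ → ℝ) (N : ℕ) : ℝ := ∑ n ∈ Finset.Icc 1 N, divSum χ n

theorem divSumTo_succ (χ : ℤ → ℝ) (N : ℕ) :
    divSumTo χ (N + 1) = divSumTo χ N + divSum χ (N + 1) := by
  rw [divSumTo, Finset.sum_Icc_succ_top (by lia), divSumTo]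

theorem sum_Icc_one_eq_sum_range (f : ℕ → ℝ) (N : ℕ) :
    ∑ n ∈ Finset.Icc 1 N, f n = ∑ n ∈ Finset.range N, f (n + 1) := by
  rw [Finset.range_eq_Ico, Finset.sum_Ico_add' f 0 N 1]
  rfl

theorem rieszSum_eq_tsum_nat (χ : ℤ → ℝ) (y : ℝ) :
    rieszSum χ y = ∑' n : ℕ, divSum χ (n + 1) * max (y - (n + 1 : ℕ)) 0 :=
  tsum_pnat_eq_tsum_succ (f := fun n : ℕ => divSum χ n * max (y - n) 0)

theorem rieszSum_term_eq_zero {χ : ℤ → ℝ} {N n : ℕ} {y : ℝ} (hy : y ≤ N + 1) (hn : n ∉ Finset.range N) :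
    divSum χ (n + 1) * max (y - (n + 1 : ℕ)) 0 = 0 := by
  have : (N : ℝ) ≤ n := Nat.cast_le.2 (by simpa using hn)
  rw [max_eq_right, mul_zero]
  push_cast
  linarith

theorem rieszSum_of_mem_Icc {χ : ℤ → ℝ} {N : ℕ} {y : ℝ} (h1 : N ≤ y) (h2 : y ≤ N + 1) :
    rieszSum χ y = ∑ n ∈ Finset.Icc 1 N, divSum χ n * (y - n) := by
  rw [rieszSum_eq_tsum_nat, tsum_eq_sum fun n hn => rieszSum_term_eq_zero h2 hn,
    sum_Icc_one_eq_sum_range]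
  refine Finset.sum_congr rfl fun n hn => ?_
  have : ((n + 1 : ℕ) : ℝ) ≤ N := Nat.cast_le.2 (Finset.mem_range.1 hn)
  rw [max_eq_left (by linarith)]

/-- With non-negative weights the Riesz sum is convex and piecewise linear, so it lies above the
continuation of each of its linear pieces. -/
theorem sum_mul_sub_le_rieszSum {χ : ℤ → ℝ} (hv : ∀ n, 0 ≤ divSum χ n) (N : ℕ) (y : ℝ) :
    ∑ n ∈ Finset.Icc 1 N, divSum χ n * (y - n) ≤ rieszSum χ y := by
  obtain ⟨M, hM⟩ := exists_nat_ge y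
  have hs : Summable fun n : ℕ => divSum χ (n + 1) * max (y - (n + 1 : ℕ)) 0 :=
    summable_of_ne_finset_zero (s := Finset.range M) fun n hn =>
      rieszSum_term_eq_zero (by linarith) hn
  rw [rieszSum_eq_tsum_nat, sum_Icc_one_eq_sum_range]
  refine le_trans (Finset.sum_le_sum fun n _ => ?_)
    (hs.sum_le_tsum (Finset.range N) fun n _ => mul_nonneg (hv _) (le_max_right _ _))
  exact mul_le_mul_of_nonneg_left (le_max_left _ _) (hv _)

theorem sum_mul_sub_add (χ : ℤ → ℝ) (N : ℕ) (y t : ℝ) :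
    ∑ n ∈ Finset.Icc 1 N, divSum χ n * (y + t - n) =
      ∑ n ∈ Finset.Icc 1 N, divSum χ n * (y - n) + divSumTo χ N * t := by
  rw [divSumTo, Finset.sum_mul, ← Finset.sum_add_distrib]
  exact Finset.sum_congr rfl fun n _ => by ring

namespace IsGaussChar

variable {q : ℕ} {χ : ℤ → ℝ}

/-- The error term of the Riesz sum. -/
noncomputable def rieszErr (q : ℕ) (χ : ℤ → ℝ) (y : ℝ) : ℝ :=
  -((√(scaleConst q))⁻¹ / scaleConst q * kerSeries q χ y)

/-- The residue `∫₀^∞ Φ` attached to `χ`. -/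
noncomputable def residue (q : ℕ) (χ : ℤ → ℝ) : ℝ := cosInt (fracSeries q χ) 0

theorem rieszErr_eq (h : IsGaussChar q χ) {y : ℝ} (hy : 0 < y) :
    rieszErr q χ y = rieszSum χ y - residue q χ / 2 * y ^ 2 := by
  rw [h.rieszSum_eq hy, rieszErr, residue]
  ring

theorem abs_rieszErr_le (h : IsGaussChar q χ) :
    ∃ C, 0 ≤ C ∧ ∀ y, 0 ≤ y → |rieszErr q χ y| ≤ C * y ^ (3 / 4 : ℝ) := by
  obtain ⟨C, hC, hk⟩ := h.abs_kerSeries_le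
  refine ⟨|(√(scaleConst q))⁻¹ / scaleConst q| * C, by positivity, fun y hy => ?_⟩
  have := hk y
  rw [abs_of_nonneg hy] at this
  rw [rieszErr, abs_neg, abs_mul, mul_assoc]
  gcongr

/-- By convexity the slope `divSumTo χ N` lies between difference quotients of the Riesz sum to the
left and to the right of `N`. With steps `±√N/2` the main term contributes `O(√N)`, and so does the
Riesz error even if bounded only by `O(N)`. -/
theorem abs_divSumTo_sub_le (h : IsGaussChar q χ) (hv : ∀ n, 0 ≤ divSum χ n) :
    ∃ C, 0 ≤ C ∧ ∀ N : ℕ, 1 ≤ N →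
      |divSumTo χ N - residue q χ * N| ≤ C * (N : ℝ) ^ (1 / 2 : ℝ) := by
  obtain ⟨C, hC, hE⟩ := h.abs_rieszErr_le
  refine ⟨|residue q χ| + 8 * C, by positivity, fun N hN => ?_⟩
  have hN1 : (1 : ℝ) ≤ N := Nat.one_le_cast.2 hN
  have hN0 : (0 : ℝ) < N := by linarith
  set t : ℝ := (N : ℝ) ^ (1 / 2 : ℝ) with ht
  have ht1 : 1 ≤ t := Real.one_le_rpow hN1 (by norm_num)
  have htt : t * t = N := by rw [ht, ← Real.rpow_add hN0]; norm_num
  have htN : t ≤ N := by nlinarith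
  have h34 : (N : ℝ) ^ (3 / 4 : ℝ) ≤ N := by
    have := rpow_le_rpow_of_one_le hN1 (show (3 / 4 : ℝ) ≤ 1 by norm_num)
    rwa [Real.rpow_one] at this
  have hR : ∀ s, -t ≤ s → s ≤ t → 0 < N + s → |rieszErr q χ (N + s)| ≤ C * 2 * N := fun s h1 h2 h3 => by
    refine (hE _ h3.le).trans ?_
    rw [mul_assoc]
    gcongr
    calc (N + s) ^ (3 / 4 : ℝ) ≤ (2 * N) ^ (3 / 4 : ℝ) := by gcongr; linarith
      _ = 2 ^ (3 / 4 : ℝ) * (N : ℝ) ^ (3 / 4 : ℝ) := Real.mul_rpow (by norm_num) hN0.le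
      _ ≤ 2 ^ (1 : ℝ) * N := by gcongr <;> norm_num
      _ = _ := by rw [Real.rpow_one]
  have key : ∀ s, |s| = t / 2 → (divSumTo χ N - residue q χ * N) * s ≤
      (|residue q χ| + 8 * C) * t * (t / 2) := fun s hs => by
    have hs1 := neg_abs_le s
    have hs2 := le_abs_self s
    rw [hs] at hs1 hs2
    have hpos : 0 < N + s := by linarith
    have h1 := sum_mul_sub_le_rieszSum hv N (N + s)
    rw [sum_mul_sub_add, ← rieszSum_of_mem_Icc le_rfl (by linarith)] at h1
    have h2 := h.rieszErr_eq hN0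
    have h3 := h.rieszErr_eq hpos
    have h4 := abs_le.1 (hR 0 (by linarith) (by linarith) (by linarith))
    have h5 := abs_le.1 (hR s (by linarith) (by linarith) hpos)
    rw [add_zero] at h4
    have h6 : residue q χ / 2 * s ^ 2 ≤ |residue q χ| / 2 * (t / 2) ^ 2 := by
      rw [← hs, sq_abs]
      gcongr
      exact le_abs_self _
    have h7 : 0 ≤ |residue q χ| * t ^ 2 := by positivity
    have h8 : C * 2 * N = C * 2 * t ^ 2 := by rw [← htt]; ring
    rw [h8] at h4 h5
    nlinarith [h4.1, h4.2, h5.1, h5.2]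
  have k1 := key (t / 2) (abs_of_pos (by linarith))
  have k2 := key (-(t / 2)) (by rw [abs_neg, abs_of_pos (by linarith)])
  have ht2 : 0 < t / 2 := by linarith
  rw [mul_neg, ← neg_mul] at k2
  exact abs_le.2 ⟨by linarith [le_of_mul_le_mul_right k2 ht2], le_of_mul_le_mul_right k1 ht2⟩

theorem hasDerivAt_rieszSum_of_mem_Ioo {N : ℕ} {y : ℝ} (hy : y ∈ Set.Ioo (N : ℝ) (N + 1)) :
    HasDerivAt (rieszSum χ) (divSumTo χ N) y := by
  have h1 : HasDerivAt (fun y : ℝ => ∑ n ∈ Finset.Icc 1 N, divSum χ n * (y - n))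
      (divSumTo χ N) y := by
    have := HasDerivAt.fun_sum (u := Finset.Icc 1 N) fun n _ =>
      ((hasDerivAt_id y).sub_const (n : ℝ)).const_mul (divSum χ n)
    simpa [divSumTo] using this
  refine h1.congr_of_eventuallyEq ?_
  filter_upwards [Ioo_mem_nhds hy.1 hy.2] with z hz
  exact rieszSum_of_mem_Icc hz.1.le hz.2.le

/-- Twofold summation by parts of `∑ v(n) f(n)`. -/
theorem sum_divSum_mul (h : IsGaussChar q χ) {f f1 f2 : ℝ → ℝ}
    (hf : ∀ y, 0 < y → HasDerivAt f (f1 y) y) (hf1 : ∀ y, 0 < y → HasDerivAt f1 (f2 y) y)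
    (hf2 : ContinuousOn f2 (Set.Ioi 0)) {M N : ℕ} (hM : 1 ≤ M) (hMN : M ≤ N) :
    ∑ n ∈ Finset.Ioc M N, divSum χ n * f n =
      ((divSumTo χ N - residue q χ * N) * f N - rieszErr q χ N * f1 N) -
      ((divSumTo χ M - residue q χ * M) * f M - rieszErr q χ M * f1 M) +
      ∫ y in (M : ℝ)..N, (rieszErr q χ y * f2 y + residue q χ * f y) := by
  have hcE : Continuous (rieszErr q χ) := (continuous_const.mul h.continuous_kerSeries).neg
  have hcf : ContinuousOn f (Set.Ioi 0) := fun y hy => (hf y hy).continuousAt.continuousWithinAt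
  have hi : ∀ a b : ℕ, 1 ≤ a → 1 ≤ b → IntervalIntegrable
      (fun y => rieszErr q χ y * f2 y + residue q χ * f y) MeasureTheory.volume a b :=
    fun a b ha hb => by
      have hs := uIcc_subset_Ioi (Nat.cast_pos.2 ha : (0 : ℝ) < a) (Nat.cast_pos.2 hb : (0 : ℝ) < b)
      exact ((hcE.continuousOn.mul (hf2.mono hs)).add
        (continuousOn_const.mul (hcf.mono hs))).intervalIntegrable
  induction N, hMN using Nat.le_induction with
  | base => simp
  | succ N hMN ih =>
    have hN1 : 1 ≤ N := hM.trans hMN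
    have hN0 : (0 : ℝ) < N := Nat.cast_pos.2 hN1
    rw [Finset.sum_Ioc_succ_top hMN, ih, ← intervalIntegral.integral_add_adjacent_intervals
      (hi M N hM hN1) (hi N (N + 1) hN1 (by lia)), divSumTo_succ]
    have hcf1 : ContinuousOn f1 (Set.Ioi 0) := fun y hy =>
      (hf1 y hy).continuousAt.continuousWithinAt
    have hsub : Set.Icc (N : ℝ) ((N + 1 : ℕ) : ℝ) ⊆ Set.Ioi 0 := fun y hy => hN0.trans_le hy.1
    have hle : (N : ℝ) ≤ ((N + 1 : ℕ) : ℝ) := by push_cast; linarith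
    -- Between consecutive integers the summatory function is constant and is the derivative of the
    -- Riesz sum, so the integrand has an explicit primitive. Replacing `divSumTo χ N` by `divSumTo
    -- χ (N + 1)` at the right end accounts for the new term of the sum.
    have hF := intervalIntegral.integral_eq_sub_of_hasDerivAt_of_le hle
      (f := fun y => rieszErr q χ y * f1 y - (divSumTo χ N - residue q χ * y) * f y)
      (f' := fun y => rieszErr q χ y * f2 y + residue q χ * f y)
      ((hcE.continuousOn.mul (hcf1.mono hsub)).sub
        (ContinuousOn.mul (by fun_prop) (hcf.mono hsub)))
      (fun y hy => by
        have hy0 : 0 < y := hN0.trans hy.1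
        have hE : HasDerivAt (rieszErr q χ) (divSumTo χ N - residue q χ * y) y := by
          have h1 := (hasDerivAt_rieszSum_of_mem_Ioo (χ := χ) (N := N) (y := y)
            ⟨hy.1, by have := hy.2; push_cast at this; exact this⟩).fun_sub
            (((hasDerivAt_id y).fun_pow 2).const_mul (residue q χ / 2))
          refine (h1.congr_of_eventuallyEq ?_).congr_deriv ?_
          · filter_upwards [Ioi_mem_nhds hy0] with z hz
            exact h.rieszErr_eq hz
          · simp only [id]; push_cast; ring
        have h2 := (hE.fun_mul (hf1 y hy0)).fun_sub
          ((((hasDerivAt_id y).const_mul (residue q χ)).const_sub (divSumTo χ N)).fun_mul (hf y hy0))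
        refine h2.congr_deriv ?_
        simp only [id]
        ring)
      (hi N (N + 1) hN1 (by lia))
    rw [hF]
    push_cast
    ring

end IsGaussChar

/-- The integrand is `Z(cy)/y`, and `Z(cy)` has primitive `E(cy)/c`. One integration by parts leaves
two boundary terms and an integral of `E(cy)/(cy²)`, with shares `1 + 1 + 4` in the constant `6`. -/
theorem abs_integral_kerF_le : ∃ C, 0 ≤ C ∧ ∀ c M N, 0 < c → 0 < M → M ≤ N →
    |∫ y in M..N, c * kerF (c * y)| ≤ C * c ^ (-(1 / 4) : ℝ) * M ^ (-(1 / 4) : ℝ) := by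
  obtain ⟨C, hC, hE⟩ := abs_kerE_le
  refine ⟨6 * C, by positivity, fun c M N hc hM hMN => ?_⟩
  have hN := hM.trans_le hMN
  have hsub := uIcc_subset_Ioi hM hN
  have hb : ∀ y, 0 < y → |kerE (c * y) / (c * y)| ≤ C * c ^ (-(1 / 4) : ℝ) * y ^ (-(1 / 4) : ℝ) :=
    fun y hy => by
      have hcy : 0 < c * y := by positivity
      rw [abs_div, abs_of_pos hcy, mul_assoc, ← Real.mul_rpow hc.le hy.le,
        show (-(1 / 4) : ℝ) = 3 / 4 - 1 by norm_num, Real.rpow_sub_one hcy.ne', ← mul_div_assoc]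
      gcongr
      exact hE _ hcy.le
  have hd : ∀ y ∈ Set.uIcc M N, HasDerivAt (fun y => kerE (c * y) / (c * y))
      (c * kerF (c * y) - kerE (c * y) / (c * y) / y) y := fun y hy => by
    have hy : 0 < y := hsub hy
    have h1 := (hasDerivAt_id y).const_mul c
    refine (((hasDerivAt_kerE (c * y)).comp y h1).fun_div h1 (by simp only [id]; positivity)).congr_deriv
      ?_
    simp only [id, kerF, Function.comp]
    field_simp
  have hcE := continuous_kerE
  have hcZ := continuous_kerZ
  have i1 : IntervalIntegrable (fun y => c * kerF (c * y)) MeasureTheory.volume M N := by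
    refine ContinuousOn.intervalIntegrable (ContinuousOn.mul (by fun_prop)
      (ContinuousOn.div (by fun_prop) (by fun_prop) fun y hy => (mul_pos hc (hsub hy)).ne'))
  have i2 : IntervalIntegrable (fun y => kerE (c * y) / (c * y) / y) MeasureTheory.volume M N := by
    refine ContinuousOn.intervalIntegrable (ContinuousOn.div (ContinuousOn.div (by fun_prop)
      (by fun_prop) fun y hy => (mul_pos hc (hsub hy)).ne') (by fun_prop) fun y hy => ne_of_gt (hsub hy))
  have h1 := intervalIntegral.integral_eq_sub_of_hasDerivAt hd (i1.sub i2)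
  rw [intervalIntegral.integral_sub i1 i2] at h1
  have h2 := abs_integral_le_rpow (f := fun y => kerE (c * y) / (c * y) / y)
    (C := C * c ^ (-(1 / 4) : ℝ)) (s := 5 / 4) (by norm_num) hM hMN (by positivity) fun y hy => by
      have hy0 : 0 < y := hM.trans_le hy.1
      rw [abs_div, abs_of_pos hy0, show (-(5 / 4) : ℝ) = -(1 / 4) - 1 by norm_num,
        Real.rpow_sub_one hy0.ne', ← mul_div_assoc]
      gcongr
      exact hb y hy0
  rw [show (1 - 5 / 4 : ℝ) = -(1 / 4) by norm_num] at h2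
  have h3 := hb N hN
  have h4 := hb M hM
  have h5 : N ^ (-(1 / 4) : ℝ) ≤ M ^ (-(1 / 4) : ℝ) :=
    Real.rpow_le_rpow_of_nonpos hM hMN (by norm_num)
  have h6 := mul_le_mul_of_nonneg_left h5 (by positivity : 0 ≤ C * c ^ (-(1 / 4) : ℝ))
  have h7 : C * c ^ (-(1 / 4) : ℝ) / (5 / 4 - 1) * M ^ (-(1 / 4) : ℝ) =
      4 * (C * c ^ (-(1 / 4) : ℝ) * M ^ (-(1 / 4) : ℝ)) := by ring
  rw [h7] at h2
  rw [mul_assoc 6, mul_assoc 6]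
  rw [abs_le] at h2 h3 h4 ⊢
  constructor <;> linarith [h2.1, h2.2, h3.1, h3.2, h4.1, h4.2]

/-- The partial sums `∑_{n ≤ N} v(n) Z(cn)/n`. -/
noncomputable def kerPartial (χ : ℤ → ℝ) (c : ℝ) (N : ℕ) : ℝ :=
  ∑ n ∈ Finset.Icc 1 N, divSum χ n * (c * kerF (c * n))

theorem kerPartial_sub {χ : ℤ → ℝ} {c : ℝ} {M N : ℕ} (h : M ≤ N) :
    kerPartial χ c N - kerPartial χ c M = ∑ n ∈ Finset.Ioc M N, divSum χ n * (c * kerF (c * n)) := by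
  have := Finset.sum_Ioc_consecutive (fun n : ℕ => divSum χ n * (c * kerF (c * n))) M.zero_le h
  have e : ∀ K : ℕ, Finset.Icc 1 K = Finset.Ioc 0 K := fun K => by
    ext; simp only [Finset.mem_Icc, Finset.mem_Ioc]; lia
  rw [kerPartial, kerPartial, e, e, ← this]
  exact add_sub_cancel_left _ _

namespace IsGaussChar

variable {q : ℕ} {χ : ℤ → ℝ}

theorem hasSum_integral_kerSeries_mul (h : IsGaussChar q χ) {g : ℝ → ℝ} {M N : ℝ} (hM : 0 < M)
    (hMN : M ≤ N) (hg : ContinuousOn g (Set.Ioi 0)) :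
    HasSum (fun m : ℕ+ => divSum χ m * (1 / (m : ℝ) ^ 2 *
      ∫ y in M..N, kerE (scaleConst q * m * y) * g y))
      (∫ y in M..N, kerSeries q χ y * g y) := by
  obtain ⟨C, hC, hE⟩ := h.abs_kerSeries_term_le
  have hsub := uIcc_subset_Ioi hM (hM.trans_le hMN)
  have hcE := continuous_kerE
  have hS := summable_divSum_one_mul_rpow (s := 5 / 4) (by norm_num)
  have key := intervalIntegral.hasSum_integral_of_dominated_convergence
    (μ := MeasureTheory.volume) (a := M) (b := N)
    (F := fun (m : ℕ+) y => divSum χ m * (kerE (scaleConst q * m * y) / m ^ 2) * g y)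
    (f := fun y => kerSeries q χ y * g y)
    (fun m y => C * |y| ^ (3 / 4 : ℝ) * (divSum (fun _ => 1) m * (m : ℝ) ^ (-(5 / 4) : ℝ)) * |g y|)
    (fun m => ?_) (fun m => Eventually.of_forall fun y _ => ?_)
    (Eventually.of_forall fun y _ => (hS.mul_left _).mul_right _) ?_
    (Eventually.of_forall fun y _ => (h.summable_kerSeries y).hasSum.mul_right _)
  · refine key.congr_fun fun m => ?_
    rw [← intervalIntegral.integral_const_mul, ← intervalIntegral.integral_const_mul]
    refine intervalIntegral.integral_congr fun y _ => ?_
    ring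
  · refine ContinuousOn.aestronglyMeasurable ?_ measurableSet_uIoc
    exact ContinuousOn.mul (by fun_prop) (hg.mono (Set.uIoc_subset_uIcc.trans hsub))
  · rw [norm_mul, Real.norm_eq_abs, Real.norm_eq_abs]
    exact mul_le_mul_of_nonneg_right (hE m y) (abs_nonneg _)
  · simp_rw [tsum_mul_right, tsum_mul_left]
    refine ContinuousOn.intervalIntegrable (ContinuousOn.mul (ContinuousOn.mul (ContinuousOn.mul
      continuousOn_const (ContinuousOn.rpow_const (by fun_prop) fun y _ => Or.inr (by norm_num)))
      continuousOn_const) (hg.mono hsub).abs)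

/-- The integral of the kernel series against `c³ F''(cy)`, uniformly for `c` in an interval on
which only the term with index `x₀` has a small frequency. -/
theorem abs_integral_kerSeries_mul_kerF2_le (h : IsGaussChar q χ) {c₁ c₂ x₀ δ : ℝ} (hc₁ : 0 < c₁)
    (hδ : 0 < δ) (hx₀ : ∀ m : ℕ+, (m : ℝ) ≠ x₀ → ∀ c ∈ Set.Icc c₁ c₂,
      δ ≤ |2 * √(scaleConst q * m) - 2 * √c|) :
    ∃ w C Y : ℝ, 0 ≤ C ∧ 0 < Y ∧ ((∀ m : ℕ+, (m : ℝ) ≠ x₀) → w = 0) ∧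
      ∀ M N : ℝ, Y ≤ M → M ≤ N → ∀ c ∈ Set.Icc c₁ c₂,
      |(∫ y in M..N, kerSeries q χ y * (c ^ 3 * kerF2 (c * y))) +
        w * c ^ (5 / 4 : ℝ) * oscInt (2 * √(scaleConst q * x₀) - 2 * √c) 0 M N| ≤
        C * M ^ (-(1 / 2) : ℝ) := by
  obtain ⟨ρ, C, hC, hJ⟩ := integral_kerE_mul_kerF2
  have hl := h.scaleConst_pos
  set l := scaleConst q
  have hS := summable_divSum_one_mul_rpow (s := 5 / 4) (by norm_num)
  set S := ∑' m : ℕ+, divSum (fun _ => 1) m * (m : ℝ) ^ (-(5 / 4) : ℝ)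
  have hS0 : 0 ≤ S := tsum_nonneg fun m => mul_nonneg (divSum_one_nonneg _) (by positivity)
  -- The first summand bounds the error of `integral_kerE_mul_kerF2` after the powers of `m` are
  -- taken out. The second bounds the main term when its frequency is at least `δ`.
  set B : ℝ := C * (l ^ (3 / 4 : ℝ) * c₂ ^ (3 / 4 : ℝ) + l ^ (1 / 4 : ℝ) * c₂ ^ (5 / 4 : ℝ)) +
    |ρ| * (l ^ (3 / 4 : ℝ) * c₂ ^ (5 / 4 : ℝ)) * (6 / δ) with hB
  -- Selects the resonant index, if `x₀` is an integer at all. As a series it gives the weight `w`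
  -- without a case distinction, and `w = 0` when no index equals `x₀`.
  set u : ℕ+ → ℝ := fun m => if (m : ℝ) = x₀ then divSum χ m * (1 / (m : ℝ) ^ 2 *
    (l * m) ^ (3 / 4 : ℝ)) else 0 with hu
  have hm34 : ∀ m : ℕ+, 1 / (m : ℝ) ^ 2 * (m : ℝ) ^ (3 / 4 : ℝ) = (m : ℝ) ^ (-(5 / 4) : ℝ) :=
    fun m => by
      have hm : (0 : ℝ) < m := Nat.cast_pos.2 m.pos
      rw [show (-(5 / 4) : ℝ) = 3 / 4 - (2 : ℕ) by norm_num, Real.rpow_sub hm, Real.rpow_natCast]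
      ring
  have hus : Summable u := by
    refine Summable.of_norm_bounded (hS.mul_left (l ^ (3 / 4 : ℝ))) fun m => ?_
    have hm : (0 : ℝ) < m := Nat.cast_pos.2 m.pos
    have h0 := divSum_one_nonneg m
    simp only [hu]
    split_ifs
    · rw [Real.mul_rpow hl.le hm.le, mul_left_comm (1 / (m : ℝ) ^ 2), hm34, norm_mul,
        Real.norm_of_nonneg (by positivity : 0 ≤ l ^ (3 / 4 : ℝ) * (m : ℝ) ^ (-(5 / 4) : ℝ)),
        Real.norm_eq_abs]
      calc _ ≤ divSum (fun _ => 1) m * (l ^ (3 / 4 : ℝ) * (m : ℝ) ^ (-(5 / 4) : ℝ)) :=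
            mul_le_mul_of_nonneg_right (abs_divSum_le h.bound _) (by positivity)
        _ = _ := by ring
    · rw [norm_zero]; positivity
  refine ⟨ρ * ∑' m, u m, |B| * S, 1 / l + 1 / c₁, by positivity, by positivity, fun hne => ?_,
    fun M N hM hMN c hc => ?_⟩
  · have : u = 0 := funext fun m => if_neg (hne m)
    rw [this]; simp
  have hc0 : 0 < c := hc₁.trans_le hc.1
  have hM0 : 0 < M := lt_of_lt_of_le (by positivity) hM
  have hlM : 1 ≤ l * M := by
    have : 1 / l ≤ M := le_trans (by linarith [(by positivity : 0 < 1 / c₁)]) hM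
    rwa [div_le_iff₀' hl] at this
  have hcM : 1 ≤ c * M := by
    have : 1 / c₁ ≤ M := le_trans (by linarith [(by positivity : 0 < 1 / l)]) hM
    rw [div_le_iff₀' hc₁] at this
    exact this.trans (by gcongr; exact hc.1)
  set O := oscInt (2 * √(l * x₀) - 2 * √c) 0 M N
  set P := M ^ (-(1 / 2) : ℝ) with hP
  have hP0 : 0 < P := by positivity
  have hg : ContinuousOn (fun y => c ^ 3 * kerF2 (c * y)) (Set.Ioi 0) :=
    continuousOn_const.mul (continuousOn_kerF2.comp (by fun_prop) fun y hy => mul_pos hc0 hy)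
  have h1 := h.hasSum_integral_kerSeries_mul hM0 hMN hg
  have h2 := h1.add (hus.hasSum.mul_right (ρ * c ^ (5 / 4 : ℝ) * O))
  have e1 : ρ * (∑' m, u m) * c ^ (5 / 4 : ℝ) * O = (∑' m, u m) * (ρ * c ^ (5 / 4 : ℝ) * O) := by
    ring
  rw [e1, ← h2.tsum_eq, ← Real.norm_eq_abs, mul_right_comm |B|]
  refine tsum_of_norm_bounded (hS.hasSum.mul_left (|B| * P)) fun m => ?_
  have hm : (0 : ℝ) < m := Nat.cast_pos.2 m.pos
  have hm1 : (1 : ℝ) ≤ m := Nat.one_le_cast.2 m.pos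
  have hlm : 0 < l * m := by positivity
  have h3 := hJ (l * m) c M N hlm hc0 hM0 hMN (hlM.trans (by gcongr; nlinarith)) hcM
  set J := ∫ y in M..N, kerE (l * m * y) * (c ^ 3 * kerF2 (c * y))
  set Om := oscInt (2 * √(l * m) - 2 * √c) 0 M N with hOm
  set V := if (m : ℝ) = x₀ then ρ * ((l * m) ^ (3 / 4 : ℝ) * c ^ (5 / 4 : ℝ)) * Om else 0 with hV
  have e2 : divSum χ m * (1 / (m : ℝ) ^ 2 * J) + u m * (ρ * c ^ (5 / 4 : ℝ) * O) =
      divSum χ m * (1 / (m : ℝ) ^ 2 * (J + V)) := by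
    simp only [hu, hV]
    split_ifs with hmx
    · have : O = Om := by rw [hOm, hmx]
      rw [this]; ring
    · ring
  rw [e2]
  have hml : (m : ℝ) ^ (1 / 4 : ℝ) ≤ (m : ℝ) ^ (3 / 4 : ℝ) :=
    rpow_le_rpow_of_one_le hm1 (by norm_num)
  have h4 : C * ((l * m) ^ (3 / 4 : ℝ) * c ^ (3 / 4 : ℝ) + (l * m) ^ (1 / 4 : ℝ) * c ^ (5 / 4 : ℝ)) *
      P ≤ C * (l ^ (3 / 4 : ℝ) * c₂ ^ (3 / 4 : ℝ) + l ^ (1 / 4 : ℝ) * c₂ ^ (5 / 4 : ℝ)) *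
      (m : ℝ) ^ (3 / 4 : ℝ) * P := by
    rw [Real.mul_rpow hl.le hm.le, Real.mul_rpow hl.le hm.le, mul_assoc C _ ((m : ℝ) ^ (3 / 4 : ℝ))]
    have hc2 := hc.2
    gcongr
    calc _ ≤ l ^ (3 / 4 : ℝ) * (m : ℝ) ^ (3 / 4 : ℝ) * c₂ ^ (3 / 4 : ℝ) +
          l ^ (1 / 4 : ℝ) * (m : ℝ) ^ (3 / 4 : ℝ) * c₂ ^ (5 / 4 : ℝ) := by gcongr
      _ = _ := by ring
  have h5 : |J + V| ≤ |B| * (m : ℝ) ^ (3 / 4 : ℝ) * P := by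
    have hδ0 : 0 ≤ |ρ| * (l ^ (3 / 4 : ℝ) * c₂ ^ (5 / 4 : ℝ)) * (6 / δ) *
        (m : ℝ) ^ (3 / 4 : ℝ) * P := by
      have : 0 ≤ c₂ := hc0.le.trans hc.2
      positivity
    have h6 : |J + V| ≤ B * (m : ℝ) ^ (3 / 4 : ℝ) * P := by
      rw [hB, add_mul, add_mul]
      by_cases hmx : (m : ℝ) = x₀
      · rw [hV, if_pos hmx]
        linarith [h3.trans h4]
      · rw [hV, if_neg hmx, add_zero]
        have hd := hx₀ m hmx c hc
        have hosc := abs_oscInt_le (ψ := 0) (M := M) (N := N)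
          (abs_pos.1 (hδ.trans_le hd)) hM0 hMN
        have h7 : |ρ * ((l * m) ^ (3 / 4 : ℝ) * c ^ (5 / 4 : ℝ)) * Om| ≤
            |ρ| * (l ^ (3 / 4 : ℝ) * c₂ ^ (5 / 4 : ℝ)) * (6 / δ) * (m : ℝ) ^ (3 / 4 : ℝ) * P := by
          rw [abs_mul, abs_mul, abs_of_pos (by positivity :
            0 < (l * m) ^ (3 / 4 : ℝ) * c ^ (5 / 4 : ℝ)), Real.mul_rpow hl.le hm.le]
          have hc2 := hc.2
          calc _ ≤ |ρ| * (l ^ (3 / 4 : ℝ) * (m : ℝ) ^ (3 / 4 : ℝ) * c₂ ^ (5 / 4 : ℝ)) *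
                (6 / δ * P) := by
                refine mul_le_mul (by gcongr) (hosc.trans (by gcongr)) (abs_nonneg _) ?_
                have : 0 ≤ c₂ := hc0.le.trans hc.2
                positivity
            _ = _ := by ring
        have h8 := h3.trans h4
        rw [abs_le] at h7 h8 ⊢
        constructor <;> linarith [h7.1, h7.2, h8.1, h8.2]
    refine h6.trans ?_
    gcongr
    exact le_abs_self _
  rw [norm_mul, norm_mul, Real.norm_eq_abs, Real.norm_eq_abs, Real.norm_eq_abs,
    abs_of_pos (by positivity : 0 < 1 / (m : ℝ) ^ 2)]
  calc _ ≤ divSum (fun _ => 1) m * (1 / (m : ℝ) ^ 2 * (|B| * (m : ℝ) ^ (3 / 4 : ℝ) * P)) := by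
        refine mul_le_mul (abs_divSum_le h.bound m) (by gcongr) (by positivity) (divSum_one_nonneg _)
    _ = _ := by rw [← hm34]; ring

end IsGaussChar

theorem kerPartial_eq {χ : ℤ → ℝ} {c : ℝ} (hc : c ≠ 0) (N : ℕ) :
    kerPartial χ c N = ∑ n ∈ Finset.Icc 1 N, divSum χ n * (kerZ (c * n) / n) := by
  refine Finset.sum_congr rfl fun n hn => ?_
  have : (n : ℝ) ≠ 0 := Nat.cast_ne_zero.2 (by have := (Finset.mem_Icc.1 hn).1; lia)
  rw [kerF]
  field_simp

theorem continuous_oscInt (N : ℕ) : Continuous fun k => oscInt k 0 1 (N + 1 : ℕ) := by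
  have h1 : (1 : ℝ) ≤ (N + 1 : ℕ) := by push_cast; linarith [(N.cast_nonneg : (0 : ℝ) ≤ N)]
  refine intervalIntegral.continuous_of_dominated_interval (bound := fun _ => 1) (fun k => ?_)
    (fun k => Eventually.of_forall fun y hy => ?_) (by simp)
    (Eventually.of_forall fun y _ => by fun_prop)
  · exact (((continuousOn_osc k 0).mono (uIcc_subset_Ioi one_pos (by linarith))).mono
      Set.uIoc_subset_uIcc).aestronglyMeasurable measurableSet_uIoc
  · rw [Set.uIoc_of_le h1] at hy
    have hy0 : 0 < y := one_pos.trans hy.1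
    rw [Real.norm_eq_abs, abs_div, abs_of_pos hy0, div_le_one hy0]
    exact (Real.abs_sin_le_one _).trans hy.1.le

namespace IsGaussChar

variable {q : ℕ} {χ : ℤ → ℝ}

/-- Twofold summation by parts. The boundary terms have orders `n^{1/2} n^{-3/4}` and `n^{3/4}
n^{-5/4}`, the mean value of `v` contributes `abs_integral_kerF_le`, and the Riesz error is expanded
into its own Bessel series. All of this is `O(M^{-1/4})` apart from the resonant integral. -/
theorem abs_kerPartial_sub_le (h : IsGaussChar q χ) (hv : ∀ n, 0 ≤ divSum χ n) {c₁ c₂ x₀ δ : ℝ}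
    (hc₁ : 0 < c₁) (hδ : 0 < δ) (hx₀ : ∀ m : ℕ+, (m : ℝ) ≠ x₀ → ∀ c ∈ Set.Icc c₁ c₂,
      δ ≤ |2 * √(scaleConst q * m) - 2 * √c|) :
    ∃ w C Y : ℝ, ((∀ m : ℕ+, (m : ℝ) ≠ x₀) → w = 0) ∧
      ∀ M N : ℕ, 1 ≤ M → Y ≤ M → M ≤ N → ∀ c ∈ Set.Icc c₁ c₂,
      |kerPartial χ c N - kerPartial χ c M -
        w * c ^ (5 / 4 : ℝ) * oscInt (2 * √(scaleConst q * x₀) - 2 * √c) 0 M N| ≤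
        C * (M : ℝ) ^ (-(1 / 4) : ℝ) := by
  obtain ⟨w, C, Y, hC, hY, hw, hK⟩ := h.abs_integral_kerSeries_mul_kerF2_le hc₁ hδ hx₀
  obtain ⟨C₁, hC₁, h1⟩ := h.abs_divSumTo_sub_le hv
  obtain ⟨C₂, hC₂, h2⟩ := h.abs_rieszErr_le
  obtain ⟨C₃, hC₃, h3⟩ := kerF_bounds
  obtain ⟨C₄, hC₄, h4⟩ := abs_integral_kerF_le
  set κ := (√(scaleConst q))⁻¹ / scaleConst q with hκ
  set A := C₁ * C₃ * |c₂| ^ (1 / 4 : ℝ) + C₂ * C₃ * |c₂| ^ (3 / 4 : ℝ) with hA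
  refine ⟨κ * w, 2 * A + |κ| * C + |residue q χ| * (C₄ * c₁ ^ (-(1 / 4) : ℝ)), max Y (1 / c₁),
    fun hne => by rw [hw hne, mul_zero], fun M N hM1 hYM hMN c hc => ?_⟩
  have hc0 : 0 < c := hc₁.trans_le hc.1
  have hcc : c ≤ |c₂| := hc.2.trans (le_abs_self _)
  have hM0 : (0 : ℝ) < M := Nat.cast_pos.2 hM1
  have hMN' : (M : ℝ) ≤ N := Nat.cast_le.2 hMN
  have hcM : 1 ≤ c * M := by
    have : 1 / c₁ ≤ M := (le_max_right _ _).trans hYM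
    rw [div_le_iff₀' hc₁] at this
    exact this.trans (by gcongr; exact hc.1)
  have hd : ∀ y, 0 < y → HasDerivAt (fun y => c * kerF (c * y)) (c ^ 2 * kerF1 (c * y)) y :=
    fun y hy => by
      refine (((hasDerivAt_kerF (mul_pos hc0 hy)).comp y
        ((hasDerivAt_id y).const_mul c)).const_mul c).congr_deriv ?_
      ring
  have hd1 : ∀ y, 0 < y → HasDerivAt (fun y => c ^ 2 * kerF1 (c * y)) (c ^ 3 * kerF2 (c * y)) y :=
    fun y hy => by
      refine (((hasDerivAt_kerF1 (mul_pos hc0 hy)).comp y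
        ((hasDerivAt_id y).const_mul c)).const_mul (c ^ 2)).congr_deriv ?_
      ring
  have hcont : ContinuousOn (fun y => c ^ 3 * kerF2 (c * y)) (Set.Ioi 0) :=
    continuousOn_const.mul (continuousOn_kerF2.comp (by fun_prop) fun y hy => mul_pos hc0 hy)
  have habel := h.sum_divSum_mul hd hd1 hcont hM1 hMN
  have hb : ∀ n : ℕ, M ≤ n → |(divSumTo χ n - residue q χ * n) * (c * kerF (c * n)) -
      rieszErr q χ n * (c ^ 2 * kerF1 (c * n))| ≤ A * (M : ℝ) ^ (-(1 / 4) : ℝ) := fun n hn => by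
    have hMn : (M : ℝ) ≤ n := Nat.cast_le.2 hn
    have hn1 : (1 : ℝ) ≤ n := Nat.one_le_cast.2 (hM1.trans hn)
    have hn0 : (0 : ℝ) < n := by linarith
    obtain ⟨f0, f1, -⟩ := h3 (c * n) (hcM.trans (by gcongr))
    have hmono : (n : ℝ) ^ (-(1 / 4) : ℝ) ≤ (M : ℝ) ^ (-(1 / 4) : ℝ) :=
      Real.rpow_le_rpow_of_nonpos hM0 hMn (by norm_num)
    have hmono' : (n : ℝ) ^ (-(1 / 2) : ℝ) ≤ (M : ℝ) ^ (-(1 / 4) : ℝ) :=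
      (rpow_le_rpow_of_one_le hn1 (by norm_num)).trans hmono
    rw [hA, add_mul]
    refine (abs_sub _ _).trans (add_le_add ?_ ?_)
    · rw [abs_mul, abs_mul, abs_of_pos hc0]
      calc _ ≤ C₁ * (n : ℝ) ^ (1 / 2 : ℝ) * (c * (C₃ * (c * n) ^ (-(3 / 4) : ℝ))) := by
            gcongr
            exact h1 n (hM1.trans hn)
        _ = C₁ * C₃ * (c ^ (1 : ℝ) * c ^ (-(3 / 4) : ℝ)) *
            ((n : ℝ) ^ (1 / 2 : ℝ) * (n : ℝ) ^ (-(3 / 4) : ℝ)) := by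
            rw [Real.mul_rpow hc0.le hn0.le, Real.rpow_one]; ring
        _ = C₁ * C₃ * c ^ (1 / 4 : ℝ) * (n : ℝ) ^ (-(1 / 4) : ℝ) := by
            rw [← Real.rpow_add hc0, ← Real.rpow_add hn0]; norm_num
        _ ≤ _ := by gcongr
    · rw [abs_mul, abs_mul, abs_of_pos (by positivity : 0 < c ^ 2)]
      calc _ ≤ C₂ * (n : ℝ) ^ (3 / 4 : ℝ) * (c ^ 2 * (C₃ * (c * n) ^ (-(5 / 4) : ℝ))) := by
            gcongr
            exact h2 n hn0.le
        _ = C₂ * C₃ * (c ^ (2 : ℝ) * c ^ (-(5 / 4) : ℝ)) *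
            ((n : ℝ) ^ (3 / 4 : ℝ) * (n : ℝ) ^ (-(5 / 4) : ℝ)) := by
            rw [Real.mul_rpow hc0.le hn0.le, Real.rpow_two]; ring
        _ = C₂ * C₃ * c ^ (3 / 4 : ℝ) * (n : ℝ) ^ (-(1 / 2) : ℝ) := by
            rw [← Real.rpow_add hc0, ← Real.rpow_add hn0]; norm_num
        _ ≤ _ := by gcongr
  have b1 := hb N hMN
  have b2 := hb M le_rfl
  have hs := uIcc_subset_Ioi hM0 (hM0.trans_le hMN')
  have i1 : IntervalIntegrable (fun y => rieszErr q χ y * (c ^ 3 * kerF2 (c * y)))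
      MeasureTheory.volume M N :=
    ((((continuous_const.mul h.continuous_kerSeries).neg :
      Continuous (rieszErr q χ)).continuousOn).mul (hcont.mono hs)).intervalIntegrable
  have i2 : IntervalIntegrable (fun y => residue q χ * (c * kerF (c * y)))
      MeasureTheory.volume M N :=
    (continuousOn_const.mul (fun y hy => (hd y (hs hy)).continuousAt.continuousWithinAt :
      ContinuousOn (fun y => c * kerF (c * y)) (Set.uIcc (M : ℝ) N))).intervalIntegrable
  rw [intervalIntegral.integral_add i1 i2, intervalIntegral.integral_const_mul] at habel
  have e1 : ∫ y in (M : ℝ)..N, rieszErr q χ y * (c ^ 3 * kerF2 (c * y)) =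
      -κ * ∫ y in (M : ℝ)..N, kerSeries q χ y * (c ^ 3 * kerF2 (c * y)) := by
    rw [← intervalIntegral.integral_const_mul]
    refine intervalIntegral.integral_congr fun y _ => ?_
    simp only [rieszErr, hκ]
    ring
  have b3 := hK M N ((le_max_left _ _).trans hYM) hMN' c hc
  have b4 := h4 c M N hc0 hM0 hMN'
  rw [e1] at habel
  rw [kerPartial_sub hMN, habel]
  set I1 := ∫ y in (M : ℝ)..N, kerSeries q χ y * (c ^ 3 * kerF2 (c * y))
  set I2 := ∫ y in (M : ℝ)..N, c * kerF (c * y)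
  set O := oscInt (2 * √(scaleConst q * x₀) - 2 * √c) 0 M N
  have b3' : |κ * (I1 + w * c ^ (5 / 4 : ℝ) * O)| ≤ |κ| * C * (M : ℝ) ^ (-(1 / 4) : ℝ) := by
    rw [abs_mul, mul_assoc |κ|]
    refine mul_le_mul_of_nonneg_left (b3.trans ?_) (abs_nonneg _)
    exact mul_le_mul_of_nonneg_left (rpow_le_rpow_of_one_le (Nat.one_le_cast.2 hM1) (by norm_num)) hC
  have b4' : |residue q χ * I2| ≤
      |residue q χ| * (C₄ * c₁ ^ (-(1 / 4) : ℝ)) * (M : ℝ) ^ (-(1 / 4) : ℝ) := by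
    rw [abs_mul, mul_assoc]
    refine mul_le_mul_of_nonneg_left (b4.trans ?_) (abs_nonneg _)
    have := Real.rpow_le_rpow_of_nonpos hc₁ hc.1 (show (-(1 / 4) : ℝ) ≤ 0 by norm_num)
    gcongr
  rw [abs_le] at b1 b2 b3' b4' ⊢
  constructor <;>
    linarith [b1.1, b1.2, b2.1, b2.2, b3'.1, b3'.2, b4'.1, b4'.2]

end IsGaussChar

/-! ### Locally uniform convergence, termwise differentiation and the value at integers. -/

theorem uniformCauchySeqOn_of_le {f : ℕ → ℝ → ℝ} {s : Set ℝ} {b : ℕ → ℝ} {Y : ℝ}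
    (hb : Tendsto b atTop (𝓝 0)) (h : ∀ M N : ℕ, 1 ≤ M → Y ≤ M → M ≤ N → ∀ x ∈ s,
      |f N x - f M x| ≤ b M) : UniformCauchySeqOn f atTop s := by
  rw [Metric.uniformCauchySeqOn_iff]
  intro ε hε
  obtain ⟨K, hK⟩ := eventually_atTop.1 ((hb.eventually_lt_const (half_pos hε)).and
    ((eventually_ge_atTop 1).and (tendsto_natCast_atTop_atTop.eventually_ge_atTop Y)))
  obtain ⟨hK1, hK2, hK3⟩ := hK K le_rfl
  refine ⟨K, fun m hm n hn x hx => ?_⟩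
  have h1 := h K m hK2 hK3 hm x hx
  have h2 := h K n hK2 hK3 hn x hx
  rw [Real.dist_eq, abs_lt]
  rw [abs_le] at h1 h2
  constructor <;> linarith [h1.1, h1.2, h2.1, h2.2]

/-- A positive real has a neighbourhood in which it is the only possible positive integer. -/
theorem exists_isolating_radius {x : ℝ} (hx : 0 < x) :
    ∃ r, 0 < r ∧ r < x ∧ ∀ m : ℕ, 1 ≤ m → (m : ℝ) ≠ x → (m : ℝ) + 2 * r ≤ x ∨ x + 2 * r ≤ m := by
  have h1 := Nat.floor_le hx.le
  have h2 := Nat.lt_floor_add_one x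
  set n := ⌊x⌋₊
  have hcases : ∀ m : ℕ, m + 1 ≤ n ∨ m = n ∨ n + 1 ≤ m := fun m => by lia
  rcases h1.eq_or_lt with h | h
  · have hn : 1 ≤ n := by
      by_contra hn
      have : n = 0 := by lia
      rw [this] at h
      norm_num at h
      linarith
    have hn' : (1 : ℝ) ≤ n := Nat.one_le_cast.2 hn
    refine ⟨1 / 2, by norm_num, by linarith, fun m _ hmx => ?_⟩
    rcases hcases m with hm | hm | hm
    · have : (m : ℝ) + 1 ≤ n := by exact_mod_cast hm
      left; linarith
    · exact absurd (hm ▸ h) hmx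
    · have : (n : ℝ) + 1 ≤ m := by exact_mod_cast hm
      right; linarith
  · have hpos : 0 < min (x - n) (n + 1 - x) := lt_min (by linarith) (by linarith)
    have hle1 := min_le_left (x - n) (n + 1 - x)
    have hle2 := min_le_right (x - n) (n + 1 - x)
    have hn0 : (0 : ℝ) ≤ n := Nat.cast_nonneg n
    refine ⟨min (x - n) (n + 1 - x) / 2, by linarith, by linarith, fun m _ hmx => ?_⟩
    rcases hcases m with hm | hm | hm
    · have : (m : ℝ) + 1 ≤ n := by exact_mod_cast hm
      left; linarith
    · left; rw [hm]; linarith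
    · have : (n : ℝ) + 1 ≤ m := by exact_mod_cast hm
      right; linarith

namespace IsGaussChar

variable {q : ℕ} {χ : ℤ → ℝ}

/-- `abs_kerPartial_sub_le` says that the partial sums corrected by the resonant integral are
uniformly Cauchy, and they are continuous in `c`. The shift to `N + 1` keeps the upper limit of that
integral at least `1`. -/
theorem exists_tendstoUniformlyOn (h : IsGaussChar q χ) (hv : ∀ n, 0 ≤ divSum χ n) {x r : ℝ}
    (hr : 0 < r) (hrx : r < x)
    (hm : ∀ m : ℕ, 1 ≤ m → (m : ℝ) ≠ x → (m : ℝ) + 2 * r ≤ x ∨ x + 2 * r ≤ m) :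
    ∃ (w : ℝ) (G : ℝ → ℝ), ((∀ m : ℕ+, (m : ℝ) ≠ x) → w = 0) ∧
      ContinuousOn G (Set.Icc (scaleConst q * (x - r)) (scaleConst q * (x + r))) ∧
      TendstoUniformlyOn (fun N c => kerPartial χ c (N + 1) - w * c ^ (5 / 4 : ℝ) *
        oscInt (2 * √(scaleConst q * x) - 2 * √c) 0 1 (N + 1 : ℕ)) G atTop
        (Set.Icc (scaleConst q * (x - r)) (scaleConst q * (x + r))) := by
  have hl := h.scaleConst_pos
  set l := scaleConst q
  have hc₁ : 0 < l * (x - r) := mul_pos hl (by linarith)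
  -- Integers other than `x` are at distance at least `2r` from `x`, whereas `c/l` stays within `r`.
  -- This is the resulting gap between the square roots on either side.
  set δ := min (2 * √(l * (x - r)) - 2 * √(l * (x - 2 * r)))
    (2 * √(l * (x + 2 * r)) - 2 * √(l * (x + r)))
  have hδ : 0 < δ := by
    have h1 : √(l * (x - 2 * r)) < √(l * (x - r)) :=
      (Real.sqrt_lt_sqrt_iff_of_pos hc₁).2 (mul_lt_mul_of_pos_left (by linarith) hl)
    have h2 : √(l * (x + r)) < √(l * (x + 2 * r)) :=
      Real.sqrt_lt_sqrt (by nlinarith) (mul_lt_mul_of_pos_left (by linarith) hl)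
    exact lt_min (by linarith) (by linarith)
  obtain ⟨w, C, Y, hw, hK⟩ := h.abs_kerPartial_sub_le hv (c₂ := l * (x + r)) hc₁ hδ
    (x₀ := x) fun m hmx c hc => by
      rcases hm m m.pos hmx with h1 | h1
      · have h2 : √(l * m) ≤ √(l * (x - 2 * r)) := Real.sqrt_le_sqrt (by gcongr; linarith)
        have h3 : √(l * (x - r)) ≤ √c := Real.sqrt_le_sqrt hc.1
        rw [abs_sub_comm]
        exact (min_le_left _ _).trans ((by linarith : _ ≤ _).trans (le_abs_self _))
      · have h2 : √(l * (x + 2 * r)) ≤ √(l * m) := Real.sqrt_le_sqrt (by gcongr)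
        have h3 : √c ≤ √(l * (x + r)) := Real.sqrt_le_sqrt hc.2
        exact (min_le_right _ _).trans ((by linarith : _ ≤ _).trans (le_abs_self _))
  set P : ℕ → ℝ → ℝ := fun N c => kerPartial χ c (N + 1) - w * c ^ (5 / 4 : ℝ) *
        oscInt (2 * √(l * x) - 2 * √c) 0 1 (N + 1 : ℕ) with hP
  set s := Set.Icc (l * (x - r)) (l * (x + r))
  have hb : Tendsto (fun M : ℕ => C * ((M + 1 : ℕ) : ℝ) ^ (-(1 / 4) : ℝ)) atTop (𝓝 0) := by
    have h1 := (tendsto_rpow_neg_atTop (show (0 : ℝ) < 1 / 4 by norm_num)).comp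
      (tendsto_natCast_atTop_atTop (R := ℝ))
    have h2 := (h1.comp (tendsto_add_atTop_nat 1)).const_mul C
    rwa [mul_zero] at h2
  have hU : UniformCauchySeqOn P atTop s := by
    refine uniformCauchySeqOn_of_le (Y := Y) hb fun M N hM hYM hMN c hc => ?_
    have h1 := hK (M + 1) (N + 1) (by lia) (by push_cast; linarith) (by lia) c hc
    have h2 := oscInt_add (k := 2 * √(l * x) - 2 * √c) (ψ := 0) one_pos
      (Nat.cast_pos.2 M.succ_pos : (0 : ℝ) < (M + 1 : ℕ)) (Nat.cast_pos.2 N.succ_pos)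
    have e : P N c - P M c = kerPartial χ c (N + 1) - kerPartial χ c (M + 1) - w * c ^ (5 / 4 : ℝ) *
        oscInt (2 * √(l * x) - 2 * √c) 0 (M + 1 : ℕ) (N + 1 : ℕ) := by
      simp only [hP]
      rw [← h2]
      ring
    rw [e]
    exact h1
  have hex : ∀ c, ∃ g, c ∈ s → Tendsto (fun N => P N c) atTop (𝓝 g) := fun c => by
    by_cases hc : c ∈ s
    · obtain ⟨g, hg⟩ := cauchySeq_tendsto_of_complete (hU.cauchySeq hc)
      exact ⟨g, fun _ => hg⟩
    · exact ⟨0, fun h => absurd h hc⟩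
  choose G hG using hex
  have hT := hU.tendstoUniformlyOn_of_tendsto hG
  refine ⟨w, G, hw, hT.continuousOn (Frequently.of_forall fun N => ?_), hT⟩
  have hpos : ∀ c ∈ s, c ≠ 0 := fun c hc => (hc₁.trans_le hc.1).ne'
  have hcZ := continuous_kerZ
  refine ContinuousOn.sub ?_ (ContinuousOn.mul (ContinuousOn.mul continuousOn_const
    (ContinuousOn.rpow_const continuousOn_id fun c hc => Or.inl (hpos c hc))) ?_)
  · refine ContinuousOn.congr (f := fun c => ∑ n ∈ Finset.Icc 1 (N + 1),
      divSum χ n * (kerZ (c * n) / n)) (by fun_prop) fun c hc => kerPartial_eq (hpos c hc) _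
  · exact ((continuous_oscInt N).comp (by fun_prop :
      Continuous fun c => 2 * √(l * x) - 2 * √c)).continuousOn

end IsGaussChar

open Classical in
/-- The summatory function of the divisor sums, the last term being halved at integers. -/
noncomputable def divSumHalf (χ : ℤ → ℝ) (x : ℝ) : ℝ :=
  ∑ n ∈ Finset.Icc 1 ⌊x⌋₊, if (n : ℝ) = x then divSum χ n / 2 else divSum χ n

theorem divSumHalf_of_ne {χ : ℤ → ℝ} {x : ℝ} (hx : ∀ m : ℕ, 1 ≤ m → (m : ℝ) ≠ x) :
    divSumHalf χ x = divSumTo χ ⌊x⌋₊ :=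
  Finset.sum_congr rfl fun n hn => if_neg (hx n (Finset.mem_Icc.1 hn).1)

theorem divSumHalf_natCast {χ : ℤ → ℝ} (N : ℕ) :
    divSumHalf χ ((N + 1 : ℕ) : ℝ) = (divSumTo χ N + divSumTo χ (N + 1)) / 2 := by
  rw [divSumHalf, Nat.floor_natCast, Finset.sum_Icc_succ_top (by lia), if_pos rfl,
    Finset.sum_congr rfl fun n hn => if_neg fun h => ?_, divSumTo_succ, divSumTo]
  · ring
  · have := (Finset.mem_Icc.1 hn).2
    have := Nat.cast_injective h
    lia

namespace IsGaussChar

variable {q : ℕ} {χ : ℤ → ℝ}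

theorem tendsto_oscInt (k : ℝ) : ∃ L, Tendsto (fun N : ℕ => oscInt k 0 1 (N + 1 : ℕ)) atTop (𝓝 L) := by
  by_cases hk : k = 0
  · exact ⟨0, by simp [hk, oscInt_zero]⟩
  · have hb : Tendsto (fun M : ℕ => 6 / |k| * ((M + 1 : ℕ) : ℝ) ^ (-(1 / 2) : ℝ)) atTop (𝓝 0) := by
      have h1 := (tendsto_rpow_neg_atTop (show (0 : ℝ) < 1 / 2 by norm_num)).comp
        (tendsto_natCast_atTop_atTop (R := ℝ))
      have h2 := (h1.comp (tendsto_add_atTop_nat 1)).const_mul (6 / |k|)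
      rwa [mul_zero] at h2
    have hU := uniformCauchySeqOn_of_le (f := fun N _ => oscInt k 0 1 (N + 1 : ℕ)) (s := Set.univ)
      (Y := 0) hb fun M N _ _ hMN x _ => by
        have h2 := oscInt_add (k := k) (ψ := 0) one_pos
          (Nat.cast_pos.2 M.succ_pos : (0 : ℝ) < (M + 1 : ℕ)) (Nat.cast_pos.2 N.succ_pos)
        rw [← h2, add_sub_cancel_left]
        exact abs_oscInt_le hk (Nat.cast_pos.2 M.succ_pos) (Nat.cast_le.2 (by lia))
    exact cauchySeq_tendsto_of_complete (hU.cauchySeq (Set.mem_univ (0 : ℝ)))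

theorem hasDerivAt_kerSeries_partial (h : IsGaussChar q χ) {x : ℝ} (hx : 0 < x) (N : ℕ) :
    HasDerivAt (fun x => ∑ n ∈ Finset.Icc 1 N, divSum χ n * (kerE (scaleConst q * n * x) / n ^ 2))
      (scaleConst q * kerPartial χ (scaleConst q * x) N) x := by
  have hl := h.scaleConst_pos
  rw [kerPartial_eq (by positivity), Finset.mul_sum]
  refine HasDerivAt.fun_sum fun n hn => ?_
  have hn : (n : ℝ) ≠ 0 := Nat.cast_ne_zero.2 (by have := (Finset.mem_Icc.1 hn).1; lia)
  have h1 := ((((hasDerivAt_kerE (scaleConst q * n * x)).comp x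
    ((hasDerivAt_id x).const_mul (scaleConst q * n))).div_const ((n : ℝ) ^ 2)).const_mul (divSum χ n))
  refine h1.congr_deriv ?_
  rw [show scaleConst q * x * n = scaleConst q * n * x by ring]
  field_simp

theorem tendsto_kerSeries_partial (h : IsGaussChar q χ) (x : ℝ) :
    Tendsto (fun N : ℕ => ∑ n ∈ Finset.Icc 1 (N + 1),
      divSum χ n * (kerE (scaleConst q * n * x) / n ^ 2)) atTop (𝓝 (kerSeries q χ x)) := by
  have h1 := h.summable_kerSeries x
  have e : kerSeries q χ x = ∑' n : ℕ, divSum χ (n + 1) *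
      (kerE (scaleConst q * (n + 1 : ℕ) * x) / (n + 1 : ℕ) ^ 2) :=
    tsum_pnat_eq_tsum_succ
      (f := fun n : ℕ => divSum χ n * (kerE (scaleConst q * n * x) / n ^ 2))
  have h2 : Summable fun n : ℕ => divSum χ (n + 1) *
      (kerE (scaleConst q * (n + 1 : ℕ) * x) / (n + 1 : ℕ) ^ 2) :=
    (summable_pnat_iff_summable_succ
      (f := fun n : ℕ => divSum χ n * (kerE (scaleConst q * n * x) / n ^ 2))).1 h1
  have h3 := h2.hasSum.tendsto_sum_nat.comp (tendsto_add_atTop_nat 1)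
  rw [← e] at h3
  refine h3.congr fun N => ?_
  rw [sum_Icc_one_eq_sum_range fun n : ℕ => divSum χ n * (kerE (scaleConst q * n * x) / n ^ 2)]
  rfl

/-- Near a non-integer no index resonates, so the differentiated series converges uniformly and may
be integrated back. Its sum is compared with the derivative of the Riesz error, which is explicit
there since the summatory function is locally constant. -/
theorem tendsto_kerPartial_of_ne (h : IsGaussChar q χ) (hv : ∀ n, 0 ≤ divSum χ n) {x : ℝ}
    (hx : 0 < x) (hne : ∀ m : ℕ, 1 ≤ m → (m : ℝ) ≠ x) :
    Tendsto (fun N => kerPartial χ (scaleConst q * x) (N + 1)) atTop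
      (𝓝 (√(scaleConst q) * (residue q χ * x - divSumTo χ ⌊x⌋₊))) := by
  obtain ⟨r, hr, hrx, hm⟩ := exists_isolating_radius hx
  obtain ⟨w, G, hw, -, hT⟩ := h.exists_tendstoUniformlyOn hv hr hrx hm
  have hl := h.scaleConst_pos
  have hw0 := hw fun m => hne m m.pos
  simp only [hw0, zero_mul, sub_zero] at hT
  set l := scaleConst q with hldef
  have hmem : ∀ z ∈ Set.Ioo (x - r) (x + r), l * z ∈ Set.Icc (l * (x - r)) (l * (x + r)) :=
    fun z hz => ⟨mul_le_mul_of_nonneg_left hz.1.le hl.le, mul_le_mul_of_nonneg_left hz.2.le hl.le⟩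
  have hxm : x ∈ Set.Ioo (x - r) (x + r) := ⟨by linarith, by linarith⟩
  have hT' : TendstoUniformlyOn (fun (N : ℕ) z => l * kerPartial χ (l * z) (N + 1))
      (fun z => l * G (l * z)) atTop (Set.Ioo (x - r) (x + r)) := by
    rw [Metric.tendstoUniformlyOn_iff] at hT ⊢
    intro ε hε
    filter_upwards [hT (ε / l) (by positivity)] with N hN z hz
    have := hN (l * z) (hmem z hz)
    rw [Real.dist_eq] at this ⊢
    rw [← mul_sub, abs_mul, abs_of_pos hl]
    rwa [lt_div_iff₀' hl] at this
  have hD := hasDerivAt_of_tendstoUniformlyOn isOpen_Ioo hT'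
    (Eventually.of_forall fun N z hz => h.hasDerivAt_kerSeries_partial
      (by have := hz.1; linarith) (N + 1))
    (fun z _ => h.tendsto_kerSeries_partial z) hxm
  have hfl : x ∈ Set.Ioo (⌊x⌋₊ : ℝ) (⌊x⌋₊ + 1) := by
    refine ⟨(Nat.floor_le hx.le).lt_of_ne fun hh => ?_, Nat.lt_floor_add_one x⟩
    rcases Nat.eq_zero_or_pos ⌊x⌋₊ with h0 | h0
    · rw [h0, Nat.cast_zero] at hh; exact hx.ne hh
    · exact hne _ h0 hh
  have hD2 : HasDerivAt (rieszErr q χ) (divSumTo χ ⌊x⌋₊ - residue q χ * x) x := by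
    have h1 := (hasDerivAt_rieszSum_of_mem_Ioo (χ := χ) hfl).fun_sub
      (((hasDerivAt_id x).fun_pow 2).const_mul (residue q χ / 2))
    refine (h1.congr_of_eventuallyEq ?_).congr_deriv ?_
    · filter_upwards [Ioi_mem_nhds hx] with z hz
      exact h.rieszErr_eq hz
    · simp only [id]; push_cast; ring
  have hD3 : HasDerivAt (rieszErr q χ) (-((√l)⁻¹ / l * (l * G (l * x)))) x :=
    (hD.const_mul ((√l)⁻¹ / l)).fun_neg
  have heq := hD2.unique hD3
  have hs : 0 < √l := Real.sqrt_pos.2 hl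
  have hG : G (l * x) = √l * (residue q χ * x - divSumTo χ ⌊x⌋₊) := by
    generalize G (l * x) = g at heq ⊢
    field_simp at heq
    linarith
  rw [← hG]
  exact hT.tendsto_at (hmem x hxm)

/-- At the integer the resonant frequency is `0`, so the partial sums converge to the value of the
continuous limit `G`. That value is found by approaching along pairs of points with opposite
resonant frequencies, where the known non-integral formula holds and the resonant integrals cancel.
-/
theorem tendsto_kerPartial_natCast (h : IsGaussChar q χ) (hv : ∀ n, 0 ≤ divSum χ n) (K : ℕ) :
    Tendsto (fun N => kerPartial χ (scaleConst q * (K + 1 : ℕ)) (N + 1)) atTop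
      (𝓝 (√(scaleConst q) * (residue q χ * (K + 1 : ℕ) - (divSumTo χ K + divSumTo χ (K + 1)) / 2))) := by
  set x : ℝ := ((K + 1 : ℕ) : ℝ) with hxdef
  have hx : 0 < x := Nat.cast_pos.2 K.succ_pos
  obtain ⟨r, hr, hrx, hm⟩ := exists_isolating_radius hx
  obtain ⟨w, G, -, hGc, hT⟩ := h.exists_tendstoUniformlyOn hv hr hrx hm
  have hl := h.scaleConst_pos
  set l := scaleConst q with hldef
  have hs : 0 < √l := Real.sqrt_pos.2 hl
  have hmem : ∀ z ∈ Set.Ioo (x - r) (x + r), l * z ∈ Set.Icc (l * (x - r)) (l * (x + r)) :=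
    fun z hz => ⟨mul_le_mul_of_nonneg_left hz.1.le hl.le, mul_le_mul_of_nonneg_left hz.2.le hl.le⟩
  have hxm : x ∈ Set.Ioo (x - r) (x + r) := ⟨by linarith, by linarith⟩
  have hGx : Tendsto (fun N => kerPartial χ (l * x) (N + 1)) atTop (𝓝 (G (l * x))) := by
    have := hT.tendsto_at (hmem x hxm)
    simpa [oscInt_zero] using this
  -- Division by `(l z)^{5/4}` gives the resonant integral the same coefficient `w` at every point,
  -- so that it can cancel between two different points.
  set H : ℝ → ℝ := fun z => G (l * z) / (l * z) ^ (5 / 4 : ℝ) with hH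
  have hHc : ContinuousAt H x := by
    have h1 : ContinuousAt (fun z => G (l * z)) x := by
      refine ContinuousAt.comp' (hGc.continuousAt ?_) (by fun_prop)
      exact Icc_mem_nhds (mul_lt_mul_of_pos_left hxm.1 hl) (mul_lt_mul_of_pos_left hxm.2 hl)
    have hlx : 0 < l * x := by positivity
    refine h1.div (ContinuousAt.rpow_const (by fun_prop) (Or.inl hlx.ne')) (by positivity)
  have hpos : ∀ z ∈ Set.Ioo (x - r) (x + r), 0 < z := fun z hz => by have := hz.1; linarith
  have hint : ∀ z ∈ Set.Ioo (x - r) (x + r), z ≠ x → ∀ m : ℕ, 1 ≤ m → (m : ℝ) ≠ z :=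
    fun z hz hzx m hm1 hmz => by
      rcases hm m hm1 (hmz ▸ hzx) with h1 | h1
      · have := hz.1; linarith
      · have := hz.2; linarith
  -- The next integer is at distance `1`, so `2r ≤ 1`. This determines the integer parts on both
  -- sides.
  have hr1 : r ≤ 1 / 2 := by
    rcases hm (K + 2) (by lia) (by simp [hxdef]) with h1 | h1
    · rw [hxdef] at h1; push_cast at h1; linarith
    · rw [hxdef] at h1; push_cast at h1; linarith
  set S : ℝ → ℝ → ℝ := fun I z => √l * (residue q χ * z - I) / (l * z) ^ (5 / 4 : ℝ) with hS
  have hSc : ∀ I, ContinuousAt (S I) x := fun I => by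
    have hlx : 0 < l * x := by positivity
    exact ContinuousAt.div (by fun_prop) (ContinuousAt.rpow_const (by fun_prop) (Or.inl hlx.ne'))
      (by positivity)
  have hHz : ∀ z ∈ Set.Ioo (x - r) (x + r), z ≠ x → ∀ L,
      Tendsto (fun N : ℕ => oscInt (2 * √(l * x) - 2 * √(l * z)) 0 1 (N + 1 : ℕ)) atTop (𝓝 L) →
      H z = S (divSumTo χ ⌊z⌋₊) z - w * L := fun z hz hzx L hL => by
    have hlz : 0 < l * z := mul_pos hl (hpos z hz)
    have h1 := h.tendsto_kerPartial_of_ne hv (hpos z hz) (hint z hz hzx)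
    have h2 := h1.sub (hL.const_mul (w * (l * z) ^ (5 / 4 : ℝ)))
    have h3 := tendsto_nhds_unique (hT.tendsto_at (hmem z hz)) h2
    simp only [hH, hS]
    have hlz' : (l * z) ^ (5 / 4 : ℝ) ≠ 0 := by positivity
    rw [h3, ← hldef, sub_div, mul_right_comm, mul_div_cancel_right₀ _ hlz']
  -- The reflection is taken in `√z`, not in `z`: the resonant frequencies at the two points are
  -- then exactly `∓2√l t`.
  set zp : ℝ → ℝ := fun t => (√x + t) ^ 2 with hzp
  set zm : ℝ → ℝ := fun t => (√x - t) ^ 2 with hzm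
  have hsx : √x ^ 2 = x := Real.sq_sqrt hx.le
  have hsx0 : 0 < √x := Real.sqrt_pos.2 hx
  have hp : Tendsto zp (𝓝[>] 0) (𝓝 x) := by
    have : ContinuousAt zp 0 := by fun_prop
    have h1 := this.tendsto.mono_left (nhdsWithin_le_nhds (s := Set.Ioi 0))
    simpa [hzp, hsx] using h1
  have hmn : Tendsto zm (𝓝[>] 0) (𝓝 x) := by
    have : ContinuousAt zm 0 := by fun_prop
    have h1 := this.tendsto.mono_left (nhdsWithin_le_nhds (s := Set.Ioi 0))
    simpa [hzm, hsx] using h1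
  have hev : ∀ᶠ t in 𝓝[>] (0 : ℝ), H (zp t) + H (zm t) =
      S (divSumTo χ (K + 1)) (zp t) + S (divSumTo χ K) (zm t) := by
    have hnb := Ioo_mem_nhds hxm.1 hxm.2
    filter_upwards [hp.eventually_mem hnb, hmn.eventually_mem hnb, self_mem_nhdsWithin,
      (Iio_mem_nhds hsx0 : _ ∈ 𝓝 (0 : ℝ)) |> mem_nhdsWithin_of_mem_nhds] with t h1 h2 h3 h4
    have h3 : 0 < t := h3
    have h4 : t < √x := h4
    have hxp : x < zp t := by simp only [hzp]; nlinarith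
    have hxn : zm t < x := by simp only [hzm]; nlinarith
    have ep : √(l * zp t) = √l * (√x + t) := by
      rw [Real.sqrt_mul hl.le, Real.sqrt_sq (by linarith)]
    have em : √(l * zm t) = √l * (√x - t) := by
      rw [Real.sqrt_mul hl.le, Real.sqrt_sq (by linarith)]
    obtain ⟨L, hL⟩ := tendsto_oscInt (2 * √(l * x) - 2 * √(l * zm t))
    have hL' : Tendsto (fun N : ℕ => oscInt (2 * √(l * x) - 2 * √(l * zp t)) 0 1 (N + 1 : ℕ)) atTop
        (𝓝 (-L)) := by
      refine hL.neg.congr fun N => ?_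
      rw [← oscInt_neg, ep, em, Real.sqrt_mul hl.le]
      congr 1
      ring
    have fp : ⌊zp t⌋₊ = K + 1 := by
      rw [Nat.floor_eq_iff (hpos _ h1).le]
      exact ⟨hxp.le, by have := h1.2; rw [← hxdef]; linarith⟩
    have fm : ⌊zm t⌋₊ = K := by
      rw [Nat.floor_eq_iff (hpos _ h2).le]
      have hxK : x = K + 1 := by rw [hxdef]; push_cast; ring
      exact ⟨by have := h2.1; linarith, by linarith⟩
    rw [hHz _ h1 hxp.ne' _ hL', hHz _ h2 hxn.ne _ hL, fp, fm]
    ring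
  have l1 := (hHc.tendsto.comp hp).add (hHc.tendsto.comp hmn)
  have l2 := ((hSc (divSumTo χ (K + 1))).tendsto.comp hp).add ((hSc (divSumTo χ K)).tendsto.comp hmn)
  have hfin := tendsto_nhds_unique (l1.congr' hev) l2
  have hlx : 0 < (l * x) ^ (5 / 4 : ℝ) := by positivity
  simp only [hH, hS] at hfin
  have hval : G (l * x) = √l * (residue q χ * x - (divSumTo χ K + divSumTo χ (K + 1)) / 2) := by
    field_simp at hfin
    linarith
  rw [← hval]
  exact hGx

/-- The Bessel series of the divisor sums of `χ`. -/
theorem tendsto_kerPartial (h : IsGaussChar q χ) (hv : ∀ n, 0 ≤ divSum χ n) {x : ℝ} (hx : 0 < x) :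
    Tendsto (kerPartial χ (scaleConst q * x)) atTop
      (𝓝 (√(scaleConst q) * (residue q χ * x - divSumHalf χ x))) := by
  rw [← tendsto_add_atTop_iff_nat 1]
  by_cases hne : ∀ m : ℕ, 1 ≤ m → (m : ℝ) ≠ x
  · rw [divSumHalf_of_ne hne]
    exact h.tendsto_kerPartial_of_ne hv hx hne
  · push Not at hne
    obtain ⟨m, hm, rfl⟩ := hne
    obtain ⟨K, rfl⟩ := Nat.exists_eq_add_of_le' hm
    rw [divSumHalf_natCast]
    exact h.tendsto_kerPartial_natCast hv K

theorem tendsto_divSumTo_div (h : IsGaussChar q χ) (hv : ∀ n, 0 ≤ divSum χ n) :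
    Tendsto (fun N : ℕ => divSumTo χ N / N) atTop (𝓝 (residue q χ)) := by
  obtain ⟨C, hC, hD⟩ := h.abs_divSumTo_sub_le hv
  have h1 := ((tendsto_rpow_neg_atTop (show (0 : ℝ) < 1 / 2 by norm_num)).comp
    (tendsto_natCast_atTop_atTop (R := ℝ))).const_mul C
  rw [mul_zero] at h1
  refine tendsto_iff_norm_sub_tendsto_zero.2 (squeeze_zero' (Eventually.of_forall fun _ =>
    norm_nonneg _) ?_ h1)
  filter_upwards [eventually_ge_atTop 1] with N hN
  have hN0 : (0 : ℝ) < N := Nat.cast_pos.2 hN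
  have e : divSumTo χ N / N - residue q χ = (divSumTo χ N - residue q χ * N) / N := by field_simp
  rw [e, Real.norm_eq_abs, abs_div, abs_of_pos hN0, Function.comp,
    show (-(1 / 2) : ℝ) = 1 / 2 - 1 by norm_num, Real.rpow_sub_one hN0.ne', ← mul_div_assoc]
  gcongr
  exact hD N hN

end IsGaussChar

/-! ### Theta series with periodic coefficients and the quadratic Gauss sum. -/

theorem summable_exp_neg_mul_int_sq {a : ℝ} (ha : 0 < a) :
    Summable fun n : ℤ => Real.exp (-Real.pi * a * (n : ℝ) ^ 2) := by
  have h := ((summable_jacobiTheta₂_term_iff 0 (Complex.I * a)).2 (by simpa using ha)).norm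
  refine h.congr fun n => ?_
  rw [norm_jacobiTheta₂_term]
  simp
  ring_nf

theorem summable_periodic_mul_exp {c : ℕ} (hc : 0 < c) {f : ℤ → ℂ}
    (hf : ∀ n k : ℤ, f (n + k * c) = f n) {w : ℂ} (hw : 0 < w.re) :
    Summable fun n : ℤ => f n * Complex.exp (-Real.pi * w * (n : ℂ) ^ 2) := by
  set B := ∑ r ∈ Finset.range c, ‖f r‖ with hB
  have hb : ∀ n, ‖f n‖ ≤ B := by
    intro n
    have h1 : f n = f ((n % c).toNat : ℤ) := by
      have h0 : (0 : ℤ) ≤ n % c := Int.emod_nonneg _ (by omega)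
      rw [Int.toNat_of_nonneg h0]
      conv_lhs => rw [← Int.emod_add_ediv_mul n c]
      exact hf _ _
    rw [h1]
    refine Finset.single_le_sum (f := fun r : ℕ => ‖f r‖) (fun _ _ => norm_nonneg _) ?_
    have := Int.emod_lt_of_pos n (by omega : (0 : ℤ) < c)
    simp only [Finset.mem_range]
    omega
  refine Summable.of_norm_bounded ((summable_exp_neg_mul_int_sq hw).mul_left B) fun n => ?_
  rw [norm_mul, Complex.norm_exp]
  refine mul_le_mul (hb n) (le_of_eq ?_) (by positivity) ((norm_nonneg _).trans (hb n))
  congr 1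
  have : -(Real.pi : ℂ) * w * (n : ℂ) ^ 2 = ((-Real.pi * (n : ℝ) ^ 2 : ℝ) : ℂ) * w := by
    push_cast; ring
  rw [this, Complex.re_ofReal_mul]
  ring

theorem cpow_half_sq_mul {a : ℝ} (ha : 0 < a) {w : ℂ} (hw : w ≠ 0) :
    ((a : ℂ) ^ 2 * w) ^ (1 / 2 : ℂ) = a * w ^ (1 / 2 : ℂ) := by
  have ha0 : (a : ℂ) ≠ 0 := by exact_mod_cast ha.ne'
  have e : (a : ℂ) ^ 2 * w = ((a ^ 2 : ℝ) : ℂ) * w := by push_cast; ring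
  rw [Complex.cpow_def_of_ne_zero (mul_ne_zero (pow_ne_zero 2 ha0) hw),
    Complex.cpow_def_of_ne_zero hw, e, Complex.log_ofReal_mul (by positivity) hw, Real.log_pow]
  conv_rhs => rw [← Complex.exp_log ha0, ← Complex.exp_add, ← Complex.ofReal_log ha.le]
  congr 1
  push_cast
  ring

/-- The twisted theta series dual to a residue class. -/
noncomputable def thetaDual (c : ℕ) (r : ℕ) (w : ℂ) : ℂ :=
  ∑' k : ℤ, Complex.exp (2 * Real.pi * Complex.I * k * (r / c : ℝ)) *
    Complex.exp (-Real.pi / (c ^ 2 * w) * (k : ℂ) ^ 2)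

/-- The theta series is split into residue classes mod `c`, and the theta transformation is applied
to each shifted Gaussian. The shift becomes the additive twist in `thetaDual`. -/
theorem tsum_periodic_mul_exp {c : ℕ} (hc : 0 < c) {f : ℤ → ℂ}
    (hf : ∀ n k : ℤ, f (n + k * c) = f n) {w : ℂ} (hw : 0 < w.re) :
    w ^ (1 / 2 : ℂ) * ∑' n : ℤ, f n * Complex.exp (-Real.pi * w * (n : ℂ) ^ 2) =
      1 / c * ∑ r ∈ Finset.range c, f r * thetaDual c r w := by
  have : NeZero c := ⟨hc.ne'⟩
  have hc0 : (c : ℂ) ≠ 0 := by exact_mod_cast hc.ne'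
  have hw0 : w ≠ 0 := by rintro rfl; simp at hw
  have hS := summable_periodic_mul_exp hc hf hw
  have hS' := (Int.divModEquiv c).symm.summable_iff.2 hS
  rw [← (Int.divModEquiv c).symm.tsum_eq]
  have hS2 : Summable fun p : Fin c × ℤ => f (p.1 + p.2 * c) *
      Complex.exp (-Real.pi * w * ((p.1 + p.2 * c : ℤ) : ℂ) ^ 2) := by
    refine ((Equiv.prodComm _ _).summable_iff.2 hS').congr fun p => ?_
    simp [Int.divModEquiv_symm_apply, add_comm]
  have e1 : ∑' c_1 : ℤ × Fin c, f ((Int.divModEquiv c).symm c_1) *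
      Complex.exp (-Real.pi * w * (((Int.divModEquiv c).symm c_1 : ℤ) : ℂ) ^ 2) =
      ∑' p : Fin c × ℤ, f (p.1 + p.2 * c) *
      Complex.exp (-Real.pi * w * ((p.1 + p.2 * c : ℤ) : ℂ) ^ 2) := by
    rw [← (Equiv.prodComm _ _).tsum_eq]
    refine tsum_congr fun p => ?_
    simp [Int.divModEquiv_symm_apply, add_comm]
  rw [e1, hS2.tsum_prod, tsum_fintype, ← Fin.sum_univ_eq_sum_range
    (fun r => f r * thetaDual c r w), Finset.mul_sum, Finset.mul_sum]
  refine Finset.sum_congr rfl fun r _ => ?_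
  have hcw : 0 < ((c : ℂ) ^ 2 * w).re := by
    have : (c : ℂ) ^ 2 * w = ((c ^ 2 : ℝ) : ℂ) * w := by push_cast; ring
    rw [this, Complex.re_ofReal_mul]
    positivity
  have h2 : ∀ k : ℤ, f (r + k * c) * Complex.exp (-Real.pi * w * ((r + k * c : ℤ) : ℂ) ^ 2) =
      f r * Complex.exp (-Real.pi * w * r ^ 2) *
      Complex.exp (-Real.pi * (c ^ 2 * w) * (k : ℂ) ^ 2 + 2 * Real.pi * (-(w * r * c)) * k) := by
    intro k
    rw [hf, mul_assoc (f r), ← Complex.exp_add]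
    congr 2
    push_cast
    ring
  have h3 : ∀ k : ℤ, Complex.exp (-Real.pi / (c ^ 2 * w) *
      ((k : ℂ) + Complex.I * (-(w * r * c))) ^ 2) = Complex.exp (Real.pi * w * r ^ 2) *
      (Complex.exp (2 * Real.pi * Complex.I * k * ((r : ℕ) / c : ℝ)) *
    Complex.exp (-Real.pi / (c ^ 2 * w) * (k : ℂ) ^ 2)) := by
    intro k
    rw [← Complex.exp_add, ← Complex.exp_add]
    congr 1
    push_cast
    have : ((k : ℂ) + Complex.I * (-(w * r * c))) ^ 2 =
      (k : ℂ) ^ 2 - 2 * Complex.I * k * (w * r * c) - (w * r * c) ^ 2 := by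
      linear_combination (w * r * c) ^ 2 * Complex.I_sq
    rw [this]
    field_simp
    ring
  have h4 : ((c : ℂ) ^ 2 * w) ^ (1 / 2 : ℂ) = c * w ^ (1 / 2 : ℂ) := by
    exact_mod_cast cpow_half_sq_mul (by exact_mod_cast hc : (0 : ℝ) < c) hw0
  simp_rw [h2]
  rw [tsum_mul_left, Complex.tsum_exp_neg_quadratic hcw]
  simp_rw [h3]
  rw [tsum_mul_left, h4]
  have hw2 : w ^ (1 / 2 : ℂ) ≠ 0 := by simp [Complex.cpow_eq_zero_iff, hw0]
  have h5 : Complex.exp (-Real.pi * w * r ^ 2) * Complex.exp (Real.pi * w * r ^ 2) = 1 := by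
    rw [← Complex.exp_add]; simp
  change _ * (_ * (_ * (_ * thetaDual c r w))) = _
  generalize thetaDual c r w = T
  generalize Complex.exp (-Real.pi * w * r ^ 2) = E1 at *
  generalize Complex.exp (Real.pi * w * r ^ 2) = E2 at *
  generalize f r = F
  field_simp
  linear_combination F * T * h5

/-- Each term with `k ≠ 0` has modulus `e^{-πk² Re(1/w)/c²}`, so only `k = 0` survives. With
`tsum_periodic_mul_exp`, the leading coefficient of a theta series with periodic coefficients is
their mean over a period. -/
theorem tendsto_thetaDual {ι : Type*} {l : Filter ι} {c : ℕ} (hc : 0 < c) (r : ℕ) {w : ι → ℂ}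
    (hw : Tendsto (fun i => (1 / w i).re) l atTop) :
    Tendsto (fun i => thetaDual c r (w i)) l (𝓝 1) := by
  have hc0 : (0 : ℝ) < c := by exact_mod_cast hc
  have hnorm : ∀ i (k : ℤ), ‖Complex.exp (2 * Real.pi * Complex.I * k * (r / c : ℝ)) *
    Complex.exp (-Real.pi / (c ^ 2 * w i) * (k : ℂ) ^ 2)‖ =
      Real.exp (-Real.pi * (1 / c ^ 2) * (k : ℝ) ^ 2 * (1 / w i).re) := by
    intro i k
    rw [norm_mul]
    have h1 : (2 * Real.pi * Complex.I * k * (r / c : ℝ) : ℂ) =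
      ((2 * Real.pi * k * (r / c) : ℝ) : ℂ) * Complex.I := by push_cast; ring
    have h2 : (-Real.pi / (c ^ 2 * w i) * (k : ℂ) ^ 2 : ℂ) =
      ((-Real.pi * (1 / c ^ 2) * (k : ℝ) ^ 2 : ℝ) : ℂ) * (1 / w i) := by
      push_cast
      rw [div_eq_mul_inv, mul_inv]
      ring
    rw [h1, Complex.norm_exp_ofReal_mul_I, one_mul, Complex.norm_exp, h2, Complex.re_ofReal_mul]
  have hlim : (∑' k : ℤ, if k = 0 then (1 : ℂ) else 0) = 1 := by simp
  rw [← hlim]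
  refine tendsto_tsum_of_dominated_convergence
    (bound := fun k : ℤ => Real.exp (-Real.pi * (1 / c ^ 2) * (k : ℝ) ^ 2))
    (summable_exp_neg_mul_int_sq (by positivity)) ?_ ?_
  · intro k
    by_cases hk : k = 0
    · simpa [hk] using tendsto_const_nhds
    · simp only [hk, if_false]
      rw [tendsto_zero_iff_norm_tendsto_zero]
      simp_rw [hnorm]
      refine Real.tendsto_exp_atBot.comp ?_
      have hk' : (k : ℝ) ≠ 0 := by exact_mod_cast hk
      refine hw.const_mul_atTop_of_neg ?_
      have : 0 < Real.pi * (1 / c ^ 2) * (k : ℝ) ^ 2 := by positivity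
      linarith
  · filter_upwards [hw.eventually_ge_atTop 1] with i hi k
    rw [hnorm]
    refine Real.exp_le_exp.2 ?_
    have : 0 ≤ Real.pi * (1 / c ^ 2) * (k : ℝ) ^ 2 := by positivity
    nlinarith

theorem tendsto_cpow_mul_tsum_periodic {ι : Type*} {l : Filter ι} {c : ℕ} (hc : 0 < c) {f : ℤ → ℂ}
    (hf : ∀ n k : ℤ, f (n + k * c) = f n) {w : ι → ℂ} (hw0 : ∀ i, 0 < (w i).re)
    (hw : Tendsto (fun i => (1 / w i).re) l atTop) :
    Tendsto (fun i => (w i) ^ (1 / 2 : ℂ) *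
        ∑' n : ℤ, f n * Complex.exp (-Real.pi * w i * (n : ℂ) ^ 2)) l
      (𝓝 (1 / c * ∑ r ∈ Finset.range c, f r)) := by
  simp_rw [fun i => tsum_periodic_mul_exp hc hf (hw0 i)]
  refine Tendsto.const_mul _ ?_
  have := tendsto_finsetSum (Finset.range c) (fun (r : ℕ) _ =>
    (tendsto_thetaDual hc r hw).const_mul (f r))
  simpa using this

/-- The quadratic Gauss sum. -/
noncomputable def quadGaussSum (c : ℕ) : ℂ :=
  ∑ r ∈ Finset.range c, Complex.exp (2 * Real.pi * Complex.I * (r ^ 2 / c : ℝ))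

theorem exp_two_pi_I_mul_add_int (x : ℂ) (k : ℤ) :
    Complex.exp (2 * Real.pi * Complex.I * (x + k)) = Complex.exp (2 * Real.pi * Complex.I * x) := by
  rw [mul_add, mul_comm _ (k : ℂ), Complex.exp_add, Complex.exp_int_mul_two_pi_mul_I, mul_one]

/-- Schaar's evaluation of the quadratic Gauss sum. -/
theorem quadGaussSum_eq {c : ℕ} (hc : 0 < c) :
    quadGaussSum c = √c * ((1 + Complex.I) / 2) *
      (1 + Complex.exp (-(2 * Real.pi * Complex.I * (c / 4 : ℝ)))) := by
  have hcR : (0 : ℝ) < c := by exact_mod_cast hc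
  have hc0 : (c : ℂ) ≠ 0 := by exact_mod_cast hc.ne'
  -- The theta function is evaluated at `ε - 2i/c` as `ε → 0`. There `e^{-πan²}` carries the
  -- coefficients of the Gauss sum, and `1/a = w + ci/2` with `w` of order `ε`, so the transformed
  -- series has coefficients of period `2`. Equating leading terms evaluates the Gauss sum.
  let a : ℝ → ℂ := fun ε => ε - 2 * Complex.I / c
  let u : ℝ → ℂ := fun ε => 1 / (1 + Complex.I * c * ε / 2)
  let w : ℝ → ℂ := fun ε => ((c / 2 * √ε : ℝ) : ℂ) ^ 2 * u ε
  have hsq : ∀ ε : ℝ, 0 < ε → ((c / 2 * √ε : ℝ) : ℂ) ^ 2 = c ^ 2 * ε / 4 := by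
    intro ε hε
    rw [← Complex.ofReal_pow, mul_pow, Real.sq_sqrt hε.le]
    push_cast
    ring
  have hare : ∀ ε, (a ε).re = ε := by
    intro ε
    have : a ε = (ε : ℂ) + ((-2 / c : ℝ) : ℂ) * Complex.I := by simp only [a]; push_cast; ring
    rw [this]; simp
  have hane : ∀ ε, 0 < ε → a ε ≠ 0 := fun ε hε h => by
    have := hare ε; rw [h] at this; simp at this; linarith
  have hune : ∀ ε : ℝ, (1 + Complex.I * c * ε / 2 : ℂ) ≠ 0 := fun ε h => by
    have := congrArg Complex.re h
    have e : (1 + Complex.I * c * ε / 2 : ℂ) = ((1 : ℝ) : ℂ) + ((c * ε / 2 : ℝ) : ℂ) * Complex.I := by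
      push_cast; ring
    rw [e] at this
    simp at this
  have hinv : ∀ ε, 0 < ε →
      1 / w ε = ((4 / (c ^ 2 * ε) : ℝ) : ℂ) + ((2 / c : ℝ) : ℂ) * Complex.I := by
    intro ε hε
    have hε0 : (ε : ℂ) ≠ 0 := by exact_mod_cast hε.ne'
    have := hune ε
    simp only [w, u]
    rw [hsq ε hε]
    push_cast
    field_simp
    ring
  have hinvre : ∀ ε, 0 < ε → (1 / w ε).re = 4 / (c ^ 2 * ε) := by
    intro ε hε
    rw [hinv ε hε, Complex.add_re, Complex.ofReal_re, Complex.re_ofReal_mul]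
    simp
  have hwne : ∀ ε, 0 < ε → w ε ≠ 0 := by
    intro ε hε h
    have := hinvre ε hε
    rw [h] at this
    simp only [div_zero, Complex.zero_re] at this
    have : 0 < 4 / (c ^ 2 * ε) := by positivity
    linarith
  have hwre : ∀ ε, 0 < ε → 0 < (w ε).re := by
    intro ε hε
    have h1 : w ε = (1 / w ε)⁻¹ := by simp
    rw [h1, Complex.inv_re, hinvre ε hε]
    have : 1 / w ε ≠ 0 := one_div_ne_zero (hwne ε hε)
    have := Complex.normSq_pos.2 this
    positivity
  have hawr : ∀ ε, 0 < ε → 1 / a ε = w ε + c * Complex.I / 2 := by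
    intro ε hε
    have h1 := hane ε hε
    have h2 := hune ε
    have h3 : a ε * c = c * ε - 2 * Complex.I := by simp only [a]; field_simp
    have h4 : (c * ε - 2 * Complex.I : ℂ) ≠ 0 := h3 ▸ mul_ne_zero h1 hc0
    have h5 : 1 / a ε = c / (c * ε - 2 * Complex.I) := by
      rw [← h3]; field_simp
    have h6 : (c * ε - 2 * Complex.I : ℂ) = -2 * Complex.I * (1 + Complex.I * c * ε / 2) := by
      linear_combination (c * ε) * Complex.I_sq
    rw [h5, h6]
    simp only [w, u]
    rw [hsq ε hε]
    have h7 : 1 / (1 + Complex.I * c * ε / 2) * (1 + Complex.I * c * ε / 2) = 1 :=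
      one_div_mul_cancel h2
    rw [div_eq_iff (mul_ne_zero (by simp) h2)]
    linear_combination Complex.I * c ^ 2 * ε / 2 * h7 +
      (c + Complex.I * c ^ 2 * ε / 2) * Complex.I_sq
  set f₁ : ℤ → ℂ := fun n => Complex.exp (2 * Real.pi * Complex.I * (n ^ 2 / c : ℝ)) with hf₁
  set f₂ : ℤ → ℂ := fun n => Complex.exp (-(2 * Real.pi * Complex.I * (n ^ 2 * c / 4 : ℝ))) with hf₂
  have p₁ : ∀ n k : ℤ, f₁ (n + k * c) = f₁ n := by
    intro n k
    simp only [hf₁]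
    rw [← exp_two_pi_I_mul_add_int _ (-(2 * n * k + k ^ 2 * c))]
    congr 2
    push_cast
    field_simp
    ring
  have p₂ : ∀ n k : ℤ, f₂ (n + k * (2 : ℕ)) = f₂ n := by
    intro n k
    simp only [hf₂, ← mul_neg]
    rw [← exp_two_pi_I_mul_add_int _ ((n * k + k ^ 2) * c)]
    congr 2
    push_cast
    ring
  let A : ℝ → ℂ := fun ε => (ε : ℂ) ^ (1 / 2 : ℂ) *
    ∑' n : ℤ, f₁ n * Complex.exp (-Real.pi * (ε : ℂ) * (n : ℂ) ^ 2)
  let B : ℝ → ℂ := fun ε => (w ε) ^ (1 / 2 : ℂ) *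
    ∑' n : ℤ, f₂ n * Complex.exp (-Real.pi * w ε * (n : ℂ) ^ 2)
  have hrel : ∀ ε, 0 < ε → (a ε) ^ (1 / 2 : ℂ) * (c / 2 * (u ε) ^ (1 / 2 : ℂ)) * A ε = B ε := by
    intro ε hε
    have hε0 : (ε : ℂ) ≠ 0 := by exact_mod_cast hε.ne'
    have h1 := Complex.tsum_exp_neg_mul_int_sq (a := a ε) (by rw [hare]; exact hε)
    have h2 : ∀ n : ℤ, Complex.exp (-Real.pi * a ε * (n : ℂ) ^ 2) =
        f₁ n * Complex.exp (-Real.pi * (ε : ℂ) * (n : ℂ) ^ 2) := by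
      intro n
      simp only [hf₁]
      rw [← Complex.exp_add]
      congr 1
      simp only [a]
      push_cast
      ring
    have h3 : ∀ n : ℤ, Complex.exp (-Real.pi / a ε * (n : ℂ) ^ 2) =
        f₂ n * Complex.exp (-Real.pi * w ε * (n : ℂ) ^ 2) := by
      intro n
      simp only [hf₂]
      rw [← Complex.exp_add, div_eq_mul_one_div, hawr ε hε]
      congr 1
      push_cast
      ring
    simp_rw [h2, h3] at h1
    have h4 : (w ε) ^ (1 / 2 : ℂ) = (c / 2 * √ε : ℝ) * (u ε) ^ (1 / 2 : ℂ) :=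
      cpow_half_sq_mul (by positivity) (one_div_ne_zero (hune ε))
    have h5 : (ε : ℂ) ^ (1 / 2 : ℂ) = √ε := by
      have := cpow_half_sq_mul (Real.sqrt_pos.2 hε) (one_ne_zero (α := ℂ))
      rw [mul_one, ← Complex.ofReal_pow, Real.sq_sqrt hε.le] at this
      simpa using this
    have h6 : a ε ^ (1 / 2 : ℂ) ≠ 0 := by simp [Complex.cpow_eq_zero_iff, hane ε hε]
    simp only [A, B]
    rw [h1, h4, h5]
    push_cast
    generalize (∑' n : ℤ, f₂ n * Complex.exp (-Real.pi * w ε * (n : ℂ) ^ 2)) = T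
    field_simp
  have hpos : ∀ ε : Set.Ioi (0 : ℝ), 0 < (ε : ℝ) := fun ε => ε.2
  -- The approach `ε → 0⁺` is expressed on the subtype of positive reals, because the limit lemma
  -- asks for `0 < Re w` at every index.
  let l : Filter (Set.Ioi (0 : ℝ)) := comap (fun ε => (ε : ℝ)) (𝓝 0)
  have hl0 : Tendsto (fun ε : Set.Ioi (0 : ℝ) => (ε : ℝ)) l (𝓝 0) := tendsto_comap
  have : l.NeBot := by
    rw [comap_neBot_iff_frequently, Subtype.range_coe]
    exact frequently_gt_nhds 0
  have hlinv : Tendsto (fun ε : Set.Ioi (0 : ℝ) => (ε : ℝ)⁻¹) l atTop :=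
    tendsto_inv_nhdsGT_zero.comp (tendsto_nhdsWithin_iff.2 ⟨hl0, .of_forall hpos⟩)
  have hA : Tendsto (fun ε : Set.Ioi (0 : ℝ) => A ε) l (𝓝 (1 / c * ∑ r ∈ Finset.range c, f₁ r)) := by
    refine tendsto_cpow_mul_tsum_periodic hc p₁ (fun ε => by simpa using hpos ε) ?_
    simpa using hlinv
  have hB : Tendsto (fun ε : Set.Ioi (0 : ℝ) => B ε) l
      (𝓝 (1 / (2 : ℕ) * ∑ r ∈ Finset.range 2, f₂ r)) := by
    refine tendsto_cpow_mul_tsum_periodic two_pos p₂ (fun ε => hwre _ (hpos ε)) ?_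
    have : Tendsto (fun ε : Set.Ioi (0 : ℝ) => 4 / (c : ℝ) ^ 2 * (ε : ℝ)⁻¹) l atTop :=
      hlinv.const_mul_atTop (by positivity)
    refine this.congr fun ε => ?_
    rw [hinvre _ (hpos ε)]
    have := (hpos ε).ne'
    field_simp
  have hcε : Tendsto (fun ε : Set.Ioi (0 : ℝ) => ((ε : ℝ) : ℂ)) l (𝓝 0) :=
    (Complex.continuous_ofReal.tendsto' 0 0 (by simp)).comp hl0
  have hu : Tendsto (fun ε : Set.Ioi (0 : ℝ) => (u ε) ^ (1 / 2 : ℂ)) l (𝓝 1) := by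
    have h1 : Tendsto (fun ε : Set.Ioi (0 : ℝ) => u ε) l (𝓝 1) := by
      have : Tendsto (fun ε : Set.Ioi (0 : ℝ) => (1 + Complex.I * c * ((ε : ℝ) : ℂ) / 2 : ℂ)) l
          (𝓝 (1 + Complex.I * c * 0 / 2)) :=
        ((hcε.const_mul _).div_const _).const_add _
      have := this.inv₀ (by simp)
      simpa [u] using this
    have := h1.cpow (tendsto_const_nhds (x := (1 / 2 : ℂ))) (by simp [Complex.slitPlane])
    simpa using this
  have ha : Tendsto (fun ε : Set.Ioi (0 : ℝ) => (a ε) ^ (1 / 2 : ℂ)) l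
      (𝓝 ((-2 * Complex.I / c) ^ (1 / 2 : ℂ))) := by
    have h1 : Tendsto (fun ε : Set.Ioi (0 : ℝ) => a ε) l (𝓝 (-2 * Complex.I / c)) := by
      have := hcε.sub_const (2 * Complex.I / c)
      simpa [a, neg_div] using this
    refine h1.cpow tendsto_const_nhds ?_
    rw [Complex.mem_slitPlane_iff]
    right
    have : (-2 * Complex.I / c : ℂ) = ((-2 / c : ℝ) : ℂ) * Complex.I := by push_cast; ring
    rw [this]
    simp [hc.ne']
  have hlim := tendsto_nhds_unique (((ha.mul (hu.const_mul (c / 2 : ℂ))).mul hA).congr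
    fun ε : Set.Ioi (0 : ℝ) => hrel ε (hpos ε)) hB
  -- `(1 - i)² = -2i`, and `1 - i` has positive real part, so it is the principal root.
  have hroot : (-2 * Complex.I / c : ℂ) ^ (1 / 2 : ℂ) = (√c)⁻¹ * (1 - Complex.I) := by
    have h1 : (-2 * Complex.I / c : ℂ) = (((√c)⁻¹ : ℝ) : ℂ) ^ 2 * (1 - Complex.I) ^ 2 := by
      rw [← Complex.ofReal_pow, inv_pow, Real.sq_sqrt hcR.le]
      push_cast
      field_simp
      linear_combination -Complex.I_sq
    have h2 : (1 - Complex.I) ^ 2 ≠ 0 := by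
      refine pow_ne_zero 2 fun h => ?_
      have := congrArg Complex.re h
      simp at this
    rw [h1, cpow_half_sq_mul (by positivity) h2, one_div,
      Complex.sq_cpow_two_inv (by simp)]
  have hG : ∑ r ∈ Finset.range c, f₁ r = quadGaussSum c := by simp [hf₁, quadGaussSum]
  have hs : (√c : ℂ) ≠ 0 := by exact_mod_cast (Real.sqrt_pos.2 hcR).ne'
  rw [hroot, hG, Finset.sum_range_succ, Finset.sum_range_one] at hlim
  have e0 : f₂ ((0 : ℕ) : ℤ) = 1 := by simp [hf₂]
  have e1 : f₂ ((1 : ℕ) : ℤ) = Complex.exp (-(2 * Real.pi * Complex.I * (c / 4 : ℝ))) := by simp [hf₂]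
  rw [e0, e1] at hlim
  generalize Complex.exp (-(2 * Real.pi * Complex.I * (c / 4 : ℝ))) = E at *
  generalize quadGaussSum c = G at *
  push_cast at hlim
  generalize ((√c : ℝ) : ℂ) = s at *
  field_simp at hlim
  linear_combination (1 + Complex.I) / 2 * hlim + G / 2 * Complex.I_sq

/-! ### Gauss sums of the Legendre and Jacobi symbols. -/

section

open scoped NumberTheorySymbols

theorem exp_two_pi_I_mul_div_congr {q : ℕ} (hq : 0 < q) {a b : ℤ} (h : a ≡ b [ZMOD q]) :
    Complex.exp (2 * Real.pi * Complex.I * (a / q)) =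
      Complex.exp (2 * Real.pi * Complex.I * (b / q)) := by
  obtain ⟨k, hk⟩ := h.dvd
  have hq0 : (q : ℂ) ≠ 0 := by exact_mod_cast hq.ne'
  have : (b : ℂ) = a + q * k := by
    have : b = a + q * k := by linarith
    exact_mod_cast this
  rw [← exp_two_pi_I_mul_add_int (a / q) k, this]
  congr 2
  field_simp

theorem quadGaussSum_odd {c : ℕ} (hc : c % 2 = 1) :
    quadGaussSum c = √c * if c % 4 = 1 then 1 else Complex.I := by
  rw [quadGaussSum_eq (by omega), mul_assoc]
  congr 1
  have e : -(2 * Real.pi * Complex.I * (c / 4 : ℝ) : ℂ) =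
      2 * Real.pi * Complex.I * ((-c : ℤ) / (4 : ℕ)) := by push_cast; ring
  have h4 : c % 4 = 1 ∨ c % 4 = 3 := by omega
  have hI : Complex.exp (2 * Real.pi * Complex.I * ((1 : ℤ) / (4 : ℕ))) = Complex.I := by
    conv_rhs => rw [← Complex.exp_pi_div_two_mul_I]
    congr 1
    push_cast
    ring
  rcases h4 with h4 | h4
  · rw [e, if_pos h4, exp_two_pi_I_mul_div_congr (b := -1) (by norm_num)]
    · rw [show 2 * Real.pi * Complex.I * (((-1 : ℤ) : ℂ) / (4 : ℕ)) =
        -(2 * Real.pi * Complex.I * ((1 : ℤ) / (4 : ℕ))) by push_cast; ring, Complex.exp_neg, hI,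
        Complex.inv_I]
      linear_combination -1 / 2 * Complex.I_sq
    · unfold Int.ModEq; push_cast; omega
  · rw [e, if_neg (by omega), exp_two_pi_I_mul_div_congr (b := 1) (by norm_num)]
    · rw [hI]
      linear_combination 1 / 2 * Complex.I_sq
    · unfold Int.ModEq; push_cast; omega

/-- A multiplicative periodic function whose finite Fourier transform is `c` times itself. -/
structure IsGaussFun (q : ℕ) (f : ℤ → ℤ) (c : ℂ) : Prop where
  pos : 0 < q
  periodic : ∀ {a b : ℤ}, a ≡ b [ZMOD q] → f a = f b
  mul : ∀ a b : ℤ, f (a * b) = f a * f b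
  gauss : ∀ m : ℤ, ∑ r ∈ Finset.range q,
    (f r : ℂ) * Complex.exp (2 * Real.pi * Complex.I * ((m * r : ℤ) / q)) = c * f m

theorem sum_range_mul_of_coprime {q₁ q₂ : ℕ} (h₁ : 0 < q₁) (h₂ : 0 < q₂) (h : Nat.Coprime q₁ q₂)
    {F : ℤ → ℂ} (hF : ∀ {a b : ℤ}, a ≡ b [ZMOD (q₁ * q₂ : ℕ)] → F a = F b) :
    ∑ r ∈ Finset.range (q₁ * q₂), F r =
      ∑ a ∈ Finset.range q₁, ∑ b ∈ Finset.range q₂, F (a * q₂ + b * q₁) := by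
  rw [← Finset.sum_product']
  symm
  have hinj : Set.InjOn (fun p : ℕ × ℕ => (p.1 * q₂ + p.2 * q₁) % (q₁ * q₂))
      (Finset.range q₁ ×ˢ Finset.range q₂ : Finset (ℕ × ℕ)) := by
    rintro ⟨a, b⟩ hab ⟨a', b'⟩ hab' he
    simp only [Finset.coe_product, Finset.coe_range, Set.mem_prod, Set.mem_Iio] at hab hab'
    have he' : a * q₂ + b * q₁ ≡ a' * q₂ + b' * q₁ [MOD q₁ * q₂] := he
    have e1 : a * q₂ ≡ a' * q₂ [MOD q₁] := by
      have := he'.of_mul_right q₂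
      simpa [Nat.ModEq] using this
    have e2 : b * q₁ ≡ b' * q₁ [MOD q₂] := by
      have := he'.of_mul_left q₁
      simpa [Nat.ModEq] using this
    have e3 := Nat.ModEq.cancel_right_of_coprime (by simpa using h) e1
    have e4 := Nat.ModEq.cancel_right_of_coprime (by simpa using h.symm) e2
    exact Prod.ext (Nat.ModEq.eq_of_lt_of_lt e3 hab.1 hab'.1)
      (Nat.ModEq.eq_of_lt_of_lt e4 hab.2 hab'.2)
  have hmaps : Set.MapsTo (fun p : ℕ × ℕ => (p.1 * q₂ + p.2 * q₁) % (q₁ * q₂))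
      (Finset.range q₁ ×ˢ Finset.range q₂ : Finset (ℕ × ℕ)) (Finset.range (q₁ * q₂)) := by
    intro p _
    simpa using Nat.mod_lt _ (Nat.mul_pos h₁ h₂)
  refine Finset.sum_nbij _ hmaps hinj ?_ ?_
  · exact Finset.surjOn_of_injOn_of_card_le _ hmaps hinj (by simp)
  · intro p _
    refine hF ?_
    push_cast
    exact (Int.mod_modEq _ _).symm

/-- By the Chinese remainder theorem the residues mod `q₁q₂` are `a q₂ + b q₁`. The additive
character splits over `a` and `b`, and multiplicativity extracts the twists `f₁ q₂` and `f₂ q₁`. -/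
theorem IsGaussFun.prod {q₁ q₂ : ℕ} {f₁ f₂ : ℤ → ℤ} {c₁ c₂ : ℂ} (h₁ : IsGaussFun q₁ f₁ c₁)
    (h₂ : IsGaussFun q₂ f₂ c₂) (h : Nat.Coprime q₁ q₂) :
    IsGaussFun (q₁ * q₂) (fun n => f₁ n * f₂ n) (f₁ q₂ * f₂ q₁ * (c₁ * c₂)) where
  pos := Nat.mul_pos h₁.pos h₂.pos
  periodic := by
    intro a b hab
    rw [Nat.cast_mul] at hab
    rw [h₁.periodic (hab.of_mul_right _), h₂.periodic (hab.of_mul_left _)]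
  mul a b := by rw [h₁.mul, h₂.mul]; ring
  gauss m := by
    have hq1 : (q₁ : ℂ) ≠ 0 := by exact_mod_cast h₁.pos.ne'
    have hq2 : (q₂ : ℂ) ≠ 0 := by exact_mod_cast h₂.pos.ne'
    have key := sum_range_mul_of_coprime h₁.pos h₂.pos h (F := fun r : ℤ =>
      ((f₁ r * f₂ r : ℤ) : ℂ) *
        Complex.exp (2 * Real.pi * Complex.I * ((m * r : ℤ) / (q₁ * q₂ : ℕ)))) (by
      intro a b hab
      rw [exp_two_pi_I_mul_div_congr (Nat.mul_pos h₁.pos h₂.pos) (hab.mul_left m)]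
      rw [Nat.cast_mul] at hab
      rw [h₁.periodic (hab.of_mul_right _), h₂.periodic (hab.of_mul_left _)])
    rw [key]
    have e : ∀ a b : ℕ, ((f₁ (a * q₂ + b * q₁) * f₂ (a * q₂ + b * q₁) : ℤ) : ℂ) *
        Complex.exp (2 * Real.pi * Complex.I * ((m * (a * q₂ + b * q₁) : ℤ) / (q₁ * q₂ : ℕ))) =
        f₁ q₂ * f₂ q₁ *
        ((f₁ a * Complex.exp (2 * Real.pi * Complex.I * ((m * a : ℤ) / q₁))) *
        (f₂ b * Complex.exp (2 * Real.pi * Complex.I * ((m * b : ℤ) / q₂)))) := by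
      intro a b
      have e1 : f₁ (a * q₂ + b * q₁) = f₁ a * f₁ q₂ := by
        rw [← h₁.mul]
        exact h₁.periodic (by simp [Int.ModEq])
      have e2 : f₂ (a * q₂ + b * q₁) = f₂ b * f₂ q₁ := by
        rw [← h₂.mul]
        exact h₂.periodic (by simp [Int.ModEq])
      have e3 : Complex.exp (2 * Real.pi * Complex.I *
          ((m * (a * q₂ + b * q₁) : ℤ) / (q₁ * q₂ : ℕ))) =
          Complex.exp (2 * Real.pi * Complex.I * ((m * a : ℤ) / q₁)) *
          Complex.exp (2 * Real.pi * Complex.I * ((m * b : ℤ) / q₂)) := by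
        rw [← Complex.exp_add]
        congr 1
        push_cast
        field_simp
      rw [e1, e2, e3]
      push_cast
      ring
    simp_rw [e, ← Finset.mul_sum]
    rw [← Finset.sum_mul, h₁.gauss, h₂.gauss]
    push_cast
    ring

theorem sum_range_natCast_zmod {p : ℕ} [NeZero p] (F : ZMod p → ℂ) :
    ∑ r ∈ Finset.range p, F (r : ZMod p) = ∑ x : ZMod p, F x := by
  refine Finset.sum_nbij' (fun r => (r : ZMod p)) ZMod.val (by simp)
    (fun x _ => by simpa using ZMod.val_lt x) ?_ (by simp) (by simp)
  intro r hr
  exact ZMod.val_cast_of_lt (by simpa using hr)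

/-- An element `y` has `1 + χ(y)` square roots, so the sum of `ψ(x²)` over `x` equals that of `χ(y)
ψ(y)` over `y`, and the quadratic Gauss sum gives the constant. A unit `m` is absorbed by the
substitution `x ↦ mx`, and for `m = 0` both sides vanish. -/
theorem isGaussFun_legendre {p : ℕ} [hp : Fact p.Prime] (hp2 : p ≠ 2) :
    IsGaussFun p (fun n => J(n | p)) (√p * if p % 4 = 1 then 1 else Complex.I) where
  pos := hp.out.pos
  periodic h := jacobiSym.mod_left' h
  mul a b := jacobiSym.mul_left a b p
  gauss m := by
    have hodd : p % 2 = 1 := hp.out.eq_two_or_odd.resolve_left hp2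
    have hchar : ringChar (ZMod p) ≠ 2 := by rwa [ZMod.ringChar_zmod_n]
    rw [← quadGaussSum_odd hodd]
    set ψ := ZMod.stdAddChar (N := p)
    let χ : ZMod p → ℂ := fun x => ((quadraticChar (ZMod p) x : ℤ) : ℂ)
    have hJ : ∀ n : ℤ, (J(n | p) : ℂ) = χ n := by
      intro n
      rw [← jacobiSym.legendreSym.to_jacobiSym]
      rfl
    have hsum : ∀ m : ℤ, ∑ r ∈ Finset.range p, (J(r | p) : ℂ) *
        Complex.exp (2 * Real.pi * Complex.I * ((m * r : ℤ) / p)) =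
        ∑ x : ZMod p, χ x * ψ (m * x) := by
      intro m
      rw [← sum_range_natCast_zmod]
      refine Finset.sum_congr rfl fun r _ => ?_
      have := hJ r
      rw [Int.cast_natCast] at this
      rw [this]
      congr 1
      have := ZMod.stdAddChar_coe (N := p) (m * r)
      push_cast at this
      rw [this]
      push_cast
      congr 1
      ring
    have hψ : ∑ x : ZMod p, ψ x = 0 :=
      AddChar.sum_eq_zero_of_ne_one (by
        simpa using ZMod.isPrimitive_stdAddChar p one_ne_zero)
    have h1 : ∑ x : ZMod p, χ x * ψ x = quadGaussSum p := by
      have h2 : quadGaussSum p = ∑ x : ZMod p, ψ (x ^ 2) := by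
        rw [quadGaussSum, ← sum_range_natCast_zmod]
        refine Finset.sum_congr rfl fun r _ => ?_
        have := ZMod.stdAddChar_coe (N := p) (r ^ 2)
        push_cast at this
        rw [this]
        push_cast
        congr 1
        ring
      have h3 : ∑ x : ZMod p, ψ (x ^ 2) = ∑ y : ZMod p, (1 + χ y) * ψ y := by
        rw [← Finset.sum_fiberwise_of_maps_to (g := fun x : ZMod p => x ^ 2)
          (t := Finset.univ) (by simp)]
        refine Finset.sum_congr rfl fun y _ => ?_
        have h4 := quadraticChar_card_sqrts hchar y
        rw [Finset.sum_congr rfl (g := fun _ => ψ y) (by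
          intro x hx
          rw [(Finset.mem_filter.1 hx).2]), Finset.sum_const, nsmul_eq_mul]
        congr 1
        have h5 : (Finset.univ.filter fun x : ZMod p => x ^ 2 = y) =
          {x : ZMod p | x ^ 2 = y}.toFinset := by ext; simp
        rw [h5]
        have h6 := congrArg (fun z : ℤ => (z : ℂ)) h4
        simp only [Int.cast_natCast, Int.cast_add, Int.cast_one] at h6
        rw [h6, add_comm]
      rw [h2, h3]
      simp_rw [add_mul, one_mul]
      rw [Finset.sum_add_distrib, hψ, zero_add]
    rw [hsum, hJ, ← h1]
    by_cases hm : (m : ZMod p) = 0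
    · rw [hm]
      simp only [zero_mul, AddChar.map_zero_eq_one, mul_one, χ, MulChar.map_zero, Int.cast_zero,
        mul_zero]
      exact_mod_cast quadraticChar_sum_zero hchar
    · have h7 : ∀ x : ZMod p, χ x * ψ (m * x) = χ m * (χ (m * x) * ψ (m * x)) := by
        intro x
        have h8 := quadraticChar_sq_one hm
        have h9 : χ m * χ m = 1 := by
          simp only [χ]
          rw [← sq]
          exact_mod_cast h8
        have h10 : χ (m * x) = χ m * χ x := by
          simp only [χ, map_mul, Int.cast_mul]
        rw [h10]
        linear_combination -(χ x * ψ (m * x)) * h9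
      simp_rw [h7]
      rw [← Finset.mul_sum, mul_comm]
      congr 1
      exact Fintype.sum_bijective (fun x => (m : ZMod p) * x) (mulLeft_bijective₀ _ hm) _ _
        (fun x => rfl)

/-- Induction on the least prime factor. Twisted multiplicativity introduces `J(k | p) J(p | k)`,
and quadratic reciprocity makes this `-1` exactly when both constants contain an `i`, compensating
`i² = -1`. -/
theorem isGaussFun_jacobi {m : ℕ} (hm : Squarefree m) (hodd : m % 2 = 1) :
    IsGaussFun m (fun n => J(n | m)) (√m * if m % 4 = 1 then 1 else Complex.I) := by
  induction m using Nat.strong_induction_on with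
  | _ m ih =>
  rcases eq_or_ne m 1 with rfl | h1
  · refine ⟨one_pos, ?_, ?_, ?_⟩
    · intro a b _
      rw [jacobiSym.one_right, jacobiSym.one_right]
    · simp [jacobiSym.one_right]
    · simp [jacobiSym.one_right]
  have hp : (m.minFac).Prime := Nat.minFac_prime h1
  obtain ⟨k, hk⟩ := m.minFac_dvd
  generalize m.minFac = p at *
  subst hk
  have : Fact p.Prime := ⟨hp⟩
  have hk0 : 0 < k := Nat.pos_of_ne_zero (by rintro rfl; simp at hodd)
  have hcop : Nat.Coprime p k := Nat.coprime_of_squarefree_mul hm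
  have ho := Nat.odd_mul.1 (Nat.odd_iff.2 hodd)
  have hp2 : p ≠ 2 := fun h => by have := Nat.odd_iff.1 ho.1; omega
  have hpo := Nat.odd_iff.1 ho.1
  have hko := Nat.odd_iff.1 ho.2
  have := (isGaussFun_legendre hp2).prod
    (ih k (by nlinarith [hp.two_le]) (hm.squarefree_of_dvd (Dvd.intro_left _ rfl)) hko) hcop
  have hJ : ∀ n : ℤ, J(n | p) * J(n | k) = J(n | p * k) :=
    fun n => (jacobiSym.mul_right' n hp.ne_zero hk0.ne').symm
  simp_rw [hJ] at this
  convert this using 1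
  have hsq : (J(k | p) : ℂ) ^ 2 = 1 := by
    exact_mod_cast jacobiSym.sq_one (a := k) (b := p) (by simpa using hcop.symm)
  have hs : (√((p * k : ℕ) : ℝ) : ℂ) = √p * √k := by
    rw [Nat.cast_mul, Real.sqrt_mul (by positivity)]
    push_cast
    rfl
  have hp4 : p % 4 = 1 ∨ p % 4 = 3 := by omega
  have hk4 : k % 4 = 1 ∨ k % 4 = 3 := by omega
  rw [hs, Nat.mul_mod]
  rcases hp4 with hp4 | hp4 <;> rcases hk4 with hk4 | hk4
  · rw [jacobiSym.quadratic_reciprocity_one_mod_four hp4 ho.2]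
    simp only [hp4, hk4]
    norm_num
    linear_combination -(√p * √k : ℂ) * hsq
  · rw [jacobiSym.quadratic_reciprocity_one_mod_four hp4 ho.2]
    simp only [hp4, hk4]
    norm_num
    linear_combination -(√p * √k * Complex.I : ℂ) * hsq
  · rw [← jacobiSym.quadratic_reciprocity_one_mod_four hk4 ho.1] 
    simp only [hp4, hk4]
    norm_num
    linear_combination -(√p * √k * Complex.I : ℂ) * hsq
  · rw [jacobiSym.quadratic_reciprocity_three_mod_four hp4 hk4]
    simp only [hp4, hk4]
    norm_num
    linear_combination -(√p * √k : ℂ) * hsq +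
      (√p * √k * (J(k | p) : ℂ) ^ 2 : ℂ) * Complex.I_sq

end

/-! ### Gauss sums of the characters mod `4` and `8`; quadratic characters. -/

section

open scoped NumberTheorySymbols
open ZMod

theorem exp_two_pi_I_eighth (k : ℤ) : Complex.exp (2 * Real.pi * Complex.I * (k / (8 : ℕ))) =
    if k % 8 = 0 then 1 else if k % 8 = 1 then √2 / 2 * (1 + Complex.I) else
    if k % 8 = 2 then Complex.I else if k % 8 = 3 then √2 / 2 * (-1 + Complex.I) else
    if k % 8 = 4 then -1 else if k % 8 = 5 then -(√2 / 2 * (1 + Complex.I)) else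
    if k % 8 = 6 then -Complex.I else √2 / 2 * (1 - Complex.I) := by
  have h1 : Complex.exp (2 * Real.pi * Complex.I * ((1 : ℤ) / (8 : ℕ))) =
      √2 / 2 * (1 + Complex.I) := by
    have : 2 * Real.pi * Complex.I * ((1 : ℤ) / (8 : ℕ)) = ((Real.pi / 4 : ℝ) : ℂ) * Complex.I := by
      push_cast; ring
    rw [this, Complex.exp_mul_I, ← Complex.ofReal_cos, ← Complex.ofReal_sin, Real.cos_pi_div_four,
      Real.sin_pi_div_four]
    push_cast
    ring
  have hs : (√2 : ℂ) ^ 2 = 2 := by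
    rw [← Complex.ofReal_pow, Real.sq_sqrt (by norm_num)]
    norm_num
  have hI := Complex.I_sq
  have hpow : ∀ n : ℕ, Complex.exp (2 * Real.pi * Complex.I * ((n : ℤ) / (8 : ℕ))) =
      (√2 / 2 * (1 + Complex.I)) ^ n := by
    intro n
    rw [← h1, ← Complex.exp_nat_mul]
    congr 1
    push_cast
    ring
  have hk : k % 8 = 0 ∨ k % 8 = 1 ∨ k % 8 = 2 ∨ k % 8 = 3 ∨ k % 8 = 4 ∨ k % 8 = 5 ∨ k % 8 = 6 ∨
    k % 8 = 7 := by omega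
  have h2 : (√2 / 2 * (1 + Complex.I) : ℂ) ^ 2 = Complex.I := by
    linear_combination (1 + Complex.I) ^ 2 / 4 * hs + 1 / 2 * hI
  have hr : ∀ n : ℕ, k % 8 = (n : ℤ) →
      Complex.exp (2 * Real.pi * Complex.I * (k / (8 : ℕ))) = (√2 / 2 * (1 + Complex.I)) ^ n := by
    intro n hn
    rw [← hpow]
    refine exp_two_pi_I_mul_div_congr (by norm_num) ?_
    rw [← hn]
    exact (Int.mod_modEq _ _).symm
  rcases hk with h | h | h | h | h | h | h | h
  · rw [hr 0 h, h]; simp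
  · rw [hr 1 h, h]; simp
  · rw [hr 2 h, h, h2]; simp
  · rw [hr 3 h, h, pow_succ, h2]; simp
    linear_combination (√2 / 2 : ℂ) * hI
  · rw [hr 4 h, h, show 4 = 2 * 2 from rfl, pow_mul, h2]; simp
  · rw [hr 5 h, h, show 5 = 2 * 2 + 1 from rfl, pow_succ, pow_mul, h2]; simp
  · rw [hr 6 h, h, show 6 = 2 * 3 from rfl, pow_mul, h2]; simp
  · rw [hr 7 h, h, show 7 = 2 * 3 + 1 from rfl, pow_succ, pow_mul, h2]; simp
    linear_combination (-√2 / 2 : ℂ) * hI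

theorem exp_two_pi_I_quarter (k : ℤ) : Complex.exp (2 * Real.pi * Complex.I * (k / (4 : ℕ))) =
    if k % 4 = 0 then 1 else if k % 4 = 1 then Complex.I else
    if k % 4 = 2 then -1 else -Complex.I := by
  have h := exp_two_pi_I_eighth (2 * k)
  have e : (2 * Real.pi * Complex.I * (((2 * k : ℤ) : ℂ) / (8 : ℕ))) =
    2 * Real.pi * Complex.I * (k / (4 : ℕ)) := by push_cast; ring
  rw [e] at h
  rw [h]
  have hk : k % 4 = 0 ∨ k % 4 = 1 ∨ k % 4 = 2 ∨ k % 4 = 3 := by omega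
  rcases hk with h | h | h | h
  · have : 2 * k % 8 = 0 := by omega
    simp [h, this]
  · have : 2 * k % 8 = 2 := by omega
    simp [h, this]
  · have : 2 * k % 8 = 4 := by omega
    simp [h, this]
  · have : 2 * k % 8 = 6 := by omega
    simp [h, this]

theorem isGaussFun_χ₄ : IsGaussFun 4 (fun n => χ₄ n) (2 * Complex.I) where
  pos := by norm_num
  periodic h := by rw [(ZMod.intCast_eq_intCast_iff _ _ 4).2 h]
  mul a b := by rw [Int.cast_mul, map_mul]
  gauss m := by
    simp only [exp_two_pi_I_quarter, χ₄_int_eq_if_mod_four, Int.mul_emod m]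
    have h2 : m % 2 = m % 4 % 2 := by omega
    rw [h2]
    have hk : m % 4 = 0 ∨ m % 4 = 1 ∨ m % 4 = 2 ∨ m % 4 = 3 := by omega
    rcases hk with h | h | h | h <;> rw [h] <;> simp [Finset.sum_range_succ] <;> ring

theorem sqrt_eight : √(8 : ℝ) = 2 * √2 := by
  rw [show (8 : ℝ) = 2 ^ 2 * 2 by norm_num, Real.sqrt_mul (by norm_num),
    Real.sqrt_sq (by norm_num)]

theorem isGaussFun_χ₈ : IsGaussFun 8 (fun n => χ₈ n) (√8 : ℝ) where
  pos := by norm_num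
  periodic h := by rw [(ZMod.intCast_eq_intCast_iff _ _ 8).2 h]
  mul a b := by rw [Int.cast_mul, map_mul]
  gauss m := by
    simp only [exp_two_pi_I_eighth, χ₈_int_eq_if_mod_eight, Int.mul_emod m, sqrt_eight]
    have h2 : m % 2 = m % 8 % 2 := by omega
    rw [h2]
    have hk : m % 8 = 0 ∨ m % 8 = 1 ∨ m % 8 = 2 ∨ m % 8 = 3 ∨ m % 8 = 4 ∨ m % 8 = 5 ∨ m % 8 = 6 ∨
      m % 8 = 7 := by omega
    rcases hk with h | h | h | h | h | h | h | h <;> rw [h] <;> simp [Finset.sum_range_succ] <;> ring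

theorem isGaussFun_χ₈' : IsGaussFun 8 (fun n => χ₈' n) ((√8 : ℝ) * Complex.I) where
  pos := by norm_num
  periodic h := by rw [(ZMod.intCast_eq_intCast_iff _ _ 8).2 h]
  mul a b := by rw [Int.cast_mul, map_mul]
  gauss m := by
    simp only [exp_two_pi_I_eighth, χ₈'_int_eq_if_mod_eight, Int.mul_emod m, sqrt_eight]
    have h2 : m % 2 = m % 8 % 2 := by omega
    rw [h2]
    have hk : m % 8 = 0 ∨ m % 8 = 1 ∨ m % 8 = 2 ∨ m % 8 = 3 ∨ m % 8 = 4 ∨ m % 8 = 5 ∨ m % 8 = 6 ∨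
      m % 8 = 7 := by omega
    rcases hk with h | h | h | h | h | h | h | h <;> rw [h] <;> simp [Finset.sum_range_succ] <;> ring

/-- The properties of the Kronecker symbol of a positive fundamental discriminant that are used. -/
structure IsQuadChar (D : ℕ) (f : ℤ → ℤ) : Prop where
  gaussFun : IsGaussFun D f (√D : ℝ)
  trichotomy : ∀ n, f n = 0 ∨ f n = 1 ∨ f n = -1
  zero : f 0 = 0
  one : f 1 = 1
  neg_one : f (-1) = 1
  odd_prime : ∀ p : ℕ, p.Prime → p ≠ 2 → f p = J(D | p)
  two : f 2 = if D % 2 = 0 then 0 else if D % 8 = 1 then 1 else -1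

theorem IsQuadChar.isGaussChar {D : ℕ} {f : ℤ → ℤ} (h : IsQuadChar D f) :
    IsGaussChar D (fun n => (f n : ℝ)) where
  pos := h.gaussFun.pos
  periodic n k := by
    rw [h.gaussFun.periodic (a := n + k * D) (b := n) (by simp [Int.ModEq])]
  bound n := by rcases h.trichotomy n with h | h | h <;> simp [h]
  zero := by rw [h.zero, Int.cast_zero]
  even n := by
    rw [neg_eq_neg_one_mul, h.gaussFun.mul, h.neg_one, one_mul]
  gauss m := by
    have := h.gaussFun.gauss m
    push_cast at this ⊢
    rw [← this]
    refine Finset.sum_congr rfl fun r _ => ?_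
    congr 2
    ring

end

/-! ### Quadratic characters attached to positive fundamental discriminants. -/

section

open scoped NumberTheorySymbols
open ZMod

/-- Positive fundamental discriminants (and `1`). -/
def IsFundDiscr (D : ℕ) : Prop :=
  (D % 4 = 1 ∧ Squarefree D) ∨ ∃ m, D = 4 * m ∧ Squarefree m ∧ (m % 4 = 2 ∨ m % 4 = 3)

theorem jacobiSym_reciprocity_χ₄ {m p : ℕ} (hm : m % 4 = 3) (hp : Odd p) :
    χ₄ p * J(p | m) = J(m | p) := by
  rcases Nat.odd_mod_four_iff.1 (Nat.odd_iff.1 hp) with h | h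
  · rw [χ₄_nat_one_mod_four h, one_mul,
      jacobiSym.quadratic_reciprocity_one_mod_four h (Nat.odd_iff.2 (by omega))]
  · rw [χ₄_nat_three_mod_four h, jacobiSym.quadratic_reciprocity_three_mod_four h hm]
    ring

theorem χ₄_mul_χ₈ (n : ℤ) : χ₄ n * χ₈ n = χ₈' n := by
  rw [χ₄_int_eq_if_mod_four, χ₈_int_eq_if_mod_eight, χ₈'_int_eq_if_mod_eight]
  have : n % 8 = 0 ∨ n % 8 = 1 ∨ n % 8 = 2 ∨ n % 8 = 3 ∨ n % 8 = 4 ∨ n % 8 = 5 ∨ n % 8 = 6 ∨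
      n % 8 = 7 := by omega
  have h2 : n % 2 = n % 8 % 2 := by omega
  have h4 : n % 4 = n % 8 % 4 := by omega
  rw [h2, h4]
  rcases this with h | h | h | h | h | h | h | h <;> rw [h] <;> rfl

theorem mul_trichotomy {a b : ℤ} (ha : a = 0 ∨ a = 1 ∨ a = -1) (hb : b = 0 ∨ b = 1 ∨ b = -1) :
    a * b = 0 ∨ a * b = 1 ∨ a * b = -1 := by
  rcases ha with rfl | rfl | rfl <;> rcases hb with rfl | rfl | rfl <;> simp

theorem coprime_of_mod_two {m k : ℕ} (hm : m % 2 = 1) : Nat.Coprime (2 ^ k) m :=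
  Nat.Coprime.pow_left _ (Nat.coprime_two_left.2 (Nat.odd_iff.2 hm))

theorem isQuadChar_one_mod_four {D : ℕ} (h1 : 1 < D) (h4 : D % 4 = 1) (hs : Squarefree D) :
    IsQuadChar D (fun n => J(n | D)) where
  gaussFun := by simpa [h4] using isGaussFun_jacobi hs (by omega)
  trichotomy n := jacobiSym.trichotomy n D
  zero := jacobiSym.zero_left h1
  one := jacobiSym.one_left D
  neg_one := by rw [jacobiSym.at_neg_one (Nat.odd_iff.2 (by omega)), χ₄_nat_one_mod_four h4]
  odd_prime p hp hp2 := (jacobiSym.quadratic_reciprocity_one_mod_four h4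
    (hp.odd_of_ne_two hp2)).symm
  two := by
    rw [jacobiSym.at_two (Nat.odd_iff.2 (by omega)), χ₈_nat_eq_if_mod_eight]
    have : ¬ D % 8 = 7 := by omega
    simp [this]

/-- Both constants, `2i` for `χ₄` and `i√m` for the Jacobi symbol, contain an `i`. The resulting
sign is undone by the twist `χ₄(m) = -1`, and the Gauss sum is again the positive root. Evenness
follows in the same way from `χ₄(-1) J(-1 | m) = (-1)(-1)`. -/
theorem isQuadChar_four_mul {m : ℕ} (h4 : m % 4 = 3) (hs : Squarefree m) :
    IsQuadChar (4 * m) (fun n => χ₄ n * J(n | m)) where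
  gaussFun := by
    have hco : Nat.Coprime 4 m := coprime_of_mod_two (k := 2) (by omega)
    convert isGaussFun_χ₄.prod (isGaussFun_jacobi hs (by omega)) hco using 1
    have e1 : χ₄ ((m : ℤ) : ZMod 4) = -1 := χ₄_int_three_mod_four (by omega)
    have e2 : J((4 : ℕ) | m) = 1 := jacobiSym.at_four (Nat.odd_iff.2 (by omega))
    rw [e1, e2, if_neg (by omega), Nat.cast_mul, Real.sqrt_mul (by positivity),
      show √((4 : ℕ) : ℝ) = 2 by rw [show ((4 : ℕ) : ℝ) = 2 ^ 2 by norm_num]; simp]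
    push_cast
    linear_combination (2 * √m : ℂ) * Complex.I_sq
  trichotomy n := mul_trichotomy (isQuadratic_χ₄ n) (jacobiSym.trichotomy n m)
  zero := by simp
  one := by simp [jacobiSym.one_left]
  neg_one := by
    rw [jacobiSym.at_neg_one (Nat.odd_iff.2 (by omega)), χ₄_nat_three_mod_four h4]
    rfl
  odd_prime p hp hp2 := by
    have ho := hp.odd_of_ne_two hp2
    have := jacobiSym_reciprocity_χ₄ h4 ho
    push_cast
    rw [jacobiSym.mul_left, jacobiSym.at_four ho, one_mul, ← this]
  two := by
    rw [if_pos (by omega)]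
    have : χ₄ ((2 : ℤ) : ZMod 4) = 0 := rfl
    rw [this, zero_mul]

theorem isQuadChar_eight_mul_one {m : ℕ} (h4 : m % 4 = 1) (hs : Squarefree m) :
    IsQuadChar (8 * m) (fun n => χ₈ n * J(n | m)) where
  gaussFun := by
    have ho : Odd m := Nat.odd_iff.2 (by omega)
    have hco : Nat.Coprime 8 m := coprime_of_mod_two (k := 3) (by omega)
    convert isGaussFun_χ₈.prod (isGaussFun_jacobi hs (by omega)) hco using 1
    have e2 : J((8 : ℕ) | m) = χ₈ ((m : ℤ) : ZMod 8) := by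
      rw [show ((8 : ℕ) : ℤ) = 4 * 2 by norm_num, jacobiSym.mul_left, jacobiSym.at_four ho,
        jacobiSym.at_two ho, one_mul, Int.cast_natCast]
    have e1 : (χ₈ ((m : ℤ) : ZMod 8)) * χ₈ ((m : ℤ) : ZMod 8) = 1 := by
      rw [χ₈_int_eq_if_mod_eight, if_neg (by omega)]
      split_ifs <;> rfl
    have e3 : ((χ₈ ((m : ℤ) : ZMod 8) : ℤ) : ℂ) * (χ₈ ((m : ℤ) : ZMod 8) : ℤ) = 1 := by
      exact_mod_cast e1
    rw [e2, e3, if_pos h4, Nat.cast_mul, Real.sqrt_mul (by positivity)]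
    push_cast
    ring
  trichotomy n := mul_trichotomy (isQuadratic_χ₈ n) (jacobiSym.trichotomy n m)
  zero := by simp
  one := by simp [jacobiSym.one_left]
  neg_one := by
    rw [jacobiSym.at_neg_one (Nat.odd_iff.2 (by omega)), χ₄_nat_one_mod_four h4]
    rfl
  odd_prime p hp hp2 := by
    have ho := hp.odd_of_ne_two hp2
    push_cast
    rw [jacobiSym.mul_left, show (8 : ℤ) = 4 * 2 by norm_num, jacobiSym.mul_left,
      jacobiSym.at_four ho, one_mul, jacobiSym.at_two ho,
      jacobiSym.quadratic_reciprocity_one_mod_four h4 ho]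
  two := by
    rw [if_pos (by omega)]
    have : χ₈ ((2 : ℤ) : ZMod 8) = 0 := rfl
    rw [this, zero_mul]

/-- As for `4m`: here the twists `χ₈'(m)` and `J(8 | m) = χ₈(m)` have product `-1` and cancel the
two factors `i`. -/
theorem isQuadChar_eight_mul_three {m : ℕ} (h4 : m % 4 = 3) (hs : Squarefree m) :
    IsQuadChar (8 * m) (fun n => χ₈' n * J(n | m)) where
  gaussFun := by
    have ho : Odd m := Nat.odd_iff.2 (by omega)
    have hco : Nat.Coprime 8 m := coprime_of_mod_two (k := 3) (by omega)
    convert isGaussFun_χ₈'.prod (isGaussFun_jacobi hs (by omega)) hco using 1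
    have e2 : J((8 : ℕ) | m) = χ₈ ((m : ℤ) : ZMod 8) := by
      rw [show ((8 : ℕ) : ℤ) = 4 * 2 by norm_num, jacobiSym.mul_left, jacobiSym.at_four ho,
        jacobiSym.at_two ho, one_mul, Int.cast_natCast]
    have e1 : (χ₈' ((m : ℤ) : ZMod 8)) * χ₈ ((m : ℤ) : ZMod 8) = -1 := by
      rw [χ₈_int_eq_if_mod_eight, χ₈'_int_eq_if_mod_eight, show (m : ℤ) % 2 = 1 by omega]
      have : (m : ℤ) % 8 = 3 ∨ (m : ℤ) % 8 = 7 := by omega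
      rcases this with h | h <;> rw [h] <;> rfl
    have e3 : ((χ₈' ((m : ℤ) : ZMod 8) : ℤ) : ℂ) * (χ₈ ((m : ℤ) : ZMod 8) : ℤ) = -1 := by
      exact_mod_cast e1
    rw [e2, e3, if_neg (by omega), Nat.cast_mul, Real.sqrt_mul (by positivity)]
    push_cast
    linear_combination (√8 * √m : ℂ) * Complex.I_sq
  trichotomy n := mul_trichotomy (isQuadratic_χ₈' n) (jacobiSym.trichotomy n m)
  zero := by simp
  one := by simp [jacobiSym.one_left]
  neg_one := by
    rw [jacobiSym.at_neg_one (Nat.odd_iff.2 (by omega)), χ₄_nat_three_mod_four h4]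
    rfl
  odd_prime p hp hp2 := by
    have ho := hp.odd_of_ne_two hp2
    have h1 := jacobiSym_reciprocity_χ₄ h4 ho
    have h2 := χ₄_mul_χ₈ p
    push_cast at h2 ⊢
    rw [jacobiSym.mul_left, show (8 : ℤ) = 4 * 2 by norm_num, jacobiSym.mul_left,
      jacobiSym.at_four ho, one_mul, jacobiSym.at_two ho, ← h1, ← h2]
    ring
  two := by
    rw [if_pos (by omega)]
    have : χ₈' ((2 : ℤ) : ZMod 8) = 0 := rfl
    rw [this, zero_mul]

theorem IsFundDiscr.exists_isQuadChar {D : ℕ} (h : IsFundDiscr D) (h1 : 1 < D) :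
    ∃ f, IsQuadChar D f := by
  rcases h with ⟨h4, hs⟩ | ⟨m, rfl, hs, h2 | h3⟩
  · exact ⟨_, isQuadChar_one_mod_four h1 h4 hs⟩
  · obtain ⟨k, rfl⟩ : 2 ∣ m := by omega
    have hk : Squarefree k := hs.squarefree_of_dvd (Dvd.intro_left _ rfl)
    rw [show 4 * (2 * k) = 8 * k by ring]
    have : k % 4 = 1 ∨ k % 4 = 3 := by omega
    rcases this with h | h
    · exact ⟨_, isQuadChar_eight_mul_one h hk⟩
    · exact ⟨_, isQuadChar_eight_mul_three h hk⟩
  · exact ⟨_, isQuadChar_four_mul h3 hs⟩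

end

/-! ### The ring of integers of a quadratic field and its discriminant. -/

section

/-- `{1, ω}` is a `ℤ`-basis of the ring `R`, and `ω² = tω + a`. -/
structure IsQuadGen {R : Type*} [CommRing R] (ω : R) (t a : ℤ) : Prop where
  sq : ω * ω = t * ω + a
  span : ∀ r : R, ∃ x y : ℤ, r = x + y * ω
  indep : ∀ {x y : ℤ}, (x + y * ω : R) = 0 → x = 0 ∧ y = 0

section QuadGen

variable {R : Type*} [CommRing R] {ω : R} {t a : ℤ}

theorem IsQuadGen.ext (h : IsQuadGen ω t a) {x y x' y' : ℤ}
    (e : (x + y * ω : R) = x' + y' * ω) : x = x' ∧ y = y' := by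
  have := h.indep (x := x - x') (y := y - y') (by push_cast; linear_combination e)
  exact ⟨by linarith [this.1], by linarith [this.2]⟩

theorem IsQuadGen.dvd_of_eq (h : IsQuadGen ω t a) {l x y : ℤ} {r : R}
    (e : (l : R) * r = x + y * ω) : l ∣ x ∧ l ∣ y := by
  obtain ⟨u, v, rfl⟩ := h.span r
  have := h.ext (x := l * u) (y := l * v) (x' := x) (y' := y) (by push_cast; linear_combination e)
  exact ⟨⟨u, this.1.symm⟩, ⟨v, this.2.symm⟩⟩

/-- The coordinates `(u, v)` of `1` are coprime, since a common divisor would be invertible, which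
`hunit` excludes. A Bézout relation completes `1` to a basis. -/
theorem exists_isQuadGen_of_basis {b₀ b₁ : R} (hspan : ∀ r : R, ∃ x y : ℤ, r = x * b₀ + y * b₁)
    (hind : ∀ x y : ℤ, (x * b₀ + y * b₁ : R) = 0 → x = 0 ∧ y = 0)
    (hunit : ∀ (l : ℕ) (r : R), (l : R) * r = 1 → l = 1) : ∃ (ω : R) (t a : ℤ), IsQuadGen ω t a := by
  obtain ⟨u, v, huv⟩ := hspan 1
  have hg : Int.gcd u v = 1 := by
    obtain ⟨u', hu'⟩ := Int.gcd_dvd_left u v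
    obtain ⟨v', hv'⟩ := Int.gcd_dvd_right u v
    refine hunit _ (u' * b₀ + v' * b₁) ?_
    have e1 : (u : R) = (Int.gcd u v : R) * u' := by exact_mod_cast congrArg (Int.cast (R := R)) hu'
    have e2 : (v : R) = (Int.gcd u v : R) * v' := by exact_mod_cast congrArg (Int.cast (R := R)) hv'
    linear_combination -huv - b₀ * e1 - b₁ * e2
  obtain ⟨s, w, hsw⟩ := Int.isCoprime_iff_gcd_eq_one.2 hg
  have hsw' : (s * u + w * v : R) = 1 := by exact_mod_cast congrArg (Int.cast (R := R)) hsw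
  set ω : R := s * b₁ - w * b₀ with hω
  have e0 : b₀ = s - v * ω := by rw [hω]; linear_combination -b₀ * hsw' - s * huv
  have e1 : b₁ = w + u * ω := by rw [hω]; linear_combination -b₁ * hsw' - w * huv
  have hs : ∀ r : R, ∃ x y : ℤ, r = x + y * ω := by
    intro r
    obtain ⟨x, y, rfl⟩ := hspan r
    refine ⟨x * s + y * w, y * u - x * v, ?_⟩
    push_cast
    linear_combination x * e0 + y * e1
  obtain ⟨a, t, hat⟩ := hs (ω * ω)
  refine ⟨ω, t, a, by rw [hat]; ring, hs, ?_⟩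
  intro x y hxy
  have := hind (x * u - y * w) (x * v + y * s) (by
    push_cast
    rw [hω] at hxy
    linear_combination hxy - x * huv)
  exact ⟨by linear_combination s * this.1 + w * this.2 - x * hsw,
    by linear_combination u * this.2 - v * this.1 - y * hsw⟩

end QuadGen

open NumberField

variable {K : Type*} [Field K] [NumberField K]

theorem exists_isQuadGen (hK : Module.finrank ℚ K = 2) :
    ∃ (ω : 𝓞 K) (t a : ℤ), IsQuadGen ω t a := by
  have hr : Module.finrank ℤ (𝓞 K) = 2 := by rw [RingOfIntegers.rank, hK]
  let b := Module.finBasisOfFinrankEq ℤ (𝓞 K) hr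
  refine exists_isQuadGen_of_basis (b₀ := b 0) (b₁ := b 1) ?_ ?_ ?_
  · intro r
    refine ⟨b.repr r 0, b.repr r 1, ?_⟩
    have := b.sum_repr r
    rw [Fin.sum_univ_two] at this
    simpa only [zsmul_eq_mul] using this.symm
  · intro x y hxy
    have := Fintype.linearIndependent_iff.1 b.linearIndependent ![x, y] (by
      simpa [Fin.sum_univ_two] using hxy)
    exact ⟨this 0, this 1⟩
  · intro l r hlr
    have h1 : IsUnit (l : 𝓞 K) := IsUnit.of_mul_eq_one _ hlr
    have h2 := Ideal.absNorm_span_natCast (S := 𝓞 K) l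
    rw [Ideal.span_singleton_eq_top.2 h1, Ideal.absNorm_top, hr] at h2
    exact (Nat.pow_eq_one.1 h2.symm).resolve_right two_ne_zero

/-- The basis `{1, ω}`. -/
noncomputable def IsQuadGen.basis {ω : 𝓞 K} {t a : ℤ} (h : IsQuadGen ω t a) :
    Module.Basis (Fin 2) ℤ (𝓞 K) :=
  Module.Basis.mk (v := ![1, ω])
    (LinearIndependent.pair_iff.2 fun x y hxy => h.indep (by simpa using hxy))
    (fun r _ => by
      obtain ⟨x, y, rfl⟩ := h.span r
      simp only [Matrix.range_cons, Matrix.range_empty, Set.union_empty]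
      rw [Set.singleton_union, Submodule.mem_span_pair]
      exact ⟨x, y, by simp⟩)

theorem IsQuadGen.discr_eq {ω : 𝓞 K} {t a : ℤ} (h : IsQuadGen ω t a) :
    discr K = t ^ 2 + 4 * a := by
  have hb0 : h.basis 0 = 1 := by simp [IsQuadGen.basis]
  have hb1 : h.basis 1 = ω := by simp [IsQuadGen.basis]
  have hrepr : ∀ x y : ℤ, h.basis.repr (x + y * ω) = Finsupp.single 0 x + Finsupp.single 1 y := by
    intro x y
    have : (x + y * ω : 𝓞 K) = x • h.basis 0 + y • h.basis 1 := by rw [hb0, hb1]; simp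
    rw [this, map_add, map_smul, map_smul, Module.Basis.repr_self, Module.Basis.repr_self]
    simp
  have htr : ∀ x y : ℤ, Algebra.trace ℤ (𝓞 K) (x + y * ω) = 2 * x + t * y := by
    intro x y
    rw [Algebra.trace_eq_matrix_trace h.basis, Matrix.trace_fin_two, Algebra.leftMulMatrix_eq_repr_mul,
      Algebra.leftMulMatrix_eq_repr_mul, hb0, hb1]
    have e1 : (x + y * ω) * ω = ((y * a : ℤ) : 𝓞 K) + ((x + y * t : ℤ) : 𝓞 K) * ω := by
      push_cast
      linear_combination y * h.sq
    rw [mul_one, e1, hrepr, hrepr]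
    simp
    ring
  rw [← discr_eq_discr K h.basis, Algebra.discr_def, Matrix.det_fin_two]
  simp only [Algebra.traceMatrix_apply, Algebra.traceForm_apply, hb0, hb1]
  have e1 := htr 1 0
  have e2 := htr 0 1
  have e3 := htr a t
  simp only [Int.cast_one, Int.cast_zero, zero_mul, add_zero, zero_add, one_mul, mul_zero,
    mul_one] at e1 e2
  rw [add_comm, ← h.sq] at e3
  rw [mul_one, one_mul, mul_one, e1, e2, e3]
  ring

/-- `x/l` is a root of the monic polynomial `X² - sX - r`, hence integral. -/
theorem exists_mul_eq_of_sq_eq {x : 𝓞 K} {l s r : ℤ} (hl : l ≠ 0)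
    (h : x ^ 2 = s * l * x + r * l ^ 2) : ∃ y : 𝓞 K, (l : 𝓞 K) * y = x := by
  have hl' : (l : K) ≠ 0 := by exact_mod_cast hl
  have hx : (x : K) ^ 2 = s * l * x + r * l ^ 2 := by
    have := congrArg (fun z : 𝓞 K => (z : K)) h
    simpa using this
  have hint : IsIntegral ℤ ((x : K) / l) := by
    refine ⟨Polynomial.X ^ 2 - Polynomial.C s * Polynomial.X - Polynomial.C r, by monicity!, ?_⟩
    simp only [Polynomial.eval₂_sub, Polynomial.eval₂_mul, Polynomial.eval₂_pow,
      Polynomial.eval₂_X, Polynomial.eval₂_C]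
    simp only [eq_intCast]
    field_simp
    linear_combination hx
  obtain ⟨y, hy⟩ : ∃ y : 𝓞 K, algebraMap (𝓞 K) K y = x / l := ⟨⟨_, hint⟩, rfl⟩
  refine ⟨y, RingOfIntegers.coe_injective ?_⟩
  rw [map_mul, map_intCast, hy]
  field_simp

/-- If the discriminant failed to be fundamental, some `(x + yω)/l` with `l` not dividing `y` would
be integral, contradicting the basis `{1, ω}`. For a repeated prime factor the element is `(ω -
k)/p` or `(2ω - t)/p`. -/
theorem IsQuadGen.isFundDiscr {ω : 𝓞 K} {t a : ℤ} (h : IsQuadGen ω t a) (hD : 0 < discr K) :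
    IsFundDiscr (discr K).natAbs := by
  have hd := h.discr_eq
  obtain ⟨D, hDn⟩ := Int.eq_ofNat_of_zero_le hD.le
  rw [hDn, Int.natAbs_natCast]
  rw [hDn] at hd
  have hdR : (D : 𝓞 K) = t ^ 2 + 4 * a := by exact_mod_cast congrArg (Int.cast (R := 𝓞 K)) hd
  have hsq : (2 * ω - t) ^ 2 = (D : 𝓞 K) := by linear_combination 4 * h.sq - hdR
  rcases Int.emod_two_eq_zero_or_one t with ht | ht
  · obtain ⟨k, rfl⟩ := Int.dvd_of_emod_eq_zero ht
    obtain ⟨m, rfl⟩ : 4 ∣ D := by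
      have : (4 : ℤ) ∣ D := ⟨k ^ 2 + a, by rw [hd]; ring⟩
      exact_mod_cast this
    have hm : (m : ℤ) = k ^ 2 + a := by push_cast at hd; linarith
    have hmR : (m : 𝓞 K) = k ^ 2 + a := by exact_mod_cast congrArg (Int.cast (R := 𝓞 K)) hm
    have hsq : (ω - k) ^ 2 = (m : 𝓞 K) := by
      have := h.sq
      push_cast at this
      linear_combination this - hmR
    have hsf : Squarefree m := by
      rw [Nat.squarefree_iff_prime_squarefree]
      rintro p hp ⟨r, hr⟩
      obtain ⟨y, hy⟩ := exists_mul_eq_of_sq_eq (x := ω - (k : 𝓞 K)) (l := p) (s := 0) (r := r)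
        (by exact_mod_cast hp.ne_zero) (by rw [hsq, hr]; push_cast; ring)
      have := (h.dvd_of_eq (l := p) (x := -k) (y := 1) (r := y) (by rw [hy]; push_cast; ring)).2
      exact hp.one_lt.ne' (by exact_mod_cast Int.eq_one_of_dvd_one (by positivity) this)
    refine Or.inr ⟨m, rfl, hsf, ?_⟩
    have h0 : m % 4 ≠ 0 := fun h0 => by
      have := (Nat.squarefree_iff_prime_squarefree.1 hsf) 2 Nat.prime_two
      omega
    -- Here `(1 + √m)/2` would be integral, with `√m` represented by `ω - k`.
    have h1 : m % 4 ≠ 1 := fun h1 => by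
      obtain ⟨r, hr⟩ : ∃ r, m = 4 * r + 1 := ⟨m / 4, by omega⟩
      obtain ⟨y, hy⟩ := exists_mul_eq_of_sq_eq (x := 1 + ω - (k : 𝓞 K)) (l := 2) (s := 1) (r := r)
        (by norm_num) (by
          rw [hr] at hsq
          push_cast at hsq ⊢
          linear_combination hsq)
      have := (h.dvd_of_eq (l := 2) (x := 1 - k) (y := 1) (r := y) (by rw [hy]; push_cast; ring)).2
      omega
    omega
  · have hD4 : D % 4 = 1 := by
      obtain ⟨k, hk⟩ : ∃ k, t = 2 * k + 1 := ⟨t / 2, by omega⟩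
      have : (D : ℤ) = 4 * (k ^ 2 + k + a) + 1 := by rw [hd, hk]; ring
      omega
    refine Or.inl ⟨hD4, ?_⟩
    rw [Nat.squarefree_iff_prime_squarefree]
    rintro p hp ⟨r, hr⟩
    have hp2 : p ≠ 2 := by rintro rfl; omega
    obtain ⟨y, hy⟩ := exists_mul_eq_of_sq_eq (x := 2 * ω - (t : 𝓞 K)) (l := p) (s := 0) (r := r)
      (by exact_mod_cast hp.ne_zero) (by rw [hsq, hr]; push_cast; ring)
    have := (h.dvd_of_eq (l := p) (x := -t) (y := 2) (r := y) (by rw [hy]; push_cast; ring)).2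
    exact hp2 ((Nat.prime_dvd_prime_iff_eq hp Nat.prime_two).1 (by exact_mod_cast this))

end

/-! ### Numbers of ideals of given norm: recursions at a prime. -/

section

open NumberField

variable {K : Type*} [Field K] [NumberField K]

variable (K) in
/-- The ideals of norm `n`. -/
def idealsOfNorm (n : ℕ) : Set (Ideal (𝓞 K)) := {I | Ideal.absNorm I = n}

theorem finite_idealsOfNorm (n : ℕ) : (idealsOfNorm K n).Finite :=
  Ideal.finite_setOfPred_absNorm_eq n

theorem idealCount_eq_ncard {n : ℕ} (hn : n ≠ 0) : idealCount K n = (idealsOfNorm K n).ncard := by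
  rw [idealCount, ← Nat.card_coe_set_eq]
  refine Nat.card_congr (Equiv.subtypeEquivRight fun I => ?_)
  refine ⟨fun h => h.2, fun h => ⟨?_, h⟩⟩
  rintro rfl
  exact hn (by simpa [idealsOfNorm] using h.symm)

theorem ncard_idealsOfNorm_one : (idealsOfNorm K 1).ncard = 1 := by
  have : idealsOfNorm K 1 = {⊤} := by
    ext I
    exact Ideal.absNorm_eq_one_iff
  rw [this, Set.ncard_singleton]

theorem ncard_idealsOfNorm_mul (P : Ideal (𝓞 K)) {m : ℕ} (hP : Ideal.absNorm P ≠ 0) :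
    {I ∈ idealsOfNorm K (Ideal.absNorm P * m) | P ∣ I}.ncard = (idealsOfNorm K m).ncard := by
  have h0 : P ≠ 0 := by
    rintro rfl
    exact hP (by simp)
  rw [← Set.ncard_image_of_injective (idealsOfNorm K m) (mul_right_injective₀ h0)]
  congr 1
  ext I
  constructor
  · rintro ⟨hI, J, rfl⟩
    refine ⟨J, ?_, rfl⟩
    have hI' : Ideal.absNorm (P * J) = Ideal.absNorm P * m := hI
    rw [map_mul] at hI'
    exact Nat.eq_of_mul_eq_mul_left (Nat.pos_of_ne_zero hP) hI'
  · rintro ⟨J, hJ, rfl⟩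
    refine ⟨?_, Dvd.intro _ rfl⟩
    have hJ' : Ideal.absNorm J = m := hJ
    change Ideal.absNorm (P * J) = _
    rw [map_mul, hJ']

theorem absNorm_span_prime (hK : Module.finrank ℚ K = 2) (p : ℕ) :
    Ideal.absNorm (Ideal.span {(p : 𝓞 K)}) = p ^ 2 := by
  rw [Ideal.absNorm_span_natCast, RingOfIntegers.rank, hK]

theorem prime_of_absNorm_prime {P : Ideal (𝓞 K)} (h : (Ideal.absNorm P).Prime) : Prime P := by
  have h0 : P ≠ ⊥ := by
    rintro rfl
    exact Nat.not_prime_zero (by simpa using h)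
  exact (Ideal.prime_iff_isPrime h0).2 (Ideal.isPrime_of_irreducible_absNorm h)

theorem dvd_span_of_absNorm_eq {P : Ideal (𝓞 K)} {p : ℕ} (h : Ideal.absNorm P = p) :
    P ∣ Ideal.span {(p : 𝓞 K)} := by
  rw [Ideal.dvd_span_singleton, ← h]
  exact Ideal.absNorm_mem P

theorem eq_of_dvd_of_absNorm_eq {P Q : Ideal (𝓞 K)} (h : P ∣ Q) (hn : Ideal.absNorm P = Ideal.absNorm Q)
    (h0 : Ideal.absNorm P ≠ 0) : P = Q := by
  obtain ⟨J, rfl⟩ := h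
  rw [map_mul] at hn
  have : Ideal.absNorm J = 1 := Nat.eq_of_mul_eq_mul_left (Nat.pos_of_ne_zero h0) (by rw [← hn, mul_one])
  rw [Ideal.absNorm_eq_one_iff.1 this, Ideal.mul_top]

/-- A maximal ideal above `p` divides `I`. It also divides `(p)`, whose norm is `p²`, so its norm is
`p` or it is `(p)` itself. -/
theorem exists_prime_dvd (hK : Module.finrank ℚ K = 2) {p : ℕ} (hp : p.Prime) {I : Ideal (𝓞 K)}
    (h : p ∣ Ideal.absNorm I) :
    ∃ P : Ideal (𝓞 K), P ∣ I ∧ (Ideal.absNorm P = p ∨ P = Ideal.span {(p : 𝓞 K)}) := by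
  obtain ⟨P, hP, hu, hd⟩ := Ideal.exists_isMaximal_dvd_of_dvd_absNorm
    (Nat.prime_iff_prime_int.1 hp) I (Int.natCast_dvd_natCast.2 h)
  refine ⟨P, hd, ?_⟩
  have hpP : P ∣ Ideal.span {(p : 𝓞 K)} := by
    rw [Ideal.dvd_span_singleton]
    have : (p : ℤ) ∈ Ideal.under ℤ P := by rw [hu]; exact Ideal.mem_span_singleton_self _
    simpa [Ideal.under, Ideal.mem_comap] using this
  have hn : Ideal.absNorm P ∣ p ^ 2 := by
    rw [← absNorm_span_prime hK]
    exact map_dvd _ hpP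
  obtain ⟨k, hk, he⟩ := (Nat.dvd_prime_pow hp).1 hn
  interval_cases k
  · exact absurd (Ideal.absNorm_eq_one_iff.1 (by simpa using he)) hP.ne_top
  · exact Or.inl (by simpa using he)
  · refine Or.inr (eq_of_dvd_of_absNorm_eq hpP (by rw [he, absNorm_span_prime hK]) ?_)
    rw [he]
    exact pow_ne_zero 2 hp.ne_zero

/-- Without ideals of norm `p`, every ideal of norm `pm` is divisible by `(p)`, and removing this
factor divides the norm by `p²`. -/
theorem ncard_inert (hK : Module.finrank ℚ K = 2) {p : ℕ} (hp : p.Prime) (m : ℕ)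
    (h0 : (idealsOfNorm K p).ncard = 0) : (idealsOfNorm K (p * m)).ncard =
      if p ∣ m then (idealsOfNorm K (m / p)).ncard else 0 := by
  rw [Set.ncard_eq_zero (finite_idealsOfNorm p)] at h0
  have hd : ∀ I ∈ idealsOfNorm K (p * m), Ideal.span {(p : 𝓞 K)} ∣ I := by
    intro I hI
    have hI' : Ideal.absNorm I = p * m := hI
    obtain ⟨P, hPI, hP | rfl⟩ := exists_prime_dvd hK hp (I := I) (by rw [hI']; exact Dvd.intro _ rfl)
    · exact absurd (show P ∈ idealsOfNorm K p from hP) (by rw [h0]; exact Set.notMem_empty _)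
    · exact hPI
  have hN := absNorm_span_prime hK p
  split_ifs with hpm
  · obtain ⟨k, rfl⟩ := hpm
    rw [Nat.mul_div_cancel_left _ hp.pos, ← ncard_idealsOfNorm_mul (Ideal.span {(p : 𝓞 K)}) (m := k)
      (by rw [hN]; exact pow_ne_zero 2 hp.ne_zero), hN, sq, mul_assoc]
    congr 1
    ext I
    exact ⟨fun h => ⟨h, hd I h⟩, fun h => h.1⟩
  · rw [Set.ncard_eq_zero (finite_idealsOfNorm _), Set.eq_empty_iff_forall_notMem]
    intro I hI
    have h1 := map_dvd Ideal.absNorm (hd I hI)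
    rw [hN, show Ideal.absNorm I = p * m from hI, sq] at h1
    exact hpm (Nat.dvd_of_mul_dvd_mul_left hp.pos h1)

/-- A factorization of `(p)` for a prime `p` that is not inert. -/
theorem exists_factorization (hK : Module.finrank ℚ K = 2) {p : ℕ} (hp : p.Prime) {P : Ideal (𝓞 K)}
    (hP : Ideal.absNorm P = p) : ∃ Q : Ideal (𝓞 K), Ideal.absNorm Q = p ∧
      P * Q = Ideal.span {(p : 𝓞 K)} ∧ ∀ P' : Ideal (𝓞 K), Ideal.absNorm P' = p → P' = P ∨ P' = Q := by
  obtain ⟨Q, hQ⟩ := dvd_span_of_absNorm_eq hP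
  have hQn : Ideal.absNorm Q = p := by
    have := congrArg Ideal.absNorm hQ
    rw [absNorm_span_prime hK, map_mul, hP, sq] at this
    exact (Nat.eq_of_mul_eq_mul_left hp.pos this).symm
  refine ⟨Q, hQn, hQ.symm, fun P' hP' => ?_⟩
  have hpr : Prime P' := prime_of_absNorm_prime (by rwa [hP'])
  have h0 : Ideal.absNorm P' ≠ 0 := by rw [hP']; exact hp.ne_zero
  rcases hpr.dvd_or_dvd (hQ ▸ dvd_span_of_absNorm_eq hP') with h | h
  · exact Or.inl (eq_of_dvd_of_absNorm_eq h (by rw [hP', hP]) h0)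
  · exact Or.inr (eq_of_dvd_of_absNorm_eq h (by rw [hP', hQn]) h0)

theorem dvd_or_dvd_of_norm (hK : Module.finrank ℚ K = 2) {p m : ℕ} (hp : p.Prime)
    {P Q I : Ideal (𝓞 K)} (hPQ : P * Q = Ideal.span {(p : 𝓞 K)})
    (hall : ∀ P' : Ideal (𝓞 K), Ideal.absNorm P' = p → P' = P ∨ P' = Q)
    (hI : I ∈ idealsOfNorm K (p * m)) : P ∣ I ∨ Q ∣ I := by
  have hI' : Ideal.absNorm I = p * m := hI
  obtain ⟨P', hPI, hP | rfl⟩ := exists_prime_dvd hK hp (I := I) (by rw [hI']; exact Dvd.intro _ rfl)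
  · rcases hall P' hP with rfl | rfl
    · exact Or.inl hPI
    · exact Or.inr hPI
  · rw [← hPQ] at hPI
    exact Or.inl ((Dvd.intro _ rfl).trans hPI)

theorem ncard_ramified (hK : Module.finrank ℚ K = 2) {p : ℕ} (hp : p.Prime) (m : ℕ)
    (h1 : (idealsOfNorm K p).ncard = 1) :
    (idealsOfNorm K (p * m)).ncard = (idealsOfNorm K m).ncard := by
  obtain ⟨P, hP⟩ := Set.ncard_eq_one.1 h1
  have hPn : Ideal.absNorm P = p := by
    have : P ∈ idealsOfNorm K p := by rw [hP]; rfl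
    exact this
  obtain ⟨Q, hQn, hPQ, hall⟩ := exists_factorization hK hp hPn
  have hQP : Q = P := by
    have : Q ∈ idealsOfNorm K p := hQn
    rw [hP] at this
    exact this
  subst hQP
  rw [← ncard_idealsOfNorm_mul Q (m := m) (by rw [hPn]; exact hp.ne_zero), hPn]
  congr 1
  ext I
  exact ⟨fun h => ⟨h, (or_self_iff).1 (dvd_or_dvd_of_norm hK hp hPQ hall h)⟩, fun h => h.1⟩

/-- Inclusion and exclusion: an ideal of norm `pm` is divisible by one of the two primes above `p`,
and by both exactly when it is divisible by their product `(p)`. -/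
theorem ncard_split (hK : Module.finrank ℚ K = 2) {p : ℕ} (hp : p.Prime) (m : ℕ)
    (h2 : (idealsOfNorm K p).ncard = 2) : (idealsOfNorm K (p * m)).ncard +
      (if p ∣ m then (idealsOfNorm K (m / p)).ncard else 0) = 2 * (idealsOfNorm K m).ncard := by
  obtain ⟨P, Q', hne, hset⟩ := Set.ncard_eq_two.1 h2
  have hPn : Ideal.absNorm P = p := by
    have : P ∈ idealsOfNorm K p := by rw [hset]; simp
    exact this
  have hQ'n : Ideal.absNorm Q' = p := by
    have : Q' ∈ idealsOfNorm K p := by rw [hset]; simp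
    exact this
  obtain ⟨Q, hQn, hPQ, hall⟩ := exists_factorization hK hp hPn
  obtain rfl : Q' = Q := (hall Q' hQ'n).resolve_left hne.symm
  have hp0 := hp.ne_zero
  set A := {I ∈ idealsOfNorm K (p * m) | P ∣ I}
  set B := {I ∈ idealsOfNorm K (p * m) | Q' ∣ I}
  have hA : A.ncard = (idealsOfNorm K m).ncard := by
    rw [← ncard_idealsOfNorm_mul P (by rwa [hPn]), hPn]
  have hB : B.ncard = (idealsOfNorm K m).ncard := by
    rw [← ncard_idealsOfNorm_mul Q' (by rwa [hQn]), hQn]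
  have hU : idealsOfNorm K (p * m) = A ∪ B := by
    ext I
    constructor
    · intro h
      exact (dvd_or_dvd_of_norm hK hp hPQ hall h).imp (fun h' => ⟨h, h'⟩) (fun h' => ⟨h, h'⟩)
    · rintro (h | h) <;> exact h.1
  have hfA : A.Finite := (finite_idealsOfNorm _).subset fun I h => h.1
  have hfB : B.Finite := (finite_idealsOfNorm _).subset fun I h => h.1
  have hI : A ∩ B = {I ∈ idealsOfNorm K (p * m) | P * Q' ∣ I} := by
    ext I
    constructor
    · rintro ⟨⟨h, J, rfl⟩, -, hQ⟩
      refine ⟨h, mul_dvd_mul_left P ?_⟩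
      refine ((prime_of_absNorm_prime (by rwa [hQn])).dvd_or_dvd hQ).resolve_left fun h' => hne ?_
      exact (eq_of_dvd_of_absNorm_eq h' (by rw [hQn, hPn]) (by rwa [hQn])).symm
    · rintro ⟨h, h'⟩
      exact ⟨⟨h, (Dvd.intro _ rfl).trans h'⟩, h, (Dvd.intro_left _ rfl).trans h'⟩
  have hN : Ideal.absNorm (P * Q') = p * p := by rw [map_mul, hPn, hQn]
  have hInt : (A ∩ B).ncard = if p ∣ m then (idealsOfNorm K (m / p)).ncard else 0 := by
    rw [hI]
    split_ifs with hpm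
    · obtain ⟨k, rfl⟩ := hpm
      rw [Nat.mul_div_cancel_left _ hp.pos, ← ncard_idealsOfNorm_mul (P * Q')
        (by rw [hN]; exact mul_ne_zero hp0 hp0), hN, mul_assoc]
    · rw [Set.ncard_eq_zero ((finite_idealsOfNorm _).subset fun I h => h.1),
        Set.eq_empty_iff_forall_notMem]
      rintro I ⟨hI, hd⟩
      have h1 := map_dvd Ideal.absNorm hd
      rw [hN, show Ideal.absNorm I = p * m from hI] at h1
      exact hpm (Nat.dvd_of_mul_dvd_mul_left hp.pos h1)
  rw [← hInt, hU, Set.ncard_union_add_ncard_inter A B hfA hfB, hA, hB]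
  ring

end

/-! ### Prime decomposition and the ideal count as a divisor sum. -/

section

open NumberField
open scoped NumberTheorySymbols

theorem IsQuadGen.exists_ringHom {R S : Type*} [CommRing R] [CommRing S] {ω : R} {t a : ℤ}
    (h : IsQuadGen ω t a) {b : S} (hb : b * b = t * b + a) : ∃ φ : R →+* S, φ ω = b := by
  choose x y hxy using h.span
  have hu : ∀ r (u v : ℤ), r = u + v * ω → x r = u ∧ y r = v := fun r u v e =>
    h.ext ((hxy r).symm.trans e)
  have h1 := hu 1 1 0 (by simp)
  have hadd := fun r s => hu (r + s) (x r + x s) (y r + y s) (by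
    push_cast; linear_combination hxy r + hxy s)
  have hmul := fun r s => hu (r * s) (x r * x s + y r * y s * a)
    (x r * y s + y r * x s + y r * y s * t) (by
      push_cast
      linear_combination s * hxy r + (x r + y r * ω) * hxy s + y r * y s * h.sq)
  have hω := hu ω 0 1 (by simp)
  have h0 := hu 0 0 0 (by simp)
  refine ⟨{ toFun := fun r => x r + y r * b, map_one' := ?_, map_mul' := ?_, map_zero' := ?_,
            map_add' := ?_ }, ?_⟩
  · rw [h1.1, h1.2]; simp
  · intro r s
    rw [(hmul r s).1, (hmul r s).2]
    push_cast
    linear_combination -(y r * y s : S) * hb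
  · rw [h0.1, h0.2]; simp
  · intro r s
    rw [(hadd r s).1, (hadd r s).2]
    push_cast
    ring
  · simp [hω]

variable {K : Type*} [Field K] [NumberField K]

/-- An ideal of norm `p` has quotient `ZMod p`, and is the kernel of exactly one homomorphism to
`ZMod p`, as that ring has no non-trivial automorphism. Such a homomorphism is determined by the
image of `ω`, which may be any root of the quadratic relation. -/
theorem ncard_idealsOfNorm_prime {ω : 𝓞 K} {t a : ℤ} (h : IsQuadGen ω t a) {p : ℕ} (hp : p.Prime) :
    (idealsOfNorm K p).ncard = Nat.card {b : ZMod p // b * b = t * b + a} := by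
  have e1 : Nat.card (𝓞 K →+* ZMod p) = Nat.card {b : ZMod p // b * b = t * b + a} := by
    refine Nat.card_eq_of_bijective (fun φ => ⟨φ ω, ?_⟩) ⟨fun φ ψ hφ => ?_, fun b => ?_⟩
    · have := congrArg φ h.sq
      simpa using this
    · have hφ' : φ ω = ψ ω := congrArg Subtype.val hφ
      refine RingHom.ext fun r => ?_
      obtain ⟨x, y, rfl⟩ := h.span r
      simp [hφ']
    · obtain ⟨φ, hφ⟩ := h.exists_ringHom b.2
      exact ⟨φ, Subtype.ext hφ⟩
  rw [← e1, ← Nat.card_coe_set_eq]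
  symm
  refine Nat.card_eq_of_bijective (fun φ => ⟨RingHom.ker φ, ?_⟩) ⟨fun φ ψ hφ => ?_, fun I => ?_⟩
  · change Ideal.absNorm _ = p
    rw [Ideal.absNorm_apply, Submodule.cardQuot_apply]
    have := Nat.card_congr (RingHom.quotientKerEquivOfSurjective (ZMod.ringHom_surjective φ)).toEquiv
    rw [Nat.card_zmod] at this
    exact this
  · exact ZMod.ringHom_eq_of_ker_eq φ ψ (congrArg Subtype.val hφ)
  · obtain ⟨I, hI⟩ := I
    have hI' : Nat.card (𝓞 K ⧸ I) = p := by
      have : Ideal.absNorm I = p := hI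
      rw [Ideal.absNorm_apply, Submodule.cardQuot_apply] at this
      exact this
    have : Finite (𝓞 K ⧸ I) := Nat.finite_of_card_ne_zero (by rw [hI']; exact hp.ne_zero)
    have := Fintype.ofFinite (𝓞 K ⧸ I)
    let e := ZMod.ringEquivOfPrime (𝓞 K ⧸ I) hp (by rw [← Nat.card_eq_fintype_card, hI'])
    refine ⟨(e.symm : 𝓞 K ⧸ I →+* ZMod p).comp (Ideal.Quotient.mk I), Subtype.ext ?_⟩
    ext r
    simp [RingHom.mem_ker, Ideal.Quotient.eq_zero_iff_mem]

/-- Completing the square, `b ↦ 2b - t` matches the roots with the square roots of the discriminant,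
as `2` is invertible. -/
theorem card_roots_odd {t a : ℤ} {p : ℕ} (hp : p.Prime) (hp2 : p ≠ 2) :
    (Nat.card {b : ZMod p // b * b = t * b + a} : ℤ) = J(t ^ 2 + 4 * a | p) + 1 := by
  have : Fact p.Prime := ⟨hp⟩
  have h2 : (2 : ZMod p) ≠ 0 := by
    intro h
    have : ((2 : ℕ) : ZMod p) = 0 := by exact_mod_cast h
    rw [ZMod.natCast_eq_zero_iff] at this
    exact hp2 ((Nat.prime_dvd_prime_iff_eq hp Nat.prime_two).1 this)
  rw [← jacobiSym.legendreSym.to_jacobiSym, legendreSym,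
    ← quadraticChar_card_sqrts (by rwa [ZMod.ringChar_zmod_n])]
  rw [Set.toFinset_card, ← Nat.card_eq_fintype_card]
  congr 1
  refine Nat.card_eq_of_bijective (fun b => ⟨2 * b.1 - t, ?_⟩) ⟨fun b b' hb => ?_, fun x => ?_⟩
  · change (2 * b.1 - (t : ZMod p)) ^ 2 = _
    push_cast
    linear_combination 4 * b.2
  · have : 2 * b.1 - (t : ZMod p) = 2 * b'.1 - t := congrArg Subtype.val hb
    exact Subtype.ext (mul_left_cancel₀ h2 (by linear_combination this))
  · obtain ⟨x, hx⟩ := x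
    have hx' : x ^ 2 = ((t ^ 2 + 4 * a : ℤ) : ZMod p) := hx
    push_cast at hx'
    refine ⟨⟨(x + t) / 2, ?_⟩, Subtype.ext ?_⟩
    · field_simp
      linear_combination hx'
    · change 2 * ((x + t) / 2) - (t : ZMod p) = x
      field_simp
      ring

theorem card_roots_two {t a : ℤ} {D : ℕ} (hD : (D : ℤ) = t ^ 2 + 4 * a) :
    (Nat.card {b : ZMod 2 // b * b = t * b + a} : ℤ) =
      (if D % 2 = 0 then 0 else if D % 8 = 1 then 1 else -1) + 1 := by
  rw [← ZMod.intCast_mod t 2, ← ZMod.intCast_mod a 2, Nat.cast_two]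
  obtain ⟨u, hu⟩ : ∃ u, t = 2 * u + t % 2 := ⟨t / 2, by omega⟩
  obtain ⟨c, hc⟩ : ∃ c, a = 2 * c + a % 2 := ⟨a / 2, by omega⟩
  rcases Int.emod_two_eq_zero_or_one t with ht | ht <;>
    rcases Int.emod_two_eq_zero_or_one a with ha | ha
  · rw [if_pos]
    · rw [ht, ha, Nat.card_eq_fintype_card]
      rfl
    · rw [hu, hc, ht, ha] at hD
      have : (D : ℤ) = 2 * (2 * u ^ 2 + 4 * c) := by rw [hD]; ring
      omega
  · rw [if_pos]
    · rw [ht, ha, Nat.card_eq_fintype_card]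
      rfl
    · rw [hu, hc, ht, ha] at hD
      have : (D : ℤ) = 2 * (2 * u ^ 2 + 4 * c + 2) := by rw [hD]; ring
      omega
  · have h2 : (D : ℤ) = 4 * (u * (u + 1)) + 8 * c + 1 := by
      rw [hu, hc, ht, ha] at hD
      rw [hD]; ring
    obtain ⟨v, hv⟩ := Int.even_mul_succ_self u
    rw [hv] at h2
    rw [if_neg (by omega), if_pos (by omega)]
    rw [ht, ha, Nat.card_eq_fintype_card]
    rfl
  · have h2 : (D : ℤ) = 4 * (u * (u + 1)) + 8 * c + 5 := by
      rw [hu, hc, ht, ha] at hD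
      rw [hD]; ring
    obtain ⟨v, hv⟩ := Int.even_mul_succ_self u
    rw [hv] at h2
    rw [if_neg (by omega), if_neg (by omega)]
    rw [ht, ha, Nat.card_eq_fintype_card]
    rfl

theorem sum_divisors_filter_dvd {f : ℤ → ℤ} (hf : ∀ a b, f (a * b) = f a * f b) {p : ℕ}
    (hp : 0 < p) (m : ℕ) : ∑ d ∈ (p * m).divisors with p ∣ d, f d = f p * ∑ d ∈ m.divisors, f d := by
  rw [Finset.mul_sum]
  symm
  refine Finset.sum_nbij (fun d => p * d) ?_ ?_ ?_ ?_
  · intro d hd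
    have := Nat.mem_divisors.1 hd
    exact Finset.mem_filter.2 ⟨Nat.mem_divisors.2 ⟨mul_dvd_mul_left p this.1,
      mul_ne_zero hp.ne' this.2⟩, Dvd.intro _ rfl⟩
  · intro d _ d' _ h
    exact Nat.eq_of_mul_eq_mul_left hp h
  · intro d hd
    have hd' := Finset.mem_filter.1 hd
    obtain ⟨e, rfl⟩ := hd'.2
    have h1 := Nat.mem_divisors.1 hd'.1
    refine ⟨e, ?_, rfl⟩
    exact Nat.mem_divisors.2 ⟨Nat.dvd_of_mul_dvd_mul_left hp h1.1, fun h => h1.2 (by rw [h, mul_zero])⟩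
  · intro d _
    rw [← hf]
    push_cast
    rfl

/-- The divisors of `pm` prime to `p` are those of `m` prime to `p`, and the others are `p` times
the divisors of `m`. The result has the shape of the ideal recursions. -/
theorem sum_divisors_prime_mul {f : ℤ → ℤ} (hf : ∀ a b, f (a * b) = f a * f b) {p m : ℕ}
    (hp : p.Prime) (hm : m ≠ 0) : ∑ d ∈ (p * m).divisors, f d +
      f p * (if p ∣ m then ∑ d ∈ (m / p).divisors, f d else 0) =
        (1 + f p) * ∑ d ∈ m.divisors, f d := by
  have h1 := Finset.sum_filter_add_sum_filter_not (p * m).divisors (p ∣ ·) (fun d => f d)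
  have h2 := Finset.sum_filter_add_sum_filter_not m.divisors (p ∣ ·) (fun d => f d)
  have h3 : (p * m).divisors.filter (fun d => ¬ p ∣ d) = m.divisors.filter (fun d => ¬ p ∣ d) := by
    ext d
    simp only [Finset.mem_filter, Nat.mem_divisors]
    constructor
    · rintro ⟨⟨h, -⟩, hpd⟩
      exact ⟨⟨((Nat.Prime.coprime_iff_not_dvd hp).2 hpd).symm.dvd_of_dvd_mul_left h, hm⟩, hpd⟩
    · rintro ⟨⟨h, -⟩, hpd⟩
      exact ⟨⟨h.mul_left p, mul_ne_zero hp.ne_zero hm⟩, hpd⟩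
  have h4 := sum_divisors_filter_dvd hf hp.pos m
  have h5 : ∑ d ∈ m.divisors with p ∣ d, f d =
      f p * (if p ∣ m then ∑ d ∈ (m / p).divisors, f d else 0) := by
    split_ifs with hpm
    · obtain ⟨k, rfl⟩ := hpm
      rw [Nat.mul_div_cancel_left _ hp.pos, sum_divisors_filter_dvd hf hp.pos]
    · rw [mul_zero]
      refine Finset.sum_eq_zero fun d hd => absurd ?_ hpm
      have := Finset.mem_filter.1 hd
      exact this.2.trans (Nat.dvd_of_mem_divisors this.1)
  rw [h3] at h1
  linear_combination h4 - h1 + h2 - h5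

/-- Ideal counts and divisor sums satisfy the same recursion in `p`: the values `0`, `1`, `-1` of `f
p` correspond to ramified, split and inert primes. Strong induction on `n`, removing the least prime
factor, identifies them. -/
theorem idealCount_eq_sum_divisors (hK : Module.finrank ℚ K = 2) {f : ℤ → ℤ}
    (hf : ∀ a b, f (a * b) = f a * f b) (h1 : f 1 = 1)
    (htri : ∀ n, f n = 0 ∨ f n = 1 ∨ f n = -1)
    (hp : ∀ p : ℕ, p.Prime → ((idealsOfNorm K p).ncard : ℤ) = f p + 1) {n : ℕ} (hn : n ≠ 0) :
    (idealCount K n : ℤ) = ∑ d ∈ n.divisors, f d := by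
  rw [idealCount_eq_ncard hn]
  induction n using Nat.strong_induction_on with
  | _ n ih =>
  rcases eq_or_ne n 1 with rfl | hn1
  · simp [ncard_idealsOfNorm_one, h1]
  have hpr := Nat.minFac_prime hn1
  obtain ⟨m, hm⟩ := n.minFac_dvd
  generalize n.minFac = p at *
  subst hm
  have hm0 : m ≠ 0 := right_ne_zero_of_mul hn
  have hrel := sum_divisors_prime_mul hf hpr hm0
  have ihm := ih m (by nlinarith [hpr.two_le, Nat.pos_of_ne_zero hm0]) hm0
  have ihq : ((if p ∣ m then (idealsOfNorm K (m / p)).ncard else 0 : ℕ) : ℤ) =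
      if p ∣ m then ∑ d ∈ (m / p).divisors, f d else 0 := by
    split_ifs with h
    · obtain ⟨k, rfl⟩ := h
      have hk0 : k ≠ 0 := right_ne_zero_of_mul hm0
      rw [Nat.mul_div_cancel_left _ hpr.pos]
      refine ih k ?_ hk0
      have := hpr.two_le
      have := Nat.pos_of_ne_zero hk0
      nlinarith [Nat.mul_le_mul this (le_refl p), mul_pos hpr.pos this]
    · rfl
  rw [← ihm, ← ihq] at hrel
  have hc := hp p hpr
  rcases htri p with h | h | h
  · rw [h, zero_add] at hc
    have := ncard_ramified hK hpr m (by exact_mod_cast hc)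
    rw [h] at hrel
    rw [this]
    linarith
  · rw [h] at hc hrel
    have := ncard_split hK hpr m (by exact_mod_cast hc)
    have : (((idealsOfNorm K (p * m)).ncard +
      (if p ∣ m then (idealsOfNorm K (m / p)).ncard else 0) : ℕ) : ℤ) =
        (2 * (idealsOfNorm K m).ncard : ℕ) := by rw [this]
    rw [Nat.cast_add, Nat.cast_mul, Nat.cast_two] at this
    linarith
  · rw [h] at hc hrel
    have := ncard_inert hK hpr m (by simpa using hc)
    rw [this]
    linarith

theorem exists_gaussChar_of_quadratic [IsTotallyReal K] (hK : Module.finrank ℚ K = 2) :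
    ∃ χ : ℤ → ℝ, IsGaussChar (discr K).natAbs χ ∧
      ∀ n : ℕ, n ≠ 0 → (idealCount K n : ℝ) = divSum χ n := by
  obtain ⟨ω, t, a, h⟩ := exists_isQuadGen hK
  have hD : 0 < discr K := by
    have := sign_discr K
    rw [IsTotallyReal.nrComplexPlaces_eq_zero, pow_zero] at this
    exact Int.sign_eq_one_iff_pos.1 this
  have h1 : 1 < (discr K).natAbs := by
    have := abs_discr_gt_two (K := K) (by rw [hK]; norm_num)
    rw [Int.abs_eq_natAbs] at this
    omega
  obtain ⟨f, hf⟩ := (h.isFundDiscr hD).exists_isQuadChar h1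
  have hDn : ((discr K).natAbs : ℤ) = t ^ 2 + 4 * a := by
    rw [← h.discr_eq]
    omega
  refine ⟨_, hf.isGaussChar, fun n hn => ?_⟩
  have := idealCount_eq_sum_divisors hK hf.gaussFun.mul hf.one hf.trichotomy (fun p hp => by
    rw [ncard_idealsOfNorm_prime h hp]
    rcases eq_or_ne p 2 with rfl | hp2
    · rw [card_roots_two hDn, Nat.cast_two, hf.two]
    · rw [card_roots_odd hp hp2, hf.odd_prime p hp hp2, hDn]) hn
  rw [divSum]
  exact_mod_cast this

end

/-! ### The residue, and translation to the Bessel series of the theorem. -/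

section

open NumberField

variable {K : Type*} [Field K] [NumberField K]

theorem card_absNorm_le (N : ℕ) :
    Nat.card {I : nonZeroDivisors (Ideal (𝓞 K)) // (Ideal.absNorm (I : Ideal (𝓞 K)) : ℝ) ≤ (N : ℝ)} =
      ∑ n ∈ Finset.Icc 1 N, idealCount K n := by
  classical
  have hset : {I : Ideal (𝓞 K) | Ideal.absNorm I ∈ Finset.Icc 1 N} =
      ⋃ n ∈ Finset.Icc 1 N, idealsOfNorm K n := by
    ext I
    simp [idealsOfNorm]
  have hfin : {I : Ideal (𝓞 K) | Ideal.absNorm I ∈ Finset.Icc 1 N}.Finite := by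
    rw [hset]
    exact (Finset.Icc 1 N).finite_toSet.biUnion fun n _ => finite_idealsOfNorm n
  have h1 : Nat.card {I : nonZeroDivisors (Ideal (𝓞 K)) //
      (Ideal.absNorm (I : Ideal (𝓞 K)) : ℝ) ≤ (N : ℝ)} = hfin.toFinset.card := by
    rw [← Set.ncard_eq_toFinset_card _ hfin, ← Nat.card_coe_set_eq]
    refine Nat.card_eq_of_bijective (fun I => ⟨I.1.1, ?_⟩) ⟨fun I J hIJ => ?_, fun I => ?_⟩
    · have h1 : I.1.1 ≠ 0 := nonZeroDivisors.ne_zero I.1.2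
      refine Finset.mem_Icc.2 ⟨Nat.one_le_iff_ne_zero.2 fun h => h1 ?_, by exact_mod_cast I.2⟩
      exact Ideal.absNorm_eq_zero_iff.1 h
    · exact Subtype.ext (Subtype.ext (Subtype.mk.inj hIJ))
    · obtain ⟨I, hI⟩ := I
      have hI' : 1 ≤ Ideal.absNorm I ∧ Ideal.absNorm I ≤ N := Finset.mem_Icc.1 hI
      have h0 : I ≠ 0 := by
        rintro rfl
        simp at hI'
      exact ⟨⟨⟨I, mem_nonZeroDivisors_of_ne_zero h0⟩, by exact_mod_cast hI'.2⟩, rfl⟩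
  rw [h1, Finset.card_eq_sum_card_fiberwise (f := fun I => Ideal.absNorm I) (t := Finset.Icc 1 N)
    (fun I hI => by simpa using hI)]
  refine Finset.sum_congr rfl fun n hn => ?_
  have hn1 := (Finset.mem_Icc.1 hn).1
  rw [idealCount_eq_ncard (by omega), ← Set.ncard_coe_finset]
  congr 1
  ext I
  simp only [Finset.coe_filter, Set.Finite.mem_toFinset, Set.mem_ofPred_eq, idealsOfNorm]
  exact ⟨fun h => h.2, fun h => ⟨h ▸ hn, h⟩⟩

theorem divSum_nonneg_of_idealCount {χ : ℤ → ℝ}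
    (hv : ∀ n : ℕ, n ≠ 0 → (idealCount K n : ℝ) = divSum χ n) (n : ℕ) : 0 ≤ divSum χ n := by
  rcases eq_or_ne n 0 with rfl | hn
  · simp [divSum]
  · rw [← hv n hn]
    positivity

/-- Both constants are the limit of the number of ideals of norm at most `N`, divided by `N`: on one
side by the summatory estimate for the divisor sums, on the other by the class number formula for
ideal counts. -/
theorem IsGaussChar.residue_eq {q : ℕ} {χ : ℤ → ℝ} (h : IsGaussChar q χ)
    (hv : ∀ n : ℕ, n ≠ 0 → (idealCount K n : ℝ) = divSum χ n) :
    IsGaussChar.residue q χ = dedekindZeta_residue K := by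
  refine tendsto_nhds_unique (h.tendsto_divSumTo_div (divSum_nonneg_of_idealCount hv)) ?_
  have := (NumberField.Ideal.tendsto_norm_le_div_atTop₀ K).comp tendsto_natCast_atTop_atTop
  refine this.congr fun N => ?_
  simp only [Function.comp]
  rw [card_absNorm_le, divSumTo, Nat.cast_sum]
  congr 1
  refine Finset.sum_congr rfl fun n hn => hv n ?_
  have := (Finset.mem_Icc.1 hn).1
  omega

theorem voronoiTerm_eq {q : ℕ} (hq : 0 < q) (hqK : absDiscr K = q) {x : ℝ} (hx : 0 < x) {n : ℕ}
    (hn : n ≠ 0) : voronoiTerm K x n =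
      (√(scaleConst q))⁻¹ * (idealCount K n * (kerZ (scaleConst q * x * n) / n)) := by
  have hqR : (0 : ℝ) < q := by exact_mod_cast hq
  have hnR : (0 : ℝ) < n := by exact_mod_cast Nat.pos_of_ne_zero hn
  have hs : √(scaleConst q) = 2 * Real.pi / √q := by
    rw [scaleConst, Real.sqrt_div (by positivity), show 4 * Real.pi ^ 2 = (2 * Real.pi) ^ 2 by ring,
      Real.sqrt_sq (by positivity)]
  have hX : √(scaleConst q * x * n) = √(scaleConst q) * √(x * n) := by
    rw [mul_assoc, Real.sqrt_mul]
    rw [scaleConst]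
    positivity
  have hz : 4 * Real.pi * √(x * n) / √(absDiscr K) = 2 * √(scaleConst q * x * n) := by
    rw [hX, hs, hqK]
    ring
  have hs0 : √(scaleConst q) ≠ 0 := by rw [hs]; positivity
  rw [voronoiTerm, hz, besselK_one, besselY_one, kerZ, kerY1, kerK1, hX]
  field_simp

theorem idealSum_eq {χ : ℤ → ℝ} (hv : ∀ n : ℕ, n ≠ 0 → (idealCount K n : ℝ) = divSum χ n) (x : ℝ) :
    idealSum K x = divSumHalf χ x := by
  rw [idealSum, divSumHalf]
  refine Finset.sum_congr rfl fun n hn => ?_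
  have := (Finset.mem_Icc.1 hn).1
  rw [hv n (by omega)]

end

/-- The constant `H`, the residue at `s = 1` of the Dedekind zeta function of `K`, is Mathlib's
`NumberField.dedekindZeta_residue K`; by `NumberField.tendsto_sub_one_mul_dedekindZeta_nhdsGT`
it is the limit of `(s - 1) ζ_K(s)` as `s → 1⁺`. The infinite series is the limit `S` of its
partial sums, taken in the natural order; its convergence is part of the claim. -/
theorem mainTheorem8 (K : Type*) [Field K] [NumberField K]
    [NumberField.IsTotallyReal K] (hK : Module.finrank ℚ K = 2) (x : ℝ) (hx : 0 < x) :
    ∃ S : ℝ,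
      Tendsto (fun N : ℕ => ∑ n ∈ Finset.Icc 1 N, voronoiTerm K x n) atTop (𝓝 S) ∧
        idealSum K x = NumberField.dedekindZeta_residue K * x - S := by
  obtain ⟨χ, h, hv⟩ := exists_gaussChar_of_quadratic (K := K) hK
  have hq : absDiscr K = (NumberField.discr K).natAbs := by
    rw [absDiscr, Nat.cast_natAbs, Int.cast_abs]
  have hlam : 0 < scaleConst (NumberField.discr K).natAbs := by
    have : (0 : ℝ) < (NumberField.discr K).natAbs := by exact_mod_cast h.pos
    rw [scaleConst]
    positivity
  have hs := Real.sqrt_pos.2 hlam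
  have hlim := (h.tendsto_kerPartial (divSum_nonneg_of_idealCount hv) hx).const_mul
    (√(scaleConst (NumberField.discr K).natAbs))⁻¹
  -- The limit of `kerPartial` carries a factor `√l`, while a term of the Bessel series is `(√l)⁻¹`
  -- times one of `kerPartial`. The scaling makes the limit `Hx` minus the halved summatory
  -- function.
  rw [inv_mul_cancel_left₀ hs.ne', h.residue_eq hv] at hlim
  refine ⟨_, hlim.congr fun N => ?_, ?_⟩
  · rw [kerPartial_eq (mul_pos hlam hx).ne', Finset.mul_sum]
    refine Finset.sum_congr rfl fun n hn => ?_
    have hn0 : n ≠ 0 := by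
      have := (Finset.mem_Icc.1 hn).1
      omega
    rw [voronoiTerm_eq h.pos hq hx hn0, hv n hn0]
  · rw [idealSum_eq hv]
    ring
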